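/- Let $\mathbb F$ be a field of characteristic $0$ and let $H^*=\bigoplus_{i\in\mathbb Z}H^i$ be an associative graded commutative algebra over $\mathbb F$ (a unit is not required) of finite type, i.e. $\dim H^i<\infty$ for all $i$. Write $|a|$ for the degree of a homogeneous $a$. **Definitions.** An $n$-ary *Harrison cochain of degree $s$* is a multilinear map $f:(H^*)^{n}\to H^*$ of degree $s$ that vanishes on all signed shuffle products: for $0<i<n$ and homogeneous $a_1,\dots,a_n$, $\sum_\sigma \pm f(a_{\sigma^{-1}(1)},\dots,a_{\sigma^{-1}(n)})=0$, the sum being over the $(i,n-i)$-shuffles $\sigma$, and the sign being $\operatorname{sgn}(\sigma)$ times the Koszul sign. For sequences $f=(f_n)$, $g=(g_n)$ of cochains in which $g_k$ has degree $c+1-k$ (we say that $g$ has degree $c$) put $$(f\circ g)_n(a_1,\dots,a_n)=\sum_{k=1}^{n}\sum_{l=0}^{n-k}(-1)^{(k-1)l+(n-k)c+(c+1-k)(|a_1|+\dots+|a_l|)}f_{n-k+1}(a_1,\dots,a_l,g_k(a_{l+1},\dots,a_{l+k}),a_{l+k+1},\dots,a_n),$$ and $[f,g]=f\circ g-(-1)^{bc}\,g\circ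 f$ for $f,g$ of degrees $b,c$. A *minimal $C_\infty$-enhancement* of $H^*$ is a sequence $(m_1=0,m_2,m_3,\dots)$ of Harrison cochains $m_n$ of arity $n$ and degree $2-n$, with $m_2$ the product of $H^*$ and $m\circ m=0$. A *$C_\infty$-isotopy* from $(m_n)$ to $(m_n')$ is a sequence $\phi=(\phi_1=\mathrm{Id},\phi_2,\dots)$ of Harrison cochains $\phi_n$ of arity $n$ and degree $1-n$ such that for all $n\ge2$ $$\sum_{r_1+\dots+r_k=n}(-1)^{\eta}\,m'_k\bigl(\phi_{r_1}(a_1,\dots,a_{r_1}),\dots,\phi_{r_k}(a_{n-r_k+1},\dots,a_n)\bigr)=(\phi\circ m)_n(a_1,\dots,a_n),\qquad \eta=\sum_{\alpha<\beta}(|A_\alpha|+r_\alpha)(1+r_\beta),$$ where the sum is over all $k\ge 1$ and $r_1,\dots,r_k\ge 1$, and $|A_\alpha|$ is the sum of the degrees of the arguments of $\phi_{r_\alpha}$. Two enhancements $A_1,A_2$ are *isotopic* if there is a $C_\infty$-isotopy from $A_1$ to $A_2$; they are *isotopic modulo $k$* if there is a $C_\infty$-isotopy from $A_1$ to an enhancement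 whose operations $m_i$, $i\le k$, coincide with those of $A_2$. $H^*$ is a *Poincaré graded commutative algebra* of degree $n$ if it is unital, concentrated in degrees $0,\dots,n$, and equipped with a linear form $\int:H^n\to\mathbb F$ for which the pairing given on homogeneous elements by $\langle a,b\rangle=\int ab$ if $|a|+|b|=n$, and $\langle a,b\rangle=0$ otherwise, is non-degenerate. A $k$-ary cochain $f$ is then *cyclic* if $\langle f(x_1,\dots,x_k),x_{k+1}\rangle=(-1)^{k+|x_1|(|x_2|+\dots+|x_{k+1}|)}\langle f(x_2,\dots,x_{k+1}),x_1\rangle$ for homogeneous $x_i$, and *normalized* if it vanishes whenever one of its arguments is $1$. An enhancement is *unital cyclic* if all $m_n$ are cyclic and $m_n$ is normalized for $n\ge3$. Let $\mathfrak g^0$ be the space of sequences $p=(p_2,p_3,\dots)$ of normalized cyclic Harrison cochains $p_n$ of arity $n$ and degree $1-n$. For $p\in\mathfrak g^0$ and $m=(m_3,m_4,\dots)$ put $$e^{\mathrm{ad}_p}*m=e^{\mathrm{ad}_p}(m)-\frac{e^{\mathrm{ad}_p}-1}{\mathrm{ad}_p}(\delta p),\qquad \mathrm{ad}_p=[p,-],\quad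 \delta p=[m_2,p]$$ (the series are finite in each arity). Two unital cyclic enhancements $A_1=(m_n)$, $A_2=(m'_n)$ are *unital cyclic isotopic* if $(m'_3,m'_4,\dots)=e^{\mathrm{ad}_p}*(m_3,m_4,\dots)$ for some $p\in\mathfrak g^0$, and *unital cyclic isotopic modulo $k$* if for some $p\in\mathfrak g^0$ the two sides agree in all arities $\le k$. **Theorem.** Let $A_1$ and $A_2$ be minimal $C_\infty$-enhancements of $H^*$. a) $A_1$ and $A_2$ are isotopic if and only if they are isotopic modulo $k$ for all integers $k\ge3$. b) If moreover $H^*$ is a Poincaré graded commutative algebra and $A_1,A_2$ are unital cyclic, then the following are equivalent: (1) $A_1$ and $A_2$ are isotopic; (2) $A_1$ and $A_2$ are unital cyclic isotopic; (3) $A_1$ and $A_2$ are unital cyclic isotopic modulo $k$ for all integers $k\ge3$. -/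

import Mathlib

/-! Conventions.  The graded vector space `H` is a module with an internal grading
`𝒜 : ℤ → Submodule F H`.  Operations are not suspended: `m_n` has degree `2 - n`, components of
morphisms have degree `1 - n`, and all signs are written out. -/

/-- `n`-ary cochains on `H` with values in `H`, i.e. linear maps `H^{⊗ n} → H`. -/
abbrev Cochain (F H : Type*) [Field F] [NonUnitalRing H] [Module F H] (n : ℕ) : Type _ :=
  MultilinearMap F (fun _ : Fin n => H) H

/-- A sequence of cochains, one in each arity. -/
abbrev CochainSeq (F H : Type*) [Field F] [NonUnitalRing H] [Module F H] : Type _ :=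
  ∀ n : ℕ, Cochain F H n

section Algebra

variable {F H : Type*} [Field F] [NonUnitalRing H] [Module F H]

/-- `a b = (-1)^{|a||b|} b a` on homogeneous elements. -/
def IsGradedCommutative (𝒜 : ℤ → Submodule F H) : Prop :=
  ∀ (i j : ℤ) (a b : H), a ∈ 𝒜 i → b ∈ 𝒜 j → a * b = (i * j).negOnePow • (b * a)

/-- The linear map equal to `(-1)^{s d}` on the degree `d` part of `H`. -/
noncomputable def koszul (𝒜 : ℤ → Submodule F H) [DirectSum.Decomposition 𝒜] (s : ℤ) :
    H →ₗ[F] H :=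
  (DirectSum.toModule F ℤ H fun d : ℤ => ((s * d).negOnePow : ℤ) • (𝒜 d).subtype) ∘ₗ
    (DirectSum.decomposeLinearEquiv 𝒜).toLinearMap

/-- The product of `H` as a binary cochain. -/
def mulCochain (F H : Type*) [Field F] [NonUnitalRing H] [Module F H]
    [IsScalarTower F H H] [SMulCommClass F H H] : Cochain F H 2 where
  toFun a := a 0 * a 1
  map_update_add' a i x y := by
    fin_cases i <;> simp [mul_add, add_mul]
  map_update_smul' a i c x := by
    fin_cases i <;> simp [smul_mul_assoc, mul_smul_comm]

/-- The product of `H` as a sequence of cochains concentrated in arity two. -/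
def mulSeq (F H : Type*) [Field F] [NonUnitalRing H] [Module F H]
    [IsScalarTower F H H] [SMulCommClass F H H] : CochainSeq F H
  | 2 => mulCochain F H
  | _ => 0

/-! ### Inserting a cochain into another one -/

/-- The tuple `(K a_1, …, K a_l, g (a_{l+1}, …, a_{l+k}), a_{l+k+1}, …, a_n)`. -/
def insertArgs {n k l : ℕ} (hk : 1 ≤ k) (hl : l + k ≤ n) (K : H →ₗ[F] H) (g : Cochain F H k)
    (a : Fin n → H) : Fin (n - k + 1) → H := fun j =>
  if (j : ℕ) < l then K (a ⟨j, by omega⟩)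
  else if (j : ℕ) = l then g fun i => a ⟨l + i, by omega⟩
  else a ⟨j + k - 1, by omega⟩

theorem insertArgs_update {n k l : ℕ} (hk : 1 ≤ k) (hl : l + k ≤ n) (K : H →ₗ[F] H)
    (g : Cochain F H k) (a : Fin n → H) (i : Fin n) :
    ∃ (j : Fin (n - k + 1)) (L : H →ₗ[F] H), ∀ v : H,
      insertArgs hk hl K g (Function.update a i v) =
        Function.update (insertArgs hk hl K g a) j (L v) := by
  have hi := i.2
  rcases lt_or_ge (i : ℕ) l with h | h
  · have hb : (i : ℕ) < n - k + 1 := by omega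
    refine ⟨⟨i, hb⟩, K, fun v => ?_⟩
    funext j
    rcases eq_or_ne (j : ℕ) i with hj | hj
    · have : j = ⟨i, hb⟩ := Fin.ext hj
      subst this
      simp [insertArgs, h]
    · have hne : j ≠ ⟨i, hb⟩ := fun e => hj (by rw [e])
      rw [Function.update_of_ne hne]
      unfold insertArgs
      split_ifs with h1 h2
      · rw [Function.update_of_ne]
        intro e; exact hj (by simpa using congrArg Fin.val e)
      · congr 1; funext q
        rw [Function.update_of_ne]
        intro e; have := congrArg Fin.val e; simp at this; omega
      · rw [Function.update_of_ne]
        intro e; have := congrArg Fin.val e; simp at this; omega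
  · rcases lt_or_ge (i : ℕ) (l + k) with h' | h'
    · have hb : (l : ℕ) < n - k + 1 := by omega
      refine ⟨⟨l, hb⟩, g.toLinearMap (fun q => a ⟨l + q, by omega⟩) ⟨i - l, by omega⟩,
        fun v => ?_⟩
      funext j
      rcases eq_or_ne (j : ℕ) l with hj | hj
      · have : j = ⟨l, hb⟩ := Fin.ext hj
        subst this
        simp only [insertArgs, lt_irrefl, if_false, if_true, Function.update_self,
          MultilinearMap.toLinearMap_apply]
        congr 1; funext q
        by_cases hq : (q : ℕ) = i - l
        · have e1 : (⟨l + q, by omega⟩ : Fin n) = i := Fin.ext (by simp; omega)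
          have e2 : q = ⟨i - l, by omega⟩ := Fin.ext hq
          rw [e1, Function.update_self, e2, Function.update_self]
        · rw [Function.update_of_ne, Function.update_of_ne]
          · intro e; exact hq (by simpa using congrArg Fin.val e)
          · intro e; have := congrArg Fin.val e; simp at this; omega
      · have hne : j ≠ ⟨l, hb⟩ := fun e => hj (by rw [e])
        rw [Function.update_of_ne hne]
        unfold insertArgs
        split_ifs with h1
        · rw [Function.update_of_ne]
          intro e; have := congrArg Fin.val e; simp at this; omega
        · rw [Function.update_of_ne]
          intro e; have := congrArg Fin.val e; simp at this; omega
    · have hb : (i + 1 - k : ℕ) < n - k + 1 := by omega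
      refine ⟨⟨i + 1 - k, hb⟩, LinearMap.id, fun v => ?_⟩
      funext j
      rcases eq_or_ne (j : ℕ) (i + 1 - k) with hj | hj
      · have : j = ⟨i + 1 - k, hb⟩ := Fin.ext hj
        subst this
        have e1 : (⟨(i : ℕ) + 1 - k + k - 1, by omega⟩ : Fin n) = i := Fin.ext (by simp; omega)
        have n1 : ¬ ((i : ℕ) + 1 - k < l) := by omega
        have n2 : ¬ ((i : ℕ) + 1 - k = l) := by omega
        simp only [insertArgs, n1, n2, if_false, Function.update_self, LinearMap.id_apply]
        rw [e1, Function.update_self]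
      · have hne : j ≠ ⟨i + 1 - k, hb⟩ := fun e => hj (by rw [e])
        rw [Function.update_of_ne hne]
        unfold insertArgs
        split_ifs with h1 h2
        · rw [Function.update_of_ne]
          intro e; have := congrArg Fin.val e; simp at this; omega
        · congr 1; funext q
          rw [Function.update_of_ne]
          intro e; have := congrArg Fin.val e; simp at this; omega
        · rw [Function.update_of_ne]
          intro e; have := congrArg Fin.val e; simp at this; omega

/-- The `n`-ary cochain
`f (K a_1, …, K a_l, g (a_{l+1}, …, a_{l+k}), a_{l+k+1}, …, a_n)`. -/
def insertCochain {n k l : ℕ} (hk : 1 ≤ k) (hl : l + k ≤ n) (K : H →ₗ[F] H)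
    (f : Cochain F H (n - k + 1)) (g : Cochain F H k) : Cochain F H n where
  toFun a := f (insertArgs hk hl K g a)
  map_update_add' {inst} a i x y := by
    rw [Subsingleton.elim inst (instDecidableEqFin n)]
    obtain ⟨j, L, h⟩ := insertArgs_update hk hl K g a i
    rw [h, h, h, map_add, f.map_update_add]
  map_update_smul' {inst} a i c x := by
    rw [Subsingleton.elim inst (instDecidableEqFin n)]
    obtain ⟨j, L, h⟩ := insertArgs_update hk hl K g a i
    rw [h, h, map_smul, f.map_update_smul]

/-! ### The Gerstenhaber product, the bracket and the gauge action -/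

/-- The Gerstenhaber circle product `f ∘ g`, where the component `g_k` of arity `k` has internal
degree `c + 1 - k` (so `c` is the degree of `g` in the Gerstenhaber Lie algebra).  In arity `n` it
is the sum over `1 ≤ k` and `l + k ≤ n` of
`(-1)^{(k-1) l + (n-k) c + (c+1-k)(|a_1| + … + |a_l|)}
  f_{n-k+1} (a_1, …, a_l, g_k (a_{l+1}, …, a_{l+k}), a_{l+k+1}, …, a_n)`. -/
noncomputable def circ (𝒜 : ℤ → Submodule F H) [DirectSum.Decomposition 𝒜] (c : ℤ)
    (f g : CochainSeq F H) : CochainSeq F H := fun n =>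
  ∑ k ∈ Finset.range (n + 1), ∑ l ∈ Finset.range (n + 1),
    if h : 1 ≤ k ∧ l + k ≤ n then
      (((k : ℤ) - 1) * l + ((n : ℤ) - k) * c).negOnePow •
        insertCochain h.1 h.2 (koszul 𝒜 (c + 1 - k)) (f (n - k + 1)) (g k)
    else 0

/-- The Gerstenhaber bracket `[f, g] = f ∘ g - (-1)^{b c} g ∘ f` of elements `f`, `g` of degrees
`b`, `c` of the Gerstenhaber Lie algebra. -/
noncomputable def gerstenhaberBracket (𝒜 : ℤ → Submodule F H) [DirectSum.Decomposition 𝒜]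
    (b c : ℤ) (f g : CochainSeq F H) : CochainSeq F H :=
  circ 𝒜 c f g - (b * c).negOnePow • circ 𝒜 b g f

/-- `ad_p = [p, -]` on elements of degree one, for `p` of degree zero. -/
noncomputable def adZero (𝒜 : ℤ → Submodule F H) [DirectSum.Decomposition 𝒜]
    (p x : CochainSeq F H) : CochainSeq F H :=
  gerstenhaberBracket 𝒜 0 1 p x

/-- The differential `δ p = [m_2, p]` of an element `p` of degree zero. -/
noncomputable def deltaZero (𝒜 : ℤ → Submodule F H) [DirectSum.Decomposition 𝒜]
    [IsScalarTower F H H] [SMulCommClass F H H] (p : CochainSeq F H) : CochainSeq F H :=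
  gerstenhaberBracket 𝒜 1 0 (mulSeq F H) p

/-- The gauge action `e^{ad_p} * m = e^{ad_p} (m) - ((e^{ad_p} - 1) / ad_p) (δ p)` of `p` of degree
zero on `m` of degree one.  It is used for `p` with components in arities `≥ 2` only; then `ad_p`
raises the arity of sequences that start in arity `≥ 2` by at least one, so that in arity `n` all
terms of the two exponential series with `j > n` vanish. -/
noncomputable def gaugeAction (𝒜 : ℤ → Submodule F H) [DirectSum.Decomposition 𝒜]
    [IsScalarTower F H H] [SMulCommClass F H H] (p m : CochainSeq F H) : CochainSeq F H := fun n =>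
  ∑ j ∈ Finset.range (n + 1), ((Nat.factorial j : F))⁻¹ • ((adZero 𝒜 p)^[j] m) n -
    ∑ j ∈ Finset.range (n + 1),
      ((Nat.factorial (j + 1) : F))⁻¹ • ((adZero 𝒜 p)^[j] (deltaZero 𝒜 p)) n

/-! ### Harrison cochains -/

/-- `f` is homogeneous of internal degree `s`. -/
def HasDegree (𝒜 : ℤ → Submodule F H) {n : ℕ} (f : Cochain F H n) (s : ℤ) : Prop :=
  ∀ (d : Fin n → ℤ) (a : Fin n → H), (∀ i, a i ∈ 𝒜 (d i)) → f a ∈ 𝒜 (∑ i, d i + s)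

/-- `σ` is an `(i, n - i)`-shuffle: it is increasing on the first `i` and on the last `n - i`
positions. -/
def IsShuffle {n : ℕ} (i : ℕ) (σ : Equiv.Perm (Fin n)) : Prop :=
  ∀ q r : Fin n, q < r → ((r : ℕ) < i ∨ i ≤ (q : ℕ)) → σ q < σ r

/-- The sign of `σ` times the Koszul sign of permuting elements of degrees `d` by `σ`: the product
over the inversions `q < r`, `σ r < σ q`, of `(-1)^{1 + d_q d_r}`. -/
def shuffleSign {n : ℕ} (d : Fin n → ℤ) (σ : Equiv.Perm (Fin n)) : ℤˣ :=
  ∏ q : Fin n, ∏ r : Fin n, if q < r ∧ σ r < σ q then (1 + d q * d r).negOnePow else 1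

open Classical in
/-- `f` is a Harrison cochain: it vanishes on all signed shuffle products
`(a_1 ⊗ … ⊗ a_i) ⧢ (a_{i+1} ⊗ … ⊗ a_n)` with `0 < i < n`. -/
def IsHarrison (𝒜 : ℤ → Submodule F H) {n : ℕ} (f : Cochain F H n) : Prop :=
  ∀ i : ℕ, 0 < i → i < n → ∀ (d : Fin n → ℤ) (a : Fin n → H), (∀ j, a j ∈ 𝒜 (d j)) →
    ∑ σ : Equiv.Perm (Fin n) with IsShuffle i σ, shuffleSign d σ • f (fun j => a (σ.symm j)) = 0

/-! ### Minimal `C_∞`-enhancements and isotopies -/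

/-- A minimal `C_∞`-algebra `(H, m_1 = 0, m_2, m_3, …)` whose `m_2` is the product of `H`.  The
relation `circ 𝒜 1 op op = 0` is the list of Stasheff identities
`∑ (-1)^{(k-1) l + (n-k) + k (|a_1| + … + |a_l|)}
  m_{n-k+1} (a_1, …, a_l, m_k (a_{l+1}, …, a_{l+k}), …, a_n) = 0`.
The component in arity zero is a dummy. -/
structure MinimalCInfEnhancement (𝒜 : ℤ → Submodule F H) [DirectSum.Decomposition 𝒜]
    [IsScalarTower F H H] [SMulCommClass F H H] where
  op : CochainSeq F H
  op_zero : op 0 = 0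
  op_one : op 1 = 0
  op_two : op 2 = mulCochain F H
  degree : ∀ n : ℕ, HasDegree 𝒜 (op n) (2 - n)
  harrison : ∀ n : ℕ, IsHarrison 𝒜 (op n)
  stasheff : circ 𝒜 1 op op = 0

/-- The sign exponent `∑_{α < β} (|A_α| + r_α) (1 + r_β)` for the blocks `A_α`, of lengths `r_α`, of
a composition `c` of `n`, applied to elements of degrees `d`. -/
def blockExponent {n : ℕ} (c : Composition n) (d : Fin n → ℤ) : ℤ :=
  ∑ α : Fin c.length, ∑ β : Fin c.length,
    if α < β then (∑ j, d (c.embedding α j) + c.blocksFun α) * (1 + (c.blocksFun β : ℤ)) else 0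

section Enhancements

variable {𝒜 : ℤ → Submodule F H} [DirectSum.Decomposition 𝒜]
  [IsScalarTower F H H] [SMulCommClass F H H]

/-- `φ = (φ_1, φ_2, …)` is a `C_∞`-morphism from `A` to `B`: `φ_n` is a Harrison cochain of degree
`1 - n` and
`∑_{r_1 + … + r_k = n} ± m'_k (φ_{r_1} ⊗ … ⊗ φ_{r_k}) = ∑ ± φ_{n-k+1} (id ⊗ m_k ⊗ id)`. -/
structure IsCInfMorphism (A B : MinimalCInfEnhancement 𝒜) (φ : CochainSeq F H) : Prop where
  zero : φ 0 = 0
  degree : ∀ n : ℕ, HasDegree 𝒜 (φ n) (1 - n)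
  harrison : ∀ n : ℕ, IsHarrison 𝒜 (φ n)
  equation : ∀ n : ℕ, 2 ≤ n → ∀ (d : Fin n → ℤ) (a : Fin n → H), (∀ i, a i ∈ 𝒜 (d i)) →
    ∑ c : Composition n, (blockExponent c d).negOnePow •
        B.op c.length (fun α => φ (c.blocksFun α) (fun j => a (c.embedding α j))) =
      circ 𝒜 1 φ A.op n a

/-- A `C_∞`-isotopy is a `C_∞`-morphism with `φ_1 = id`. -/
def IsCInfIsotopy (A B : MinimalCInfEnhancement 𝒜) (φ : CochainSeq F H) : Prop :=
  IsCInfMorphism A B φ ∧ ∀ a : Fin 1 → H, φ 1 a = a 0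

/-- `A` and `B` are isotopic as minimal `C_∞`-algebras. -/
def Isotopic (A B : MinimalCInfEnhancement 𝒜) : Prop :=
  ∃ φ : CochainSeq F H, IsCInfIsotopy A B φ

/-- `A` and `B` are equal modulo `k`. -/
def EqualMod (k : ℕ) (A B : MinimalCInfEnhancement 𝒜) : Prop :=
  ∀ i : ℕ, i ≤ k → A.op i = B.op i

/-- `A` and `B` are isotopic modulo `k`: some `C_∞`-isotopy `φ` transforms `A` into an enhancement
`C = φ(A)` that is equal to `B` modulo `k`. -/
def IsotopicMod (k : ℕ) (A B : MinimalCInfEnhancement 𝒜) : Prop :=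
  ∃ (φ : CochainSeq F H) (C : MinimalCInfEnhancement 𝒜), IsCInfIsotopy A C φ ∧ EqualMod k C B

/-- The twisting element `(m_3, m_4, …)` of an enhancement. -/
def MinimalCInfEnhancement.twisting (A : MinimalCInfEnhancement 𝒜) : CochainSeq F H := fun n =>
  if 3 ≤ n then A.op n else 0

/-! ### Poincaré algebras, cyclic and unital structures -/

/-- The data making `H` a Poincaré graded commutative algebra of degree `dim`: `H` has a unit and is
concentrated in degrees `0, …, dim`, and there is a fundamental class `∫` on the top degree part
whose pairing `⟨a, b⟩ = ∫ (a b)` is non-degenerate. -/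
structure PoincareStructure (𝒜 : ℤ → Submodule F H) [DirectSum.Decomposition 𝒜] where
  dim : ℕ
  bounded : ∀ i : ℤ, i < 0 ∨ (dim : ℤ) < i → 𝒜 i = ⊥
  unit : H
  unit_mul : ∀ a : H, unit * a = a
  mul_unit : ∀ a : H, a * unit = a
  fundamentalClass : Module.Dual F (𝒜 (dim : ℤ))
  nondegenerate : ∀ a : H,
    (∀ b : H, fundamentalClass (DirectSum.decompose 𝒜 (a * b) (dim : ℤ)) = 0) → a = 0

/-- The Poincaré pairing; on homogeneous `a`, `b` it is `∫ (a b)` if the degrees add up to `dim`, and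
zero otherwise. -/
def PoincareStructure.pairing (P : PoincareStructure 𝒜) (a b : H) : F :=
  P.fundamentalClass (DirectSum.decompose 𝒜 (a * b) (P.dim : ℤ))

/-- Cyclicity:
`⟨f (x_1, …, x_k), x_{k+1}⟩ = (-1)^{k + |x_1| (|x_2| + … + |x_{k+1}|)} ⟨f (x_2, …, x_{k+1}), x_1⟩`. -/
def IsCyclicCochain (P : PoincareStructure 𝒜) {k : ℕ} (f : Cochain F H k) : Prop :=
  ∀ (d : Fin (k + 1) → ℤ) (x : Fin (k + 1) → H), (∀ i, x i ∈ 𝒜 (d i)) →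
    P.pairing (f fun i => x i.castSucc) (x (Fin.last k)) =
      ((k : ℤ) + d 0 * ∑ i : Fin k, d i.succ).negOnePow • P.pairing (f fun i => x i.succ) (x 0)

/-- `f` is normalized: it vanishes if one of its arguments is the unit. -/
def IsNormalized (P : PoincareStructure 𝒜) {k : ℕ} (f : Cochain F H k) : Prop :=
  ∀ a : Fin k → H, (∃ i, a i = P.unit) → f a = 0

/-- The enhancement `A` is unital and cyclic. -/
def IsUnitalCyclic (P : PoincareStructure 𝒜) (A : MinimalCInfEnhancement 𝒜) : Prop :=
  (∀ n : ℕ, 3 ≤ n → IsNormalized P (A.op n)) ∧ ∀ n : ℕ, IsCyclicCochain P (A.op n)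

/-- `p` is an element of degree zero, with components in arities `≥ 2`, of the Lie algebra of
normalized cyclic Harrison cochains. -/
structure IsUnitalCyclicGauge (P : PoincareStructure 𝒜) (p : CochainSeq F H) : Prop where
  zero : p 0 = 0
  one : p 1 = 0
  degree : ∀ n : ℕ, HasDegree 𝒜 (p n) (1 - n)
  harrison : ∀ n : ℕ, IsHarrison 𝒜 (p n)
  cyclic : ∀ n : ℕ, IsCyclicCochain P (p n)
  normalized : ∀ n : ℕ, IsNormalized P (p n)

/-- `A` and `B` are isotopic as minimal unital cyclic `C_∞`-algebras: `B = e^{ad_p} * A`. -/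
def UnitalCyclicIsotopic (P : PoincareStructure 𝒜) (A B : MinimalCInfEnhancement 𝒜) : Prop :=
  ∃ p : CochainSeq F H, IsUnitalCyclicGauge P p ∧ B.twisting = gaugeAction 𝒜 p A.twisting

/-- `A` and `B` are isotopic modulo `k` as minimal unital cyclic `C_∞`-algebras: `B` is equal to
`e^{ad_p} * A` modulo `k`. -/
def UnitalCyclicIsotopicMod (P : PoincareStructure 𝒜) (k : ℕ)
    (A B : MinimalCInfEnhancement 𝒜) : Prop :=
  ∃ p : CochainSeq F H, IsUnitalCyclicGauge P p ∧
    ∀ i : ℕ, i ≤ k → B.twisting i = gaugeAction 𝒜 p A.twisting i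

end Enhancements

end Algebra

/-! Fix a homogeneous basis of `H` and work in the tensor coalgebra of the suspension of `H`, with
words in the basis as a vector space basis. A homogeneous sequence of cochains is the letter-valued
component of a unique coderivation, or, in degree zero, of a unique coalgebra endomorphism. The
Harrison condition holds exactly if this operator is also a derivation, respectively an
endomorphism, of the shuffle product (`IsCoder.isShuffleDer`, `IsCoalgHom.isShuffleHom` and their
converses). An enhancement becomes a codifferential of square zero. An isotopy from `A` to `C`
becomes an automorphism `U` such that `U - 1` lowers the length of words and `C U = U A`
(`IsCInfIsotopy.exists_gauge`, `isotopic_of_gauge`). The gauge action becomes conjugation by an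
exponential (`MinimalCInfEnhancement.suspend_gaugeAction`).

Exponential and logarithm relate the group of these automorphisms to the Lie algebra of
length-lowering coderivations (`IsGaugeLie.exp`, `IsGaugeGroup.log`, `expL_logL`). The logarithm is
defined as the linear coefficient of the polynomial sequence `U ^ n`, so every condition that is
inherited by powers passes to the Lie algebra by comparison of linear coefficients. Unital cyclic
isotopies form the subgroup that is normalized on the span `𝔑` of the words containing the unit and
preserves the suspended pairing `ω`; plain isotopies are the case `𝔑 = ⊥`, `ω = 0`. Therefore a) and
the equivalence of (2) and (3) are the same statement, `exists_intertwiner_of_forall`: if there are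
intertwiners on words of length at most `k` for all `k`, then there is an intertwiner.

The spaces of intertwiners modulo `k` need not be finite-dimensional, because there may be
infinitely many words of a given length. Finite type gives something weaker: the value of an
operator at a word has finitely many coordinates. A system of linear equations with finitely many
unknowns in each equation is solvable if all its finite subsystems are (`exists_solution`). For
intertwiners `V_k` modulo `k`, this gives a limit point of the logarithms of `V_k⁻¹ V_K` for `K → ∞`
(`exists_limit_point`). Multiplying `V_k` by the exponential of the limit point makes the `V_k`
agree on words that are longer by one (`exists_extension`), and these corrections converge.

For (1) implies (2), let `U` be an isotopy between unital cyclic models that is the identity on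
words shorter than `r`. The leading component `g` of its logarithm has a Hochschild differential
equal, up to sign, to the leading difference of the two structures, so the differential is
normalized and cyclic. Then `g` is cohomologous to a normalized Harrison cochain: the classical
normalization is made compatible with shuffles by Eulerian idempotents
(`IsUnitalProduct.exists_harrison_normalized`). That cochain in turn is cohomologous to a normalized
cyclic one: contraction with the unit gives a primitive of the defect, and the adjoint of the Dynkin
operator realizes it by a Harrison cochain (`IsUnitalProduct.exists_cyclic`). Coboundaries can be
absorbed in automorphisms of the target, so `U` may be assumed to have a normalized cyclic leading
component. This component is split off as a unital cyclic gauge transformation, and the process is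
repeated in the next arity (`IsUnitalCyclicModel.exists_gauge`,
`IsUnitalCyclicModel.exists_intertwiner`). -/

open TensorProduct Module
open LinearMap (comp_apply mem_ker ker mulLeft mulRight mulLeft_apply mulRight_apply comp_assoc id_apply)
open Finset (sum_congr smul_sum sum_range_succ' sum_eq_zero sum_sub_distrib mem_range range_mono sum_filter sum_comm range)
open Submodule (subset_span span_induction mem_bot mem_comap span span_le mkQ_apply)

noncomputable section

/-! ### The tensor algebra on a set of letters -/

/-- The free vector space on words in the alphabet `I`, with the concatenation product. -/
def WordSpace (F I : Type*) [Field F] : Type _ := MonoidAlgebra F (FreeMonoid I)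

instance (F I : Type*) [Field F] : Ring (WordSpace F I) :=
  inferInstanceAs (Ring (MonoidAlgebra F (FreeMonoid I)))

instance (F I : Type*) [Field F] : Algebra F (WordSpace F I) :=
  inferInstanceAs (Algebra F (MonoidAlgebra F (FreeMonoid I)))

instance (F I : Type*) [Field F] : Module F (WordSpace F I) := Algebra.toModule

/-! The notations `Λ`, `Θ`, `Ξ`, `ϖ`, … refer to the variables `F`, `I`, `deg`, `β`, `B` in scope. -/

set_option hygiene false in
/-- The word space on the letters `I` over `F`. -/
notation "Λ" => WordSpace F I

set_option hygiene false in
/-- The operators on the word space. -/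
notation "Θ" => Module.End F (WordSpace F I)

/-! ### Pointwise evaluation of linear maps -/

section Apply

variable {F M N : Type*} [Field F] [AddCommGroup M] [Module F M] [AddCommGroup N] [Module F N]

instance : IsZeroApply (M →ₗ[F] N) M N := ⟨fun _ => rfl⟩

instance : IsAddApply (M →ₗ[F] N) M N := ⟨fun _ _ _ => rfl⟩

instance : IsNegApply (M →ₗ[F] N) M N := ⟨fun _ _ => rfl⟩

instance : IsSubApply (M →ₗ[F] N) M N := ⟨fun _ _ _ => rfl⟩

instance {S : Type*} [Monoid S] [DistribMulAction S N] [SMulCommClass F S N] :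
    IsSMulApply S (M →ₗ[F] N) M N := ⟨fun _ _ _ => rfl⟩

end Apply

section Words

variable {F I : Type*} [Field F]

/-- Words form a basis of the word space. -/
def wordBasis (F I : Type*) [Field F] : Basis (List I) F Λ :=
  Basis.ofRepr (MonoidAlgebra.coeffLinearEquiv F : MonoidAlgebra F (FreeMonoid I) ≃ₗ[F] _)

/-- A word, as an element of the word space. -/
def word (F : Type*) {I : Type*} [Field F] (w : List I) : Λ :=
  wordBasis F I w

set_option hygiene false in
/-- A word as an element of the word space. -/
notation "Ξ" => word F

lemma word_eq_single (w : List I) :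
    Ξ w = (MonoidAlgebra.single (FreeMonoid.ofList w) 1 : MonoidAlgebra F (FreeMonoid I)) := by
  apply (wordBasis F I).repr.injective
  rw [word, Basis.repr_self]
  rfl

lemma word_mul_word (u v : List I) : Ξ u * Ξ v = Ξ (u ++ v) := by
  rw [word_eq_single, word_eq_single, word_eq_single]
  refine (MonoidAlgebra.single_mul_single _ _ _ _).trans ?_
  rw [mul_one]; rfl

lemma word_nil : Ξ ([] : List I) = 1 := by rw [word_eq_single]; rfl

lemma word_cons (x : I) (w : List I) : Ξ (x :: w) = Ξ [x] * Ξ w := by rw [word_mul_word]; rfl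

variable {M N : Type*} [AddCommGroup M] [Module F M] [AddCommGroup N] [Module F N]

/-- Linear extension of a function on words. -/
def wordLift (F : Type*) {I : Type*} [Field F] {M : Type*} [AddCommGroup M]
    [Module F M] (f : List I → M) : Λ →ₗ[F] M :=
  (wordBasis F I).constr F f

@[simp] lemma wordLift_word (f : List I → M) (w : List I) : wordLift F f (Ξ w) = f w :=
  (wordBasis F I).constr_basis F f w

@[simp] lemma wordLift_one (f : List I → M) : wordLift F f 1 = f [] := by
  rw [← word_nil, wordLift_word]

lemma word_hom_ext {f g : Λ →ₗ[F] M} (h : ∀ w, f (Ξ w) = g (Ξ w)) : f = g := (wordBasis F I).ext h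

lemma word_induction {p : Λ → Prop} (t : Λ) (h0 : p 0)
    (hadd : ∀ s t, p s → p t → p (s + t)) (hw : ∀ (c : F) w, p (c • Ξ w)) : p t := by
  rw [← (wordBasis F I).linearCombination_repr t, Finsupp.linearCombination_apply]
  exact Finset.sum_induction _ p hadd h0 fun w _ => hw _ _

/-! ### Signs and degrees -/

/-- The sign `(-1)^n` as a scalar. -/
def sgn (F : Type*) [Field F] (n : ℤ) : F := ((((-1 : Fˣ)) ^ n : Fˣ) : F)

lemma sgn_add (a b : ℤ) : sgn F (a + b) = sgn F a * sgn F b := by simp [sgn, zpow_add]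

lemma sgn_even {a : ℤ} (h : Even a) : sgn F a = 1 := by simp [sgn, h.neg_one_zpow]

lemma sgn_congr {a b : ℤ} (h : Even a ↔ Even b) : sgn F a = sgn F b := by
  have h' : Even (a - b) := by rw [Int.even_sub]; exact h
  rw [← sub_add_cancel a b, sgn_add, sgn_even h', one_mul]

@[simp] lemma sgn_zero : sgn F 0 = 1 := sgn_even (by simp)

@[simp] lemma sgn_one : sgn F 1 = -1 := by simp [sgn]

lemma sgn_odd {a : ℤ} (h : Odd a) : sgn F a = -1 := by rw [← sgn_one]; apply sgn_congr; simp [h]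

@[simp] lemma sgn_mul_self (a : ℤ) : sgn F a * sgn F a = 1 := by
  rw [← sgn_add]; exact sgn_even ⟨a, rfl⟩

lemma negOnePow_smul_eq (a : ℤ) (x : M) : a.negOnePow • x = sgn F a • x := by
  rcases Int.even_or_odd a with h | h
  · simp [Int.negOnePow_even _ h, sgn_even h]
  · simp [Int.negOnePow_odd _ h, sgn_odd h]

/-- The total degree of a word. -/
def wordDeg (deg : I → ℤ) (w : List I) : ℤ := (w.map deg).sum

set_option hygiene false in
/-- The total degree of a word. -/
notation "η" => wordDeg deg

variable (deg : I → ℤ)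

@[simp] lemma wordDeg_nil : η [] = 0 := rfl

@[simp] lemma wordDeg_cons (x : I) (w : List I) : η (x :: w) = deg x + η w := by simp [wordDeg]

@[simp] lemma wordDeg_append (u v : List I) : η (u ++ v) = η u + η v := by simp [wordDeg]

/-- The rescaling `w ↦ z^{|w|} w`. -/
def scale (z : Fˣ) : Θ :=
  wordLift F fun w => ((z ^ η w : Fˣ) : F) • Ξ w

@[simp] lemma scale_word (z : Fˣ) (w : List I) :
    scale deg z (Ξ w) = ((z ^ η w : Fˣ) : F) • Ξ w := by
  simp [scale]

@[simp] lemma scale_one (z : Fˣ) : scale deg z (1 : Λ) = 1 := by rw [← word_nil]; simp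

/-- `D` is homogeneous of degree `c`. -/
def HomDeg (c : ℤ) (D : Θ) : Prop :=
  ∀ z : Fˣ, scale deg z * D = ((z ^ c : Fˣ) : F) • (D * scale deg z)

/-- The sign operator `w ↦ (-1)^{c |w|} w`. -/
def par (c : ℤ) : Θ := scale deg ((-1) ^ c)

@[simp] lemma par_word (c : ℤ) (w : List I) : par deg c (Ξ w) = sgn F (c * η w) • Ξ w := by
  simp [par, sgn, zpow_mul]

@[simp] lemma par_one (c : ℤ) : par deg c (1 : Λ) = 1 := scale_one deg _

lemma scale_mul (z : Fˣ) (s t : Λ) : scale deg z (s * t) = scale deg z s * scale deg z t := by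
  induction t using word_induction with
  | h0 => simp
  | hadd a b ha hb => rw [mul_add, map_add, ha, hb, map_add, mul_add]
  | hw c v =>
    induction s using word_induction with
    | h0 => simp
    | hadd a b ha hb => rw [add_mul, map_add, ha, hb, map_add, add_mul]
    | hw d u =>
      simp only [smul_mul_smul_comm, map_smul, word_mul_word, scale_word, wordDeg_append, zpow_add,
        Units.val_mul]

lemma HomDeg.mul {c d : ℤ} {D E : Θ} (hD : HomDeg deg c D)
    (hE : HomDeg deg d E) : HomDeg deg (c + d) (D * E) := by
  intro z
  rw [← mul_assoc, hD z, smul_mul_assoc, mul_assoc, hE z, mul_smul_comm, smul_smul, zpow_add,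
    Units.val_mul, mul_assoc]

lemma HomDeg.add {c : ℤ} {D E : Θ} (hD : HomDeg deg c D)
    (hE : HomDeg deg c E) : HomDeg deg c (D + E) := by
  intro z
  rw [mul_add, hD z, hE z, add_mul, smul_add]

lemma HomDeg.smul {c : ℤ} {D : Θ} (hD : HomDeg deg c D) (a : F) : HomDeg deg c (a • D) := by
  intro z
  rw [mul_smul_comm, hD z, smul_mul_assoc, smul_comm]

lemma HomDeg.neg {c : ℤ} {D : Θ} (hD : HomDeg deg c D) : HomDeg deg c (-D) := by
  rw [← neg_one_smul F D]; exact hD.smul deg (-1)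

lemma HomDeg.sub {c : ℤ} {D E : Θ} (hD : HomDeg deg c D)
    (hE : HomDeg deg c E) : HomDeg deg c (D - E) := by
  rw [sub_eq_add_neg]; exact hD.add deg (hE.neg deg)

lemma homDeg_zero (c : ℤ) : HomDeg (F := F) deg c 0 := by intro z; simp

lemma homDeg_one : HomDeg (F := F) deg 0 1 := by intro z; simp

lemma HomDeg.pow_zero {D : Θ} (hD : HomDeg deg 0 D) (n : ℕ) : HomDeg deg 0 (D ^ n) := by
  induction n with
  | zero => simpa using homDeg_one deg
  | succ n ih => rw [pow_succ]; simpa using ih.mul deg hD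

lemma HomDeg.par_mul {c : ℤ} {D : Θ} (hD : HomDeg deg c D) (a : ℤ) :
    par deg a * D = sgn F (a * c) • (D * par deg a) := by
  have := hD ((-1) ^ a)
  rwa [← zpow_mul] at this

lemma HomDeg.scale_apply {c : ℤ} {D : Θ} (hD : HomDeg deg c D)
    (z : Fˣ) (w : List I) : scale deg z (D (Ξ w)) = ((z ^ (η w + c) : Fˣ) : F) • D (Ξ w) := by
  have := LinearMap.congr_fun (hD z) (Ξ w)
  simp only [End.mul_apply, smul_apply, scale_word, map_smul, smul_smul] at this
  rw [this, zpow_add, Units.val_mul, mul_comm]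

lemma HomDeg.par_apply {c : ℤ} {D : Θ} (hD : HomDeg deg c D)
    (a : ℤ) (w : List I) : par deg a (D (Ξ w)) = sgn F (a * (η w + c)) • D (Ξ w) := by
  rw [par, hD.scale_apply]; simp [sgn, zpow_mul]

/-- The coordinate description of homogeneity. -/
lemma homDeg_iff [CharZero F] {c : ℤ} {D : Θ} : HomDeg deg c D ↔
    ∀ w v, (wordBasis F I).repr (D (Ξ w)) v ≠ 0 → η v = η w + c := by
  have key : ∀ (z : Fˣ) (t : Λ) v, (wordBasis F I).repr (scale deg z t) v =
      ((z ^ η v : Fˣ) : F) * (wordBasis F I).repr t v := by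
    intro z t v
    induction t using word_induction with
    | h0 => simp
    | hadd a b ha hb => rw [map_add, map_add, Finsupp.add_apply, ha, hb, map_add, Finsupp.add_apply,
        mul_add]
    | hw d u =>
      rw [map_smul, scale_word]
      simp only [map_smul, word, Basis.repr_self, Finsupp.smul_apply, smul_eq_mul]
      by_cases h : u = v
      · subst h; simp; ring
      · simp [h]
  constructor
  · intro h w v hv
    -- Rescaling by `2` alone separates the degrees: its integral powers are distinct in
    -- characteristic zero, which is checked in `ℚ`.
    have h2 : (2 : F) ≠ 0 := two_ne_zero
    have h1 := congrArg (fun t => (wordBasis F I).repr t v) (h.scale_apply deg (Units.mk0 2 h2) w)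
    simp only [key, map_smul, Finsupp.smul_apply, smul_eq_mul] at h1
    have h3 := mul_right_cancel₀ hv h1
    simp only [Units.val_zpow_eq_zpow_val, Units.val_mk0] at h3
    have h4 : ((2 : ℚ) : F) ^ η v = ((2 : ℚ) : F) ^ (η w + c) := by simpa using h3
    rw [← Rat.cast_zpow, ← Rat.cast_zpow, Rat.cast_inj] at h4
    exact zpow_right_injective₀ (by norm_num) (by norm_num) h4
  · intro h z
    apply word_hom_ext; intro w
    apply (wordBasis F I).repr.injective
    ext v
    simp only [End.mul_apply, smul_apply, scale_word, map_smul, key, Finsupp.smul_apply,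
      smul_eq_mul]
    by_cases hv : (wordBasis F I).repr (D (Ξ w)) v = 0
    · simp [hv]
    · rw [h w v hv, zpow_add, Units.val_mul]; ring

/-! ### The length filtration -/

/-- The span of the words of length less than `n`. -/
def lenLT (F I : Type*) [Field F] (n : ℕ) : Submodule F Λ :=
  span F (Ξ '' {w | w.length < n})

set_option hygiene false in
/-- The length filtration. -/
notation "Γ" => lenLT F I

lemma word_mem_lenLT {w : List I} {n : ℕ} (h : w.length < n) : Ξ w ∈ Γ n := subset_span ⟨w, h, rfl⟩

lemma lenLT_zero : Γ 0 = ⊥ := by simp [lenLT]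

lemma lenLT_mono {m n : ℕ} (h : m ≤ n) : Γ m ≤ Γ n :=
  Submodule.span_mono (Set.image_mono fun _ hw => lt_of_lt_of_le hw h)

lemma exists_mem_lenLT (t : Λ) : ∃ n, t ∈ Γ n := by
  induction t using word_induction with
  | h0 => exact ⟨0, zero_mem _⟩
  | hadd a b ha hb =>
    obtain ⟨m, hm⟩ := ha
    obtain ⟨n, hn⟩ := hb
    exact ⟨max m n, add_mem (lenLT_mono (le_max_left _ _) hm) (lenLT_mono (le_max_right _ _) hn)⟩
  | hw c w => exact ⟨w.length + 1, Submodule.smul_mem _ _ (word_mem_lenLT (Nat.lt_succ_self _))⟩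

lemma lenLT_le_iff {n : ℕ} {S : Submodule F Λ} :
    Γ n ≤ S ↔ ∀ w : List I, w.length < n → Ξ w ∈ S := by
  rw [lenLT, span_le]
  exact ⟨fun h w hw => h ⟨w, hw, rfl⟩, by rintro h _ ⟨w, hw, rfl⟩; exact h w hw⟩

/-- `D` lowers the length by at least `k`. -/
def Lowers (k : ℕ) (D : Θ) : Prop :=
  ∀ w : List I, D (Ξ w) ∈ Γ (w.length + 1 - k)

lemma Lowers.mem {k : ℕ} {D : Θ} (h : Lowers k D) {n : ℕ}
    {t : Λ} (ht : t ∈ Γ n) : D t ∈ Γ (n - k) := by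
  have : Γ n ≤ (Γ (n - k)).comap D := lenLT_le_iff.2 fun w hw => lenLT_mono (by omega) (h w)
  exact this ht

lemma Lowers.mul {k l : ℕ} {D E : Θ} (hD : Lowers k D)
    (hE : Lowers l E) : Lowers (k + l) (D * E) := fun w =>
  lenLT_mono (by omega) (hD.mem (hE w))

lemma Lowers.mono {k l : ℕ} {D : Θ} (hD : Lowers k D) (h : l ≤ k) :
    Lowers l D := fun w => lenLT_mono (by omega) (hD w)

lemma Lowers.add {k : ℕ} {D E : Θ} (hD : Lowers k D)
    (hE : Lowers k E) : Lowers k (D + E) := fun w => add_mem (hD w) (hE w)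

lemma Lowers.smul {k : ℕ} {D : Θ} (hD : Lowers k D) (a : F) :
    Lowers k (a • D) := fun w => Submodule.smul_mem _ _ (hD w)

lemma Lowers.neg {k : ℕ} {D : Θ} (hD : Lowers k D) : Lowers k (-D) := fun w => neg_mem (hD w)

lemma Lowers.sub {k : ℕ} {D E : Θ} (hD : Lowers k D)
    (hE : Lowers k E) : Lowers k (D - E) := fun w => sub_mem (hD w) (hE w)

lemma lowers_one : Lowers 0 (1 : Θ) := fun w => word_mem_lenLT (by omega)

lemma lowers_zero (k : ℕ) : Lowers k (0 : Θ) := fun _ => zero_mem _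

lemma Lowers.pow {D : Θ} (hD : Lowers 1 D) (n : ℕ) : Lowers n (D ^ n) := by
  induction n with
  | zero => simpa using lowers_one
  | succ n ih => rw [pow_succ]; exact ih.mul hD

lemma lowers_scale (z : Fˣ) : Lowers 0 (scale (F := F) deg z) := fun w => by
  rw [scale_word]; exact Submodule.smul_mem _ _ (word_mem_lenLT (by omega))

/-! ### Deconcatenation -/

/-- Sum over all ways to cut a word in two. -/
def cutSum (f : List I → List I → M) (w : List I) : M :=
  ∑ i ∈ range (w.length + 1), f (w.take i) (w.drop i)

@[simp] lemma cutSum_nil (f : List I → List I → M) : cutSum f [] = f [] [] := by simp [cutSum]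

lemma cutSum_cons (f : List I → List I → M) (x : I) (w : List I) :
    cutSum f (x :: w) = f [] (x :: w) + cutSum (fun u v => f (x :: u) v) w := by
  simp only [cutSum, List.length_cons]
  rw [sum_range_succ' _ (w.length + 1), add_comm]
  simp

lemma cutSum_append_singleton (f : List I → List I → M) (w : List I) (x : I) :
    cutSum f (w ++ [x]) = cutSum (fun u v => f u (v ++ [x])) w + f (w ++ [x]) [] := by
  induction w generalizing f with
  | nil => simp [cutSum_cons]
  | cons y w ih => rw [List.cons_append, cutSum_cons, ih, cutSum_cons, add_assoc]; simp

lemma cutSum_congr {f g : List I → List I → M} {w : List I}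
    (h : ∀ u v, u ++ v = w → f u v = g u v) : cutSum f w = cutSum g w :=
  sum_congr rfl fun _ _ => h _ _ (List.take_append_drop _ _)

lemma map_cutSum {G : Type*} [FunLike G M N] [AddMonoidHomClass G M N] (φ : G)
    (f : List I → List I → M) (w : List I) :
    φ (cutSum f w) = cutSum (fun u v => φ (f u v)) w := by
  simp [cutSum, map_sum]

lemma cutSum_add (f g : List I → List I → M) (w : List I) :
    cutSum (fun u v => f u v + g u v) w = cutSum f w + cutSum g w := by
  simp [cutSum, Finset.sum_add_distrib]

lemma cutSum_smul (c : F) (f : List I → List I → M) (w : List I) :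
    cutSum (fun u v => c • f u v) w = c • cutSum f w := by
  simp [cutSum, smul_sum]

lemma cutSum_eq_zero {f : List I → List I → M} {w : List I}
    (h : ∀ u v, u ++ v = w → f u v = 0) : cutSum f w = 0 :=
  sum_eq_zero fun _ _ => h _ _ (List.take_append_drop _ _)

lemma cutSum_mem {S : Submodule F M} {f : List I → List I → M} {w : List I}
    (h : ∀ u v, u ++ v = w → f u v ∈ S) : cutSum f w ∈ S :=
  Submodule.sum_mem _ fun _ _ => h _ _ (List.take_append_drop _ _)

lemma cutSum_comm (f : List I → List I → List I → List I → M) (u v : List I) :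
    cutSum (fun a b => cutSum (fun c d => f a b c d) v) u =
      cutSum (fun c d => cutSum (fun a b => f a b c d) u) v := by
  simp only [cutSum]; exact sum_comm

/-- The deconcatenation coproduct. -/
def decon (F I : Type*) [Field F] :
    Λ →ₗ[F] Λ ⊗[F] Λ :=
  wordLift F (cutSum fun u v => Ξ u ⊗ₜ Ξ v)

set_option hygiene false in
/-- Deconcatenation. -/
notation "Δ" => decon F I

lemma decon_word (w : List I) : Δ (Ξ w) = cutSum (fun u v => Ξ u ⊗ₜ Ξ v) w := by simp [decon]

lemma decon_nil : Δ 1 = 1 ⊗ₜ 1 := by rw [← word_nil, decon_word]; simp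

/-- Left multiplication by a letter. -/
def consL (F : Type*) {I : Type*} [Field F] (x : I) : Θ :=
  mulLeft F (Ξ [x])

@[simp] lemma consL_word (x : I) (w : List I) : consL F x (Ξ w) = Ξ (x :: w) := by
  simp [consL, word_mul_word]

@[simp] lemma consL_one (x : I) : consL F x 1 = Ξ [x] := by rw [← word_nil, consL_word]

lemma consL_apply (x : I) (t : Λ) : consL F x t = Ξ [x] * t := rfl

lemma decon_cons (x : I) (w : List I) : Δ (Ξ (x :: w)) =
    1 ⊗ₜ Ξ (x :: w) + map (consL F x) 1 (Δ (Ξ w)) := by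
  rw [decon_word, cutSum_cons, decon_word, map_cutSum, word_nil]
  simp

/-- Projection to the words of length one. -/
def letterProj (F I : Type*) [Field F] : Θ :=
  wordLift F fun w => if w.length = 1 then Ξ w else 0

set_option hygiene false in
/-- The projection to the letters. -/
notation "ϖ" => letterProj F I

@[simp] lemma letterProj_singleton (x : I) : ϖ (Ξ [x]) = Ξ [x] := by simp [letterProj]

@[simp] lemma letterProj_cons_cons (x y : I) (w : List I) : ϖ (Ξ (x :: y :: w)) = 0 := by
  simp [letterProj]

lemma letterProj_of_length_ne {w : List I} (h : w.length ≠ 1) : ϖ (Ξ w) = 0 := by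
  simp [letterProj, h]

@[simp] lemma letterProj_nil : ϖ (1 : Λ) = 0 := by rw [← word_nil]; simp [letterProj]

lemma letterProj_idem : ϖ * ϖ = ϖ := by
  apply word_hom_ext; intro w
  rw [End.mul_apply]
  match w with
  | [] => simp [word_nil]
  | [x] => simp
  | x :: y :: w => simp

/-- The coefficient of the empty word. -/
def emptyCoeff (F I : Type*) [Field F] : Λ →ₗ[F] F :=
  wordLift F fun w => if w = [] then 1 else 0

set_option hygiene false in
/-- The coefficient of the empty word. -/
notation "ε" => emptyCoeff F I

@[simp] lemma emptyCoeff_one : ε 1 = 1 := by rw [← word_nil]; simp [emptyCoeff]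

@[simp] lemma emptyCoeff_cons (x : I) (w : List I) : ε (Ξ (x :: w)) = 0 := by simp [emptyCoeff]

-- Identities that are linear in a letter-valued element reduce in this way to single letters, since
-- such an element is its own projection.
@[elab_as_elim]
lemma letter_induction {p : Λ → Prop} (t : Λ)
    (ht : ϖ t = t) (h0 : p 0) (hadd : ∀ s t, p s → p t → p (s + t))
    (hw : ∀ (c : F) x, p (c • Ξ [x])) : p t := by
  have key : ∀ s : Λ, p (ϖ s) := by
    intro s
    induction s using word_induction with
    | h0 => simpa
    | hadd a b ha hb => rw [map_add]; exact hadd _ _ ha hb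
    | hw c w =>
      rw [map_smul]
      match w with
      | [] => simpa [word_nil] using h0
      | [x] => simpa using hw c x
      | x :: y :: w => simpa using h0
  rw [← ht]
  exact key t

/-- Convolution of operators. -/
def conv (A B : Θ) : Θ :=
  LinearMap.mul' F Λ ∘ₗ map A B ∘ₗ Δ

lemma conv_word (A B : Θ) (w : List I) :
    conv A B (Ξ w) = cutSum (fun u v => A (Ξ u) * B (Ξ v)) w := by
  simp [conv, decon_word, map_cutSum]

lemma conv_nil (A B : Θ) : conv A B 1 = A 1 * B 1 := by rw [← word_nil, conv_word]; simp

lemma conv_cons (A B : Θ) (x : I) (w : List I) :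
    conv A B (Ξ (x :: w)) = A 1 * B (Ξ (x :: w)) + conv (A * consL F x) B (Ξ w) := by
  simp [conv_word, cutSum_cons, word_nil]

end Words

/-! ### Coderivations and endomorphisms of the deconcatenation coalgebra -/

section Coalgebra

variable {F I : Type*} [Field F] (deg : I → ℤ)

/-- A nonempty word is recovered from its first letter and the rest. Applied to `U t` or `D t`, this
turns compatibility with the coproduct into a recursion on the length. -/
lemma eq_emptyCoeff_add_conv (t : Λ) : t = ε t • 1 + conv ϖ 1 t := by
  have : (1 : Θ) = LinearMap.smulRight ε 1 + conv ϖ 1 := by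
    apply word_hom_ext; intro w
    match w with
    | [] => simp [word_nil, conv_nil]
    | x :: w =>
      have h : conv (ϖ * consL F x) 1 (Ξ w) = Ξ (x :: w) := by
        cases w with
        | nil => rw [word_nil, conv_nil]; simp
        | cons y w =>
          rw [conv_cons, conv_word, cutSum_eq_zero, ← word_nil, word_cons x]
          · simp
          · intro u v _; simp
      simp [conv_cons, h]
  simpa using LinearMap.congr_fun this t

/-- `D` is a coderivation of degree `c` of the deconcatenation coalgebra. -/
structure IsCoder (c : ℤ) (D : Θ) : Prop where
  comul : Δ ∘ₗ D = (map D 1 + map (par deg c) D) ∘ₗ Δ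
  counit : ∀ t, ε (D t) = 0
  map_one : D 1 = 0

/-- `U` is an endomorphism of the deconcatenation coalgebra. -/
structure IsCoalgHom (U : Θ) : Prop where
  comul : Δ ∘ₗ U = map U U ∘ₗ Δ
  counit : ∀ t, ε (U t) = ε t
  map_one : U 1 = 1

variable {deg}

lemma map_mul_map (A B C D : Θ) : map A B ∘ₗ map C D = map (A * C) (B * D) :=
  (TensorProduct.map_comp _ _ _ _).symm

lemma map_map_apply (A B C D : Θ) (t : Λ ⊗[F] Λ) : map A B (map C D t) = map (A * C) (B * D) t :=
  LinearMap.congr_fun (map_mul_map A B C D) t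

lemma IsCoalgHom.one : IsCoalgHom (1 : Θ) where
  comul := by rw [End.one_eq_id, TensorProduct.map_id]; rfl
  counit _ := rfl
  map_one := rfl

lemma IsCoalgHom.mul {U V : Θ} (hU : IsCoalgHom U) (hV : IsCoalgHom V) : IsCoalgHom (U * V) where
  comul := by
    rw [End.mul_eq_comp, ← comp_assoc, hU.comul, comp_assoc, hV.comul, ← comp_assoc,
      map_mul_map]; rfl
  counit t := by rw [End.mul_apply, hU.counit, hV.counit]
  map_one := by rw [End.mul_apply, hV.map_one, hU.map_one]

lemma IsCoder.decon_apply {c : ℤ} {D : Θ} (hD : IsCoder deg c D) (t : Λ) : Δ (D t) =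
      map D 1 (Δ t) + map (par deg c) D (Δ t) :=
  LinearMap.congr_fun hD.comul t

lemma IsCoalgHom.decon_apply {U : Θ} (hU : IsCoalgHom U) (t : Λ) : Δ (U t) = map U U (Δ t) :=
  LinearMap.congr_fun hU.comul t

lemma IsCoder.add {c : ℤ} {D E : Θ} (hD : IsCoder deg c D)
    (hE : IsCoder deg c E) : IsCoder deg c (D + E) where
  comul := by
    rw [LinearMap.comp_add, hD.comul, hE.comul, map_add_left, map_add_right]
    simp only [LinearMap.add_comp]; abel
  counit t := by rw [add_apply, map_add, hD.counit, hE.counit, add_zero]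
  map_one := by rw [add_apply, hD.map_one, hE.map_one, add_zero]

lemma IsCoder.smul {c : ℤ} {D : Θ} (hD : IsCoder deg c D) (a : F) : IsCoder deg c (a • D) where
  comul := by
    rw [LinearMap.comp_smul, hD.comul, map_smul_left, map_smul_right]
    simp only [LinearMap.smul_comp, LinearMap.add_comp, smul_add]
  counit t := by rw [smul_apply, map_smul, hD.counit, smul_zero]
  map_one := by rw [smul_apply, hD.map_one, smul_zero]

lemma IsCoder.neg {c : ℤ} {D : Θ} (hD : IsCoder deg c D) : IsCoder deg c (-D) := by
  rw [← neg_one_smul F D]; exact hD.smul (-1)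

lemma IsCoder.sub {c : ℤ} {D E : Θ} (hD : IsCoder deg c D)
    (hE : IsCoder deg c E) : IsCoder deg c (D - E) := by
  rw [sub_eq_add_neg]; exact hD.add hE.neg

lemma isCoder_zero (c : ℤ) : IsCoder (F := F) deg c 0 where
  comul := by simp
  counit t := by simp
  map_one := by simp

lemma par_mul_par (a b : ℤ) : par (F := F) deg a * par deg b = par deg (a + b) := by
  apply word_hom_ext; intro w
  simp only [End.mul_apply, par_word, map_smul, smul_smul, add_mul, sgn_add]
  rw [mul_comm]

lemma par_even {a : ℤ} (h : Even a) : par (F := F) deg a = 1 := by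
  apply word_hom_ext; intro w
  simp [sgn_even (h.mul_right _)]

/-- The mixed terms, with one operator on each tensor factor, cancel: moving either operator past
the sign operator of the other costs the sign `(-1)^{c d}`. -/
lemma IsCoder.bracket {c d : ℤ} {D E : Θ} (hD : IsCoder deg c D)
    (hE : IsCoder deg d E) (hD' : HomDeg deg c D) (hE' : HomDeg deg d E) :
    IsCoder deg (c + d) (D * E - sgn F (c * d) • (E * D)) where
  comul := by
    ext1 t
    have h1 := hD'.par_mul deg d
    have h2 := hE'.par_mul deg c
    rw [sub_eq_add_neg, ← neg_one_smul F (sgn F (c * d) • (E * D)), smul_smul]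
    simp only [comp_apply, smul_apply, map_smul, End.mul_apply, add_apply, hD.decon_apply,
      hE.decon_apply, map_add,
      map_map_apply, map_add_left, map_add_right,
      map_smul_left, map_smul_right, mul_one, one_mul, h1, h2, smul_add,
      smul_smul, par_mul_par, neg_mul, one_mul]
    rw [mul_comm d c, sgn_mul_self, add_comm d c]
    simp only [neg_smul, one_smul]
    abel
  counit t := by simp [hD.counit, hE.counit]
  map_one := by simp [hD.map_one, hE.map_one]

lemma IsCoalgHom.conv_comp {U : Θ} (hU : IsCoalgHom U)
    (A B : Θ) : conv A B * U = conv (A * U) (B * U) := by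
  ext1 t
  simp only [conv, End.mul_apply, comp_apply, hU.decon_apply, map_map_apply]

lemma IsCoder.conv_comp {c : ℤ} {D : Θ} (hD : IsCoder deg c D) (A B : Θ) :
    conv A B * D = conv (A * D) B + conv (A * par deg c) (B * D) := by
  ext1 t
  simp only [conv, End.mul_apply, comp_apply, hD.decon_apply, map_map_apply, add_apply, map_add,
    mul_one]

/-- The recursion expressing a coalgebra morphism through its components. -/
lemma IsCoalgHom.apply_cons {U : Θ} (hU : IsCoalgHom U) (x : I) (w : List I) : U (Ξ (x :: w)) =
      conv (ϖ * U) U (Ξ (x :: w)) := by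
  rw [eq_emptyCoeff_add_conv (U (Ξ (x :: w))), hU.counit, emptyCoeff_cons, zero_smul, zero_add,
    ← End.mul_apply, hU.conv_comp, one_mul]

lemma IsCoder.apply_eq {c : ℤ} {D : Θ} (hD : IsCoder deg c D) (t : Λ) : D t =
      conv (ϖ * D) 1 t + conv (ϖ * par deg c) D t := by
  rw [eq_emptyCoeff_add_conv (D t), hD.counit, zero_smul, zero_add, ← End.mul_apply, hD.conv_comp,
    one_mul, add_apply]

lemma conv_letterProj_par (c : ℤ) (D : Θ) (x : I) (w : List I) :
    conv (ϖ * par deg c) D (Ξ (x :: w)) = sgn F (c * deg x) • (Ξ [x] * D (Ξ w)) := by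
  have h1 : (ϖ * par deg c : Θ) 1 = 0 := by simp
  rw [conv_cons, h1, zero_mul, zero_add]
  cases w with
  | nil => rw [word_nil, conv_nil]; simp
  | cons y w =>
    rw [conv_cons, conv_word, cutSum_eq_zero]
    · simp
    · intro u v _; simp

lemma IsCoder.apply_cons {c : ℤ} {D : Θ} (hD : IsCoder deg c D)
    (x : I) (w : List I) : D (Ξ (x :: w)) = conv (ϖ * D) 1 (Ξ (x :: w)) +
        sgn F (c * deg x) • (Ξ [x] * D (Ξ w)) := by
  rw [hD.apply_eq, conv_letterProj_par]

/-- A map that is a coderivation along a coalgebra morphism vanishes on short words if its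
components do. -/
lemma eq_zero_of_comul {c : ℤ} {U E : Θ} (hU1 : ϖ (U 1) = 0) (hE : Δ ∘ₗ E =
      (map E U + map (par deg c * U) E) ∘ₗ Δ)
    (hE0 : ∀ t, ε (E t) = 0) {n : ℕ}
    (hn : ∀ w : List I, w.length < n → ϖ (E (Ξ w)) = 0) (w : List I)
    (hw : w.length < n) : E (Ξ w) = 0 := by
  induction h : w.length using Nat.strong_induction_on generalizing w with
  | _ k ih =>
  have h1 : conv ϖ 1 (E (Ξ w)) = conv (ϖ * E) U (Ξ w) + conv (ϖ * (par deg c * U)) E (Ξ w) := by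
    have := LinearMap.congr_fun hE (Ξ w)
    simp only [comp_apply, add_apply] at this
    simp only [conv, comp_apply, this, map_add, map_map_apply, one_mul]
  -- In the first sum the letter component of `E` is evaluated at a subword and vanishes. In the
  -- second, an empty first part contributes nothing and otherwise `E` is evaluated at a shorter
  -- word.
  rw [eq_emptyCoeff_add_conv (E (Ξ w)), hE0, zero_smul, zero_add, h1, conv_word, conv_word,
    cutSum_eq_zero, cutSum_eq_zero, add_zero]
  · rintro u v rfl
    rcases u with _ | ⟨x, u⟩
    · have h2 : ∀ s : Λ, ϖ s = 0 → ϖ (par deg c s) = 0 := by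
        have h3 : ϖ * par (F := F) deg c = par deg c * ϖ := by
          apply word_hom_ext; intro w
          by_cases hw : w.length = 1 <;> simp [letterProj, hw]
        intro s hs
        rw [← End.mul_apply, h3, End.mul_apply, hs, map_zero]
      simp [word_nil, h2 _ hU1]
    · rw [ih v.length (by simp at h; omega) v (by simp at hw; omega) rfl, mul_zero]
  · rintro u v rfl
    simp at hw
    rw [End.mul_apply, hn u (by omega), zero_mul]

lemma IsCoder.eq_zero {c : ℤ} {D : Θ} (hD : IsCoder deg c D) {n : ℕ}
    (hn : ∀ w : List I, w.length < n → ϖ (D (Ξ w)) = 0) (w : List I)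
    (hw : w.length < n) : D (Ξ w) = 0 :=
  eq_zero_of_comul (deg := deg) (c := c) (U := 1) (by simp) (by simpa using hD.comul) hD.counit
    hn w hw

lemma IsCoder.ext {c : ℤ} {D E : Θ} (hD : IsCoder deg c D)
    (hE : IsCoder deg c E) (h : ϖ * D = ϖ * E) : D = E := by
  apply word_hom_ext; intro w
  rw [← sub_eq_zero, ← sub_apply]
  refine (hD.sub hE).eq_zero (n := w.length + 1) (fun v _ => ?_) w (Nat.lt_succ_self _)
  have := LinearMap.congr_fun h (Ξ v)
  simp only [End.mul_apply] at this
  rw [sub_apply, map_sub, this, sub_self]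

/-- The recursion `IsCoalgHom.apply_cons` involves the letter component at initial subwords and the
morphism itself only at strictly shorter words, as the component at the empty word is zero. -/
lemma IsCoalgHom.eqOn {U V : Θ} (hU : IsCoalgHom U) (hV : IsCoalgHom V) {n : ℕ}
    (hn : ∀ w : List I, w.length < n → ϖ (U (Ξ w)) = ϖ (V (Ξ w)))
    (w : List I) (hw : w.length < n) : U (Ξ w) = V (Ξ w) := by
  induction h : w.length using Nat.strong_induction_on generalizing w with
  | _ k ih =>
  rcases w with _ | ⟨x, w⟩
  · rw [word_nil, hU.map_one, hV.map_one]
  rw [hU.apply_cons, hV.apply_cons, conv_word, conv_word]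
  apply cutSum_congr
  intro u v huv
  have hl := congrArg List.length huv
  simp at hl hw h
  rw [End.mul_apply, hn u (by omega), End.mul_apply]
  rcases u with _ | ⟨y, u⟩
  · simp [word_nil, hV.map_one]
  · simp at hl
    rw [ih v.length (by omega) v (by omega) rfl]

lemma IsCoalgHom.ext {U V : Θ} (hU : IsCoalgHom U)
    (hV : IsCoalgHom V) (h : ϖ * U = ϖ * V) : U = V := by
  apply word_hom_ext; intro w
  exact hU.eqOn hV (n := w.length + 1) (fun v _ => LinearMap.congr_fun h (Ξ v)) w
    (Nat.lt_succ_self _)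

/-! ### Construction of coderivations and coalgebra morphisms -/

/-- A cut is either in front of the leading letter or inside the remaining factor. -/
lemma decon_letter_mul {y : Λ} (hy : ϖ y = y) (t : Λ) : Δ (y * t) = 1 ⊗ₜ (y * t) +
      map (mulLeft F y) 1 (Δ t) := by
  induction t using word_induction with
  | h0 => simp
  | hadd a b ha hb => rw [mul_add, map_add, ha, hb, map_add, map_add, tmul_add]; abel
  | hw c w =>
    refine letter_induction y hy ?_ ?_ ?_
    · simp [LinearMap.mulLeft_zero_eq_zero]
    · intro a b ha hb
      have h1 : mulLeft F (a + b) = mulLeft F a + mulLeft F b := by ext1 s; simp [add_mul]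
      rw [add_mul, map_add, ha, hb, h1, map_add_left, add_apply, tmul_add]; abel
    · intro d x
      have h1 : mulLeft F (d • Ξ [x]) = d • consL F x := by ext1 s; simp [consL]
      rw [h1, smul_mul_smul_comm, ← word_cons, map_smul, map_smul, map_smul, decon_cons, mul_smul,
        map_smul_left, smul_apply, tmul_smul, mul_smul,
        smul_comm c d, smul_add, smul_add]

/-- `U` needs to respect the coproduct only up to the length of `w`; this allows the use of the
lemma inside the induction that proves this property of `coalgHom`. For coderivations it is used
with `U = 1`. -/
lemma decon_conv {U : Θ} (hU1 : U 1 = 1) (w : List I) (hU : ∀ v : List I, v.length ≤ w.length →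
      Δ (U (Ξ v)) = map U U (Δ (Ξ v)))
    (g : Θ) (hg : ϖ * g = g) :
    Δ (conv g U (Ξ w)) = 1 ⊗ₜ conv g U (Ξ w) + map (conv g U) U (Δ (Ξ w)) := by
  have hgy : ∀ t, ϖ (g t) = g t := fun t => LinearMap.congr_fun hg t
  induction w generalizing g with
  | nil =>
    rw [word_nil, conv_nil, hU1, decon_letter_mul (hgy 1), decon_nil]
    simp [conv_nil, hU1]
  | cons x w ih =>
    have hg' : ϖ * (g * consL F x) = g * consL F x := by rw [← mul_assoc, hg]
    have h1 : conv g U * consL F x =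
        mulLeft F (g 1) * (U * consL F x) + conv (g * consL F x) U := by
      apply word_hom_ext; intro v; simp [conv_cons]
    rw [conv_cons, map_add, ih (fun v hv => hU v (by simp; omega)) _ hg'
      (fun t => LinearMap.congr_fun hg' t), decon_letter_mul (hgy 1), hU (x :: w) le_rfl,
      map_map_apply, decon_cons, map_add, map_add, map_map_apply, map_map_apply, h1,
      map_add_left, map_tmul, map_tmul,
      tmul_add, add_apply, End.mul_apply, hU1, conv_nil, hU1]
    simp only [mulLeft_apply, mul_one, one_mul, mul_assoc]
    abel

/-- The coderivation of degree `c` with component `g`, on words. -/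
def coderAux (deg : I → ℤ) (c : ℤ) (g : Θ) :
    List I → Λ
  | [] => 0
  | x :: w => conv g 1 (Ξ (x :: w)) + sgn F (c * deg x) • (Ξ [x] * coderAux deg c g w)

/-- The coderivation of degree `c` with component `g`. -/
def coder (deg : I → ℤ) (c : ℤ) (g : Θ) :
    Θ :=
  wordLift F (coderAux deg c g)

set_option hygiene false in
/-- The coderivation with given components. -/
notation "κ" => coder deg

@[simp] lemma coder_one (c : ℤ) (g : Θ) : κ c g 1 = 0 := by rw [← word_nil]; simp [coder, coderAux]

lemma coder_cons (c : ℤ) (g : Θ) (x : I) (w : List I) : κ c g (Ξ (x :: w)) =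
      conv g 1 (Ξ (x :: w)) + sgn F (c * deg x) • (Ξ [x] * κ c g (Ξ w)) := by
  simp [coder, coderAux]

lemma emptyCoeff_letter {y : Λ} (hy : ϖ y = y) (t : Λ) : ε (y * t) = 0 := by
  induction t using word_induction with
  | h0 => simp
  | hadd a b ha hb => rw [mul_add, map_add, ha, hb, add_zero]
  | hw c w =>
    refine letter_induction y hy ?_ ?_ ?_
    · simp
    · intro a b ha hb
      rw [add_mul, map_add, ha, hb, add_zero]
    · intro d x
      rw [smul_mul_smul_comm, ← word_cons, map_smul, emptyCoeff_cons, smul_zero]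

lemma letterProj_letter_mul {y : Λ} (hy : ϖ y = y) (t : Λ) : ϖ (y * t) = ε t • y := by
  induction t using word_induction with
  | h0 => simp
  | hadd a b ha hb => rw [mul_add, map_add, ha, hb, map_add, add_smul]
  | hw c w =>
    refine letter_induction y hy ?_ ?_ ?_
    · simp
    · intro a b ha hb
      rw [add_mul, map_add, ha, hb, smul_add]
    · intro d x
      rw [smul_mul_smul_comm, ← word_cons, map_smul, map_smul]
      cases w with
      | nil => simp [word_nil, smul_smul, mul_comm]
      | cons z w => simp

lemma letter_apply {g : Θ} (hg : ϖ * g = g) (t : Λ) : ϖ (g t) = g t := LinearMap.congr_fun hg t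

/-- Of the two terms in the recursion for `coder`, the one with `g` at the front is treated by
`decon_conv`, the other by induction. The sign in the recursion is the one that the sign operator
picks up at the first letter. -/
lemma isCoder_coder (c : ℤ) {g : Θ} (hg : ϖ * g = g) (hg1 : g 1 = 0) : IsCoder deg c (κ c g) where
  comul := by
    apply word_hom_ext; intro w
    rw [comp_apply, comp_apply, add_apply]
    induction w with
    | nil => simp [word_nil, decon_nil]
    | cons x w ih =>
      have h1 : κ c g * consL F x =
          conv g 1 * consL F x + sgn F (c * deg x) • (consL F x * κ c g) := by
        apply word_hom_ext; intro v; simp [coder_cons]; rfl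
      have h2 : par (F := F) deg c * consL F x = sgn F (c * deg x) • (consL F x * par deg c) := by
        apply word_hom_ext; intro v; simp [mul_add, sgn_add, mul_smul]
      rw [coder_cons, map_add, map_smul, decon_conv rfl (x :: w) (fun v _ => by
        rw [End.one_eq_id, TensorProduct.map_id]; rfl) g hg,
        decon_letter_mul (letterProj_singleton x), ih, decon_cons]
      simp only [map_add, map_map_apply, map_tmul, coder_one, conv_nil, hg1, h1, h2, map_add_left,
        map_smul_left, add_apply,
        smul_apply, TensorProduct.zero_tmul, End.one_apply, one_mul,
        mul_one, zero_add, smul_add, ← consL_apply, show mulLeft F (Ξ [x]) =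
          consL F x from rfl, coder_cons, tmul_add, tmul_smul]
      rw [par_one]
      abel
  counit t := by
    induction t using word_induction with
    | h0 => simp
    | hadd a b ha hb => rw [map_add, map_add, ha, hb, add_zero]
    | hw d w =>
      rw [map_smul, map_smul]
      cases w with
      | nil => simp [word_nil]
      | cons x w =>
        rw [coder_cons, map_add, map_smul, emptyCoeff_letter (letterProj_singleton x), conv_word,
          map_cutSum, cutSum_eq_zero]
        · simp
        · intro u v _; exact emptyCoeff_letter (letter_apply hg _) _
  map_one := coder_one c g

lemma letterProj_coder (c : ℤ) {g : Θ} (hg : ϖ * g = g) (hg1 : g 1 = 0) : ϖ * κ c g = g := by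
  apply word_hom_ext; intro w
  rw [End.mul_apply]
  cases w with
  | nil => simp [word_nil, hg1]
  | cons x w =>
    rw [coder_cons, map_add, map_smul, letterProj_letter_mul (letterProj_singleton x),
      (isCoder_coder c hg hg1).counit, zero_smul, smul_zero, add_zero, conv_word, map_cutSum]
    have : ∀ v : List I, cutSum (fun u v => ε (Ξ v) • g (Ξ u)) v = g (Ξ v) := by
      intro v
      induction v using List.reverseRecOn with
      | nil => simp [word_nil]
      | append_singleton v x _ =>
        rw [cutSum_append_singleton, cutSum_eq_zero]
        · simp [word_nil]
        · intro u w _; cases w <;> simp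
    rw [← this (x :: w)]
    apply cutSum_congr
    intro u v _
    rw [letterProj_letter_mul (letter_apply hg _)]; rfl

lemma HomDeg.conv {c d : ℤ} {A B : Θ} (hA : HomDeg deg c A)
    (hB : HomDeg deg d B) : HomDeg deg (c + d) (conv A B) := by
  intro z
  apply word_hom_ext; intro w
  simp only [End.mul_apply, conv_word, map_cutSum, scale_mul, smul_apply, scale_word, map_smul,
    hA.scale_apply, hB.scale_apply, ← cutSum_smul]
  apply cutSum_congr
  rintro u v rfl
  simp only [smul_mul_smul_comm, smul_smul, wordDeg_append, zpow_add, Units.val_mul]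
  congr 1; ring

lemma homDeg_coder {c : ℤ} {g : Θ} (hg : HomDeg deg c g) : HomDeg deg c (κ c g) := by
  intro z
  apply word_hom_ext; intro w
  induction w with
  | nil => simp [word_nil]
  | cons x w ih =>
    have h1 := LinearMap.congr_fun ((hg.conv (homDeg_one deg)) z) (Ξ (x :: w))
    simp only [End.mul_apply, smul_apply, scale_word, map_smul, coder_cons, map_add, scale_mul,
      wordDeg_cons, wordDeg_nil, add_zero] at h1 ih ⊢
    rw [ih, h1]
    simp only [smul_add, smul_smul, mul_smul_comm, smul_mul_assoc, zpow_add, Units.val_mul]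
    congr 2; ring

/-- The component replaces more than `k` letters by a single one. -/
lemma lowers_coder {c : ℤ} {k : ℕ} {g : Θ}
    (hg : ϖ * g = g) (hk : ∀ w : List I, w.length ≤ k → g (Ξ w) = 0) :
    Lowers k (κ c g) := by
  have hmul : ∀ {y : Λ}, ϖ y = y → ∀ {n t}, t ∈ Γ n → y * t ∈ Γ (n + 1) := by
    intro y hy n t ht
    have : Γ n ≤ (Γ (n + 1)).comap (mulLeft F y) := by
      refine lenLT_le_iff.2 fun w hw => ?_
      rw [mem_comap, mulLeft_apply]
      refine letter_induction y hy ?_ ?_ ?_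
      · simp
      · intro a b ha hb
        rw [add_mul]; exact add_mem ha hb
      · intro d x
        rw [smul_mul_assoc, ← word_cons]
        exact Submodule.smul_mem _ _ (word_mem_lenLT (by simpa using hw))
    exact this ht
  intro w
  induction w with
  | nil => simp [word_nil]
  | cons x w ih =>
    rw [coder_cons]
    refine add_mem ?_ (Submodule.smul_mem _ _ ?_)
    · rw [conv_word]
      refine cutSum_mem fun u v huv => ?_
      have hl := congrArg List.length huv
      simp only [List.length_append, List.length_cons] at hl
      by_cases hu : u.length ≤ k
      · rw [hk u hu, zero_mul]; exact zero_mem _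
      · refine lenLT_mono ?_ (hmul (letter_apply hg _) (word_mem_lenLT (n := v.length + 1) ?_))
        · simp; omega
        · omega
    · by_cases hw : w.length + 1 ≤ k
      · have : Γ (w.length + 1 - k) = ⊥ := by rw [Nat.sub_eq_zero_of_le hw, lenLT_zero]
        rw [this, mem_bot] at ih
        rw [ih, mul_zero]; exact zero_mem _
      · refine lenLT_mono ?_ (hmul (letterProj_singleton x) ih)
        simp; omega

/-- The value at `u_1 w` of `∑ ψ(u_1 w_1) φ(w_2) ⋯ φ(w_k)`, summed over `w = w_1 ⋯ w_k`. -/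
def coalgHomAux (φ : List I → Λ) :
    (List I → Λ) → List I → Λ
  | ψ, [] => ψ []
  | ψ, x :: w => ψ [] * coalgHomAux φ (fun u => φ (x :: u)) w +
      coalgHomAux φ (fun u => ψ (x :: u)) w

/-- The coalgebra morphism with component `φ`. -/
def coalgHom (φ : Θ) : Θ :=
  wordLift F fun w => match w with
    | [] => 1
    | x :: w => coalgHomAux (fun u => φ (Ξ u)) (fun u => φ (Ξ (x :: u))) w

lemma coalgHom_one (φ : Θ) : coalgHom φ 1 = 1 := by simp [coalgHom]

lemma coalgHomAux_eq (φ : Θ) (ψ : List I → Λ) (w : List I) : coalgHomAux (fun u => φ (Ξ u)) ψ w =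
      conv (wordLift F ψ) (coalgHom φ) (Ξ w) := by
  induction w generalizing ψ with
  | nil => rw [coalgHomAux, word_nil, conv_nil, coalgHom_one]; simp
  | cons x w ih =>
    have : wordLift F ψ * consL F x = wordLift F fun u => ψ (x :: u) := by
      apply word_hom_ext; intro v; simp
    rw [coalgHomAux, ih, ih, conv_cons, this]
    simp [coalgHom, ih]

lemma coalgHom_cons (φ : Θ) (x : I) (w : List I) :
    coalgHom φ (Ξ (x :: w)) = conv (φ * consL F x) (coalgHom φ) (Ξ w) := by
  have : (wordLift F fun u => φ (Ξ (x :: u))) = φ * consL F x := by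
    apply word_hom_ext; intro v; simp
  rw [← this, ← coalgHomAux_eq]
  simp [coalgHom]

/-- Strong induction on the length; after the first letter is absorbed into the component,
`decon_conv` needs the claim only for shorter words. -/
lemma isCoalgHom_coalgHom {φ : Θ} (hφ : ϖ * φ = φ) : IsCoalgHom (coalgHom φ) where
  comul := by
    apply word_hom_ext; intro w
    rw [comp_apply, comp_apply]
    induction h : w.length using Nat.strong_induction_on generalizing w with
    | _ k ih =>
    cases w with
    | nil => simp [word_nil, decon_nil, coalgHom_one]
    | cons x w =>
      have hg' : ϖ * (φ * consL F x) = φ * consL F x := by rw [← mul_assoc, hφ]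
      have h1 : coalgHom φ * consL F x = conv (φ * consL F x) (coalgHom φ) := by
        apply word_hom_ext; intro v; simp [coalgHom_cons]
      rw [decon_cons, map_add, map_map_apply, h1, coalgHom_cons, decon_conv (coalgHom_one φ) w
        (fun v hv => ih v.length (by simp at h; omega) v rfl) _ hg']
      simp [coalgHom_one, coalgHom_cons]
  counit t := by
    induction t using word_induction with
    | h0 => simp
    | hadd a b ha hb => rw [map_add, map_add, ha, hb, map_add]
    | hw d w =>
      rw [map_smul, map_smul, map_smul]
      cases w with
      | nil => simp [word_nil, coalgHom_one]
      | cons x w =>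
        rw [coalgHom_cons, conv_word, map_cutSum, cutSum_eq_zero, emptyCoeff_cons]
        intro u v _; exact emptyCoeff_letter (letter_apply hφ _) _
  map_one := coalgHom_one φ

lemma letterProj_coalgHom {φ : Θ} (hφ : ϖ * φ = φ) (hφ1 : φ 1 = 0) : ϖ * coalgHom φ = φ := by
  apply word_hom_ext; intro w
  rw [End.mul_apply]
  cases w with
  | nil => simp [word_nil, hφ1, coalgHom_one]
  | cons x w =>
    rw [coalgHom_cons, conv_word, map_cutSum]
    have : ∀ v : List I, cutSum (fun u v => ε (Ξ v) • φ (Ξ (x :: u))) v = φ (Ξ (x :: v)) := by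
      intro v
      induction v using List.reverseRecOn with
      | nil => simp [word_nil]
      | append_singleton v x _ =>
        rw [cutSum_append_singleton, cutSum_eq_zero]
        · simp [word_nil]
        · intro u w _; cases w <;> simp
    rw [← this w]
    apply cutSum_congr
    intro u v _
    rw [End.mul_apply, consL_word, letterProj_letter_mul (letter_apply hφ _),
      (isCoalgHom_coalgHom hφ).counit]

lemma homDeg_coalgHom {φ : Θ} (hφ : HomDeg deg 0 φ) : HomDeg deg 0 (coalgHom φ) := by
  intro z
  apply word_hom_ext; intro w
  induction h : w.length using Nat.strong_induction_on generalizing w with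
  | _ k ih =>
  cases w with
  | nil => simp [word_nil, coalgHom_one]
  | cons x w =>
    simp only [End.mul_apply, scale_word, map_smul, coalgHom_cons, conv_word,
      map_cutSum, zpow_zero, Units.val_one, one_smul, scale_mul] at ih ⊢
    rw [← cutSum_smul (F := F)]
    apply cutSum_congr
    rintro u v rfl
    rw [ih v.length (by simp at h; omega) v rfl, consL_word, hφ.scale_apply]
    simp only [smul_mul_smul_comm, wordDeg_cons, wordDeg_append, zpow_add, Units.val_mul, add_zero,
      mul_assoc]

end Coalgebra

/-! ### The shuffle product and the Harrison condition -/

section Shuffle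

variable {F I : Type*} [Field F] (deg : I → ℤ)

/-- The signed shuffle product of two words. -/
def shuffle (F : Type*) {I : Type*} [Field F] (deg : I → ℤ) :
    List I → List I → Λ
  | [], v => Ξ v
  | x :: u, [] => Ξ (x :: u)
  | x :: u, y :: v => consL F x (shuffle F deg u (y :: v)) +
      sgn F (deg y * η (x :: u)) • consL F y (shuffle F deg (x :: u) v)
termination_by u v => u.length + v.length

set_option hygiene false in
/-- The shuffle product of words. -/
notation "ш" => shuffle F deg

@[simp] lemma shuffle_nil_left (v : List I) : ш [] v = Ξ v := by rw [shuffle]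

@[simp] lemma shuffle_nil_right (u : List I) : ш u [] = Ξ u := by cases u <;> rw [shuffle]

lemma shuffle_cons_cons (x y : I) (u v : List I) : ш (x :: u) (y :: v) = consL F x (ш u (y :: v)) +
      sgn F (deg y * η (x :: u)) • consL F y (ш (x :: u) v) := by
  rw [shuffle]

/-- The signed shuffle product as a bilinear map. -/
def shuffleMul (F : Type*) {I : Type*} [Field F] (deg : I → ℤ) :
    Λ →ₗ[F] Λ →ₗ[F] Λ :=
  wordLift F fun u => wordLift F fun v => ш u v

set_option hygiene false in
/-- The bilinear shuffle product. -/
notation "Ш" => shuffleMul F deg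

@[simp] lemma shuffleMul_word (u v : List I) : Ш (Ξ u) (Ξ v) = ш u v := by simp [shuffleMul]

@[simp] lemma shuffleMul_one_left (t : Λ) : Ш 1 t = t := by
  have : Ш 1 = LinearMap.id := by apply word_hom_ext; intro w; rw [← word_nil]; simp
  rw [this]; rfl

@[simp] lemma shuffleMul_one_right (t : Λ) : Ш t 1 = t := by
  have : Ш.flip 1 = LinearMap.id := by
    apply word_hom_ext; intro w; rw [LinearMap.flip_apply, ← word_nil]; simp
  exact LinearMap.congr_fun this t

lemma scale_shuffle (z : Fˣ) (u v : List I) : scale deg z (ш u v) =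
    ((z ^ (η u + η v) : Fˣ) : F) • ш u v := by
  induction u, v using shuffle.induct with
  | case1 v => simp
  | case2 x u => simp
  | case3 x u y v ih1 ih2 =>
    rw [shuffle_cons_cons, map_add, map_smul, consL_apply, consL_apply, scale_mul, scale_mul, ih1,
      ih2]
    simp only [scale_word, smul_mul_smul_comm, smul_add, smul_smul, wordDeg_cons, wordDeg_nil,
      zpow_add, Units.val_mul, add_zero]
    congr 2 <;> ring

lemma par_shuffle (c : ℤ) (u v : List I) : par deg c (ш u v) = sgn F (c * (η u + η v)) • ш u v := by
  rw [par, scale_shuffle, sgn, zpow_mul]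

lemma shuffle_comm (u v : List I) : ш u v = sgn F (η u * η v) • ш v u := by
  induction u, v using shuffle.induct with
  | case1 v => simp
  | case2 x u => simp
  | case3 x u y v ih1 ih2 =>
    rw [shuffle_cons_cons, shuffle_cons_cons, ih1, ih2, add_comm, smul_add, smul_smul, map_smul,
      map_smul, smul_smul, ← sgn_add, ← sgn_add]
    congr 2
    · apply sgn_congr; simp only [wordDeg_cons, Int.even_add, Int.even_mul]; grind
    · apply sgn_congr; simp only [wordDeg_cons, Int.even_add, Int.even_mul]; grind

lemma decon_consL (x : I) (t : Λ) : Δ (consL F x t) = 1 ⊗ₜ consL F x t + map (consL F x) 1 (Δ t) :=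
  decon_letter_mul (letterProj_singleton x) t

/-- The shuffle product is compatible with deconcatenation. -/
lemma decon_shuffle (u v : List I) : Δ (ш u v) =
    cutSum (fun u₁ u₂ => cutSum (fun v₁ v₂ => sgn F (η u₂ * η v₁) •
      (ш u₁ v₁ ⊗ₜ[F] ш u₂ v₂)) v) u := by
  induction u, v using shuffle.induct with
  | case1 v => simp [decon_word]
  | case2 x u => simp [decon_word]
  | case3 x u y v ih1 ih2 =>
    rw [shuffle_cons_cons, map_add, map_smul, decon_consL, decon_consL, ih1, ih2]
    simp only [cutSum_cons, map_cutSum, cutSum_add, map_add, map_smul, map_tmul, shuffle_nil_left,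
      shuffle_nil_right, wordDeg_nil, wordDeg_cons, mul_zero, sgn_zero,
      one_smul, consL_word, End.one_apply, word_nil, shuffle_cons_cons,
      TensorProduct.add_tmul, tmul_add, TensorProduct.smul_tmul',
      tmul_smul, smul_add, ← cutSum_smul]
    have key : ∀ a b c d e f e' f' : Λ ⊗[F] Λ, e = e' → f = f' →
        a + (b + c) + (d + (e + f)) = a + d + e' + (b + (c + f')) := by
      rintro a b c d e f _ _ rfl rfl; abel
    refine key _ _ _ _ _ _ _ _ (cutSum_congr ?_) (cutSum_congr fun u₁ u₂ hu => cutSum_congr ?_)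
    · intro v₁ v₂ _
      rw [smul_smul, ← sgn_add]
      congr 3; ring
    · intro v₁ v₂ _
      subst hu
      rw [smul_smul, smul_smul, ← sgn_add, ← sgn_add]
      congr 2
      apply sgn_congr; simp only [wordDeg_append, Int.even_add, Int.even_mul]; grind

/-- The span of the letters of degree `n`. -/
def lettersOfDeg (F : Type*) {I : Type*} [Field F] (deg : I → ℤ) (n : ℤ) :
    Submodule F Λ :=
  span F ((fun x => Ξ [x]) '' {x | deg x = n})

lemma homDeg_letterProj : HomDeg deg 0 ϖ := by
  intro z; apply word_hom_ext; intro w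
  by_cases h : w.length = 1
  · simp [letterProj, h]
  · simp [letterProj, h]

variable {deg}

/-- Homogeneity is defined by the behaviour under rescaling; in characteristic zero `homDeg_iff`
makes it a statement about each coordinate. -/
lemma mem_lettersOfDeg [CharZero F] {c : ℤ} {g : Θ}
    (hg : ϖ * g = g) (hc : HomDeg deg c g) (w : List I) :
    g (Ξ w) ∈ lettersOfDeg F deg (η w + c) := by
  rw [← letter_apply hg (Ξ w), ← (wordBasis F I).linearCombination_repr (g (Ξ w)),
    Finsupp.linearCombination_apply,
    Finsupp.sum, map_sum]
  refine Submodule.sum_mem _ fun v hv => ?_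
  rw [map_smul]
  refine Submodule.smul_mem _ _ ?_
  have h1 := (homDeg_iff deg).1 hc w v (Finsupp.mem_support_iff.1 hv)
  change ϖ (Ξ v) ∈ _
  match v, h1 with
  | [], _ => simp [word_nil]
  | [x], h1 =>
    rw [letterProj_singleton]
    exact subset_span ⟨x, by simpa using h1, rfl⟩
  | x :: y :: v, _ => simp

/-- The recursion for shuffle products. -/
lemma shuffleMul_letter_mul {a b : Λ} {n : ℤ} (ha : ϖ a = a)
    (hb : b ∈ lettersOfDeg F deg n) (s t : Λ) :
    Ш (a * s) (b * t) = a * Ш s (b * t) + b * Ш (par deg n (a * s)) t := by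
  induction hb using span_induction with
  | zero => simp
  | add b b' _ _ hb hb' => rw [add_mul, map_add, hb, hb', map_add, mul_add, add_mul]; abel
  | smul c b _ hb => rw [smul_mul_assoc, map_smul, hb, map_smul, mul_smul_comm, smul_mul_assoc,
      smul_add]
  | mem b h =>
  obtain ⟨y, rfl, rfl⟩ := h
  induction t using word_induction with
  | h0 => simp
  | hadd t t' ht ht' => rw [mul_add, map_add, ht, ht', map_add, mul_add, map_add, mul_add]; abel
  | hw c v =>
  rw [mul_smul_comm, map_smul, map_smul, mul_smul_comm, map_smul, mul_smul_comm, ← smul_add]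
  congr 1
  refine letter_induction a ha ?_ ?_ ?_
  · simp
  · intro a a' ha ha'
    simp only [add_mul, map_add, add_apply, ha, ha', mul_add]; abel
  · intro d x
    induction s using word_induction with
    | h0 => simp
    | hadd s s' hs hs' => simp only [mul_add, map_add, add_apply, hs, hs']; abel
    | hw e u =>
      simp only [map_smul, smul_apply, ← word_cons, par_word, shuffleMul_word, shuffle_cons_cons,
        consL_apply, mul_smul_comm, smul_mul_assoc, smul_add,
        smul_smul]

lemma emptyCoeff_shuffle {u v : List I} (hu : u ≠ [] ∨ v ≠ []) : ε (ш u v) = 0 := by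
  match u, v with
  | [], [] => simp at hu
  | [], y :: v => simp
  | x :: u, [] => simp
  | x :: u, y :: v =>
    rw [shuffle_cons_cons, map_add, map_smul, consL_apply, consL_apply,
      emptyCoeff_letter (letterProj_singleton x), emptyCoeff_letter (letterProj_singleton y)]
    simp

lemma letterProj_shuffle {u v : List I} (hu : u ≠ []) (hv : v ≠ []) : ϖ (ш u v) = 0 := by
  match u, v with
  | [], _ => exact absurd rfl hu
  | _, [] => exact absurd rfl hv
  | x :: u, y :: v =>
    rw [shuffle_cons_cons, map_add, map_smul, consL_apply, consL_apply,
      letterProj_letter_mul (letterProj_singleton x), letterProj_letter_mul (letterProj_singleton y),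
      emptyCoeff_shuffle (by simp), emptyCoeff_shuffle (by simp)]
    simp

lemma letterProj_shuffleMul (s t : Λ) : ϖ (Ш s t) = ε s • ϖ t + ε t • ϖ s := by
  induction s using word_induction with
  | h0 => simp
  | hadd a b ha hb => simp only [map_add, add_apply, ha, hb, add_smul, smul_add]; abel
  | hw c u =>
  induction t using word_induction with
  | h0 => simp
  | hadd a b ha hb => simp only [map_add, ha, hb, add_smul, smul_add]; abel
  | hw d v =>
    simp only [map_smul, smul_apply, shuffleMul_word]
    match u, v with
    | [], v => simp [word_nil, smul_smul, mul_comm]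
    | x :: u, [] => simp [word_nil, smul_smul, mul_comm]
    | x :: u, y :: v => rw [letterProj_shuffle (by simp) (by simp)]; simp

variable (deg)

/-- A linear map on the word space is Harrison if it vanishes on proper shuffle products. -/
def KillsShuffles {M : Type*} [AddCommGroup M] [Module F M] (f : Λ →ₗ[F] M) : Prop :=
  ∀ u v : List I, u ≠ [] → v ≠ [] → f (ш u v) = 0

/-- `D` is a derivation of degree `c` of the shuffle product. -/
def IsShuffleDer (c : ℤ) (D : Θ) : Prop :=
  ∀ u v : List I, D (ш u v) = Ш (D (Ξ u)) (Ξ v) + sgn F (c * η u) • Ш (Ξ u) (D (Ξ v))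

/-- `U` is multiplicative for the shuffle product. -/
def IsShuffleHom (U : Θ) : Prop :=
  ∀ u v : List I, U (ш u v) = Ш (U (Ξ u)) (U (Ξ v))

variable {deg}

lemma mul_cutSum (a : Λ) (f : List I → List I → Λ) (w : List I) :
    a * cutSum f w = cutSum (fun u v => a * f u v) w :=
  map_cutSum (mulLeft F a) f w

lemma conv_shuffle (A B : Θ) (u v : List I) : conv A B (ш u v) =
      cutSum (fun u₁ u₂ => cutSum (fun v₁ v₂ => sgn F (η u₂ * η v₁) •
        (A (ш u₁ v₁) * B (ш u₂ v₂))) v) u := by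
  simp [conv, decon_shuffle, map_cutSum]

/-- In the sum over pairs of cuts, `A` is applied to the shuffle of the two initial parts. It
vanishes unless one of them is empty, so the first block comes from one word only. -/
lemma conv_shuffle_of_kills {A : Θ} (hA : KillsShuffles deg A)
    (hA1 : A 1 = 0) (B : Θ) (u v : List I) :
    conv A B (ш u v) = cutSum (fun u₁ u₂ => A (Ξ u₁) * B (ш u₂ v)) u +
      cutSum (fun v₁ v₂ => sgn F (η u * η v₁) • (A (Ξ v₁) * B (ш u v₂))) v := by
  rw [conv_shuffle]
  cases v with
  | nil => simp [word_nil, hA1]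
  | cons y v =>
  have h1 : ∀ u₁ u₂, u₁ ++ u₂ = u → cutSum (fun v₁ v₂ => sgn F (η u₂ * η v₁) •
        (A (ш u₁ v₁) * B (ш u₂ v₂))) (y :: v) =
      A (Ξ u₁) * B (ш u₂ (y :: v)) + if u₁ = [] then cutSum (fun v₁ v₂ => sgn F (η u * η v₁) •
          (A (Ξ v₁) * B (ш u v₂))) (y :: v) else 0 := by
    rintro u₁ u₂ rfl
    split_ifs with h
    · subst h; simp [word_nil, hA1]
    · rw [cutSum_cons, cutSum_eq_zero (f := fun u v_1 => _)]
      · simp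
      · intro v₁ v₂ _; rw [hA u₁ (y :: v₁) h (by simp), zero_mul, smul_zero]
  rw [cutSum_congr h1, cutSum_add]
  congr 1
  cases u with
  | nil => simp
  | cons x u =>
    rw [cutSum_cons (x := x), cutSum_eq_zero (w := u)]
    · simp
    · intro _ _ _; simp

lemma conv_letterProj_par_consL (c : ℤ) (D : Θ) (x : I)
    (t : Λ) : conv (ϖ * par deg c) D (consL F x t) = sgn F (c * deg x) • (Ξ [x] * D t) := by
  induction t using word_induction with
  | h0 => simp
  | hadd a b ha hb => simp only [map_add, ha, hb, mul_add, smul_add]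
  | hw d w =>
    rw [map_smul, map_smul, consL_word, conv_letterProj_par, map_smul, mul_smul_comm, smul_comm]

lemma cutSum_apply {M N : Type*} [AddCommGroup M] [Module F M] [AddCommGroup N] [Module F N]
    (f : List I → List I → M →ₗ[F] N) (w : List I) (t : M) :
    cutSum f w t = cutSum (fun u v => f u v t) w := by
  simp [cutSum]

lemma map_shuffleMul_cutSum_left (f : List I → List I → Λ) (w : List I) (t : Λ) : Ш (cutSum f w) t =
      cutSum (fun u v => Ш (f u v) t) w := by
  rw [← LinearMap.flip_apply, map_cutSum]; rfl

/-- All three terms of the Leibniz rule are expanded by what stands at the front: a value of the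
component on part of `u` or of `v` (`conv_shuffle_of_kills`), or one of the two first letters
(`shuffleMul_letter_mul`). The terms with a value of the component match directly, the others by
induction on the total length. -/
lemma IsCoder.isShuffleDer [CharZero F] {c : ℤ} {D : Θ} (hD : IsCoder deg c D) (hc : HomDeg deg c D)
    (hH : KillsShuffles deg (ϖ * D)) : IsShuffleDer deg c D := by
  intro u v
  have hA' : HomDeg deg c (ϖ * D) := by simpa using (homDeg_letterProj deg).mul deg hc
  set A := ϖ * D with hA
  have hAA : ϖ * A = A := by rw [hA, ← mul_assoc, letterProj_idem]
  have hA1 : A 1 = 0 := by simp [hA, hD.map_one]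
  induction h : u.length + v.length using Nat.strong_induction_on generalizing u v with
  | _ k ih =>
  match u, v with
  | [], v => simp [word_nil, hD.map_one]
  | x :: u, [] => simp [word_nil, hD.map_one]
  | x :: u, y :: v =>
  simp only [List.length_cons] at h
  have hx := letterProj_singleton (F := F) x
  have hy : Ξ [y] ∈ lettersOfDeg F deg (deg y) := subset_span ⟨y, rfl, rfl⟩
  have e1 : D (ш (x :: u) (y :: v)) = cutSum (fun u₁ u₂ => A (Ξ u₁) * ш u₂ (y :: v)) (x :: u) +
      cutSum (fun v₁ v₂ => sgn F (η (x :: u) * η v₁) • (A (Ξ v₁) * ш (x :: u) v₂)) (y :: v) +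
      (sgn F (c * deg x) • (Ξ [x] * D (ш u (y :: v))) +
      sgn F (deg y * η (x :: u)) • sgn F (c * deg y) • (Ξ [y] * D (ш (x :: u) v))) := by
    rw [hD.apply_eq, ← hA, conv_shuffle_of_kills hH hA1]
    congr 1
    rw [shuffle_cons_cons, map_add, map_smul, conv_letterProj_par_consL, conv_letterProj_par_consL]
  have e2 : Ш (D (Ξ (x :: u))) (Ξ (y :: v)) =
      cutSum (fun u₁ u₂ => A (Ξ u₁) * ш u₂ (y :: v)) (x :: u) +
      sgn F (c * deg x) • (Ξ [x] * Ш (D (Ξ u)) (Ξ (y :: v))) +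
      Ξ [y] * Ш (par deg (deg y) (D (Ξ (x :: u)))) (Ξ v) := by
    rw [hD.apply_cons, ← hA, conv_word]
    simp only [map_add, add_apply, map_smul, smul_apply, map_cutSum, cutSum_apply, mul_add,
      mul_smul_comm, mul_cutSum]
    rw [word_cons y v, shuffleMul_letter_mul hx hy, smul_add]
    have : cutSum (fun u₁ u₂ => Ш (A (Ξ u₁) * (1 : Θ) (Ξ u₂)) (Ξ [y] * Ξ v)) (x :: u) =
        cutSum (fun u₁ u₂ => A (Ξ u₁) * ш u₂ (y :: v)) (x :: u) +
        cutSum (fun u₁ u₂ => Ξ [y] * Ш (par deg (deg y) (A (Ξ u₁) *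
          (1 : Θ) (Ξ u₂))) (Ξ v)) (x :: u) := by
      rw [← cutSum_add]
      refine cutSum_congr fun u₁ u₂ _ => ?_
      rw [shuffleMul_letter_mul (letter_apply hAA _) hy, ← word_cons, End.one_apply,
        shuffleMul_word]
    rw [this]
    abel
  have e3 : Ш (Ξ (x :: u)) (D (Ξ (y :: v))) = Ξ [x] * Ш (Ξ u) (D (Ξ (y :: v))) +
      (cutSum (fun v₁ v₂ => sgn F ((η v₁ + c) * η (x :: u)) • (A (Ξ v₁) * ш (x :: u) v₂)) (y :: v) +
      sgn F (c * deg y) • sgn F (deg y * η (x :: u)) • (Ξ [y] * Ш (Ξ (x :: u)) (D (Ξ v)))) := by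
    rw [hD.apply_cons, ← hA, conv_word, map_add, map_add, map_smul, map_smul, map_cutSum,
      map_cutSum, word_cons x u, shuffleMul_letter_mul hx hy, mul_add, mul_smul_comm,
      ← word_cons, par_word, map_smul, smul_apply, mul_smul_comm, smul_add, mul_cutSum]
    have : cutSum (fun v₁ v₂ => Ш (Ξ (x :: u)) (A (Ξ v₁) * (1 : Θ) (Ξ v₂))) (y :: v) =
        cutSum (fun v₁ v₂ => Ξ [x] * Ш (Ξ u) (A (Ξ v₁) * (1 : Θ) (Ξ v₂))) (y :: v) +
        cutSum (fun v₁ v₂ => sgn F ((η v₁ + c) * η (x :: u)) •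
        (A (Ξ v₁) * ш (x :: u) v₂)) (y :: v) := by
      rw [← cutSum_add]
      refine cutSum_congr fun v₁ v₂ _ => ?_
      rw [word_cons x u, shuffleMul_letter_mul hx (mem_lettersOfDeg hAA hA' v₁), ← word_cons,
        par_word, End.one_apply, map_smul, smul_apply, shuffleMul_word,
        mul_smul_comm]
    rw [this]
    abel
  rw [e1, e2, e3, ih _ (by simp; omega) u (y :: v) rfl, ih _ (by simp; omega) (x :: u) v rfl,
    hc.par_apply]
  simp only [mul_add, smul_add, mul_smul_comm, map_smul, smul_apply, smul_smul, ← sgn_add,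
    ← cutSum_smul]
  have key : ∀ a b b' c d d' e e' f f' : Λ, b = b' → d = d' → e = e' → f = f' →
      a + b + (c + d + (e + f)) = a + c + e' + (d' + (b' + f')) := by
    rintro a b _ c d _ e _ f _ rfl rfl rfl rfl; abel
  refine key _ _ _ _ _ _ _ _ _ _ (cutSum_congr fun v₁ v₂ _ => ?_) ?_ ?_ ?_ <;> congr 1 <;>
    apply sgn_congr <;> simp only [wordDeg_cons, Int.even_add, Int.even_mul] <;> grind

/-- By `conv_shuffle_of_kills` the first block of the value at a shuffle comes either from `u` or
from `v`. Expanding the product of the values at `u` and `v` by first blocks gives the same two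
families, with shorter words behind them. -/
lemma IsCoalgHom.isShuffleHom [CharZero F] {U : Θ} (hU : IsCoalgHom U) (hc : HomDeg deg 0 U)
    (hH : KillsShuffles deg (ϖ * U)) : IsShuffleHom deg U := by
  intro u v
  have hA' : HomDeg deg 0 (ϖ * U) := by simpa using (homDeg_letterProj deg).mul deg hc
  set A := ϖ * U with hA
  have hAA : ϖ * A = A := by rw [hA, ← mul_assoc, letterProj_idem]
  have hA1 : A 1 = 0 := by simp [hA, hU.map_one]
  induction h : u.length + v.length using Nat.strong_induction_on generalizing u v with
  | _ k ih =>
  match u, v with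
  | [], v => simp [word_nil, hU.map_one]
  | x :: u, [] => simp [word_nil, hU.map_one]
  | x :: u, y :: v =>
  have e1 : U (ш (x :: u) (y :: v)) = cutSum (fun u₁ u₂ => A (Ξ u₁) *
        Ш (U (Ξ u₂)) (U (Ξ (y :: v)))) (x :: u) +
      cutSum (fun v₁ v₂ => sgn F (η (x :: u) * η v₁) •
        (A (Ξ v₁) * Ш (U (Ξ (x :: u))) (U (Ξ v₂)))) (y :: v) := by
    rw [eq_emptyCoeff_add_conv (U _), hU.counit, emptyCoeff_shuffle (Or.inl (by simp)), zero_smul,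
      zero_add, ← End.mul_apply, hU.conv_comp, one_mul, ← hA, conv_shuffle_of_kills hH hA1]
    congr 1
    · refine cutSum_congr fun u₁ u₂ hu => ?_
      have hl := congrArg List.length hu
      cases u₁ with
      | nil => simp [word_nil, hA1]
      | cons z u₁ => rw [ih _ (by simp at h hl ⊢; omega) u₂ (y :: v) rfl]
    · refine cutSum_congr fun v₁ v₂ hv => ?_
      have hl := congrArg List.length hv
      cases v₁ with
      | nil => simp [word_nil, hA1]
      | cons z v₁ => rw [ih _ (by simp at h hl ⊢; omega) (x :: u) v₂ rfl]
  have e2 : ∀ z w, U (Ξ (z :: w)) = cutSum (fun u₁ u₂ => A (Ξ u₁) * U (Ξ u₂)) (z :: w) := by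
    intro z w; rw [hU.apply_cons, conv_word]
  rw [e1]
  conv_rhs => rw [e2 x u, e2 y v, map_shuffleMul_cutSum_left]
  have e3 : ∀ u₁ u₂, u₁ ++ u₂ = x :: u → Ш (A (Ξ u₁) * U (Ξ u₂))
      (cutSum (fun v₁ v₂ => A (Ξ v₁) * U (Ξ v₂)) (y :: v)) =
      A (Ξ u₁) * Ш (U (Ξ u₂)) (U (Ξ (y :: v))) +
      cutSum (fun v₁ v₂ => sgn F (η (x :: u) * η v₁) • (A (Ξ v₁) *
        Ш (A (Ξ u₁) * U (Ξ u₂)) (U (Ξ v₂)))) (y :: v) := by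
    intro u₁ u₂ hu
    rw [e2 y v, map_cutSum, map_cutSum, mul_cutSum, ← cutSum_add]
    refine cutSum_congr fun v₁ v₂ _ => ?_
    rw [shuffleMul_letter_mul (letter_apply hAA _) (mem_lettersOfDeg hAA hA' v₁)]
    congr 1
    rw [par, scale_mul, hc.scale_apply, hA'.scale_apply, smul_mul_smul_comm, map_smul, smul_apply,
      mul_smul_comm, ← hu]
    congr 1
    simp only [add_zero, ← Units.val_mul, ← zpow_add, wordDeg_append, sgn, ← zpow_mul]
    congr 2; ring
  rw [cutSum_congr e3, cutSum_add, cutSum_comm]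
  congr 1
  refine cutSum_congr fun v₁ v₂ _ => ?_
  rw [cutSum_smul, e2 x u, map_shuffleMul_cutSum_left, mul_cutSum]

/-- By `letterProj_shuffleMul`, a shuffle of two elements without constant term has no letter
component. -/
lemma IsShuffleDer.killsShuffles {c : ℤ} {D : Θ} (hD : IsCoder deg c D) (h : IsShuffleDer deg c D) :
    KillsShuffles deg (ϖ * D) := by
  intro u v hu hv
  have h1 : ∀ {u : List I}, u ≠ [] → ε (Ξ u) = 0 := by intro u hu; cases u <;> simp_all
  rw [End.mul_apply, h u v, map_add, map_smul, letterProj_shuffleMul, letterProj_shuffleMul,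
    hD.counit, hD.counit, h1 hu, h1 hv]
  simp

lemma IsShuffleHom.killsShuffles {U : Θ} (hU : IsCoalgHom U) (h : IsShuffleHom deg U) :
    KillsShuffles deg (ϖ * U) := by
  intro u v hu hv
  have h1 : ∀ {u : List I}, u ≠ [] → ε (Ξ u) = 0 := by intro u hu; cases u <;> simp_all
  rw [End.mul_apply, h u v, letterProj_shuffleMul, hU.counit, hU.counit, h1 hu, h1 hv]
  simp

end Shuffle

/-! ### Polynomial sequences and their linear coefficients -/

section PolynomialSequences

variable {F : Type*} [Field F] {M N P : Type*} [AddCommGroup M] [Module F M] [AddCommGroup N]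
  [Module F N] [AddCommGroup P] [Module F P]

lemma sum_range_antidiagonal {A : Type*} [AddCommMonoid A] (K : ℕ) (f : ℕ → ℕ → A)
    (hf : ∀ i j, K ≤ i + j → f i j = 0) :
    ∑ n ∈ range K, ∑ p ∈ Finset.HasAntidiagonal.antidiagonal n, f p.1 p.2 =
      ∑ i ∈ range K, ∑ j ∈ range K, f i j := by
  rw [← Finset.sum_product', Finset.sum_sigma']
  refine Finset.sum_bij_ne_zero (fun p _ _ => p.2) ?_ ?_ ?_ ?_
  · rintro ⟨n, i, j⟩ h _
    simp only [Finset.mem_sigma, mem_range, Finset.HasAntidiagonal.mem_antidiagonal, Finset.mem_product] at h ⊢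
    omega
  · rintro ⟨n, i, j⟩ h _ ⟨n', i', j'⟩ h' _ h2
    simp only [Finset.mem_sigma, mem_range, Finset.HasAntidiagonal.mem_antidiagonal, Prod.mk.injEq] at h h' h2
    obtain ⟨rfl, rfl⟩ := h2
    obtain rfl : n = n' := by omega
    rfl
  · rintro ⟨i, j⟩ _ hne
    have : i + j < K := by
      by_contra h
      exact hne (hf i j (by omega))
    exact ⟨⟨i + j, i, j⟩, by simp [this], hne, rfl⟩
  · rintro ⟨n, i, j⟩ _ _; rfl

/-- After applying a linear functional this is the vanishing of a polynomial with infinitely many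
roots. -/
lemma eq_zero_of_forall_sum_pow_smul [CharZero F] {K : ℕ} {c : ℕ → M}
    (h : ∀ n : ℕ, ∑ k ∈ range K, (n : F) ^ k • c k = 0) (k : ℕ) (hk : k < K) : c k = 0 := by
  rw [← Module.forall_dual_apply_eq_zero_iff F]
  intro l
  let p : Polynomial F := ∑ k ∈ range K, Polynomial.monomial k (l (c k))
  have hp : p = 0 := by
    refine Polynomial.eq_zero_of_infinite_isRoot p (Set.Infinite.mono ?_
      (Set.infinite_range_of_injective (Nat.cast_injective (R := F))))
    rintro _ ⟨n, rfl⟩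
    have := congrArg l (h n)
    simp only [map_sum, map_smul, map_zero, smul_eq_mul] at this
    simp only [p, Set.mem_ofPred_eq, Polynomial.IsRoot, Polynomial.eval_finsetSum,
      Polynomial.eval_monomial]
    rw [← this]
    exact sum_congr rfl fun _ _ => mul_comm _ _
  have := congrArg (fun q => Polynomial.coeff q k) hp
  simpa [p, Polynomial.finsetSum_coeff, Polynomial.coeff_monomial, hk] using this

/-- The sequence `f` is polynomial with constant coefficient `a` and linear coefficient `b`. -/
def HasLin (F : Type*) [Field F] {M : Type*} [AddCommGroup M] [Module F M] (f : ℕ → M) (a b : M) :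
    Prop :=
  ∃ (K : ℕ) (c : ℕ → M), (∀ k, K ≤ k → c k = 0) ∧ c 0 = a ∧ c 1 = b ∧
    ∀ n, f n = ∑ k ∈ range K, (n : F) ^ k • c k

lemma sum_range_extend {K L : ℕ} {c : ℕ → M} (hc : ∀ k, K ≤ k → c k = 0) (h : K ≤ L) (x : ℕ → F) :
    ∑ k ∈ range K, x k • c k = ∑ k ∈ range L, x k • c k := by
  refine Finset.sum_subset (range_mono h) fun k _ hk => ?_
  rw [hc k (by simpa using hk), smul_zero]

/-- The properties of the logarithm are derived with this lemma: two descriptions of one sequence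
have the same linear coefficient. -/
lemma HasLin.unique [CharZero F] {f : ℕ → M} {a b a' b' : M} (h : HasLin F f a b)
    (h' : HasLin F f a' b') : b = b' := by
  obtain ⟨K, c, hc, rfl, rfl, hf⟩ := h
  obtain ⟨K', c', hc', rfl, rfl, hf'⟩ := h'
  rw [← sub_eq_zero]
  refine eq_zero_of_forall_sum_pow_smul (F := F) (K := max K K' + 2) (c := fun k => c k - c' k)
    (fun n => ?_) 1 (by omega)
  simp only [smul_sub, sum_sub_distrib]
  rw [← sum_range_extend hc (by omega), ← sum_range_extend hc' (by omega), ← hf, ← hf', sub_self]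

lemma HasLin.map {f : ℕ → M} {a b : M} (h : HasLin F f a b) (l : M →ₗ[F] N) :
    HasLin F (fun n => l (f n)) (l a) (l b) := by
  obtain ⟨K, c, hc, rfl, rfl, hf⟩ := h
  exact ⟨K, fun k => l (c k), fun k hk => by simp only [hc k hk, map_zero], rfl, rfl, fun n => by
    simp only [hf, map_sum, map_smul]⟩

lemma HasLin.congr {f g : ℕ → M} {a b a' b' : M} (h : HasLin F f a b) (hf : ∀ n, f n = g n)
    (ha : a = a') (hb : b = b') : HasLin F g a' b' := by
  subst ha hb
  rwa [← (funext hf : f = g)]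

lemma hasLin_const (a : M) : HasLin F (fun _ => a) a 0 :=
  ⟨1, fun k => if k = 0 then a else 0, fun k hk => if_neg (by omega), rfl, rfl, fun n => by simp⟩

lemma HasLin.add {f g : ℕ → M} {a b a' b' : M} (h : HasLin F f a b) (h' : HasLin F g a' b') :
    HasLin F (fun n => f n + g n) (a + a') (b + b') := by
  obtain ⟨K, c, hc, rfl, rfl, hf⟩ := h
  obtain ⟨K', c', hc', rfl, rfl, hf'⟩ := h'
  refine ⟨max K K', fun k => c k + c' k, fun k hk => ?_, rfl, rfl, fun n => ?_⟩
  · simp only [hc k (by omega), hc' k (by omega), add_zero]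
  · simp only [smul_add, Finset.sum_add_distrib]
    rw [hf, hf', sum_range_extend hc (le_max_left K K'), sum_range_extend hc' (le_max_right K K')]

lemma HasLin.sum {ι : Type*} (s : Finset ι) {f : ι → ℕ → M} {a b : ι → M}
    (h : ∀ i ∈ s, HasLin F (f i) (a i) (b i)) :
    HasLin F (fun n => ∑ i ∈ s, f i n) (∑ i ∈ s, a i) (∑ i ∈ s, b i) := by
  classical
  induction s using Finset.induction_on with
  | empty => simpa using hasLin_const (F := F) (0 : M)
  | insert i s hi ih =>
    simp only [Finset.sum_insert hi]
    exact (h i (Finset.mem_insert_self _ _)).add (ih fun j hj => h j (Finset.mem_insert_of_mem hj))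

/-- The linear coefficient of a product follows the Leibniz rule; this is why the logarithm of a
multiplicative operator is a derivation. -/
lemma HasLin.bilin {f : ℕ → M} {g : ℕ → N} {a b : M} {a' b' : N} (h : HasLin F f a b)
    (h' : HasLin F g a' b') (β : M →ₗ[F] N →ₗ[F] P) :
    HasLin F (fun n => β (f n) (g n)) (β a a') (β b a' + β a b') := by
  obtain ⟨K, c, hc, rfl, rfl, hf⟩ := h
  obtain ⟨K', c', hc', rfl, rfl, hf'⟩ := h'
  have h0 : ∀ i j, K + K' ≤ i + j → β (c i) (c' j) = 0 := by
    intro i j hij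
    rcases le_or_gt K i with h | h
    · rw [hc i h, map_zero, zero_apply]
    · rw [hc' j (by omega), map_zero]
  refine ⟨K + K', fun k => ∑ p ∈ Finset.HasAntidiagonal.antidiagonal k, β (c p.1) (c' p.2), fun k hk => ?_,
    by simp, ?_, fun n => ?_⟩
  · refine sum_eq_zero fun p hp => h0 _ _ ?_
    rw [Finset.HasAntidiagonal.mem_antidiagonal] at hp; omega
  · show ∑ p ∈ Finset.HasAntidiagonal.antidiagonal 1, β (c p.1) (c' p.2) = _
    rw [Finset.Nat.antidiagonal_succ]; simp [add_comm]
  · have := sum_range_antidiagonal (K + K') (fun i j => (n : F) ^ (i + j) • β (c i) (c' j))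
      (fun i j hij => by rw [h0 i j hij, smul_zero])
    beta_reduce
    rw [hf, hf', sum_range_extend hc (Nat.le_add_right K K'),
      sum_range_extend hc' (Nat.le_add_left K' K)]
    simp only [map_sum, map_smul, sum_apply, smul_apply, smul_sum, smul_smul]
    simp only [← pow_add]
    rw [sum_comm]
    simp only [add_comm _ (_ : ℕ)] at this ⊢
    rw [← this]
    refine sum_congr rfl fun k _ => sum_congr rfl fun p hp => ?_
    rw [Finset.HasAntidiagonal.mem_antidiagonal] at hp
    rw [← hp, add_comm]

lemma hasLin_polynomial (p : Polynomial F) (m : M) :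
    HasLin F (fun n => p.eval (n : F) • m) (p.coeff 0 • m) (p.coeff 1 • m) := by
  refine ⟨p.natDegree + 1, fun k => p.coeff k • m, fun k hk => ?_, rfl, rfl, fun n => ?_⟩
  · simp only [Polynomial.coeff_eq_zero_of_natDegree_lt (by omega : p.natDegree < k), zero_smul]
  · beta_reduce
    rw [Polynomial.eval_eq_sum_range, Finset.sum_smul]
    exact sum_congr rfl fun k _ => by rw [smul_smul, mul_comm]

/-- The exponential of a derivation of a bilinear map. -/
lemma sum_pow_bilin [CharZero F] {D₁ : End F M} {D₂ : End F N} {E : End F P}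
    {β : M →ₗ[F] N →ₗ[F] P} (h : ∀ s t, E (β s t) = β (D₁ s) t + β s (D₂ t)) {K : ℕ} {s : M} {t : N}
    (hK : ∀ i j, K ≤ i + j → β ((D₁ ^ i) s) ((D₂ ^ j) t) = 0) :
    ∑ n ∈ range K, (n.factorial : F)⁻¹ • (E ^ n) (β s t) = ∑ i ∈ range K, ∑ j ∈ range K,
        ((i.factorial : F)⁻¹ * (j.factorial : F)⁻¹) • β ((D₁ ^ i) s) ((D₂ ^ j) t) := by
  rw [← sum_range_antidiagonal K (fun i j => ((i.factorial : F)⁻¹ * (j.factorial : F)⁻¹) •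
    β ((D₁ ^ i) s) ((D₂ ^ j) t)) fun i j hij => by rw [hK i j hij, smul_zero]]
  refine sum_congr rfl fun n _ => ?_
  -- `E` lifts to the sum of these two commuting operators on the tensor product, to which the
  -- binomial theorem applies.
  have hc : Commute (map D₁ (1 : End F N)) (map (1 : End F M) D₂) := by ext s t; simp
  have h1 : E ∘ₗ lift β = lift β ∘ₗ (map D₁ 1 + map 1 D₂) := by ext s t; simp [h]
  have h2 : ∀ n : ℕ, (E ^ n) ∘ₗ lift β = lift β ∘ₗ ((map D₁ 1 + map 1 D₂) ^ n) := by
    intro n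
    induction n with
    | zero => rfl
    | succ n ih =>
      rw [pow_succ, End.mul_eq_comp, comp_assoc, h1, ← comp_assoc, ih, pow_succ, End.mul_eq_comp,
        comp_assoc]
  have h3 := LinearMap.congr_fun (h2 n) (s ⊗ₜ t)
  rw [comp_apply, TensorProduct.lift.tmul] at h3
  rw [h3, hc.add_pow', comp_apply, sum_apply, map_sum, smul_sum]
  refine sum_congr rfl fun p hp => ?_
  rw [Finset.HasAntidiagonal.mem_antidiagonal] at hp
  have h4 : ∀ i, (map D₁ (1 : End F N)) ^ i = map (D₁ ^ i) 1 := by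
    intro i; rw [TensorProduct.map_pow, one_pow]
  have h5 : ∀ i, (map (1 : End F M) D₂) ^ i = map 1 (D₂ ^ i) := by
    intro i; rw [TensorProduct.map_pow, one_pow]
  rw [h4, h5, smul_apply, map_nsmul, End.mul_apply, map_tmul, map_tmul, TensorProduct.lift.tmul,
    ← Nat.cast_smul_eq_nsmul F, smul_smul]
  congr 1
  subst hp
  rw [Nat.cast_add_choose]
  have := Nat.cast_ne_zero (R := F).2 (Nat.factorial_ne_zero (p.1 + p.2))
  have := Nat.cast_ne_zero (R := F).2 (Nat.factorial_ne_zero p.1)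
  have := Nat.cast_ne_zero (R := F).2 (Nat.factorial_ne_zero p.2)
  field_simp

end PolynomialSequences

/-! ### Exponential and logarithm of length-lowering operators -/

section ExpLog

variable {F I : Type*} [Field F]

lemma Lowers.pow_apply_eq_zero {D : Θ} (hD : Lowers 1 D) {n j : ℕ}
    {t : Λ} (ht : t ∈ Γ n) (h : n ≤ j) : (D ^ j) t = 0 := by
  have := (hD.pow j).mem ht
  rwa [Nat.sub_eq_zero_of_le h, lenLT_zero, mem_bot] at this

/-- The series `∑ a_j D_j`, for operators `D_j` lowering the length by `j`. -/
def opSum (D : ℕ → Θ) : Θ :=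
  wordLift F fun w => ∑ j ∈ range (w.length + 1), D j (Ξ w)

/-- Words of length less than `n` are killed by `D j` for `j ≥ n`, so any sufficiently late
truncation computes the series. Sums over words of different lengths thereby become comparable. -/
lemma opSum_apply {D : ℕ → Θ} (hD : ∀ j, Lowers j (D j)) {n : ℕ}
    {t : Λ} (ht : t ∈ Γ n) : opSum D t = ∑ j ∈ range n, D j t := by
  have : Γ n ≤ ker (opSum D - ∑ j ∈ range n, D j) := lenLT_le_iff.2 fun w hw => by
      rw [mem_ker, sub_apply, sub_eq_zero, opSum, wordLift_word, sum_apply]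
      refine Finset.sum_subset (range_mono hw) fun j _ hj => ?_
      have h := hD j w
      rwa [Nat.sub_eq_zero_of_le (by simpa using hj), lenLT_zero, mem_bot] at h
  have := this ht
  rwa [mem_ker, sub_apply, sub_eq_zero, sum_apply] at this

/-- The exponential of an operator which lowers the length. -/
def expL (D : Θ) : Θ :=
  opSum fun j => (j.factorial : F)⁻¹ • D ^ j

lemma expL_apply {D : Θ} (hD : Lowers 1 D) {n : ℕ} {t : Λ} (ht : t ∈ Γ n) :
    expL D t = ∑ j ∈ range n, (j.factorial : F)⁻¹ • (D ^ j) t :=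
  opSum_apply (fun j => (hD.pow j).smul _) ht

/-- The principle that the exponential of a derivation is multiplicative, applied later to the
tensor product and to the shuffle product. -/
lemma expL_bilin [CharZero F] {A B : Θ} {P : Type*} [AddCommGroup P]
    [Module F P] (hA : Lowers 1 A) (hB : Lowers 1 B) {E : End F P}
    {β : Λ →ₗ[F] Λ →ₗ[F] P}
    (h : ∀ s t, E (β s t) = β (A s) t + β s (B t)) {m n K : ℕ} {s t : Λ}
    (hs : s ∈ Γ m) (ht : t ∈ Γ n) (hK : m + n ≤ K) :
    ∑ j ∈ range K, (j.factorial : F)⁻¹ • (E ^ j) (β s t) = β (expL A s) (expL B t) := by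
  rw [sum_pow_bilin h, expL_apply hA (lenLT_mono (by omega : m ≤ K) hs),
    expL_apply hB (lenLT_mono (by omega : n ≤ K) ht)]
  · simp only [map_sum, map_smul, sum_apply, smul_apply, smul_sum, smul_smul]
    rw [sum_comm]
    exact sum_congr rfl fun _ _ => sum_congr rfl fun _ _ => by rw [mul_comm]
  · intro i j hij
    rcases le_or_gt m i with h | h
    · rw [hA.pow_apply_eq_zero hs h, map_zero, zero_apply]
    · rw [hB.pow_apply_eq_zero ht (by omega), map_zero]

/-- The commutator with `D`. -/
def adOp (D : Θ) : End F (Θ) :=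
  mulLeft F D - mulRight F D

lemma adOp_apply (D X : Θ) : adOp D X = D * X - X * D := rfl

lemma lowers_adOp_pow {D X : Θ} {k : ℕ} (hD : Lowers 1 D)
    (hX : Lowers k X) (j : ℕ) : Lowers (j + k) ((adOp D ^ j) X) := by
  induction j with
  | zero => simpa using hX
  | succ j ih =>
    rw [pow_succ', End.mul_apply, adOp_apply]
    exact ((hD.mul ih).mono (by omega)).sub ((ih.mul hD).mono (by omega))

/-- Evaluation of operators at vectors is bilinear, and `D` acts on it as a derivation, through the
commutator on the operator and through `D` on the vector. Exponentiating this derivation gives the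
identity. -/
lemma expL_mul_eq [CharZero F] {D X : Θ} (hD : Lowers 1 D) (hX : Lowers 0 X) :
    expL D * X = opSum (fun j => (j.factorial : F)⁻¹ • (adOp D ^ j) X) * expL D := by
  have hD0 : Lowers 0 (expL D) := by
    intro w
    rw [expL_apply hD (word_mem_lenLT (Nat.lt_succ_self _))]
    exact Submodule.sum_mem _ fun j _ => Submodule.smul_mem _ _ (lenLT_mono (by omega) (hD.pow j w))
  have h1 : ∀ j, Lowers j ((j.factorial : F)⁻¹ • (adOp D ^ j) X) := fun j =>
    (lowers_adOp_pow hD hX j).smul _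
  apply word_hom_ext; intro w
  have hw : Ξ w ∈ Γ (w.length + 1) := word_mem_lenLT (Nat.lt_succ_self _)
  set K := w.length + 1 with hK
  let β : Θ →ₗ[F] Λ →ₗ[F] Λ := LinearMap.id
  have hβ : ∀ X t, D (β X t) = β (adOp D X) t + β X (D t) := by
    intro X t
    simp only [β, id_apply, adOp_apply, sub_apply, End.mul_apply]
    abel
  have h := sum_pow_bilin (K := K) (s := X) (t := Ξ w) hβ (fun i j hij => by
    have := (lowers_adOp_pow hD hX i).mem ((hD.pow j).mem hw)
    rwa [Nat.sub_eq_zero_of_le (by omega), lenLT_zero, mem_bot] at this)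
  rw [End.mul_apply, End.mul_apply, expL_apply hD (by simpa using hX.mem hw),
    opSum_apply h1 (by simpa using hD0.mem hw)]
  refine h.trans ?_
  rw [expL_apply hD hw]
  simp only [map_sum, map_smul, smul_apply, smul_smul, β, id_apply]
  exact sum_congr rfl fun _ _ => sum_congr rfl fun _ _ => by rw [mul_comm]

lemma Lowers.expL_sub_one {D : Θ} (hD : Lowers 1 D) : Lowers 1 (expL D - 1) := by
  intro w
  rw [sub_apply, expL_apply hD (word_mem_lenLT (Nat.lt_succ_self _)), sum_range_succ', pow_zero,
    Nat.factorial_zero, Nat.cast_one, inv_one, one_smul,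
    add_sub_cancel_right]
  exact Submodule.sum_mem _ fun j _ => Submodule.smul_mem _ _
    (lenLT_mono (by omega) (hD.pow (j + 1) w))

lemma Lowers.of_sub_one {U : Θ} (h : Lowers 1 (U - 1)) : Lowers 0 U := by
  simpa using (h.mono (Nat.zero_le 1)).add lowers_one

lemma expL_mul_expL_neg [CharZero F] {D : Θ} (hD : Lowers 1 D) : expL D * expL (-D) = 1 := by
  apply word_hom_ext; intro w
  have hw : Ξ w ∈ Γ (w.length + 1) := word_mem_lenLT (Nat.lt_succ_self _)
  let β : Θ →ₗ[F] Λ →ₗ[F] Λ := LinearMap.id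
  have hp : ∀ i, (mulRight F D ^ i) 1 = D ^ i := by
    intro i
    rw [LinearMap.pow_mulRight, mulRight_apply, one_mul]
  -- Evaluation of operators at vectors again: right multiplication by `D` on the operator and `-D`
  -- on the vector cancel. So `E = 0`, and its exponential has only the term of order zero.
  have h := sum_pow_bilin (F := F) (K := w.length + 1) (E := 0) (D₁ := mulRight F D)
    (D₂ := -D) (β := β) (s := 1) (t := Ξ w) (by intro X t; simp [β]) (fun i j hij => by
      rw [hp]
      exact ((hD.pow i).mul (hD.neg.pow j)).mem hw |> fun h => by
        rwa [Nat.sub_eq_zero_of_le (by omega), lenLT_zero, mem_bot] at h)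
  rw [End.mul_apply, expL_apply hD (by simpa using (hD.neg.expL_sub_one).of_sub_one.mem hw),
    expL_apply hD.neg hw]
  simp only [hp, β, id_apply] at h
  simp only [map_sum, map_smul, smul_sum, smul_smul]
  rw [← h, sum_range_succ', sum_eq_zero (fun j _ => by simp)]
  simp

/-- The logarithm of an operator `U` for which `U - 1` lowers the length: the linear coefficient of
the polynomial sequence `U ^ n`. -/
def logL (U : Θ) : Θ :=
  opSum fun j => ((descPochhammer F j).coeff 1 * (j.factorial : F)⁻¹) • (U - 1) ^ j

/-- The binomial expansion of `U ^ n` in powers of `U - 1` is finite on `t`. Its coefficients are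
falling factorials of `n` divided by `j!`, hence polynomial in `n`, and their linear coefficients
are those in `logL`. -/
lemma hasLin_pow [CharZero F] {U : Θ} (hU : Lowers 1 (U - 1))
    (t : Λ) : HasLin F (fun n => (U ^ n) t) t (logL U t) := by
  obtain ⟨N, ht⟩ := exists_mem_lenLT t
  have h1 : ∀ j, Lowers j (((descPochhammer F j).coeff 1 * (j.factorial : F)⁻¹) • (U - 1) ^ j) :=
    fun j => (hU.pow j).smul _
  have h := HasLin.sum (F := F) (range (N + 1)) fun j _ =>
    hasLin_polynomial (descPochhammer F j) ((j.factorial : F)⁻¹ • ((U - 1) ^ j) t)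
  refine h.congr (fun n => ?_) ?_ ?_
  · have hc : U = 1 + (U - 1) := by abel
    conv_rhs => rw [hc, (Commute.one_left (U - 1)).add_pow', sum_apply]
    rw [← Finset.Nat.sum_antidiagonal_swap, Finset.Nat.sum_antidiagonal_eq_sum_range_succ_mk]
    simp only [Prod.swap, one_pow, one_mul]
    have hz : ∀ j, N ≤ j → ((U - 1) ^ j) t = 0 := fun j hj => hU.pow_apply_eq_zero ht hj
    have e1 : ∀ j, ((descPochhammer F j).eval (n : F)) • (j.factorial : F)⁻¹ • ((U - 1) ^ j) t =
        (n.choose j) • ((U - 1) ^ j) t := by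
      intro j
      rw [descPochhammer_eval_eq_descFactorial, smul_smul, Nat.descFactorial_eq_factorial_mul_choose,
        ← Nat.cast_smul_eq_nsmul F]
      congr 1
      have := Nat.cast_ne_zero (R := F).2 (Nat.factorial_ne_zero j)
      push_cast
      field_simp
    simp only [e1, smul_apply]
    -- The two ranges of summation differ by terms that vanish either because `(U - 1) ^ j` kills
    -- `t` or because the binomial coefficient is zero.
    rcases le_total N n with hN | hN
    · refine Finset.sum_subset_zero_on_sdiff (range_mono (by omega)) (fun j hj => ?_) ?_
      · rw [hz j (by simp at hj; omega), smul_zero]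
      · intro j hj
        rw [Nat.choose_symm (by simp at hj; omega)]
    · symm
      refine Finset.sum_subset_zero_on_sdiff (range_mono (by omega)) (fun j hj => ?_) ?_
      · rw [Nat.choose_eq_zero_of_lt (by simp at hj; omega), zero_smul]
      · intro j hj
        rw [Nat.choose_symm (by simp at hj; omega)]
  · rw [sum_range_succ', sum_eq_zero]
    · simp
    · intro j _
      rw [Polynomial.coeff_zero_eq_eval_zero, descPochhammer_ne_zero_eval_zero F (Nat.succ_ne_zero j),
        zero_smul]
  · rw [logL, opSum_apply h1 (lenLT_mono (Nat.le_succ N) ht)]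
    exact sum_congr rfl fun j _ => by rw [smul_smul, smul_apply]

lemma Lowers.logL {U : Θ} (hU : Lowers 1 (U - 1)) : Lowers 1 (logL U) := by
  intro w
  have h1 : ∀ j, Lowers j (((descPochhammer F j).coeff 1 * (j.factorial : F)⁻¹) • (U - 1) ^ j) :=
    fun j => (hU.pow j).smul _
  rw [_root_.logL, opSum_apply h1 (word_mem_lenLT (Nat.lt_succ_self _)), sum_range_succ']
  refine add_mem (Submodule.sum_mem _ fun j _ => lenLT_mono (by omega) (h1 (j + 1) w)) ?_
  simp [Polynomial.coeff_one]

/-- Write `U ^ n w = ∑ n ^ k c_k`. The coefficient of `m` in `U ^ (m + n) w` gives `log U (c_k) = (k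
+ 1) c_{k+1}`, so `c_k` is `(log U) ^ k w / k!`; then `n = 1` is the claim. -/
lemma expL_logL [CharZero F] {U : Θ} (hU : Lowers 1 (U - 1)) : expL (logL U) = U := by
  apply word_hom_ext; intro w
  obtain ⟨K, c, hc, h0, h1, hf⟩ := hasLin_pow hU (Ξ w)
  beta_reduce at hf
  have hrec : ∀ k, logL U (c k) = ((k : F) + 1) • c (k + 1) := by
    intro k
    rw [← sub_eq_zero]
    rcases le_or_gt (K + 1) k with hk | hk
    · rw [hc k (by omega), hc (k + 1) (by omega)]; simp
    refine eq_zero_of_forall_sum_pow_smul (F := F) (K := K + 1)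
      (c := fun k => logL U (c k) - ((k : F) + 1) • c (k + 1)) (fun n => ?_) k hk
    have e1 := hasLin_pow hU ((U ^ n) (Ξ w))
    have e2 := HasLin.sum (F := F) (range (K + 2)) fun k _ =>
      hasLin_polynomial ((Polynomial.X + Polynomial.C (n : F)) ^ k) (c k)
    have e3 := e1.unique (e2.congr (a' := ∑ k ∈ range (K + 2), _)
      (b' := ∑ k ∈ range (K + 2), _) (fun m => ?_) rfl rfl)
    · rw [hf, sum_range_extend hc (Nat.le_succ K)] at e3
      simp only [map_sum, map_smul, Polynomial.coeff_X_add_C_pow, Nat.choose_one_right] at e3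
      simp only [smul_sub, sum_sub_distrib, e3]
      rw [sub_eq_zero, sum_range_succ']
      simp only [Nat.cast_zero, mul_zero, zero_smul, add_zero]
      refine sum_congr rfl fun k _ => ?_
      rw [smul_smul]
      push_cast
      simp
    · rw [← End.mul_apply, ← pow_add, hf, sum_range_extend hc (by omega : K ≤ K + 2)]
      simp
  have hck : ∀ k, c k = (k.factorial : F)⁻¹ • ((logL U) ^ k) (Ξ w) := by
    intro k
    induction k with
    | zero => simp [h0]
    | succ k ih =>
      have hk : ((k : F) + 1) ≠ 0 := by exact_mod_cast Nat.succ_ne_zero k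
      rw [pow_succ', End.mul_apply]
      have := hrec k
      rw [ih, map_smul] at this
      rw [Nat.factorial_succ, Nat.cast_mul, mul_inv, mul_smul, this, smul_smul]
      push_cast
      rw [inv_mul_cancel₀ hk, one_smul]
  have e := hf 1
  rw [pow_one] at e
  rw [e, sum_range_extend hc (le_max_left K (w.length + 1)),
    expL_apply hU.logL (lenLT_mono (le_max_right K _) (word_mem_lenLT (Nat.lt_succ_self _)))]
  exact sum_congr rfl fun k _ => by rw [hck]; simp

end ExpLog

/-! ### Gauge transformations and their Lie algebra -/

section Gauge

variable {F I : Type*} [Field F]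

/-- An infinitesimal gauge transformation: a coderivation of degree zero given by Harrison cochains
that is normalized with respect to `𝔑` and preserves the form `ω`. -/
structure IsGaugeLie (deg : I → ℤ) (𝔑 : Submodule F Λ) (ω : Λ →ₗ[F] F)
    (D : Θ) : Prop where
  coder : IsCoder deg 0 D
  homDeg : HomDeg deg 0 D
  shuffleDer : IsShuffleDer deg 0 D
  lowers : Lowers 1 D
  stable : ∀ t ∈ 𝔑, D t ∈ 𝔑
  normal : ∀ t ∈ 𝔑, ϖ (D t) = 0
  cyclic : ∀ t, ω (D t) = 0

/-- A gauge transformation: an automorphism given by Harrison cochains that is normalized with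
respect to `𝔑` and preserves the form `ω`. -/
structure IsGaugeGroup (deg : I → ℤ) (𝔑 : Submodule F Λ) (ω : Λ →ₗ[F] F)
    (U : Θ) : Prop where
  coalgHom : IsCoalgHom U
  homDeg : HomDeg deg 0 U
  shuffleHom : IsShuffleHom deg U
  lowers : Lowers 1 (U - 1)
  stable : ∀ t ∈ 𝔑, U t ∈ 𝔑
  normal : ∀ t ∈ 𝔑, ϖ (U t) = ϖ t
  cyclic : ∀ t, ω (U t) = ω t

variable {deg : I → ℤ} {𝔑 : Submodule F Λ} {ω : Λ →ₗ[F] F}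

lemma IsShuffleHom.apply {U : Θ} (h : IsShuffleHom deg U)
    (s t : Λ) : U (Ш s t) = Ш (U s) (U t) := by
  induction s using word_induction with
  | h0 => simp
  | hadd a b ha hb => simp only [map_add, add_apply, ha, hb]
  | hw c u =>
    induction t using word_induction with
    | h0 => simp
    | hadd a b ha hb => simp only [map_add, ha, hb]
    | hw d v => simp only [map_smul, smul_apply, shuffleMul_word, h u v]

lemma IsShuffleDer.apply {D : Θ} (h : IsShuffleDer deg 0 D) (s t : Λ) :
    D (Ш s t) = Ш (D s) t + Ш s (D t) := by
  induction s using word_induction with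
  | h0 => simp
  | hadd a b ha hb => simp only [map_add, add_apply, ha, hb]; abel
  | hw c u =>
    induction t using word_induction with
    | h0 => simp
    | hadd a b ha hb => simp only [map_add, ha, hb]; abel
    | hw d v =>
      simp only [map_smul, smul_apply, shuffleMul_word, h u v, zero_mul, sgn_zero, one_smul,
        smul_add]

/-- Only the term of order zero of the exponential is seen by `l`. The target of `l` is arbitrary so
that quotient maps, which test membership in a subspace, are covered. -/
lemma expL_apply_of_comp_eq_zero {M : Type*} [AddCommGroup M] [Module F M]
    {D : Θ} (hD : Lowers 1 D) (l : Λ →ₗ[F] M)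
    {S : Submodule F Λ} (hS : ∀ t ∈ S, D t ∈ S) (hl : ∀ t ∈ S, l (D t) = 0)
    {t : Λ} (ht : t ∈ S) : l (expL D t) = l t := by
  obtain ⟨n, hn⟩ := exists_mem_lenLT t
  have hS' : ∀ j, (D ^ j) t ∈ S := by
    intro j
    induction j with
    | zero => exact ht
    | succ j ih => rw [pow_succ']; exact hS _ ih
  rw [expL_apply hD (lenLT_mono (Nat.le_succ n) hn), sum_range_succ', map_add, map_sum, sum_eq_zero]
  · simp
  · intro j _
    rw [pow_succ', map_smul, End.mul_apply, hl _ (hS' j), smul_zero]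

lemma cutSum_finsetSum {M ι : Type*} [AddCommGroup M] (s : Finset ι)
    (f : ι → List I → List I → M) (w : List I) :
    cutSum (fun u v => ∑ i ∈ s, f i u v) w = ∑ i ∈ s, cutSum (f i) w := by
  simp only [cutSum]; exact sum_comm

lemma consL_mem_lenLT (x : I) {n : ℕ} {t : Λ} (ht : t ∈ Γ n) : consL F x t ∈ Γ (n + 1) := by
  have : Γ n ≤ (Γ (n + 1)).comap (consL F x) := lenLT_le_iff.2 fun w hw => by
    rw [mem_comap, consL_word]
    exact word_mem_lenLT (by simpa using hw)
  exact this ht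

lemma shuffle_mem_lenLT (deg : I → ℤ) (u v : List I) : ш u v ∈ Γ (u.length + v.length + 1) := by
  fun_induction ш u v with
  | case1 v => exact word_mem_lenLT (by simp)
  | case2 x u => exact word_mem_lenLT (by simp)
  | case3 x u y v ih1 ih2 =>
    exact add_mem (lenLT_mono (by simp) (consL_mem_lenLT x ih1))
      (Submodule.smul_mem _ _ (lenLT_mono (by simp) (consL_mem_lenLT y ih2)))

lemma HomDeg.apply_scale {D : Θ} (hD : HomDeg deg 0 D) (z : Fˣ)
    (t : Λ) : scale deg z (D t) = D (scale deg z t) := by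
  have := LinearMap.congr_fun (hD z) t
  rwa [zpow_zero, Units.val_one, one_smul] at this

/-- The two Leibniz rules exponentiate to multiplicativity by `expL_bilin`, the linear conditions by
`expL_apply_of_comp_eq_zero`; homogeneity is checked term by term. -/
lemma IsGaugeLie.exp [CharZero F] {D : Θ}
    (hD : IsGaugeLie deg 𝔑 ω D) : IsGaugeGroup deg 𝔑 ω (expL D) where
  coalgHom := by
    refine ⟨?_, fun t => ?_, ?_⟩
    · apply word_hom_ext; intro w
      set K := (w.length + 1) + (w.length + 1)
      -- In degree zero the sign operator is trivial, so the coproduct intertwines `D` with `E`,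
      -- which acts as a derivation on pure tensors.
      obtain ⟨E, hE'⟩ : ∃ E : End F (Λ ⊗[F] Λ), E = map D 1 + map 1 D := ⟨_, rfl⟩
      have hE : ∀ t, Δ (D t) = E (Δ t) := by
        intro t
        rw [hD.coder.decon_apply, par_even Even.zero, hE']; rfl
      have hEj : ∀ j t, Δ ((D ^ j) t) = (E ^ j) (Δ t) := by
        intro j
        induction j with
        | zero => intro t; rfl
        | succ j ih => intro t; rw [pow_succ, End.mul_apply, ih, hE, pow_succ, End.mul_apply]
      rw [comp_apply, comp_apply, expL_apply hD.lowers
        (word_mem_lenLT (by omega : w.length < K)), map_sum]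
      simp only [map_smul, hEj]
      rw [decon_word, map_cutSum]
      simp only [map_cutSum, map_tmul]
      have : ∀ (j : ℕ), (j.factorial : F)⁻¹ • cutSum (fun u v => (E ^ j) (Ξ u ⊗ₜ[F] Ξ v)) w =
          cutSum (fun u v => (j.factorial : F)⁻¹ • (E ^ j) (Ξ u ⊗ₜ[F] Ξ v)) w := by
        intro j; rw [← cutSum_smul (F := F)]
      simp only [this]
      rw [← cutSum_finsetSum]
      refine cutSum_congr fun u v huv => ?_
      have hl : u.length + v.length = w.length := by rw [← huv, List.length_append]
      exact expL_bilin hD.lowers hD.lowers (β := TensorProduct.mk F _ _) (E := E)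
        (fun s t => by simp [hE']) (word_mem_lenLT (by omega : u.length < w.length + 1))
        (word_mem_lenLT (by omega : v.length < w.length + 1)) le_rfl
    · exact expL_apply_of_comp_eq_zero hD.lowers _ (S := ⊤) (by simp)
        (fun t _ => hD.coder.counit t) trivial
    · rw [← word_nil, expL_apply hD.lowers (word_mem_lenLT (n := 1) (by simp))]
      simp
  homDeg := by
    intro z
    apply word_hom_ext; intro w
    rw [zpow_zero, Units.val_one, one_smul, End.mul_apply, End.mul_apply, scale_word, map_smul,
      expL_apply hD.lowers (word_mem_lenLT (Nat.lt_succ_self _)), map_sum, smul_sum]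
    refine sum_congr rfl fun j _ => ?_
    rw [map_smul, (hD.homDeg.pow_zero deg j).apply_scale, scale_word, map_smul, smul_comm]
  shuffleHom := by
    intro u v
    have hs : ш u v ∈ Γ (u.length + 1 + (v.length + 1)) :=
      lenLT_mono (by omega) (shuffle_mem_lenLT deg u v)
    rw [expL_apply hD.lowers hs, ← shuffleMul_word]
    exact expL_bilin hD.lowers hD.lowers (β := Ш) (E := D)
      hD.shuffleDer.apply (word_mem_lenLT (Nat.lt_succ_self _))
      (word_mem_lenLT (Nat.lt_succ_self _)) le_rfl
  lowers := hD.lowers.expL_sub_one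
  stable t ht := by
    have := expL_apply_of_comp_eq_zero hD.lowers 𝔑.mkQ hD.stable
      (fun t ht => (Submodule.Quotient.mk_eq_zero _).2 (hD.stable t ht)) ht
    rw [mkQ_apply, mkQ_apply, (Submodule.Quotient.mk_eq_zero _).2 ht] at this
    exact (Submodule.Quotient.mk_eq_zero _).1 this
  normal t ht := expL_apply_of_comp_eq_zero hD.lowers _ hD.stable hD.normal ht
  cyclic t := expL_apply_of_comp_eq_zero hD.lowers _ (S := ⊤) (by simp)
    (fun t _ => hD.cyclic t) trivial

lemma IsGaugeGroup.one : IsGaugeGroup deg 𝔑 ω (1 : Θ) where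
  coalgHom := .one
  homDeg := homDeg_one deg
  shuffleHom u v := by simp
  lowers := by rw [sub_self]; exact lowers_zero 1
  stable _ ht := ht
  normal _ _ := rfl
  cyclic _ := rfl

lemma IsGaugeGroup.mul {U V : Θ} (hU : IsGaugeGroup deg 𝔑 ω U)
    (hV : IsGaugeGroup deg 𝔑 ω V) : IsGaugeGroup deg 𝔑 ω (U * V) where
  coalgHom := hU.coalgHom.mul hV.coalgHom
  homDeg := by simpa using hU.homDeg.mul deg hV.homDeg
  shuffleHom u v := by rw [End.mul_apply, hV.shuffleHom u v, hU.shuffleHom.apply]; rfl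
  lowers := by
    have : U * V - 1 = (U - 1) * V + (V - 1) := by rw [sub_mul, one_mul]; abel
    rw [this]
    exact (hU.lowers.mul hV.lowers.of_sub_one).add hV.lowers
  stable t ht := hU.stable _ (hV.stable t ht)
  normal t ht := by rw [End.mul_apply, hU.normal _ (hV.stable t ht), hV.normal t ht]
  cyclic t := by rw [End.mul_apply, hU.cyclic, hV.cyclic]

lemma IsGaugeGroup.pow {U : Θ} (hU : IsGaugeGroup deg 𝔑 ω U) (n : ℕ) :
    IsGaugeGroup deg 𝔑 ω (U ^ n) := by
  induction n with
  | zero => exact .one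
  | succ n ih => rw [pow_succ]; exact ih.mul hU

/-- The sequence `l (U ^ n t)` is constant, so its linear coefficient is zero. -/
lemma logL_mem_of_forall_pow [CharZero F] {U : Θ}
    (hU : Lowers 1 (U - 1)) {M : Type*} [AddCommGroup M] [Module F M] (l : Λ →ₗ[F] M)
    {t : Λ} (h : ∀ n, l ((U ^ n) t) = l t) : l (logL U t) = 0 :=
  (((hasLin_pow hU t).map l).congr h rfl rfl).unique (hasLin_const _)

lemma logL_comm_apply [CharZero F] {U X : Θ}
    (hU : Lowers 1 (U - 1)) {t : Λ} (h : ∀ n, (U ^ n) (X t) = X ((U ^ n) t)) :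
    logL U (X t) = X (logL U t) :=
  ((hasLin_pow hU (X t)).congr h rfl rfl).unique ((hasLin_pow hU t).map X)

/-- Every condition holds for all powers of `U` and is thus an identity between polynomial sequences
in the exponent. Linear coefficients give the infinitesimal condition; products are differentiated
by `HasLin.bilin`. -/
lemma IsGaugeGroup.log [CharZero F] {U : Θ}
    (hU : IsGaugeGroup deg 𝔑 ω U) : IsGaugeLie deg 𝔑 ω (logL U) where
  coder := by
    refine ⟨?_, fun t => ?_, ?_⟩
    · ext1 t
      have key : ∀ x : Λ ⊗[F] Λ, HasLin F (fun n => map (U ^ n) (U ^ n) x) x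
            ((map (logL U) 1 + map 1 (logL U) : End F (Λ ⊗[F] Λ)) x) := by
        intro x
        induction x using TensorProduct.induction_on with
        | zero => simpa using hasLin_const (F := F) (0 : Λ ⊗[F] Λ)
        | add x y hx hy =>
          exact (hx.add hy).congr (fun n => (map_add _ _ _).symm) rfl (map_add _ _ _).symm
        | tmul s t =>
          exact (hasLin_pow hU.lowers s).bilin (hasLin_pow hU.lowers t) (TensorProduct.mk F _ _)
      rw [comp_apply, comp_apply, par_even Even.zero]
      exact (((hasLin_pow hU.lowers t).map Δ).congr
        (fun n => (hU.pow n).coalgHom.decon_apply t) rfl rfl).unique (key _)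
    · exact logL_mem_of_forall_pow hU.lowers _ fun n => (hU.pow n).coalgHom.counit t
    · exact logL_mem_of_forall_pow hU.lowers LinearMap.id fun n => (hU.pow n).coalgHom.map_one
  homDeg z := by
    ext1 t
    rw [zpow_zero, Units.val_one, one_smul]
    exact (logL_comm_apply hU.lowers fun n => ((hU.pow n).homDeg.apply_scale z t).symm).symm
  shuffleDer u v := by
    rw [zero_mul, sgn_zero, one_smul]
    exact ((hasLin_pow hU.lowers (ш u v)).congr (fun n => (hU.pow n).shuffleHom u v)
      rfl rfl).unique ((hasLin_pow hU.lowers (Ξ u)).bilin (hasLin_pow hU.lowers (Ξ v)) Ш)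
  lowers := hU.lowers.logL
  stable t ht := by
    have := logL_mem_of_forall_pow hU.lowers 𝔑.mkQ (t := t) fun n => by
      rw [mkQ_apply, mkQ_apply, (Submodule.Quotient.mk_eq_zero _).2 ht]
      exact (Submodule.Quotient.mk_eq_zero _).2 ((hU.pow n).stable t ht)
    exact (Submodule.Quotient.mk_eq_zero _).1 this
  normal t ht := logL_mem_of_forall_pow hU.lowers _ fun n => (hU.pow n).normal t ht
  cyclic t := logL_mem_of_forall_pow hU.lowers _ fun n => (hU.pow n).cyclic t

lemma IsGaugeLie.smul {D : Θ} (hD : IsGaugeLie deg 𝔑 ω D) (a : F) : IsGaugeLie deg 𝔑 ω (a • D) where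
  coder := hD.coder.smul a
  homDeg := hD.homDeg.smul deg a
  shuffleDer u v := by simp only [smul_apply, hD.shuffleDer u v, map_smul, smul_add, smul_comm a]
  lowers := hD.lowers.smul a
  stable t ht := 𝔑.smul_mem a (hD.stable t ht)
  normal t ht := by rw [smul_apply, map_smul, hD.normal t ht, smul_zero]
  cyclic t := by rw [smul_apply, map_smul, hD.cyclic, smul_zero]

lemma IsGaugeLie.neg {D : Θ} (hD : IsGaugeLie deg 𝔑 ω D) : IsGaugeLie deg 𝔑 ω (-D) := by
  rw [← neg_one_smul F D]; exact hD.smul (-1)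

/-- Taking the exponential of minus the logarithm as the inverse gives all the defining conditions
of the group at once. -/
lemma IsGaugeGroup.exists_inv [CharZero F] {U : Θ}
    (hU : IsGaugeGroup deg 𝔑 ω U) : ∃ V, IsGaugeGroup deg 𝔑 ω V ∧ U * V = 1 ∧ V * U = 1 := by
  have h := hU.log.lowers
  refine ⟨expL (-logL U), hU.log.neg.exp, ?_, ?_⟩
  · conv_lhs => rw [← expL_logL hU.lowers]
    rw [expL_logL hU.lowers, ← expL_mul_expL_neg h, expL_logL hU.lowers]
  · have := expL_mul_expL_neg h.neg
    rwa [neg_neg, expL_logL hU.lowers] at this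

end Gauge

/-! ### Infinite linear systems with finitely many unknowns in each equation -/

section LinearSystems

variable {F Ω : Type*} [Field F]

/-- A linear functional depending on finitely many coordinates. -/
def Finitary (l : (Ω → F) → F) : Prop :=
  ∃ p : Ω →₀ F, ∀ y, l y = Finsupp.linearCombination F y p

lemma finitary_zero : Finitary (fun _ : Ω → F => (0 : F)) := ⟨0, fun y => by simp⟩

lemma Finitary.add {l m : (Ω → F) → F} (hl : Finitary l) (hm : Finitary m) :
    Finitary fun y => l y + m y := by
  obtain ⟨p, hp⟩ := hl
  obtain ⟨q, hq⟩ := hm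
  exact ⟨p + q, fun y => by simp only [map_add, hp, hq]⟩

lemma Finitary.smul {l : (Ω → F) → F} (hl : Finitary l) (a : F) : Finitary fun y => a * l y := by
  obtain ⟨p, hp⟩ := hl
  exact ⟨a • p, fun y => by simp only [map_smul, hp, smul_eq_mul]⟩

lemma Finitary.sum {ι : Type*} (s : Finset ι) {l : ι → (Ω → F) → F}
    (h : ∀ i ∈ s, Finitary (l i)) : Finitary fun y => ∑ i ∈ s, l i y := by
  classical
  induction s using Finset.induction_on with
  | empty => simpa using finitary_zero
  | insert i s hi ih =>
    simp only [Finset.sum_insert hi]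
    exact (h i (Finset.mem_insert_self _ _)).add (ih fun j hj => h j (Finset.mem_insert_of_mem hj))

lemma finitary_eval (o : Ω) : Finitary fun y : Ω → F => y o :=
  ⟨Finsupp.single o 1, fun y => by simp⟩

/-- A system of linear equations, each involving finitely many unknowns, is solvable if all its
finite subsystems are. -/
lemma exists_solution {J : Type*} {l : J → (Ω → F) → F} (c : J → F) (hl : ∀ j, Finitary (l j))
    (h : ∀ s : Finset J, ∃ y, ∀ j ∈ s, l j y = c j) : ∃ y, ∀ j, l j y = c j := by
  choose p hp using hl
  let T : (J →₀ F) →ₗ[F] (Ω →₀ F) := Finsupp.linearCombination F p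
  let C : (J →₀ F) →ₗ[F] F := Finsupp.linearCombination F c
  -- A linear relation between left-hand sides involves finitely many equations. A common solution
  -- of these shows that the right-hand sides satisfy the same relation.
  have hker : ker T ≤ ker C := by
    intro a ha
    obtain ⟨y, hy⟩ := h a.support
    have h1 : Finsupp.linearCombination F y (T a) = 0 := by rw [LinearMap.mem_ker.1 ha, map_zero]
    rw [mem_ker, ← h1]
    simp only [T, C, Finsupp.linearCombination_apply F (v := p),
      Finsupp.linearCombination_apply F (v := c), Finsupp.sum, map_sum, map_smul]
    exact sum_congr rfl fun j hj => by rw [← hp, hy j hj]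
  -- The values prescribed on the span of the left-hand sides are consistent. A linear extension to
  -- all finitely supported vectors is determined by its values at the unit vectors, which form the
  -- solution.
  obtain ⟨f, hf⟩ := LinearMap.exists_extend
    (((ker T).liftQ C hker) ∘ₗ T.quotKerEquivRange.symm.toLinearMap)
  refine ⟨fun o => f (Finsupp.single o 1), fun j => ?_⟩
  have h2 : Finsupp.linearCombination F (fun o => f (Finsupp.single o 1)) = f := by ext o; simp
  rw [hp, h2]
  have h3 := LinearMap.congr_fun hf ⟨T (Finsupp.single j 1), ⟨_, rfl⟩⟩
  have h4 : T.quotKerEquivRange.symm ⟨T (Finsupp.single j 1), ⟨_, rfl⟩⟩ =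
      Submodule.Quotient.mk (Finsupp.single j 1) := by
    rw [LinearEquiv.symm_apply_eq]; rfl
  simp only [comp_apply, LinearEquiv.coe_coe, h4, Submodule.subtype_apply] at h3
  have h5 : T (Finsupp.single j 1) = p j := by simp [T]
  rw [← h5, h3]
  simp [C]

end LinearSystems

/-! ### Intertwiners modulo all lengths and the Mittag-Leffler argument -/

section Limits

variable {F I : Type*} [Field F] {deg : I → ℤ} {𝔑 : Submodule F Λ}
  {ω : Λ →ₗ[F] F} {A B : Θ}

/-- The operator on words with coordinates `y`, with components of length at least `r`. -/
def componentMap (hI : ∀ n : ℤ, {i | deg i = n}.Finite) (r : ℕ)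
    (y : List I × I → F) : Θ :=
  wordLift F fun w => if w.length < r then 0 else ∑ i ∈ (hI (η w)).toFinset, y (w, i) • Ξ [i]

variable (hI : ∀ n : ℤ, {i | deg i = n}.Finite)

lemma letterProj_componentMap (r : ℕ) (y : List I × I → F) :
    ϖ * componentMap hI r y = componentMap hI r y := by
  apply word_hom_ext; intro w
  rw [End.mul_apply, componentMap, wordLift_word]
  split_ifs <;> simp

lemma homDeg_componentMap (r : ℕ) (y : List I × I → F) : HomDeg deg 0 (componentMap hI r y) := by
  intro z
  apply word_hom_ext; intro w
  rw [zpow_zero, Units.val_one, one_smul, End.mul_apply, End.mul_apply, scale_word, map_smul,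
    componentMap, wordLift_word]
  split_ifs
  · simp
  · rw [map_sum, smul_sum]
    refine sum_congr rfl fun i hi => ?_
    have : deg i = η w := by simpa using hi
    rw [map_smul, scale_word, smul_comm]
    simp [this]

lemma componentMap_of_length_lt {r : ℕ} (y : List I × I → F) {w : List I} (h : w.length < r) :
    componentMap hI r y (Ξ w) = 0 := by
  rw [componentMap, wordLift_word, if_pos h]

/-- An operator of degree zero with values in letters sends a word into the span of the letters of
the same degree. These are finite in number, so each word needs only finitely many coordinates. -/
lemma exists_componentMap_eq [CharZero F] {r : ℕ} {g : Θ} (hg : ϖ * g = g) (hd : HomDeg deg 0 g)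
    (hr : ∀ w : List I, w.length < r → g (Ξ w) = 0) : ∃ y, componentMap hI r y = g := by
  refine ⟨fun p => (wordBasis F I).repr (g (Ξ p.1)) [p.2], ?_⟩
  apply word_hom_ext; intro w
  rw [componentMap, wordLift_word]
  split_ifs with h
  · rw [hr w h]
  · have key : ∀ b ∈ lettersOfDeg F deg (η w + 0),
        ∑ i ∈ (hI (η w)).toFinset, (wordBasis F I).repr b [i] • Ξ [i] = b := by
      intro b hb
      induction hb using span_induction with
      | mem _ h =>
        obtain ⟨x, hx, rfl⟩ := h
        have hx' : deg x = η w := by simpa using hx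
        classical
        rw [Finset.sum_eq_single x]
        · change (wordBasis F I).repr (wordBasis F I [x]) [x] • _ = _
          rw [Basis.repr_self, Finsupp.single_eq_same, one_smul]
        · intro i _ hi
          change (wordBasis F I).repr (wordBasis F I [x]) [i] • _ = _
          rw [Basis.repr_self, Finsupp.single_eq_of_ne (by simpa using hi), zero_smul]
        · intro h; exact absurd (by simpa using hx') h
      | zero => simp
      | add a b _ _ ha hb =>
        conv_rhs => rw [← ha, ← hb]
        rw [← Finset.sum_add_distrib]
        exact sum_congr rfl fun i _ => by rw [map_add, Finsupp.add_apply, add_smul]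
      | smul c a _ ha =>
        conv_rhs => rw [← ha]
        rw [smul_sum]
        exact sum_congr rfl fun i _ => by rw [map_smul, Finsupp.smul_apply, smul_eq_mul, mul_smul]
    have := key _ (mem_lettersOfDeg hg hd w)
    dsimp only
    exact this

/-- The coderivation with coordinates `y`. -/
def coordCoder (r : ℕ) (y : List I × I → F) : Θ :=
  κ 0 (componentMap hI r y)

lemma componentMap_one {r : ℕ} (hr : 0 < r) (y : List I × I → F) : componentMap hI r y 1 = 0 := by
  rw [← word_nil]; exact componentMap_of_length_lt hI y hr

lemma isCoder_coordCoder {r : ℕ} (hr : 0 < r) (y : List I × I → F) :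
    IsCoder deg 0 (coordCoder hI r y) :=
  isCoder_coder 0 (letterProj_componentMap hI r y) (componentMap_one hI hr y)

lemma letterProj_coordCoder {r : ℕ} (hr : 0 < r) (y : List I × I → F) (t : Λ) :
    ϖ (coordCoder hI r y t) = componentMap hI r y t := by
  rw [coordCoder, ← End.mul_apply,
    letterProj_coder 0 (letterProj_componentMap hI r y) (componentMap_one hI hr y)]

/-- The value at `t` involves the component at finitely many subwords, with finitely many
coordinates each. The reindexing `ι` lets several operators share one space of unknowns. -/
lemma finitary_coordCoder {Ω : Type*} (r : ℕ) (ι : List I × I → Ω) (l : Λ →ₗ[F] F)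
    (t : Λ) : Finitary fun y : Ω → F => l (coordCoder hI r (fun p => y (ι p)) t) := by
  induction t using word_induction with
  | h0 => simpa using finitary_zero
  | hadd a b ha hb => simpa using ha.add hb
  | hw c w =>
    simp only [map_smul, smul_eq_mul]
    refine Finitary.smul ?_ c
    induction w generalizing l with
    | nil => simpa [coordCoder, word_nil] using finitary_zero
    | cons x w ih =>
      simp only [coordCoder, coder_cons, map_add, map_smul, smul_eq_mul]
      refine Finitary.add ?_ (Finitary.smul (ih (l ∘ₗ mulLeft F (Ξ [x]))) _)
      simp only [conv_word, cutSum, map_sum]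
      refine Finitary.sum _ fun i _ => ?_
      simp only [componentMap, wordLift_word, End.one_apply]
      split_ifs
      · simpa using finitary_zero
      · simp only [Finset.sum_mul, map_sum, smul_mul_assoc, map_smul, smul_eq_mul]
        refine Finitary.sum _ fun j _ => ?_
        simp only [mul_comm (_ : F) (l _)]
        exact (finitary_eval _).smul _

/-- `U` intertwines `A` and `B` on words of length at most `k`. -/
def Intertwines (A B : Θ) (k : ℕ) (U : Θ) :
    Prop :=
  ∀ t ∈ Γ (k + 1), B (U t) = U (A t)

lemma expL_mem_lenLT {D : Θ} (hD : Lowers 1 D) {n : ℕ} {t : Λ} (ht : t ∈ Γ n) : expL D t ∈ Γ n := by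
  simpa using hD.expL_sub_one.of_sub_one.mem ht

lemma intertwines_expL (hA : Lowers 0 A) {D : Θ} (hD : Lowers 1 D)
    {k : ℕ} (h : Intertwines A A k D) : Intertwines A A k (expL D) := by
  intro t ht
  have hAt : A t ∈ Γ (k + 1) := by simpa using hA.mem ht
  rw [expL_apply hD ht, expL_apply hD hAt, map_sum]
  refine sum_congr rfl fun j hj => ?_
  clear hj
  rw [map_smul]
  congr 1
  induction j with
  | zero => rfl
  | succ j ih =>
    have : (D ^ j) t ∈ Γ (k + 1) := by simpa using ((hD.pow j).mono (Nat.zero_le j)).mem ht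
    rw [pow_succ', End.mul_apply, End.mul_apply, h _ this, ih]

lemma intertwines_logL [CharZero F] {U : Θ}
    (hU : Lowers 1 (U - 1)) {k : ℕ} (h : Intertwines A A k U) : Intertwines A A k (logL U) := by
  intro t ht
  refine (logL_comm_apply hU fun n => ?_).symm
  induction n with
  | zero => rfl
  | succ n ih =>
    have : (U ^ n) t ∈ Γ (k + 1) := by
      clear ih
      induction n with
      | zero => exact ht
      | succ n ih => rw [pow_succ']; simpa using hU.of_sub_one.mem ih
    rw [pow_succ', End.mul_apply, End.mul_apply, h _ this, ih]

lemma IsGaugeGroup.letterProj_apply {U : Θ} (hU : IsGaugeGroup deg 𝔑 ω U) {t : Λ} (ht : t ∈ Γ 2) :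
    ϖ (U t) = ϖ t := by
  have h1 : (U - 1) t ∈ Γ 1 := lenLT_mono (by norm_num) (hU.lowers.mem ht)
  have h2 : Γ 1 ≤ ker ϖ := lenLT_le_iff.2 fun w hw => by
    rw [mem_ker, letterProj_of_length_ne (by omega)]
  have h3 := LinearMap.mem_ker.1 (h2 h1)
  rwa [sub_apply, map_sub, sub_eq_zero] at h3

lemma lenLT_induction {n : ℕ} {f g : Λ →ₗ[F] Λ}
    (h : ∀ w : List I, w.length < n → f (Ξ w) = g (Ξ w)) {t : Λ}
    (ht : t ∈ Γ n) : f t = g t := by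
  have : Γ n ≤ LinearMap.eqLocus f g := lenLT_le_iff.2 h
  exact this ht

/-- On these words `D` produces words of length at most one; `D` kills them and `V` preserves their
letter part. Hence in the leading arity composition is addition of components. -/
lemma letterProj_mul_expL {V D : Θ} (hV : IsGaugeGroup deg 𝔑 ω V)
    {r : ℕ} (hr : 2 ≤ r) (hD : Lowers (r - 1) D) (hD0 : ∀ w : List I, w.length < r → D (Ξ w) = 0)
    {w : List I} (hw : w.length ≤ r) : ϖ (V (expL D (Ξ w))) = ϖ (V (Ξ w)) + ϖ (D (Ξ w)) := by
  have h2 : D (Ξ w) ∈ Γ 2 := lenLT_mono (by omega) (hD w)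
  have h3 : D (D (Ξ w)) = 0 := by
    have := lenLT_induction (f := D) (g := 0) (n := 2) (fun v hv => hD0 v (by omega)) h2
    simpa using this
  have h4 : expL D (Ξ w) = Ξ w + D (Ξ w) := by
    rw [expL_apply (hD.mono (by omega)) (word_mem_lenLT (by omega : w.length < r + 1)),
      ← Finset.sum_subset (range_mono (by omega : 2 ≤ r + 1))]
    · simp [Finset.sum_range_succ]
    · intro j _ hj
      obtain ⟨i, rfl⟩ : ∃ i, j = i + 2 := ⟨j - 2, by simp at hj; omega⟩
      rw [pow_add, End.mul_apply, pow_two, End.mul_apply, h3, map_zero, smul_zero]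
  rw [h4, map_add, map_add, hV.letterProj_apply h2]

lemma isGaugeLie_of_log_data [CharZero F] {r : ℕ} (hr : 2 ≤ r) {g : Θ}
    (hg : ϖ * g = g) (hd : HomDeg deg 0 g)
    (hg0 : ∀ w : List I, w.length < r → g (Ξ w) = 0)
    (hs : KillsShuffles deg g)
    (h𝔑 : ∀ t ∈ 𝔑, κ 0 g t ∈ 𝔑) (hn : ∀ t ∈ 𝔑, ϖ (κ 0 g t) = 0)
    (hω : ∀ t, ω (κ 0 g t) = 0) : IsGaugeLie deg 𝔑 ω (κ 0 g) := by
  have h1 : g 1 = 0 := by rw [← word_nil]; exact hg0 [] (by simp; omega)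
  refine ⟨isCoder_coder 0 hg h1, homDeg_coder hd, ?_, ?_, h𝔑, hn, hω⟩
  · refine (isCoder_coder 0 hg h1).isShuffleDer (homDeg_coder hd) ?_
    rwa [letterProj_coder 0 hg h1]
  · exact lowers_coder hg fun w hw => hg0 w (by omega)

/-- A coderivation is recovered from its component, which here consumes at least `r` letters and
returns one. -/
lemma lowers_of_eq_zero {D : Θ} {c : ℤ} {r : ℕ} (hr : 2 ≤ r)
    (hD : IsCoder deg c D) (h : ∀ w : List I, w.length < r → D (Ξ w) = 0) :
    Lowers (r - 1) D := by
  have hp : ϖ * (ϖ * D) = ϖ * D := by rw [← mul_assoc, letterProj_idem]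
  have hp1 : (ϖ * D) 1 = 0 := by rw [End.mul_apply, hD.map_one, map_zero]
  have : D = κ c (ϖ * D) := hD.ext (isCoder_coder c hp hp1) (letterProj_coder c hp hp1).symm
  rw [this]
  exact lowers_coder hp fun w hw => by rw [End.mul_apply, h w (by omega), map_zero]

/-- A sequence of families of infinitesimal gauge transformations has a limit point: it satisfies
every linear condition on finitely many coordinates that holds eventually. -/
lemma exists_limit_point [CharZero F] (hI : ∀ n : ℤ, {i | deg i = n}.Finite) {r : ℕ} (hr : 2 ≤ r)
    (L : ℕ → ℕ → Θ) (hL : ∀ K k, IsGaugeLie deg 𝔑 ω (L K k))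
    (hL0 : ∀ K k (w : List I), w.length < r → L K k (Ξ w) = 0) :
    ∃ z : ℕ → Θ, (∀ k, IsGaugeLie deg 𝔑 ω (z k)) ∧
      (∀ k (w : List I), w.length < r → z k (Ξ w) = 0) ∧
      ∀ (k k' : ℕ) (l l' : Λ →ₗ[F] F) (t t' : Λ) (c : F),
        (∃ K₀, ∀ K, K₀ ≤ K → l (L K k t) + l' (L K k' t') = c) → l (z k t) + l' (z k' t') = c := by
  have hex : ∀ K k, ∃ y, componentMap hI r y = ϖ * L K k := fun K k =>
    exists_componentMap_eq hI (by rw [← mul_assoc, letterProj_idem])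
      (by simpa using (homDeg_letterProj deg).mul deg (hL K k).homDeg) fun w hw => by
        rw [End.mul_apply, hL0 K k w hw, map_zero]
  choose Y hY using hex
  have hYL : ∀ K k, coordCoder hI r (Y K k) = L K k := fun K k =>
    (isCoder_coordCoder hI (by omega) _).ext (hL K k).coder (by
      rw [← hY K k]; exact LinearMap.ext (letterProj_coordCoder hI (by omega) (Y K k)))
  -- The equations are all finitary functionals of the coordinates of the whole family, together
  -- with the values they eventually take along the sequence.
  let J : Type _ := {e : ((ℕ × List I × I → F) → F) × F // Finitary e.1 ∧
    ∃ K₀, ∀ K, K₀ ≤ K → e.1 (fun p => Y K p.1 p.2) = e.2}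
  -- Finitely many equations are satisfied by a member of the sequence beyond all their thresholds.
  obtain ⟨y, hy⟩ := exists_solution (fun e : J => e.1.2) (fun e => e.2.1) fun s => by
    choose K₀ hK₀ using fun e : J => e.2.2
    exact ⟨fun p => Y (s.sup K₀) p.1 p.2, fun j hj => hK₀ j _ (Finset.le_sup hj)⟩
  have key : ∀ (k k' : ℕ) (l l' : Λ →ₗ[F] F) (t t' : Λ) (c : F),
      (∃ K₀, ∀ K, K₀ ≤ K → l (L K k t) + l' (L K k' t') = c) →
      l (coordCoder hI r (fun p => y (k, p)) t) + l' (coordCoder hI r (fun p => y (k', p)) t') = c := by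
    rintro k k' l l' t t' c ⟨K₀, h⟩
    refine hy ⟨(fun y => l (coordCoder hI r (fun p => y (k, p)) t) +
      l' (coordCoder hI r (fun p => y (k', p)) t'), c),
      (finitary_coordCoder hI r (fun p => (k, p)) l t).add
        (finitary_coordCoder hI r (fun p => (k', p)) l' t'), K₀, fun K hK => ?_⟩
    have h1 := h K hK
    rw [← hYL, ← hYL] at h1
    exact h1
  have key' : ∀ k (l : Λ →ₗ[F] F) t, (∀ K, l (L K k t) = 0) →
      l (coordCoder hI r (fun p => y (k, p)) t) = 0 := fun k l t h => by
    have := key k k l 0 t t 0 ⟨0, fun K _ => by rw [h, zero_apply, add_zero]⟩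
    rwa [zero_apply, add_zero] at this
  have hdual : ∀ a : Λ, (∀ l : Λ →ₗ[F] F, l a = 0) → a = 0 := fun a h =>
    (Module.forall_dual_apply_eq_zero_iff F a).1 h
  refine ⟨fun k => coordCoder hI r fun p => y (k, p), fun k => ?_, fun k w hw => ?_, key⟩
  · have hpz : ∀ t, ϖ (coordCoder hI r (fun p => y (k, p)) t) =
        componentMap hI r (fun p => y (k, p)) t :=
      letterProj_coordCoder hI (by omega) fun p => y (k, p)
    have hkill : KillsShuffles deg (componentMap hI r fun p => y (k, p)) := by
      intro u v hu hv
      refine hdual _ fun l => ?_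
      rw [← hpz]
      refine key' k (l ∘ₗ ϖ) _ fun K => ?_
      rw [comp_apply, ← End.mul_apply, (hL K k).shuffleDer.killsShuffles (hL K k).coder u v hu hv,
        map_zero]
    have hstable : ∀ t ∈ 𝔑, coordCoder hI r (fun p => y (k, p)) t ∈ 𝔑 := by
      intro t ht
      by_contra hne
      -- Membership in `𝔑` is tested by functionals that vanish on `𝔑`, and each test is one
      -- finitary equation.
      obtain ⟨l, hl1, hl2⟩ := Submodule.exists_le_ker_of_notMem hne
      exact hl1 (key' k l t fun K => hl2 ((hL K k).stable t ht))
    have hnormal : ∀ t ∈ 𝔑, ϖ (coordCoder hI r (fun p => y (k, p)) t) = 0 := by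
      intro t ht
      exact hdual _ fun l => key' k (l ∘ₗ ϖ) t fun K => by
        rw [comp_apply, (hL K k).normal t ht, map_zero]
    have hcyclic : ∀ t, ω (coordCoder hI r (fun p => y (k, p)) t) = 0 := fun t =>
      key' k ω t fun K => (hL K k).cyclic t
    exact isGaugeLie_of_log_data (g := componentMap hI r fun p => y (k, p)) hr
      (letterProj_componentMap hI r _) (homDeg_componentMap hI r _)
      (fun w hw => componentMap_of_length_lt hI _ hw) hkill hstable hnormal hcyclic
  · exact hdual _ fun l => key' k l _ fun K => by rw [hL0 K k w hw, map_zero]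

/-- One step of the Mittag-Leffler argument. -/
lemma exists_extension [CharZero F] (hI : ∀ n : ℤ, {i | deg i = n}.Finite) (hA : Lowers 0 A)
    {r : ℕ} (hr : 2 ≤ r)
    (V : ℕ → Θ) (hV : ∀ k, IsGaugeGroup deg 𝔑 ω (V k))
    (hVI : ∀ k, Intertwines A B k (V k))
    (hVr : ∀ k (w : List I), w.length < r → V k (Ξ w) = V 0 (Ξ w)) :
    ∃ V' : ℕ → Θ, (∀ k, IsGaugeGroup deg 𝔑 ω (V' k)) ∧ (∀ k, Intertwines A B k (V' k)) ∧
      (∀ k (w : List I), w.length < r → V' k (Ξ w) = V k (Ξ w)) ∧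
      ∀ k (w : List I), w.length < r + 1 → V' k (Ξ w) = V' 0 (Ξ w) := by
  choose W hW hVW hWV using fun k => (hV k).exists_inv
  have hWA : ∀ k t, t ∈ Γ (k + 1) → W k (B t) = A (W k t) := by
    intro k t ht
    have h1 : W k t ∈ Γ (k + 1) := by simpa using (hW k).lowers.of_sub_one.mem ht
    have h2 : V k (W k t) = t := LinearMap.congr_fun (hVW k) t
    conv_lhs => rw [← h2, hVI k _ h1]
    exact LinearMap.congr_fun (hWV k) _
  -- For `K ≥ k` the product of the inverse of `V k` with `V K` commutes with `A` on words of length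
  -- at most `k`, and it is trivial below length `r`. Its logarithm satisfies linear conditions, so
  -- a limit for `K → ∞` can be taken.
  obtain ⟨L, hLdef⟩ : ∃ L : ℕ → ℕ → Θ, ∀ K k, L K k = logL (W k * V K) := ⟨_, fun _ _ => rfl⟩
  have hWVK : ∀ K k, IsGaugeGroup deg 𝔑 ω (W k * V K) := fun K k => (hW k).mul (hV K)
  have hL : ∀ K k, IsGaugeLie deg 𝔑 ω (L K k) := fun K k => by rw [hLdef]; exact (hWVK K k).log
  have hWV1 : ∀ K k (w : List I), w.length < r → (W k * V K) (Ξ w) = Ξ w := by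
    intro K k w hw
    rw [End.mul_apply, hVr K w hw, ← hVr k w hw]
    exact LinearMap.congr_fun (hWV k) _
  have hL0 : ∀ K k (w : List I), w.length < r → L K k (Ξ w) = 0 := by
    intro K k w hw
    rw [hLdef]
    refine logL_mem_of_forall_pow (hWVK K k).lowers LinearMap.id (t := Ξ w) fun n => ?_
    simp only [id_apply]
    induction n with
    | zero => rfl
    | succ n ih => rw [pow_succ, End.mul_apply, hWV1 K k w hw, ih]
  have hLA : ∀ K k, k ≤ K → Intertwines A A k (L K k) := by
    intro K k hk
    rw [hLdef]
    refine intertwines_logL (hWVK K k).lowers fun t ht => ?_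
    have h1 : V K t ∈ Γ (k + 1) := by simpa using (hV K).lowers.of_sub_one.mem ht
    rw [End.mul_apply, End.mul_apply, ← hWA k _ h1, hVI K t (lenLT_mono (by omega) ht)]
  have hLlow : ∀ K k, Lowers (r - 1) (L K k) := fun K k =>
    lowers_of_eq_zero hr (hL K k).coder (hL0 K k)
  -- In length `r`, the component of `V k` corrected by that of `L K k` is the component of `V K`,
  -- which does not depend on `k`.
  have hagree : ∀ K k (w : List I), w.length = r → ϖ (V k (Ξ w)) +
      ϖ (L K k (Ξ w)) = ϖ (V K (Ξ w)) := by
    intro K k w hw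
    rw [← letterProj_mul_expL (hV k) hr (hLlow K k) (hL0 K k) hw.le, hLdef,
      expL_logL (hWVK K k).lowers, ← End.mul_apply (V k), ← mul_assoc, hVW, one_mul]
  obtain ⟨z, hLie, hz0, hz⟩ := exists_limit_point hI hr L hL hL0
  have hsub : ∀ a b : Λ, (∀ l : Λ →ₗ[F] F, l a = l b) → a = b :=
    fun a b h => sub_eq_zero.1 ((Module.forall_dual_apply_eq_zero_iff F _).1 fun l => by
      rw [map_sub, h l, sub_self])
  have hzlow : ∀ k, Lowers (r - 1) (z k) := fun k => lowers_of_eq_zero hr (hLie k).coder (hz0 k)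
  have hcomm : ∀ k, Intertwines A A k (z k) := fun k t ht => hsub _ _ fun l =>
    sub_eq_zero.1 (by
      have := hz k k (l ∘ₗ A) (-l) t (A t) 0 ⟨k, fun K hK => by
        rw [comp_apply, hLA K k hK t ht, neg_apply, add_neg_cancel]⟩
      rwa [comp_apply, neg_apply, ← sub_eq_add_neg] at this)
  have hG : ∀ k, IsGaugeGroup deg 𝔑 ω (V k * expL (z k)) := fun k => (hV k).mul (hLie k).exp
  have hlt : ∀ k (w : List I), w.length < r → expL (z k) (Ξ w) = Ξ w := by
    intro k w hw
    rw [expL_apply (hLie k).lowers (word_mem_lenLT (Nat.lt_succ_self _)), sum_range_succ',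
      sum_eq_zero]
    · simp
    · intro j _
      rw [pow_succ, End.mul_apply, hz0 k w hw, map_zero, smul_zero]
  refine ⟨fun k => V k * expL (z k), hG, ?_, ?_, ?_⟩
  · intro k t ht
    rw [End.mul_apply, End.mul_apply, hVI k _ (expL_mem_lenLT (hLie k).lowers ht),
      intertwines_expL hA (hLie k).lowers (hcomm k) t ht]
  · intro k w hw
    rw [End.mul_apply, hlt k w hw]
  · intro k
    refine (hG k).coalgHom.eqOn (hG 0).coalgHom fun w hw => ?_
    simp only [End.mul_apply]
    rcases (Nat.lt_succ_iff.1 hw).lt_or_eq with h | h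
    · rw [hlt k w h, hlt 0 w h, hVr k w h]
    · rw [letterProj_mul_expL (hV k) hr (hzlow k) (hz0 k) h.le,
        letterProj_mul_expL (hV 0) hr (hzlow 0) (hz0 0) h.le]
      refine hsub _ _ fun l => ?_
      -- By `hagree` the difference of the corrections with indices `k` and `0` is the same for all
      -- `K`, hence also in the limit. This is why the limit point must respect conditions that
      -- involve two indices.
      have := hz k 0 (l ∘ₗ ϖ) (-(l ∘ₗ ϖ)) (Ξ w) (Ξ w) (l (ϖ (V 0 (Ξ w))) - l (ϖ (V k (Ξ w))))
        ⟨0, fun K _ => by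
          have h1 := congrArg l (hagree K k w h)
          have h2 := congrArg l (hagree K 0 w h)
          rw [map_add] at h1 h2
          simp only [comp_apply, neg_apply]
          linear_combination h1 - h2⟩
      simp only [comp_apply, neg_apply] at this
      rw [map_add, map_add]
      linear_combination this

/-- A compatible sequence of gauge transformations has a limit. -/
lemma exists_limit (U : ℕ → Θ) (hU : ∀ n, IsGaugeGroup deg 𝔑 ω (U n))
    (h : ∀ n (w : List I), w.length < n → U (n + 1) (Ξ w) = U n (Ξ w)) :
    ∃ V, IsGaugeGroup deg 𝔑 ω V ∧ ∀ n, ∀ t ∈ Γ n, V t = U n t := by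
  have h' : ∀ n m, n ≤ m → ∀ w : List I, w.length < n → U m (Ξ w) = U n (Ξ w) := by
    intro n m hnm w hw
    induction m, hnm using Nat.le_induction with
    | base => rfl
    | succ m hnm ih => rw [h m w (by omega), ih]
  let V : Θ := wordLift F fun w => U (w.length + 1) (Ξ w)
  have hV : ∀ n, ∀ t ∈ Γ n, V t = U n t := fun n t ht =>
    lenLT_induction (fun w hw => by
      simp only [V, wordLift_word]; exact (h' _ _ hw w (Nat.lt_succ_self _)).symm) ht
  refine ⟨V, ⟨⟨?_, fun t => ?_, ?_⟩, fun z => ?_, fun u v => ?_, fun w => ?_, fun t ht => ?_,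
    fun t ht => ?_, fun t => ?_⟩, hV⟩
  · apply word_hom_ext; intro w
    rw [comp_apply, comp_apply, hV (w.length + 1) _
      (word_mem_lenLT (Nat.lt_succ_self _)), (hU _).coalgHom.decon_apply, decon_word, map_cutSum,
      map_cutSum]
    refine cutSum_congr fun u v huv => ?_
    have : u.length + v.length = w.length := by rw [← huv, List.length_append]
    rw [map_tmul, map_tmul, hV (w.length + 1) _ (word_mem_lenLT
      (by omega)), hV (w.length + 1) _ (word_mem_lenLT (by omega))]
  · obtain ⟨n, ht⟩ := exists_mem_lenLT t
    rw [hV n t ht, (hU n).coalgHom.counit]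
  · rw [hV 1 1 (by rw [← word_nil]; exact word_mem_lenLT (by simp)), (hU 1).coalgHom.map_one]
  · ext1 t
    obtain ⟨n, ht⟩ := exists_mem_lenLT t
    rw [zpow_zero, Units.val_one, one_smul, End.mul_apply, End.mul_apply, hV n t ht,
      hV n _ (by simpa using (lowers_scale deg z).mem ht), (hU n).homDeg.apply_scale]
  · rw [hV _ _ (shuffle_mem_lenLT deg u v), hV (u.length + v.length + 1) _ (word_mem_lenLT
      (by omega)), hV (u.length + v.length + 1) _ (word_mem_lenLT (by omega)), (hU _).shuffleHom]
  · rw [sub_apply, hV (w.length + 1) _ (word_mem_lenLT (Nat.lt_succ_self _))]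
    exact (hU _).lowers w
  all_goals obtain ⟨n, hn⟩ := exists_mem_lenLT t; rw [hV n t hn]
  · exact (hU n).stable t ht
  · exact (hU n).normal t ht
  · exact (hU n).cyclic t

/-- Starting from arbitrary intertwiners modulo each `k`, iteration of `exists_extension` produces
sequences whose members agree up to larger and larger length, without changing what was already
settled. Their limit intertwines on all words. -/
lemma exists_intertwiner_of_forall [CharZero F] (hI : ∀ n : ℤ, {i | deg i = n}.Finite)
    (hA : Lowers 0 A)
    (h : ∀ k, ∃ V, IsGaugeGroup deg 𝔑 ω V ∧ Intertwines A B k V) :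
    ∃ U, IsGaugeGroup deg 𝔑 ω U ∧ ∀ t, B (U t) = U (A t) := by
  choose V₀ hV₀ hVI₀ using h
  -- The shift by two is the starting point of the induction: all gauge transformations agree on
  -- words of length at most one.
  let P : ℕ → (ℕ → Θ) → Prop := fun r V =>
    (∀ k, IsGaugeGroup deg 𝔑 ω (V k)) ∧ (∀ k, Intertwines A B k (V k)) ∧
      ∀ k (w : List I), w.length < r + 2 → V k (Ξ w) = V 0 (Ξ w)
  have h0 : P 0 V₀ := ⟨hV₀, hVI₀, fun k => (hV₀ k).coalgHom.eqOn (hV₀ 0).coalgHom fun w hw => by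
    rw [(hV₀ k).letterProj_apply (word_mem_lenLT hw), (hV₀ 0).letterProj_apply (word_mem_lenLT hw)]⟩
  have hstep : ∀ r (V : {V // P r V}), ∃ V' : {V // P (r + 1) V},
      ∀ k (w : List I), w.length < r + 2 → V'.1 k (Ξ w) = V.1 k (Ξ w) := by
    rintro r ⟨V, hV, hVI, hVr⟩
    obtain ⟨V', h1, h2, h3, h4⟩ := exists_extension hI hA (by omega : 2 ≤ r + 2) V hV hVI hVr
    exact ⟨⟨V', h1, h2, h4⟩, h3⟩
  choose next hnext using hstep
  let W : ∀ r, {V // P r V} := fun r => Nat.rec ⟨V₀, h0⟩ (fun r V => next r V) r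
  obtain ⟨U, hU, hlim⟩ := exists_limit (fun r => (W r).1 0) (fun r => (W r).2.1 0)
    fun r w hw => hnext r (W r) 0 w (by omega)
  refine ⟨U, hU, fun t => ?_⟩
  obtain ⟨n, ht⟩ := exists_mem_lenLT t
  have hAt : A t ∈ Γ n := by simpa using hA.mem ht
  -- On short words the members of the `n`-th sequence agree, so the limit may be compared with the
  -- member of index `n`, which is known to intertwine there.
  have e : ∀ s ∈ Γ n, U s = (W n).1 n s := fun s hs => by
    rw [hlim n s hs]
    exact lenLT_induction (fun w hw => ((W n).2.2.2 n w (by omega)).symm) hs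
  rw [e t ht, e _ hAt, (W n).2.2.1 n t (lenLT_mono (Nat.le_succ n) ht)]

end Limits

/-! ### The Hochschild differential and normalization -/

section Hochschild

variable {F I : Type*} [Field F]

/-- The suspension of an associative graded commutative product with unit `o`. -/
structure IsUnitalProduct (deg : I → ℤ) (β : Θ) (o : I) : Prop where
  letter : ϖ * β = β
  length : ∀ w : List I, w.length ≠ 2 → β (Ξ w) = 0
  homDeg : HomDeg deg 1 β
  kills : KillsShuffles deg β
  square : κ 1 β * κ 1 β = 0
  deg_unit : deg o = -1
  unit_left : ∀ x, β (Ξ [o, x]) = -Ξ [x]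
  unit_right : ∀ x, β (Ξ [x, o]) = sgn F (deg x) • Ξ [x]

/-- A cochain of arity `r` and degree `e`. -/
structure IsCochain (deg : I → ℤ) (r : ℕ) (e : ℤ) (c : Θ) : Prop where
  letter : ϖ * c = c
  length : ∀ w : List I, w.length ≠ r → c (Ξ w) = 0
  homDeg : HomDeg deg e c

/-- The Hochschild differential of a cochain of degree `e`. -/
def hochschild (deg : I → ℤ) (β : Θ) (e : ℤ)
    (c : Θ) : Θ :=
  β * κ e c - sgn F e • (c * κ 1 β)

set_option hygiene false in
/-- The differential given by the product `β`. -/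
notation "𝒹" => hochschild deg β

variable {deg : I → ℤ} {β : Θ} {o : I} {r : ℕ} {e : ℤ}
  {c : Θ}

lemma IsCochain.map_one (hc : IsCochain deg r e c) (hr : 0 < r) : c 1 = 0 := by
  rw [← word_nil]; exact hc.length [] (by simp; omega)

lemma IsCochain.isCoder (hc : IsCochain deg r e c) (hr : 0 < r) :
    IsCoder deg e (κ e c) := isCoder_coder e hc.letter (hc.map_one hr)

lemma IsCochain.letterProj_coder (hc : IsCochain deg r e c) (hr : 0 < r) :
    ϖ * κ e c = c := _root_.letterProj_coder e hc.letter (hc.map_one hr)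

lemma IsCochain.homDeg_coder (hc : IsCochain deg r e c) : HomDeg deg e (κ e c) :=
  _root_.homDeg_coder hc.homDeg

lemma IsCochain.lowers (hc : IsCochain deg r e c) (hr : 0 < r) : Lowers (r - 1) (κ e c) :=
  lowers_coder hc.letter fun w hw => hc.length w (by omega)

/-- The span of the words of length `n`. -/
def lenEq (F I : Type*) [Field F] (n : ℕ) : Submodule F Λ :=
  span F (Ξ '' {w | w.length = n})

lemma word_mem_lenEq {w : List I} {n : ℕ} (h : w.length = n) : Ξ w ∈ lenEq F I n :=
  subset_span ⟨w, h, rfl⟩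

lemma lenEq_le_iff {n : ℕ} {S : Submodule F Λ} :
    lenEq F I n ≤ S ↔ ∀ w : List I, w.length = n → Ξ w ∈ S := by
  rw [lenEq, span_le]
  exact ⟨fun h w hw => h ⟨w, hw, rfl⟩, by rintro h _ ⟨w, hw, rfl⟩; exact h w hw⟩

lemma consL_mem_lenEq (x : I) {n : ℕ} {t : Λ} (ht : t ∈ lenEq F I n) :
    Ξ [x] * t ∈ lenEq F I (n + 1) := by
  have : lenEq F I n ≤ (lenEq F I (n + 1)).comap (consL F x) := lenEq_le_iff.2 fun w hw => by
    rw [mem_comap, consL_word]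
    exact word_mem_lenEq (by simpa using hw)
  exact this ht

lemma letter_mul_mem_lenEq {y : Λ} (hy : ϖ y = y) {n : ℕ}
    {t : Λ} (ht : t ∈ lenEq F I n) : y * t ∈ lenEq F I (n + 1) := by
  refine letter_induction y hy ?_ ?_ ?_
  · rw [zero_mul]; exact zero_mem _
  · intro s u hs hu; rw [add_mul]; exact add_mem hs hu
  · intro a x; rw [smul_mul_assoc]; exact Submodule.smul_mem _ _ (consL_mem_lenEq x ht)

lemma IsCochain.coder_eq_zero (hc : IsCochain deg r e c) {w : List I} (h : w.length < r) :
    κ e c (Ξ w) = 0 := by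
  induction w with
  | nil => rw [word_nil, coder_one]
  | cons y w ih =>
    rw [coder_cons, ih (by simp at h; omega), mul_zero, smul_zero, add_zero, conv_word]
    refine cutSum_eq_zero fun u v huv => ?_
    have : u.length + v.length = w.length + 1 := by rw [← List.length_append, huv, List.length_cons]
    rw [hc.length u (by simp at h; omega), zero_mul]

/-- Each term replaces `r` consecutive letters by one; the equation of lengths is written without
subtraction. -/
lemma IsCochain.coder_mem_lenEq (hc : IsCochain deg r e c) (w : List I) (n : ℕ)
    (h : w.length + 1 = n + r) : κ e c (Ξ w) ∈ lenEq F I n := by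
  induction w generalizing n with
  | nil => rw [word_nil, coder_one]; exact zero_mem _
  | cons x w ih =>
    rw [coder_cons]
    refine add_mem ?_ (Submodule.smul_mem _ _ ?_)
    · rw [conv_word]
      refine cutSum_mem fun u v huv => ?_
      by_cases hu : u.length = r
      · have : u.length + v.length = w.length + 1 := by
          rw [← List.length_append, huv, List.length_cons]
        obtain ⟨m, rfl⟩ : ∃ m, n = m + 1 := ⟨n - 1, by simp at h; omega⟩
        exact letter_mul_mem_lenEq (letter_apply hc.letter _) (word_mem_lenEq (by simp at h; omega))
      · rw [hc.length u hu, zero_mul]; exact zero_mem _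
    · rcases Nat.eq_zero_or_pos n with rfl | hn
      · rw [hc.coder_eq_zero (by simp at h; omega), mul_zero]; exact zero_mem _
      · obtain ⟨m, rfl⟩ : ∃ m, n = m + 1 := ⟨n - 1, by omega⟩
        exact consL_mem_lenEq x (ih m (by simp at h; omega))

lemma IsCochain.eq_zero_of_mem_lenEq (hc : IsCochain deg r e c) {n : ℕ} (hn : n ≠ r)
    {t : Λ} (ht : t ∈ lenEq F I n) : c t = 0 := by
  have : lenEq F I n ≤ ker c := lenEq_le_iff.2 fun w hw => hc.length w (by omega)
  exact this ht

lemma IsCochain.add {c' : Θ} (hc : IsCochain deg r e c)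
    (hc' : IsCochain deg r e c') : IsCochain deg r e (c + c') where
  letter := by rw [mul_add, hc.letter, hc'.letter]
  length w hw := by rw [add_apply, hc.length w hw, hc'.length w hw, add_zero]
  homDeg := hc.homDeg.add deg hc'.homDeg

lemma IsCochain.smul (hc : IsCochain deg r e c) (a : F) : IsCochain deg r e (a • c) where
  letter := by rw [mul_smul_comm, hc.letter]
  length w hw := by rw [smul_apply, hc.length w hw, smul_zero]
  homDeg := hc.homDeg.smul deg a

lemma IsCochain.neg (hc : IsCochain deg r e c) : IsCochain deg r e (-c) := by
  rw [← neg_one_smul F c]; exact hc.smul (-1)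

lemma IsCochain.sub {c' : Θ} (hc : IsCochain deg r e c)
    (hc' : IsCochain deg r e c') : IsCochain deg r e (c - c') := by
  rw [sub_eq_add_neg]; exact hc.add hc'.neg

lemma coder_add (c c' : Θ) : κ e (c + c') = κ e c + κ e c' := by
  apply word_hom_ext; intro w
  induction w with
  | nil => simp [word_nil]
  | cons x w ih =>
    have hconv : ∀ t, conv (c + c') 1 t = conv c 1 t + conv c' 1 t := fun t => by
      simp [conv, map_add_left]
    rw [add_apply, coder_cons, coder_cons, coder_cons, ih, hconv, add_apply, mul_add, smul_add]
    abel

lemma coder_smul (a : F) (c : Θ) : κ e (a • c) = a • κ e c := by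
  apply word_hom_ext; intro w
  induction w with
  | nil => simp [word_nil]
  | cons x w ih =>
    have hconv : ∀ t, conv (a • c) 1 t = a • conv c 1 t := fun t => by simp [conv, map_smul_left]
    rw [smul_apply, coder_cons, coder_cons, ih, hconv, smul_apply, smul_add, mul_smul_comm,
      smul_comm a]

lemma hochschild_add (c c' : Θ) : 𝒹 e (c + c') = 𝒹 e c + 𝒹 e c' := by
  simp only [hochschild, coder_add, mul_add, add_mul, smul_add]; abel

lemma hochschild_smul (a : F) (c : Θ) : 𝒹 e (a • c) = a • 𝒹 e c := by
  simp only [hochschild, coder_smul, mul_smul_comm, smul_mul_assoc, smul_sub, smul_comm a]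

lemma hochschild_sub (c c' : Θ) : 𝒹 e (c - c') = 𝒹 e c - 𝒹 e c' := by
  rw [sub_eq_add_neg, ← neg_one_smul F c', hochschild_add, hochschild_smul]
  module

/-- The contribution of the first letter to the Hochschild differential. -/
def headTerm (deg : I → ℤ) (β : Θ) (e : ℤ)
    (c : Θ) : List I → List I → Λ
  | [], _ => 0
  | x :: p, t => sgn F (e * deg x) • β (Ξ [x] * c (Ξ (p ++ t)))

namespace IsUnitalProduct

variable (hβ : IsUnitalProduct deg β o)

lemma isCochain (hβ : IsUnitalProduct deg β o) : IsCochain deg 2 1 β :=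
  ⟨hβ.letter, hβ.length, hβ.homDeg⟩

/-- Both sides are coderivations with the same component. On the level of coderivations the
Hochschild differential is therefore the graded commutator with the codifferential of the product.
-/
lemma coder_hochschild (hβ : IsUnitalProduct deg β o) (hc : IsCochain deg r e c) (hr : 0 < r) :
    κ (1 + e) (𝒹 e c) = κ 1 β * κ e c - sgn F e • (κ e c * κ 1 β) := by
  have h1 := hβ.isCochain.isCoder two_pos
  have h2 := hc.isCoder hr
  have h3 := h1.bracket h2 hβ.isCochain.homDeg_coder hc.homDeg_coder
  rw [one_mul] at h3
  have h4 : ϖ * (κ 1 β * κ e c - sgn F e • (κ e c * κ 1 β)) = 𝒹 e c := by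
    rw [mul_sub, mul_smul_comm, ← mul_assoc, ← mul_assoc, hβ.isCochain.letterProj_coder two_pos,
      hc.letterProj_coder hr, hochschild]
  rw [← h4]
  have h5 : ϖ * (ϖ * (κ 1 β * κ e c - sgn F e • (κ e c * κ 1 β))) = ϖ * (κ 1 β * κ e c -
      sgn F e • (κ e c * κ 1 β)) := by rw [← mul_assoc, letterProj_idem]
  have h6 : (ϖ * (κ 1 β * κ e c - sgn F e • (κ e c * κ 1 β))) 1 = 0 := by
    rw [End.mul_apply, h3.map_one, map_zero]
  exact (isCoder_coder _ h5 h6).ext h3 (_root_.letterProj_coder _ h5 h6)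

lemma isCochain_hochschild (hβ : IsUnitalProduct deg β o) (hc : IsCochain deg r e c) :
    IsCochain deg (r + 1) (1 + e) (𝒹 e c) where
  letter := by
    rw [hochschild, mul_sub, mul_smul_comm, ← mul_assoc, ← mul_assoc, hβ.letter, hc.letter]
  homDeg := by
    have h1 := hβ.homDeg.mul deg hc.homDeg_coder
    have h2 := hc.homDeg.mul deg hβ.isCochain.homDeg_coder
    rw [add_comm] at h2
    exact h1.sub deg (h2.smul deg _)
  length w hw := by
    rw [hochschild, sub_apply, smul_apply, End.mul_apply, End.mul_apply]
    have h1 : β (κ e c (Ξ w)) = 0 := by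
      rcases lt_or_ge w.length r with h | h
      · rw [hc.coder_eq_zero h, map_zero]
      · exact hβ.isCochain.eq_zero_of_mem_lenEq (n := w.length + 1 - r) (by omega)
          (hc.coder_mem_lenEq w _ (by omega))
    have h2 : c (κ 1 β (Ξ w)) = 0 := by
      rcases lt_or_ge w.length 2 with h | h
      · rw [hβ.isCochain.coder_eq_zero h, map_zero]
      · exact hc.eq_zero_of_mem_lenEq (n := w.length - 1) (by omega)
          (hβ.isCochain.coder_mem_lenEq w _ (by omega))
    rw [h1, h2, smul_zero, sub_zero]

/-- The commutator with an odd operator of square zero has square zero. -/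
lemma hochschild_hochschild (hβ : IsUnitalProduct deg β o) (hc : IsCochain deg r e c)
    (hr : 0 < r) : 𝒹 (1 + e) (𝒹 e c) = 0 := by
  have hb := hβ.isCochain.letterProj_coder two_pos
  have hsq := hβ.square
  set D := κ 1 β
  have h1 : β * D = 0 := by rw [← hb, mul_assoc, hsq, mul_zero]
  rw [hochschild, hβ.coder_hochschild hc hr, hochschild, mul_sub, mul_smul_comm, sub_mul,
    smul_mul_assoc, mul_assoc c, hsq, mul_zero, smul_zero, sub_zero, ← mul_assoc, h1, zero_mul,
    zero_sub, sgn_add, sgn_one, mul_assoc, neg_one_mul]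
  module

/-! ### Words containing the unit -/

lemma coder_cons_cons (hβ : IsUnitalProduct deg β o) (x y : I) (w : List I) :
    κ 1 β (Ξ (x :: y :: w)) = β (Ξ [x, y]) * Ξ w +
      sgn F (deg x) • (Ξ [x] * κ 1 β (Ξ (y :: w))) := by
  have h1 : β 1 = 0 := hβ.isCochain.map_one two_pos
  have h2 : cutSum (fun u v => β (Ξ (x :: y :: u)) * Ξ v) w = β (Ξ [x, y]) * Ξ w := by
    cases w with
    | nil => simp
    | cons z w =>
      rw [cutSum_cons, cutSum_eq_zero, add_zero]
      intro u v _
      rw [hβ.length _ (by simp), zero_mul]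
  rw [coder_cons, one_mul, conv_word, cutSum_cons, cutSum_cons, hβ.length [x] (by simp)]
  simp only [End.one_apply, word_nil, h1, zero_mul, zero_add, h2]

lemma coder_unit_cons (hβ : IsUnitalProduct deg β o) (x : I) (s : List I) :
    κ 1 β (Ξ (o :: x :: s)) = -Ξ (x :: s) - Ξ [o] * κ 1 β (Ξ (x :: s)) := by
  rw [hβ.coder_cons_cons, hβ.unit_left, hβ.deg_unit, sgn_odd (by decide), neg_mul, word_mul_word,
    List.singleton_append]
  module

/-- The middle term is the product of the last letter of the prefix with the unit, the only product
across the seam. -/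
lemma coder_append_unit (hβ : IsUnitalProduct deg β o) (x : I) (p s : List I) :
    κ 1 β (Ξ (x :: p ++ o :: s)) = κ 1 β (Ξ (x :: p)) * Ξ (o :: s) +
      sgn F (η (x :: p)) • (Ξ (x :: p ++ s) + Ξ (x :: p) * κ 1 β (Ξ (o :: s))) := by
  induction p generalizing x with
  | nil =>
    rw [List.singleton_append, hβ.coder_cons_cons, hβ.unit_right,
      hβ.isCochain.coder_eq_zero (w := [x]) (by simp)]
    simp [word_mul_word, smul_add]
  | cons y p ih =>
    have e1 : Ξ (p ++ o :: s) = Ξ p * Ξ (o :: s) := (word_mul_word _ _).symm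
    have e2 : Ξ (x :: y :: p ++ s) = Ξ [x] * Ξ (y :: p ++ s) := word_cons _ _
    have e3 : Ξ (x :: y :: p) = Ξ [x] * Ξ (y :: p) := word_cons _ _
    rw [List.cons_append, List.cons_append, hβ.coder_cons_cons, ← List.cons_append, ih,
      hβ.coder_cons_cons, e1, e2, e3, wordDeg_cons deg x, sgn_add]
    simp only [add_mul, mul_add, smul_add, mul_smul_comm, smul_mul_assoc, smul_smul, mul_assoc]
    abel

lemma mul_letterProj (hβ : IsUnitalProduct deg β o) {y : Λ}
    (hy : ϖ y = y) (t : Λ) : β (y * t) = β (y * ϖ t) := by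
  induction t using word_induction with
  | h0 => simp
  | hadd a b ha hb => rw [mul_add, map_add, ha, hb, map_add, mul_add, map_add]
  | hw a w =>
    simp only [map_smul, mul_smul_comm]
    congr 1
    by_cases hw : w.length = 1
    · obtain ⟨x, rfl⟩ := List.length_eq_one_iff.1 hw
      simp
    · rw [letterProj_of_length_ne hw, mul_zero, map_zero]
      exact hβ.isCochain.eq_zero_of_mem_lenEq (n := w.length + 1) (by omega)
        (letter_mul_mem_lenEq hy (word_mem_lenEq rfl))

lemma hochschild_cons (hβ : IsUnitalProduct deg β o) (hc : IsCochain deg r e c) (hr : 0 < r)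
    (x : I) (w : List I) : 𝒹 e c (Ξ (x :: w)) = β (conv c ϖ (Ξ (x :: w))) +
        sgn F (e * deg x) • β (Ξ [x] * c (Ξ w)) -
        sgn F e • c (κ 1 β (Ξ (x :: w))) := by
  rw [hochschild, sub_apply, smul_apply, End.mul_apply, End.mul_apply, coder_cons, map_add,
    map_smul, hβ.mul_letterProj (letterProj_singleton x),
    ← End.mul_apply ϖ, hc.letterProj_coder hr, conv_word, conv_word,
    map_cutSum, map_cutSum]
  congr 2
  exact cutSum_congr fun u v _ => hβ.mul_letterProj (letter_apply hc.letter (Ξ u)) (Ξ v)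

lemma conv_letterProj_concat (c : Θ) (w : List I) (y : I) :
    conv c ϖ (Ξ (w ++ [y])) = c (Ξ w) * Ξ [y] := by
  rw [conv_word, cutSum_append_singleton, word_nil, letterProj_nil, mul_zero, add_zero]
  induction w using List.reverseRecOn with
  | nil => simp
  | append_singleton w z _ =>
    rw [cutSum_append_singleton, cutSum_eq_zero, zero_add]
    · simp
    · intro u v _
      rw [letterProj_of_length_ne (by simp), mul_zero]

lemma unit_mul (hβ : IsUnitalProduct deg β o) {y : Λ} (hy : ϖ y = y) : β (Ξ [o] * y) = -y := by
  refine letter_induction y hy (by simp) ?_ ?_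
  · intro s t hs ht; rw [mul_add, map_add, hs, ht, neg_add]
  · intro a x; rw [mul_smul_comm, map_smul, word_mul_word, List.singleton_append, hβ.unit_left,
      smul_neg]

lemma mul_unit (hβ : IsUnitalProduct deg β o) {y : Λ} {n : ℤ}
    (hy : y ∈ lettersOfDeg F deg n) : β (y * Ξ [o]) = sgn F n • y := by
  induction hy using span_induction with
  | mem _ h =>
    obtain ⟨x, hx, rfl⟩ := h
    rw [word_mul_word, List.singleton_append, hβ.unit_right, hx]
  | zero => simp
  | add a b _ _ ha hb => rw [add_mul, map_add, ha, hb, smul_add]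
  | smul a y _ h => rw [smul_mul_assoc, map_smul, h, smul_comm]

/-- In the Hochschild differential the terms which multiply by the unit cancel. -/
lemma hochschild_append_unit_concat (hβ : IsUnitalProduct deg β o) (hc : IsCochain deg r e c)
    (hr : 0 < r) (p s : List I) (y : I) :
    𝒹 e c (Ξ (p ++ o :: (s ++ [y]))) =
      headTerm deg β e c p (o :: (s ++ [y])) + β (c (Ξ (p ++ o :: s)) * Ξ [y]) -
      sgn F e • c (κ 1 β (Ξ p) * Ξ (o :: (s ++ [y]))) +
      sgn F (e + η p) • c (Ξ p * (Ξ [o] * κ 1 β (Ξ (s ++ [y])))) := by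
  have h1 : κ 1 β (Ξ (o :: (s ++ [y]))) = -Ξ (s ++ [y]) - Ξ [o] * κ 1 β (Ξ (s ++ [y])) := by
    cases s with
    | nil => exact hβ.coder_unit_cons y []
    | cons z s => exact hβ.coder_unit_cons z (s ++ [y])
  cases p with
  | nil =>
    rw [List.nil_append, hβ.hochschild_cons hc hr, ← List.cons_append, conv_letterProj_concat,
      List.cons_append, hβ.unit_mul (letter_apply hc.letter _), h1, hβ.deg_unit, mul_neg_one,
      headTerm, word_nil, coder_one, zero_mul, map_zero, smul_zero, one_mul, wordDeg_nil, add_zero,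
      map_sub, map_neg, List.nil_append, sgn_congr (a := -e) (b := e) (by simp)]
    module
  | cons x p =>
    have h2 : x :: p ++ o :: (s ++ [y]) = (x :: p ++ o :: s) ++ [y] := by simp
    have h3 : Ξ (x :: p ++ (s ++ [y])) = Ξ (x :: p) * Ξ (s ++ [y]) := (word_mul_word _ _).symm
    rw [List.cons_append, hβ.hochschild_cons hc hr, ← List.cons_append, hβ.coder_append_unit, h1,
      h2, conv_letterProj_concat, headTerm, h3, sgn_add]
    simp only [map_add, map_sub, map_neg, map_smul, mul_sub, mul_neg]
    module

/-- The product of the value with the final unit cancels the term in which the letter in front of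
the unit is multiplied by it. -/
lemma hochschild_append_unit [CharZero F] (hβ : IsUnitalProduct deg β o)
    (hc : IsCochain deg r e c) (hr : 0 < r) (x : I) (p : List I) :
    𝒹 e c (Ξ (x :: p ++ [o])) = headTerm deg β e c (x :: p) [o] -
        sgn F e • c (κ 1 β (Ξ (x :: p)) * Ξ [o]) := by
  have h1 : κ 1 β (Ξ [o]) = 0 := hβ.isCochain.coder_eq_zero (by simp)
  rw [List.cons_append, hβ.hochschild_cons hc hr, ← List.cons_append, hβ.coder_append_unit,
    conv_letterProj_concat, h1, headTerm, hβ.mul_unit (mem_lettersOfDeg hc.letter hc.homDeg _),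
    sgn_add]
  simp only [map_add, map_smul, mul_zero, add_zero, List.append_nil]
  module

end IsUnitalProduct

/-! ### Normalization -/

/-- `f` vanishes if the unit is among the first `j` arguments. -/
def VanishesUpTo (o : I) (j : ℕ) (f : Θ) : Prop :=
  ∀ p s : List I, p.length < j → f (Ξ (p ++ o :: s)) = 0

lemma VanishesUpTo.apply {j : ℕ} {f : Θ} (h : VanishesUpTo o j f)
    {a : Λ} (ha : a ∈ Γ j) (s : List I) : f (a * Ξ (o :: s)) = 0 := by
  have : Γ j ≤ ker (f ∘ₗ mulRight F (Ξ (o :: s))) := lenLT_le_iff.2 fun p hp => by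
      rw [mem_ker, comp_apply, mulRight_apply, word_mul_word]
      exact h p s hp
  exact this ha

lemma VanishesUpTo.headTerm {j : ℕ} {f : Θ} (h : VanishesUpTo o j f)
    {p : List I} (hp : p.length ≤ j) (s : List I) : headTerm deg β e f p (o :: s) = 0 := by
  cases p with
  | nil => rfl
  | cons x p => rw [_root_.headTerm, h p s (by simpa using hp), mul_zero, map_zero, smul_zero]

/-- The cochain obtained by inserting the unit after `j` arguments. -/
def insertUnit (deg : I → ℤ) (o : I) (j : ℕ) (f : Θ) :
    Θ :=
  wordLift F fun w => sgn F (η (w.take j)) • f (Ξ (w.take j ++ o :: w.drop j))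

lemma insertUnit_append {j : ℕ} (f : Θ) {p : List I}
    (hp : p.length = j) (t : Λ) : insertUnit deg o j f (Ξ p * t) =
      sgn F (η p) • f (Ξ p * (Ξ [o] * t)) := by
  induction t using word_induction with
  | h0 => simp
  | hadd a b ha hb => simp only [mul_add, map_add, ha, hb, smul_add]
  | hw a w =>
    simp only [mul_smul_comm, map_smul, word_mul_word, insertUnit, wordLift_word]
    rw [List.take_left' hp, List.drop_left' hp, smul_comm]
    rfl

lemma isCochain_insertUnit (hβ : IsUnitalProduct deg β o) {f : Θ}
    {r : ℕ} (hf : IsCochain deg (r + 1) 0 f) (j : ℕ) :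
    IsCochain deg r (-1) (insertUnit deg o j f) where
  letter := by
    apply word_hom_ext; intro w
    rw [End.mul_apply, insertUnit, wordLift_word, map_smul, letter_apply hf.letter]
  length w hw := by rw [insertUnit, wordLift_word, hf.length _ (by simp; omega), smul_zero]
  homDeg z := by
    apply word_hom_ext; intro w
    have h := List.take_append_drop j w
    rw [smul_apply, End.mul_apply, End.mul_apply, scale_word, map_smul, insertUnit, wordLift_word,
      map_smul, hf.homDeg.scale_apply, smul_comm, smul_smul]
    have h' : η w = η (w.take j) + η (w.drop j) := by rw [← wordDeg_append, h]
    have h2 : ((z ^ (η (w.take j ++ o :: w.drop j) + 0) : Fˣ) : F) =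
        ((z ^ (-1 : ℤ) : Fˣ) : F) * ((z ^ η w : Fˣ) : F) := by
      rw [← Units.val_mul, ← zpow_add, h']
      simp only [wordDeg_append, wordDeg_cons, hβ.deg_unit]
      congr 2; ring
    simp only [smul_smul]
    congr 1
    rw [h2]; ring

lemma VanishesUpTo.insertUnit {j : ℕ} {f : Θ}
    (h : VanishesUpTo o j f) : VanishesUpTo o j (insertUnit deg o j f) := by
  intro p s hp
  obtain ⟨k, hk⟩ : ∃ k, j = p.length + (k + 1) := ⟨j - p.length - 1, by omega⟩
  rw [_root_.insertUnit, wordLift_word]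
  have : (p ++ o :: s).take j = p ++ o :: s.take k := by rw [hk, List.take_length_add_append]; rfl
  rw [this, List.append_assoc, List.cons_append, h p _ hp, smul_zero]

/-- Insertion of a unit is a contracting homotopy. On a word with two consecutive units after `j`
letters, the vanishing of the differential of `f` expresses `f`, at the word with one of these units
removed, by the differential of the cochain with an inserted unit; the other terms have a unit among
the first `j` arguments. -/
lemma IsUnitalProduct.normalize_step [CharZero F] (hβ : IsUnitalProduct deg β o)
    {f : Θ} {r j : ℕ} (hf : IsCochain deg (r + 1) 0 f) (hr : 0 < r)
    (h : VanishesUpTo o j f) (hδ : ∀ p s : List I, 𝒹 0 f (Ξ (p ++ o :: s)) = 0) :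
    VanishesUpTo o (j + 1) (f - 𝒹 (-1) (insertUnit deg o j f)) := by
  have hc := isCochain_insertUnit hβ hf j
  have hv := h.insertUnit (deg := deg)
  have hDp : ∀ {p : List I}, p.length ≤ j → κ 1 β (Ξ p) ∈ Γ j := fun {p} hp =>
    lenLT_mono (by omega) (hβ.isCochain.lowers two_pos p)
  have hDo : κ 1 β (Ξ [o]) = 0 := hβ.isCochain.coder_eq_zero (by simp)
  intro p s hp
  by_cases hlen : (p ++ o :: s).length = r + 1
  swap
  · exact (hf.sub (by simpa using hβ.isCochain_hochschild hc)).length _ hlen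
  rw [sub_apply, sub_eq_zero]
  rcases List.eq_nil_or_concat' s with rfl | ⟨s, y, rfl⟩
  · obtain ⟨x, p, rfl⟩ : ∃ x p', p = x :: p' := by
      cases p with
      | nil => simp at hlen; omega
      | cons x p => exact ⟨x, p, rfl⟩
    rw [hβ.hochschild_append_unit hc hr, hv.headTerm (Nat.lt_succ_iff.1 hp),
      hv.apply (hDp (Nat.lt_succ_iff.1 hp)), smul_zero, sub_zero]
    -- The unit is the last argument here. Doubling it shows that `f` already vanishes, and so does
    -- the correction term.
    have h1 := hδ (x :: p) [o]
    have h2 := hβ.hochschild_append_unit_concat hf (Nat.succ_pos r) (x :: p) [] o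
    rw [List.nil_append] at h2
    rw [h2, h.headTerm (Nat.lt_succ_iff.1 hp), h.apply (hDp (Nat.lt_succ_iff.1 hp)), hDo, mul_zero,
      mul_zero, map_zero, smul_zero, smul_zero, add_zero, sub_zero, zero_add,
      hβ.mul_unit (mem_lettersOfDeg hf.letter hf.homDeg _)] at h1
    have h3 := congrArg (fun t => sgn F (η (x :: p ++ [o]) + 0) • t) h1
    simpa only [smul_smul, sgn_mul_self, one_smul, smul_zero] using h3
  · rw [hβ.hochschild_append_unit_concat hc hr, hv.headTerm (Nat.lt_succ_iff.1 hp),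
      hv.apply (hDp (Nat.lt_succ_iff.1 hp)), smul_zero, sub_zero, zero_add]
    rcases (Nat.lt_succ_iff.1 hp).lt_or_eq with hlt | heq
    · rw [h p _ hlt, hv p _ hlt, zero_mul, map_zero, zero_add]
      have : insertUnit deg o j f (Ξ p * (Ξ [o] * κ 1 β (Ξ (s ++ [y])))) = 0 := by
        generalize κ 1 β (Ξ (s ++ [y])) = t
        induction t using word_induction with
        | h0 => simp
        | hadd a b ha hb => simp only [mul_add, map_add, ha, hb, add_zero]
        | hw a w =>
          simp only [mul_smul_comm, map_smul, word_mul_word]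
          rw [List.singleton_append, hv p w hlt, smul_zero]
      rw [this, smul_zero]
    · have h1 := hδ p (o :: (s ++ [y]))
      have h2 := hβ.hochschild_append_unit_concat hf (Nat.succ_pos r) p (o :: s) y
      have h3 : κ 1 β (Ξ (o :: s ++ [y])) = -Ξ (s ++ [y]) - Ξ [o] * κ 1 β (Ξ (s ++ [y])) := by
        cases s with
        | nil => exact hβ.coder_unit_cons y []
        | cons z s => exact hβ.coder_unit_cons z (s ++ [y])
      rw [List.cons_append] at h2 h3
      rw [h2, h.headTerm heq.le, h.apply (hDp heq.le), h3] at h1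
      rw [insertUnit_append f heq, ← word_mul_word p (o :: s), insertUnit_append f heq]
      have h4 : Ξ p * (Ξ [o] * Ξ (o :: s)) = Ξ (p ++ o :: o :: s) := by simp [word_mul_word]
      have h5 : Ξ p * (Ξ [o] * Ξ (s ++ [y])) = Ξ (p ++ o :: (s ++ [y])) := by simp [word_mul_word]
      rw [h4, sgn_add, sgn_odd (by decide : Odd (-1 : ℤ)), smul_mul_assoc, map_smul, smul_smul,
        mul_assoc, sgn_mul_self]
      rw [zero_add, smul_zero, sub_zero, mul_sub, mul_neg, mul_sub, mul_neg, h5, map_sub, map_neg,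
        zero_add] at h1
      have h6 := congrArg (fun t => sgn F (η p) • t) h1
      simp only [smul_add, smul_smul, sgn_mul_self, one_smul, smul_zero] at h6
      rw [← sub_eq_zero, ← neg_eq_zero, ← h6]
      module

/-- A cochain with normalized differential is cohomologous to a normalized one. -/
lemma IsUnitalProduct.exists_normalized [CharZero F] (hβ : IsUnitalProduct deg β o)
    {f : Θ} {r : ℕ} (hf : IsCochain deg (r + 1) 0 f) (hr : 0 < r)
    (hδ : ∀ p s : List I, 𝒹 0 f (Ξ (p ++ o :: s)) = 0) :
    ∃ c, IsCochain deg r (-1) c ∧ ∀ p s : List I, (f - 𝒹 (-1) c) (Ξ (p ++ o :: s)) = 0 := by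
  have key : ∀ j, ∃ c, IsCochain deg r (-1) c ∧ VanishesUpTo o j (f - 𝒹 (-1) c) := by
    intro j
    induction j with
    | zero =>
      refine ⟨0, ⟨by simp, by simp, homDeg_zero deg _⟩, fun p s hp => absurd hp (Nat.not_lt_zero _)⟩
    | succ j ih =>
      obtain ⟨c, hc, hv⟩ := ih
      have hc' : IsCochain deg (r + 1) 0 (f - 𝒹 (-1) c) :=
        hf.sub (by simpa using hβ.isCochain_hochschild hc)
      -- The corrections already made do not change the differential of `f`, so the hypothesis of
      -- the next step persists.
      have h0 := hβ.hochschild_hochschild hc hr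
      rw [show (1 + -1 : ℤ) = 0 by norm_num] at h0
      have := hβ.normalize_step hc' hr hv fun p s => by rw [hochschild_sub, h0, sub_zero, hδ]
      refine ⟨c + insertUnit deg o j (f - 𝒹 (-1) c), hc.add (isCochain_insertUnit hβ hc' j), ?_⟩
      rwa [hochschild_add, ← sub_sub]
  obtain ⟨c, hc, hv⟩ := key (r + 1)
  refine ⟨c, hc, fun p s => ?_⟩
  by_cases h : p.length < r + 1
  · exact hv p s h
  · exact (hf.sub (by simpa using hβ.isCochain_hochschild hc)).length _ (by simp; omega)

end Hochschild

/-! ### Associativity and commutativity of the shuffle product -/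

section ShuffleAlgebra

variable {F I : Type*} [Field F] {deg : I → ℤ}

lemma shuffleMul_consL (x y : I) (s t : Λ) :
    Ш (consL F x s) (consL F y t) = consL F x (Ш s (consL F y t)) +
      consL F y (Ш (par deg (deg y) (consL F x s)) t) :=
  shuffleMul_letter_mul (letterProj_singleton x) (subset_span ⟨y, rfl, rfl⟩) s t

/-- Both sides are sums over which of the three words supplies the first letter, with the same
signs; the remaining triple products are shorter. -/
lemma shuffleMul_assoc_word (u v w : List I) : Ш (ш u v) (Ξ w) = Ш (Ξ u) (ш v w) := by
  induction h : u.length + v.length + w.length using Nat.strong_induction_on generalizing u v w with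
  | _ n ih =>
  match u, v, w with
  | [], v, w => simp [word_nil]
  | x :: u, [], w => simp
  | x :: u, y :: v, [] => simp [word_nil]
  | x :: u, y :: v, z :: w =>
    simp only [List.length_cons] at h
    have i1 := ih _ (by simp; omega) u (y :: v) (z :: w) rfl
    have i2 := ih _ (by simp; omega) (x :: u) v (z :: w) rfl
    have i3 := ih _ (by simp; omega) (x :: u) (y :: v) w rfl
    have e1 : par deg (deg z) (consL F x (ш u (y :: v))) + sgn F (deg y * η (x :: u)) •
          par deg (deg z) (consL F y (ш (x :: u) v)) =
        sgn F (deg z * (η (x :: u) + η (y :: v))) • ш (x :: u) (y :: v) := by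
      rw [← par_shuffle, shuffle_cons_cons, map_add, map_smul]
    have L : Ш (ш (x :: u) (y :: v)) (Ξ (z :: w)) = consL F x (Ш (ш u (y :: v)) (Ξ (z :: w))) +
        sgn F (deg y * η (x :: u)) • consL F y (Ш (ш (x :: u) v) (Ξ (z :: w))) +
        sgn F (deg z * (η (x :: u) + η (y :: v))) • consL F z (Ш (ш (x :: u) (y :: v)) (Ξ w)) := by
      rw [shuffle_cons_cons deg x y u v, map_add, map_smul, ← consL_word z w, add_apply, smul_apply,
        shuffleMul_consL, shuffleMul_consL, consL_word]
      have := congrArg (fun t => consL F z (Ш t (Ξ w))) e1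
      simp only [map_add, map_smul, add_apply, smul_apply] at this
      rw [shuffle_cons_cons deg x y u v] at this
      simp only [map_add, map_smul, add_apply, smul_apply, smul_add] at this ⊢
      rw [add_add_add_comm, this]
    have R : Ш (Ξ (x :: u)) (ш (y :: v) (z :: w)) = consL F x (Ш (Ξ u) (ш (y :: v) (z :: w))) +
        sgn F (deg y * η (x :: u)) • consL F y (Ш (Ξ (x :: u)) (ш v (z :: w))) +
        sgn F (deg z * (η (x :: u) + η (y :: v))) • consL F z (Ш (Ξ (x :: u)) (ш (y :: v) w)) := by
      rw [shuffle_cons_cons deg y z v w, ← consL_word x u, map_add, map_smul, shuffleMul_consL,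
        shuffleMul_consL, map_add, map_smul, consL_word, par_word, par_word, map_add, map_smul]
      simp only [map_smul, smul_apply, smul_add, smul_smul, ← sgn_add]
      rw [show deg z * η (y :: v) + deg z * η (x :: u) = deg z * (η (x :: u) + η (y :: v)) by ring]
      abel
    rw [L, R, i1, i2, i3]

lemma shuffleMul_assoc (s t r : Λ) : Ш (Ш s t) r = Ш s (Ш t r) := by
  induction s using word_induction with
  | h0 => simp
  | hadd a b ha hb => simp only [map_add, add_apply, ha, hb]
  | hw c u =>
  induction t using word_induction with
  | h0 => simp
  | hadd a b ha hb =>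
    simp only [map_add, map_smul, smul_apply, add_apply] at ha hb ⊢
    rw [ha, hb]
  | hw d v =>
  induction r using word_induction with
  | h0 => simp
  | hadd a b ha hb => simp only [map_add, ha, hb]
  | hw e w => simp only [map_smul, smul_apply, shuffleMul_word, shuffleMul_assoc_word]

lemma word_shuffleMul_comm (v : List I) (t : Λ) : Ш (Ξ v) t = Ш (par deg (η v) t) (Ξ v) := by
  induction t using word_induction with
  | h0 => simp
  | hadd a b ha hb => simp only [map_add, add_apply, ha, hb]
  | hw c w =>
    simp only [map_smul, par_word, smul_apply, shuffleMul_word]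
    rw [shuffle_comm deg v w]

lemma IsShuffleDer.apply_par {c : ℤ} {D : Θ} (h : IsShuffleDer deg c D) (s t : Λ) : D (Ш s t) =
      Ш (D s) t + Ш (par deg c s) (D t) := by
  induction s using word_induction with
  | h0 => simp
  | hadd a b ha hb => simp only [map_add, add_apply, ha, hb]; abel
  | hw c u =>
    induction t using word_induction with
    | h0 => simp
    | hadd a b ha hb =>
      simp only [map_add, map_smul, smul_apply] at ha hb ⊢
      rw [ha, hb]; abel
    | hw d v => simp only [map_smul, smul_apply, shuffleMul_word, h u v, smul_add, par_word]

lemma shuffle_mem_lenEq (u v : List I) : ш u v ∈ lenEq F I (u.length + v.length) := by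
  fun_induction ш u v with
  | case1 v => exact word_mem_lenEq (by simp)
  | case2 x u => exact word_mem_lenEq (by simp)
  | case3 x u y v ih1 ih2 =>
    refine add_mem ?_ (Submodule.smul_mem _ _ ?_)
    · have := consL_mem_lenEq x ih1
      rwa [show u.length + (y :: v).length + 1 = (x :: u).length + (y :: v).length by
        simp only [List.length_cons]; omega] at this
    · have := consL_mem_lenEq y ih2
      rwa [show (x :: u).length + v.length + 1 = (x :: u).length + (y :: v).length by
        simp only [List.length_cons]; omega] at this

lemma emptyCoeff_of_ne {w : List I} (hw : w ≠ []) : ε (Ξ w) = 0 := by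
  cases w with
  | nil => exact absurd rfl hw
  | cons => simp

/-- The formula `key` is bilinear and includes the empty word as a factor, so it can be checked on
words and then restricted to elements without constant term. -/
lemma KillsShuffles.apply {M : Type*} [AddCommGroup M] [Module F M] {f : Λ →ₗ[F] M}
    (hf : KillsShuffles deg f) {s t : Λ} (hs : ε s = 0)
    (ht : ε t = 0) : f (Ш s t) = 0 := by
  have key : ∀ s t : Λ, f (Ш s t) = ε s • f t + ε t • f s - (ε s * ε t) • f 1 := by
    intro s t
    induction s using word_induction with
    | h0 => simp
    | hadd a b ha hb => simp only [map_add, add_apply, ha, hb]; module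
    | hw c u =>
    induction t using word_induction with
    | h0 => simp
    | hadd a b ha hb => simp only [map_add, ha, hb]; module
    | hw d v =>
      simp only [map_smul, smul_apply, shuffleMul_word, smul_eq_mul]
      match u, v with
      | [], v => simp only [shuffle_nil_left, word_nil, emptyCoeff_one]; module
      | x :: u, [] => simp only [shuffle_nil_right, word_nil, emptyCoeff_one, emptyCoeff_cons]; module
      | x :: u, y :: v => rw [hf _ _ (by simp) (by simp)]; simp
  rw [key, hs, ht]; simp

end ShuffleAlgebra

/-! ### Adams operations and Eulerian idempotents -/

section Adams

variable {F I : Type*} [Field F] (deg : I → ℤ)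

/-- The second Adams operation `w ↦ ∑ u ⧢ v` of the shuffle algebra, the sum being over all
decompositions `w = u v`. -/
def adamsTwo : Θ :=
  lift Ш ∘ₗ Δ

variable {deg}

lemma adamsTwo_word (w : List I) : adamsTwo deg (Ξ w) = cutSum ш w := by
  simp [adamsTwo, decon_word, map_cutSum]

lemma adamsTwo_mem_lenEq {n : ℕ} {t : Λ} (ht : t ∈ lenEq F I n) : adamsTwo deg t ∈ lenEq F I n := by
  have : lenEq F I n ≤ (lenEq F I n).comap (adamsTwo deg) := lenEq_le_iff.2 fun w hw => by
    rw [mem_comap, adamsTwo_word]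
    refine cutSum_mem fun u v huv => ?_
    have := shuffle_mem_lenEq (F := F) (deg := deg) u v
    rwa [← List.length_append, huv, hw] at this
  exact this ht

lemma homDeg_adamsTwo : HomDeg deg 0 (adamsTwo (F := F) deg) := by
  intro z
  apply word_hom_ext; intro w
  rw [zpow_zero, Units.val_one, one_smul, End.mul_apply, End.mul_apply, scale_word, map_smul,
    adamsTwo_word, map_cutSum, ← cutSum_smul (F := F)]
  refine cutSum_congr fun u v huv => ?_
  rw [scale_shuffle, ← huv, wordDeg_append]

lemma emptyCoeff_adamsTwo (t : Λ) : ε (adamsTwo deg t) = ε t := by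
  have : ε ∘ₗ adamsTwo deg = ε := by
    apply word_hom_ext; intro w
    rw [comp_apply, adamsTwo_word, map_cutSum]
    cases w with
    | nil => simp
    | cons x w =>
      rw [emptyCoeff_cons]
      refine cutSum_eq_zero fun u v huv => emptyCoeff_shuffle ?_
      by_contra! h
      simp [h.1, h.2] at huv
  exact LinearMap.congr_fun this t

/-- Deconcatenation is multiplicative for the shuffle product; graded commutativity then allows the
exchange of the two middle factors, with the sign that `decon_shuffle` provides. -/
lemma adamsTwo_shuffle (u v : List I) : adamsTwo deg (ш u v) =
    Ш (adamsTwo deg (Ξ u)) (adamsTwo deg (Ξ v)) := by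
  rw [adamsTwo_word, adamsTwo_word, adamsTwo, comp_apply, decon_shuffle, map_cutSum,
    map_shuffleMul_cutSum_left]
  refine cutSum_congr fun u₁ u₂ _ => ?_
  rw [map_cutSum, map_cutSum]
  refine cutSum_congr fun v₁ v₂ _ => ?_
  rw [map_smul, TensorProduct.lift.tmul]
  simp only [← shuffleMul_word]
  rw [shuffleMul_assoc, shuffleMul_assoc, ← shuffleMul_assoc (Ξ v₁), ← shuffleMul_assoc (Ξ u₂),
    word_shuffleMul_comm u₂, par_word]
  simp only [map_smul, smul_apply]

lemma adamsTwo_shuffleMul (s t : Λ) : adamsTwo deg (Ш s t) =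
    Ш (adamsTwo deg s) (adamsTwo deg t) := by
  induction s using word_induction with
  | h0 => simp
  | hadd a b ha hb => simp only [map_add, add_apply, ha, hb]
  | hw c u =>
    induction t using word_induction with
    | h0 => simp
    | hadd a b ha hb => simp only [map_add, ha, hb]
    | hw d v => simp only [map_smul, smul_apply, shuffleMul_word, adamsTwo_shuffle u v]

/-- A coderivation passes through the coproduct and a derivation through the product, here by the
same rule on tensors. -/
lemma IsCoder.commute_adamsTwo {c : ℤ} {D : Θ} (hD : IsCoder deg c D)
    (hs : IsShuffleDer deg c D) : Commute D (adamsTwo deg) := by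
  have h1 : ∀ x : Λ ⊗[F] Λ, D (lift Ш x) = lift Ш (map D 1 x + map (par deg c) D x) := by
    intro x
    induction x with
    | zero => simp
    | tmul s t => simp [hs.apply_par]
    | add a b ha hb => rw [map_add, map_add, ha, hb]; simp only [map_add]; abel
  refine LinearMap.ext fun t => ?_
  rw [End.mul_apply, End.mul_apply, adamsTwo, comp_apply, comp_apply, h1, hD.decon_apply]

/-- Of the cuts of a nonempty word only the two with an empty part survive. -/
lemma KillsShuffles.apply_adamsTwo {M : Type*} [AddCommGroup M] [Module F M]
    {f : Λ →ₗ[F] M} (hf : KillsShuffles deg f) {t : Λ}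
    (ht : ε t = 0) : f (adamsTwo deg t) = (2 : F) • f t := by
  have : ∀ t, f (adamsTwo deg t) = (2 : F) • f t - ε t • f 1 := by
    intro t
    induction t using word_induction with
    | h0 => simp
    | hadd a b ha hb => simp only [map_add, ha, hb]; module
    | hw c w =>
      rw [map_smul, map_smul, map_smul, map_smul, adamsTwo_word, map_cutSum]
      rcases w with _ | ⟨x, w⟩
      · simp only [cutSum_nil, shuffle_nil_left, word_nil, emptyCoeff_one, smul_eq_mul]; module
      · rw [cutSum_cons, shuffle_nil_left, emptyCoeff_cons]
        rcases List.eq_nil_or_concat' w with rfl | ⟨w, y, rfl⟩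
        · rw [cutSum_nil, shuffle_nil_right]; module
        · rw [cutSum_append_singleton, cutSum_eq_zero, shuffle_nil_right]
          · module
          · intro u v _
            exact hf _ _ (by simp) (by simp)
  rw [this, ht, zero_smul, sub_zero]

variable (F deg) in
/-- The powers of the augmentation ideal of the shuffle algebra. -/
def shufflePower : ℕ → Submodule F Λ
  | 0 => ker ε
  | k + 1 => Submodule.map₂ Ш (shufflePower k) (ker ε)

lemma adamsTwo_sub_mem_shufflePower_one {t : Λ} (ht : ε t = 0) :
    adamsTwo deg t - (2 : F) • t ∈ shufflePower F deg 1 := by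
  have hk : KillsShuffles deg (shufflePower F deg 1).mkQ := fun u v hu hv => by
    rw [mkQ_apply, Submodule.Quotient.mk_eq_zero, ← shuffleMul_word]
    exact Submodule.apply_mem_map₂ _ (emptyCoeff_of_ne hu) (emptyCoeff_of_ne hv)
  rw [← Submodule.Quotient.mk_eq_zero, ← mkQ_apply, map_sub, map_smul, hk.apply_adamsTwo ht,
    sub_self]

/-- The index is shifted: `shufflePower F deg k` is the power `k + 1` of the augmentation ideal.
Since the Adams operation is multiplicative and acts as `2` modulo products, it acts as `2 ^ (k +
1)` on this power modulo the next. -/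
lemma adamsTwo_sub_mem_shufflePower {k : ℕ} {t : Λ} (ht : t ∈ shufflePower F deg k) :
    adamsTwo deg t - (2 : F) ^ (k + 1) • t ∈ shufflePower F deg (k + 1) := by
  induction k generalizing t with
  | zero => simpa using adamsTwo_sub_mem_shufflePower_one ht
  | succ k ih =>
    have key : shufflePower F deg (k + 1) ≤ (shufflePower F deg (k + 2)).comap
        (adamsTwo deg - (2 : F) ^ (k + 2) • (1 : Θ)) := by
      rw [shufflePower, Submodule.map₂_le]
      intro s hs t ht
      rw [mem_comap]
      have h2 : ∀ p ∈ shufflePower F deg 1, Ш s p ∈ shufflePower F deg (k + 2) := by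
        have : shufflePower F deg 1 ≤ (shufflePower F deg (k + 2)).comap (Ш s) := by
          rw [shufflePower, Submodule.map₂_le]
          intro a ha b hb
          rw [mem_comap, ← shuffleMul_assoc]
          exact Submodule.apply_mem_map₂ _ (Submodule.apply_mem_map₂ _ hs ha) hb
        exact this
      have : (adamsTwo deg - (2 : F) ^ (k + 2) • 1 : Θ) (Ш s t) =
          Ш (adamsTwo deg s - (2 : F) ^ (k + 1) • s) (adamsTwo deg t) +
            (2 : F) ^ (k + 1) • Ш s (adamsTwo deg t - (2 : F) • t) := by
        simp only [sub_apply, smul_apply, End.one_apply, adamsTwo_shuffleMul, map_sub, map_smul]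
        module
      rw [this]
      refine add_mem (Submodule.apply_mem_map₂ _ (ih hs) ?_)
        (Submodule.smul_mem _ _ (h2 _ (adamsTwo_sub_mem_shufflePower_one ht)))
      rw [mem_ker, emptyCoeff_adamsTwo]
      exact ht
    exact key ht

/-- The span of the words of length at least `n`. -/
def lenGE (F I : Type*) [Field F] (n : ℕ) : Submodule F Λ :=
  span F (Ξ '' {w | n ≤ w.length})

lemma ker_emptyCoeff_le : ker ε ≤ lenGE F I 1 := by
  have : ∀ t, t - ε t • 1 ∈ lenGE F I 1 := by
    intro t
    induction t using word_induction with
    | h0 => simp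
    | hadd a b ha hb =>
      have := add_mem ha hb
      rwa [show a - ε a • 1 + (b - ε b • 1) = a + b - ε (a + b) • 1 by rw [map_add]; module] at this
    | hw c w =>
      rcases w with _ | ⟨x, w⟩
      · simp [word_nil]
      · rw [map_smul, emptyCoeff_cons, smul_zero, zero_smul, sub_zero]
        exact Submodule.smul_mem _ _ (subset_span ⟨_, by simp, rfl⟩)
  intro t ht
  have h := this t
  rwa [LinearMap.mem_ker.1 ht, zero_smul, sub_zero] at h

lemma shufflePower_le_lenGE (k : ℕ) : shufflePower F deg k ≤ lenGE F I (k + 1) := by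
  induction k with
  | zero => exact ker_emptyCoeff_le
  | succ k ih =>
    refine (Submodule.map₂_le_map₂ ih ker_emptyCoeff_le).trans ?_
    rw [lenGE, lenGE, Submodule.map₂_span_span, span_le]
    rintro _ ⟨_, ⟨u, hu, rfl⟩, _, ⟨v, hv, rfl⟩, rfl⟩
    have h := shuffle_mem_lenEq (F := F) (deg := deg) u v
    have hle : lenEq F I (u.length + v.length) ≤ lenGE F I (k + 1 + 1) :=
      lenEq_le_iff.2 fun w hw => subset_span ⟨w, by
        have h1 : k + 1 ≤ u.length := hu
        have h2 : 1 ≤ v.length := hv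
        show k + 1 + 1 ≤ w.length
        omega, rfl⟩
    simp only [SetLike.mem_coe, shuffleMul_word]
    exact hle h

lemma eq_zero_of_mem_lenGE {m n : ℕ} (h : m < n) {t : Λ} (ht : t ∈ lenEq F I m)
    (ht' : t ∈ lenGE F I n) : t = 0 := by
  have h1 : lenEq F I m ≤ ker (wordLift F fun w : List I =>
      if n ≤ w.length then Ξ w else 0) := lenEq_le_iff.2 fun w hw => by
    rw [mem_ker, wordLift_word, if_neg (by omega)]
  have h2 : lenGE F I n ≤ ker (wordLift F (fun w : List I =>
      if n ≤ w.length then Ξ w else 0) - LinearMap.id) := by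
    rw [lenGE, span_le]
    rintro _ ⟨w, hw, rfl⟩
    have hw' : n ≤ w.length := hw
    rw [SetLike.mem_coe, mem_ker, sub_apply, wordLift_word, if_pos hw', id_apply, sub_self]
  have h3 := h2 ht'
  rw [mem_ker, sub_apply, LinearMap.mem_ker.1 (h1 ht), id_apply, zero_sub, neg_eq_zero] at h3
  exact h3

variable (F deg) in
/-- A polynomial in the second Adams operation which, on words of length at most `n + 1`, is the
projection onto the eigenspace for the eigenvalue `2`: an Eulerian idempotent. -/
def eulerian : ℕ → Θ
  | 0 => 1
  | n + 1 => ((2 : F) - 2 ^ (n + 2))⁻¹ • ((adamsTwo deg - (2 : F) ^ (n + 2) • 1) * eulerian n)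

lemma eulerian_mem {S : Submodule F Λ} (h : ∀ t ∈ S, adamsTwo deg t ∈ S) (n : ℕ)
    {t : Λ} (ht : t ∈ S) : eulerian F deg n t ∈ S := by
  induction n with
  | zero => exact ht
  | succ n ih =>
    rw [eulerian, smul_apply, End.mul_apply, sub_apply, smul_apply, End.one_apply]
    exact Submodule.smul_mem _ _ (sub_mem (h _ ih) (Submodule.smul_mem _ _ ih))

lemma commute_eulerian {D : Θ} (h : Commute D (adamsTwo deg)) (n : ℕ) :
    Commute D (eulerian F deg n) := by
  induction n with
  | zero => exact Commute.one_right D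
  | succ n ih =>
    exact Commute.smul_right ((h.sub_right ((Commute.one_right D).smul_right _)).mul_right ih) _

lemma commute_par_eulerian (c : ℤ) (n : ℕ) : Commute (par deg c) (eulerian F deg n) := by
  refine commute_eulerian ?_ n
  have := (homDeg_adamsTwo (F := F) (deg := deg)).par_mul deg c
  rwa [mul_zero, sgn_zero, one_smul] at this

lemma homDeg_eulerian (n : ℕ) : HomDeg deg 0 (eulerian F deg n) := by
  induction n with
  | zero => exact homDeg_one deg
  | succ n ih =>
    have h := (homDeg_adamsTwo (F := F) (deg := deg)).sub deg
      ((homDeg_one deg).smul deg ((2 : F) ^ (n + 2)))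
    have h' := (h.mul deg ih).smul deg ((2 : F) - 2 ^ (n + 2))⁻¹
    rwa [add_zero] at h'

/-- Under `f` the Adams operation becomes multiplication by `2`, and each factor of the idempotent
is scaled to be `1` at this eigenvalue. Characteristic zero keeps the scaling factors finite. -/
lemma KillsShuffles.apply_eulerian [CharZero F] {M : Type*} [AddCommGroup M] [Module F M]
    {f : Λ →ₗ[F] M} (hf : KillsShuffles deg f) {t : Λ}
    (ht : ε t = 0) (n : ℕ) : f (eulerian F deg n t) = f t := by
  induction n with
  | zero => rfl
  | succ n ih =>
    have h0 : ε (eulerian F deg n t) = 0 := eulerian_mem (S := ker ε)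
        (fun t ht => by rw [mem_ker, emptyCoeff_adamsTwo]; exact ht) n ht
    have hne : (2 : F) - 2 ^ (n + 2) ≠ 0 := by
      rw [sub_ne_zero]
      intro h
      have h' : (2 : ℕ) ^ 1 = 2 ^ (n + 2) := by
        have : ((2 ^ 1 : ℕ) : F) = ((2 ^ (n + 2) : ℕ) : F) := by push_cast; simpa using h
        exact Nat.cast_injective this
      have := Nat.pow_right_injective le_rfl h'
      omega
    rw [eulerian, smul_apply, End.mul_apply, sub_apply, smul_apply, End.one_apply, map_smul,
      map_sub, map_smul,
      hf.apply_adamsTwo h0, ← sub_smul, ih, smul_smul, inv_mul_cancel₀ hne, one_smul]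

lemma eulerian_mem_shufflePower (n : ℕ) {t : Λ} (ht : t ∈ shufflePower F deg 1) :
    eulerian F deg n t ∈ shufflePower F deg (n + 1) := by
  induction n with
  | zero => exact ht
  | succ n ih =>
    rw [eulerian, smul_apply, End.mul_apply, sub_apply, smul_apply, End.one_apply]
    exact Submodule.smul_mem _ _ (adamsTwo_sub_mem_shufflePower ih)

/-- The factors for the eigenvalues `2 ^ 2, …, 2 ^ (n + 1)` push products into the power `n + 2` of
the augmentation ideal. This consists of elements of length at least `n + 2`, while the idempotent
preserves length. -/
lemma eulerian_shuffle {u v : List I} (hu : u ≠ []) (hv : v ≠ []) {n : ℕ}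
    (hn : u.length + v.length ≤ n + 1) : eulerian F deg n (ш u v) = 0 := by
  refine eq_zero_of_mem_lenGE (m := u.length + v.length) (n := n + 2) (by omega)
    (eulerian_mem (fun t => adamsTwo_mem_lenEq) n (shuffle_mem_lenEq u v))
    (shufflePower_le_lenGE (n + 1) (eulerian_mem_shufflePower n ?_))
  rw [← shuffleMul_word]
  exact Submodule.apply_mem_map₂ _ (emptyCoeff_of_ne hu) (emptyCoeff_of_ne hv)

end Adams

/-! ### Compatibility of the Hochschild differential with Eulerian idempotents -/

section Peel

variable {F I : Type*} [Field F] (deg : I → ℤ)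

open Classical in
/-- The binary cochain `x y ↦ y`, `y x ↦ ∓ y`. -/
def peelCochain (F : Type*) [Field F] {I : Type*} (deg : I → ℤ) (x : I) :
    Θ :=
  wordLift F fun w => match w with
    | [a, b] => (if a = x then Ξ [b] else 0) - sgn F (deg x * deg a) • (if b = x then Ξ [a] else 0)
    | _ => 0

open Classical in
lemma peelCochain_pair (x a b : I) : peelCochain F deg x (Ξ [a, b]) = (if a = x then Ξ [b] else 0) -
      sgn F (deg x * deg a) • (if b = x then Ξ [a] else 0) := by
  simp [peelCochain]

variable {deg}

lemma isCochain_peelCochain (x : I) : IsCochain deg 2 (-deg x) (peelCochain F deg x) where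
  letter := by
    apply word_hom_ext; intro w
    match w with
    | [] => simp [peelCochain]
    | [a] => simp [peelCochain]
    | [a, b] =>
      rw [End.mul_apply, peelCochain_pair]
      split_ifs <;> simp
    | a :: b :: c :: w => simp [peelCochain]
  length w hw := by
    match w with
    | [] => simp [peelCochain]
    | [a] => simp [peelCochain]
    | [a, b] => simp at hw
    | a :: b :: c :: w => simp [peelCochain]
  homDeg := by
    intro z
    apply word_hom_ext; intro w
    match w with
    | [] => simp [peelCochain]
    | [a] => simp [peelCochain]
    | [a, b] =>
      rw [smul_apply, End.mul_apply, End.mul_apply, scale_word, map_smul, peelCochain_pair,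
        smul_smul, ← Units.val_mul, ← zpow_add]
      split_ifs with h1 h2 h2
      · subst h1
        rw [h2, map_sub, map_smul, scale_word, wordDeg_cons, wordDeg_cons, neg_add_cancel_left,
          wordDeg_cons]
        module
      · subst h1; simp
      · subst h2
        rw [map_sub, map_smul, scale_word, wordDeg_cons, wordDeg_cons, wordDeg_cons, wordDeg_nil,
          add_zero, add_zero, add_comm (deg a), neg_add_cancel_left, map_zero]
        module
      · simp
    | a :: b :: c :: w => simp [peelCochain]

open Classical in
lemma killsShuffles_peelCochain (x : I) : KillsShuffles deg (peelCochain F deg x) := by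
  intro u v hu hv
  by_cases h : u.length + v.length = 2
  · match u, v with
    | [a], [b] =>
      have : ш [a] [b] = Ξ [a, b] + sgn F (deg b * deg a) • Ξ [b, a] := by
        rw [shuffle_cons_cons]; simp
      rw [this, map_add, map_smul, peelCochain_pair, peelCochain_pair]
      have hp : (sgn F (deg b * deg a) * sgn F (deg x * deg b)) •
          (if a = x then Ξ [b] else 0) = if a = x then Ξ [b] else 0 := by
        split_ifs with h
        · rw [h, mul_comm (deg x), sgn_mul_self, one_smul]
        · rw [smul_zero]
      have hq : sgn F (deg b * deg a) • (if b = x then Ξ [a] else 0) =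
          sgn F (deg x * deg a) • (if b = x then Ξ [a] else 0) := by
        split_ifs with h
        · rw [h]
        · simp
      rw [smul_sub, smul_smul, hp, hq]
      abel
    | [], _ => exact absurd rfl hu
    | _, [] => exact absurd rfl hv
    | a :: b :: u, c :: v => simp at h; omega
    | a :: u, b :: c :: v => simp at h; omega
  · exact (isCochain_peelCochain x).eq_zero_of_mem_lenEq h (shuffle_mem_lenEq u v)

-- The contributions of neighbouring positions telescope: there remains the removal of a first
-- letter `x` minus the removal of a last letter `x`. Since the cochain is Harrison, the operator
-- commutes with the Eulerian idempotents.
open Classical in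
lemma coder_peelCochain (x a y : I) (w v : List I) (h : a :: w = v ++ [y]) :
    κ (-deg x) (peelCochain F deg x) (Ξ (a :: w)) = (if a = x then Ξ w else 0) -
        sgn F (deg x * η v) • (if y = x then Ξ v else 0) := by
  have hlen := (isCochain_peelCochain (F := F) (deg := deg) x).length
  induction w generalizing a v with
  | nil =>
    obtain ⟨rfl, rfl⟩ : v = [] ∧ a = y := by
      cases v with
      | nil => simpa using h
      | cons b v => simp at h
    rw [coder_cons, word_nil, coder_one, mul_zero, smul_zero, add_zero, conv_word, cutSum_eq_zero]
    · simp
    · intro s t hst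
      rw [hlen s, zero_mul]
      have := congrArg List.length hst
      simp at this; omega
  | cons b w ih =>
    obtain ⟨v, rfl⟩ : ∃ v', v = a :: v' := by
      cases v with
      | nil => simp at h
      | cons c v => simp at h; exact ⟨v, by rw [h.1]⟩
    have hconv : conv (peelCochain F deg x) 1 (Ξ (a :: b :: w)) =
        peelCochain F deg x (Ξ [a, b]) * Ξ w := by
      have h1 : peelCochain F deg x * consL F a * consL F b * 1 = peelCochain F deg x * consL F a *
        consL F b := mul_one _
      rw [conv_cons, conv_cons, ← word_nil, hlen [] (by simp), zero_mul, zero_add, End.mul_apply,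
        consL_word, hlen [a] (by simp), zero_mul, zero_add, conv_word]
      cases w with
      | nil => simp
      | cons c w =>
        rw [cutSum_cons, cutSum_eq_zero]
        · simp
        · intro s t _
          simp [hlen]
    rw [coder_cons, ih b v (by simpa using h), hconv, peelCochain_pair]
    have e1 : (if b = x then Ξ [a] else 0) * Ξ w =
        Ξ [a] * (if b = x then Ξ w else 0) := by split_ifs <;> simp
    have e2 : (if a = x then Ξ [b] else 0) * Ξ w =
        if a = x then Ξ (b :: w) else 0 := by split_ifs <;> simp [word_mul_word]
    have e3 : Ξ [a] * (if y = x then Ξ v else 0) =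
        if y = x then Ξ (a :: v) else 0 := by split_ifs <;> simp [word_mul_word]
    rw [sub_mul, smul_mul_assoc, e1, e2, mul_sub, mul_smul_comm, e3, smul_sub, smul_smul, ← sgn_add,
      wordDeg_cons, mul_add,
      show sgn F (-deg x * deg a) = sgn F (deg x * deg a) from
        sgn_congr (by rw [neg_mul, even_neg]),
      show sgn F (-deg x * deg a + deg x * η v) = sgn F (deg x * deg a + deg x * η v) from
        sgn_congr (by rw [neg_mul, Int.even_add, Int.even_add, even_neg])]
    abel

/-- The Hochschild differential in terms of the operators removing the first or last letter. -/
lemma IsUnitalProduct.mul_coder [CharZero F] [Fintype I] {β c : Θ} {o : I}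
    (hβ : IsUnitalProduct deg β o) {r : ℕ} {e : ℤ} (hc : IsCochain deg r e c) (hr : 0 < r) :
    β * κ e c = ∑ x, (-sgn F (deg x * deg x)) •
      ((β ∘ₗ mulRight F (Ξ [x])) * c * κ (-deg x) (peelCochain F deg x) * par deg (deg x)) := by
  classical
  apply word_hom_ext; intro w
  rw [sum_apply]
  simp only [smul_apply, End.mul_apply, comp_apply, mulRight_apply, par_word, map_smul]
  by_cases hw : w.length = r + 1
  · obtain ⟨v, y, hv⟩ : ∃ v y, w = v ++ [y] := by
      rcases List.eq_nil_or_concat' w with rfl | ⟨v, y, rfl⟩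
      · simp at hw
      · exact ⟨v, y, rfl⟩
    obtain ⟨a, u, ha⟩ : ∃ a u, w = a :: u := List.exists_cons_of_ne_nil (by rintro rfl; simp at hw)
    have hterm : ∀ x, β (c (κ (-deg x) (peelCochain F deg x) (Ξ w)) * Ξ [x]) =
        (if a = x then β (c (Ξ u) * Ξ [a]) else 0) -
          sgn F (deg y * η v) • (if y = x then β (c (Ξ v) * Ξ [y]) else 0) := by
      intro x
      rw [ha, coder_peelCochain x a y u v (ha.symm.trans hv), map_sub, map_smul, sub_mul, map_sub,
        smul_mul_assoc, map_smul]
      congr 1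
      · split_ifs with h
        · rw [h]
        · simp
      · split_ifs with h
        · rw [h]
        · simp
    have hL : β (κ e c (Ξ w)) = β (c (Ξ v) * Ξ [y]) + sgn F (e * deg a) • β (Ξ [a] * c (Ξ u)) := by
      have h := hβ.hochschild_cons hc hr a u
      rw [hochschild, sub_apply, smul_apply, End.mul_apply, End.mul_apply, sub_left_inj, ← ha] at h
      rw [h, hv, conv_letterProj_concat]
    -- Commutativity of the product moves the first letter to the right, so that both outer terms of
    -- the differential have the form of a value multiplied by a removed letter.
    have hcomm : β (Ξ [a] * c (Ξ u)) = -sgn F (deg a * (η u + e)) • β (c (Ξ u) * Ξ [a]) := by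
      have hmem := mem_lettersOfDeg hc.letter hc.homDeg u
      generalize c (Ξ u) = b at hmem ⊢
      induction hmem using span_induction with
      | mem _ h =>
        obtain ⟨z, hz, rfl⟩ := h
        have hk := hβ.kills [a] [z] (by simp) (by simp)
        rw [shuffle_cons_cons] at hk
        simp only [shuffle_nil_left, shuffle_nil_right, map_add, map_smul, consL_word, wordDeg_cons,
          wordDeg_nil, add_zero] at hk
        rw [word_mul_word, word_mul_word, List.singleton_append, List.singleton_append,
          eq_neg_of_add_eq_zero_left hk, neg_smul, hz, mul_comm]
      | zero => simp
      | add s t _ _ hs ht => rw [mul_add, map_add, hs, ht, add_mul, map_add, smul_add]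
      | smul b t _ ht => rw [mul_smul_comm, map_smul, ht, smul_mul_assoc, map_smul, smul_comm]
    simp only [hterm, smul_sub, sum_sub_distrib, smul_ite, smul_zero, Finset.sum_ite_eq,
      Finset.mem_univ, if_true]
    rw [hL, hcomm, smul_smul, smul_smul, smul_smul, smul_smul, add_comm, sub_eq_add_neg, ← neg_smul]
    have h1 : η w = deg a + η u := by rw [ha, wordDeg_cons]
    have h2 : η w = η v + deg y := by rw [hv]; simp
    congr 1
    · congr 1
      rw [h1, mul_neg, neg_mul, ← sgn_add, ← sgn_add, neg_inj]
      apply sgn_congr; simp only [Int.even_add, Int.even_mul]; grind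
    · rw [h2, neg_mul, neg_mul, neg_neg, ← sgn_add, ← sgn_add, sgn_even, one_smul]
      simp only [Int.even_add, Int.even_mul]; grind
  · have h0 : β (κ e c (Ξ w)) = 0 := by
      rcases Nat.lt_or_ge w.length r with h | h
      · rw [hc.coder_eq_zero h, map_zero]
      · exact hβ.isCochain.eq_zero_of_mem_lenEq (n := w.length + 1 - r) (by omega)
          (hc.coder_mem_lenEq w _ (by omega))
    rw [h0]
    symm
    refine sum_eq_zero fun x _ => ?_
    have h1 : c (κ (-deg x) (peelCochain F deg x) (Ξ w)) = 0 := by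
      rcases Nat.eq_zero_or_pos w.length with h | h
      · rw [List.length_eq_zero_iff.1 h, word_nil, coder_one, map_zero]
      · exact hc.eq_zero_of_mem_lenEq (n := w.length - 1) (by omega)
          ((isCochain_peelCochain x).coder_mem_lenEq w _ (by omega))
    rw [h1, zero_mul, map_zero, smul_zero, smul_zero]

lemma IsCochain.mul_eulerian {c : Θ} {r : ℕ} {e : ℤ}
    (hc : IsCochain deg r e c) (n : ℕ) : IsCochain deg r e (c * eulerian F deg n) where
  letter := by rw [← mul_assoc, hc.letter]
  length w hw := hc.eq_zero_of_mem_lenEq hw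
    (eulerian_mem (fun t => adamsTwo_mem_lenEq) n (word_mem_lenEq rfl))
  homDeg := by simpa using hc.homDeg.mul deg (homDeg_eulerian n)

/-- The Hochschild differential is compatible with the Eulerian idempotents. -/
lemma IsUnitalProduct.hochschild_mul_eulerian [CharZero F] [Fintype I] {β c : Θ} {o : I}
    (hβ : IsUnitalProduct deg β o) {r : ℕ} {e : ℤ} (hc : IsCochain deg r e c) (hr : 0 < r) (n : ℕ) :
    𝒹 e (c * eulerian F deg n) = 𝒹 e c * eulerian F deg n := by
  -- The inner terms of the differential, and by `IsUnitalProduct.mul_coder` also the outer ones,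
  -- are compositions with coderivations of binary Harrison cochains.
  have hcomm : ∀ {d : ℤ} {g : Θ}, IsCochain deg 2 d g →
      KillsShuffles deg g → Commute (κ d g) (eulerian F deg n) := fun hg hk => by
    refine commute_eulerian ((hg.isCoder two_pos).commute_adamsTwo
      ((hg.isCoder two_pos).isShuffleDer hg.homDeg_coder ?_)) n
    rwa [hg.letterProj_coder two_pos]
  rw [hochschild, hochschild, sub_mul, smul_mul_assoc, mul_assoc c, mul_assoc c,
    (hcomm hβ.isCochain hβ.kills).eq, hβ.mul_coder hc hr, hβ.mul_coder (hc.mul_eulerian n) hr,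
    Finset.sum_mul]
  congr 1
  refine sum_congr rfl fun x _ => ?_
  rw [smul_mul_assoc]
  simp only [mul_assoc]
  rw [(commute_par_eulerian (deg x) n).eq, ← mul_assoc (eulerian F deg n),
    ← (hcomm (isCochain_peelCochain x) (killsShuffles_peelCochain x)).eq, mul_assoc]

/-- The span of the words that contain the letter `o`. -/
def wordsWith (F : Type*) [Field F] {I : Type*} (o : I) : Submodule F Λ :=
  span F (Ξ '' {w | o ∈ w})

lemma wordsWith_le_iff {o : I} {S : Submodule F Λ} :
    wordsWith F o ≤ S ↔ ∀ p s : List I, Ξ (p ++ o :: s) ∈ S := by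
  rw [wordsWith, span_le]
  constructor
  · exact fun h p s => h ⟨_, by simp, rfl⟩
  · rintro h _ ⟨w, hw, rfl⟩
    obtain ⟨p, s, rfl⟩ := List.append_of_mem hw
    exact h p s

lemma shuffle_mem_wordsWith {o : I} {u v : List I} (h : o ∈ u ∨ o ∈ v) : ш u v ∈ wordsWith F o := by
  have hw : ∀ {w : List I}, o ∈ w → Ξ w ∈ wordsWith F o := fun h => subset_span ⟨_, h, rfl⟩
  have hcons : ∀ (x : I) {t : Λ}, t ∈ wordsWith F o → consL F x t ∈ wordsWith F o := by
    intro x t ht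
    have : wordsWith F o ≤ (wordsWith F o).comap (consL F x) := wordsWith_le_iff.2 fun p s => by
      rw [mem_comap, consL_word]; exact hw (by simp)
    exact this ht
  have hhead : ∀ (t : Λ), consL F o t ∈ wordsWith F o := by
    intro t
    induction t using word_induction with
    | h0 => simp
    | hadd a b ha hb => rw [map_add]; exact add_mem ha hb
    | hw c w => rw [map_smul, consL_word]; exact Submodule.smul_mem _ _ (hw (by simp))
  fun_induction ш u v with
  | case1 v => exact hw (by simpa using h)
  | case2 x u => exact hw (by simpa using h)
  | case3 x u y v ih1 ih2 =>
    refine add_mem ?_ (Submodule.smul_mem _ _ ?_)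
    · by_cases hx : x = o
      · rw [hx]; exact hhead _
      · refine hcons x (ih1 ?_)
        rcases h with h | h
        · exact Or.inl ((List.mem_cons.1 h).resolve_left (Ne.symm hx))
        · exact Or.inr h
    · by_cases hy : y = o
      · rw [hy]; exact hhead _
      · refine hcons y (ih2 ?_)
        rcases h with h | h
        · exact Or.inl h
        · exact Or.inr ((List.mem_cons.1 h).resolve_left (Ne.symm hy))

lemma adamsTwo_mem_wordsWith {o : I} {t : Λ} (ht : t ∈ wordsWith F o) :
    adamsTwo deg t ∈ wordsWith F o := by
  have : wordsWith F o ≤ (wordsWith F o).comap (adamsTwo deg) := wordsWith_le_iff.2 fun p s => by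
    rw [mem_comap, adamsTwo_word]
    refine cutSum_mem fun u v huv => shuffle_mem_wordsWith ?_
    have : o ∈ u ++ v := by rw [huv]; simp
    simpa using this
  exact this ht

/-- A Harrison cochain with normalized differential is cohomologous to a normalized one. -/
lemma IsUnitalProduct.exists_harrison_normalized [CharZero F] [Fintype I]
    {β f : Θ} {o : I} (hβ : IsUnitalProduct deg β o) {r : ℕ}
    (hf : IsCochain deg (r + 1) 0 f) (hk : KillsShuffles deg f) (hr : 0 < r)
    (hδ : ∀ t ∈ wordsWith F o, 𝒹 0 f t = 0) :
    ∃ c, IsCochain deg r (-1) c ∧ KillsShuffles deg c ∧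
      ∀ t ∈ wordsWith F o, (f - 𝒹 (-1) c) t = 0 := by
  obtain ⟨c, hc, hn⟩ := hβ.exists_normalized hf hr fun p s => hδ _ (subset_span ⟨_, by simp, rfl⟩)
  -- Composition with the idempotent makes the normalizing cochain Harrison. It commutes with the
  -- differential, does not change the Harrison cochain `f` on elements without constant term, and
  -- preserves the words that contain the unit.
  refine ⟨c * eulerian F deg r, hc.mul_eulerian r, fun u v hu hv => ?_, ?_⟩
  · rw [End.mul_apply]
    by_cases h : u.length + v.length = r
    · rw [eulerian_shuffle hu hv (by omega), map_zero]
    · exact hc.eq_zero_of_mem_lenEq h (eulerian_mem (fun t => adamsTwo_mem_lenEq) r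
        (shuffle_mem_lenEq u v))
  · intro t ht
    have h0 : ∀ t ∈ wordsWith F o, ε t = 0 := by
      have : wordsWith F o ≤ ker ε := wordsWith_le_iff.2 fun p s => emptyCoeff_of_ne (by simp)
      exact fun t ht => this ht
    have h1 : ∀ t ∈ wordsWith F o, (f - 𝒹 (-1) c) t = 0 := by
      have : wordsWith F o ≤ ker (f - 𝒹 (-1) c) := wordsWith_le_iff.2 hn
      exact fun t ht => this ht
    have h2 := h1 _ (eulerian_mem (deg := deg) (fun t => adamsTwo_mem_wordsWith) r ht)
    rw [hβ.hochschild_mul_eulerian hc hr, sub_apply, ← hk.apply_eulerian (h0 t ht) r]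
    exact h2

end Peel

/-! ### The adjoint of the Dynkin operator -/

section Dynkin

variable {F I : Type*} [Field F] {deg : I → ℤ}

/-- The recursion of the shuffle product with respect to the last letters. -/
lemma shuffle_concat_concat (u v : List I) (x y : I) :
    ш (u ++ [x]) (v ++ [y]) = ш (u ++ [x]) v * Ξ [y] +
      sgn F (deg x * (η v + deg y)) • (ш u (v ++ [y]) * Ξ [x]) := by
  induction h : u.length + v.length using Nat.strong_induction_on generalizing u v with
  | _ n ih =>
  match u, v with
  | [], [] => simp [shuffle_cons_cons, word_mul_word, mul_comm]
  | a :: u, [] =>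
    have i1 := ih _ (by simp at h ⊢; omega) u [] rfl
    simp only [List.nil_append, shuffle_nil_right, wordDeg_nil, zero_add, List.cons_append] at i1 ⊢
    rw [shuffle_cons_cons, i1, shuffle_cons_cons]
    simp only [shuffle_nil_right, map_add, map_smul, consL_apply, add_mul, mul_add, smul_mul_assoc,
      smul_add, wordDeg_cons, wordDeg_append, wordDeg_nil, sgn_add, word_mul_word,
      mul_assoc, List.cons_append, List.nil_append, add_zero]
    rw [mul_comm (deg y) (deg x)]
    module
  | [], b :: v =>
    have i1 := ih _ (by simp at h ⊢; omega) [] v rfl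
    simp only [List.nil_append, shuffle_nil_left, List.cons_append] at i1 ⊢
    rw [shuffle_cons_cons, i1, shuffle_cons_cons]
    simp only [shuffle_nil_left, map_add, map_smul, consL_apply, add_mul, mul_add, smul_mul_assoc,
      smul_add, wordDeg_cons, wordDeg_nil, sgn_add, word_mul_word,
      mul_assoc, List.cons_append, List.nil_append, add_zero]
    rw [mul_comm (deg b) (deg x)]
    module
  | a :: u, b :: v =>
    have i1 := ih _ (by simp at h ⊢; omega) u (b :: v) rfl
    have i2 := ih _ (by simp at h ⊢; omega) (a :: u) v rfl
    simp only [List.cons_append] at i1 i2 ⊢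
    rw [shuffle_cons_cons, i1, i2, shuffle_cons_cons deg a b (u ++ [x]) v,
      shuffle_cons_cons deg a b u (v ++ [y])]
    simp only [map_add, map_smul, consL_apply, add_mul, mul_add, smul_mul_assoc, smul_add,
      wordDeg_cons, wordDeg_append, wordDeg_nil, sgn_add, mul_assoc, add_zero]
    rw [mul_comm (deg b) (deg x)]
    module

lemma shuffleMul_concat_concat (t : Λ) (v : List I) (x y : I) : Ш (t * Ξ [x]) (Ξ (v ++ [y])) =
      Ш (t * Ξ [x]) (Ξ v) * Ξ [y] +
      sgn F (deg x * (η v + deg y)) • (Ш t (Ξ (v ++ [y])) * Ξ [x]) := by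
  induction t using word_induction with
  | h0 => simp
  | hadd a b ha hb => simp only [add_mul, map_add, add_apply, ha, hb, smul_add]; abel
  | hw c u =>
    simp only [smul_mul_assoc, map_smul, smul_apply, word_mul_word, shuffleMul_word,
      shuffle_concat_concat, smul_add]
    rw [smul_comm c]

/-- The antipode of the shuffle algebra on words. -/
def antipodeAux (F : Type*) [Field F] {I : Type*} (deg : I → ℤ) :
    List I → Λ
  | [] => 1
  | a :: u => -(sgn F (deg a * η u) • (antipodeAux F deg u * Ξ [a]))

/-- The convolution `∑ φ(|v|) S(u) ⧢ v`, over all decompositions `w = u v`, of the antipode with a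
function of the length. -/
def antipodeConv (deg : I → ℤ) (φ : ℕ → F) (w : List I) : Λ :=
  cutSum (fun u v => φ v.length • Ш (antipodeAux F deg u) (Ξ v)) w

/-- The antipode of a nonempty word that starts with `a` ends with `a`. Hence every term of the
convolution ends either with the first or with the last letter of the given word. -/
lemma antipodeConv_eq (φ : ℕ → F) {a y : I} {w v : List I} (h : a :: w = v ++ [y]) :
    antipodeConv deg φ (a :: w) = antipodeConv deg (fun n => φ (n + 1)) v * Ξ [y] -
      sgn F (deg a * η w) • (antipodeConv deg φ w * Ξ [a]) := by
  cases v with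
  | nil =>
    obtain ⟨rfl, rfl⟩ : a = y ∧ w = [] := by simpa using h
    simp [antipodeConv, cutSum_cons, antipodeAux, word_nil]
    module
  | cons b v =>
    obtain ⟨rfl, rfl⟩ : a = b ∧ w = v ++ [y] := by simpa using h
    have key : ∀ u v' : List I, u ++ v' = v →
        φ (v' ++ [y]).length • Ш (antipodeAux F deg (a :: u)) (Ξ (v' ++ [y])) =
        φ (v'.length + 1) • (Ш (antipodeAux F deg (a :: u)) (Ξ v') *
          Ξ [y]) - sgn F (deg a * η (v ++ [y])) •
          ((φ (v' ++ [y]).length • Ш (antipodeAux F deg u) (Ξ (v' ++ [y]))) * Ξ [a]) := by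
      rintro u v' rfl
      rw [antipodeAux, ← neg_smul, map_smul, smul_apply, shuffleMul_concat_concat]
      simp only [wordDeg_append, wordDeg_cons, wordDeg_nil, mul_add, sgn_add, add_zero, smul_apply,
        List.length_append, List.length_singleton, smul_mul_assoc]
      module
    rw [antipodeConv, cutSum_cons, cutSum_append_singleton, cutSum_congr key]
    rw [antipodeConv, cutSum_cons, antipodeConv, cutSum_append_singleton]
    have hsub : ∀ (f g : List I → List I → Λ), cutSum (fun u v => f u v - g u v) v =
        cutSum f v - cutSum g v := fun f g => by simp [cutSum, sum_sub_distrib]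
    have hmul : ∀ (f : List I → List I → Λ) (t : Λ),
        cutSum f v * t = cutSum (fun u v => f u v * t) v := fun f t => by
      simp [cutSum, Finset.sum_mul]
    rw [hsub, cutSum_smul]
    simp only [add_mul, hmul, zero_add, antipodeAux, shuffleMul_one_left, word_nil, shuffleMul_one_right, smul_mul_assoc,
      List.length_append, List.length_cons, List.length_nil, word_mul_word, List.cons_append,
      smul_add]
    module

/-- The antipode axiom. In the recursion the two terms cancel for a single letter and vanish by
induction for longer words. -/
lemma antipodeConv_one {w : List I} (hw : w ≠ []) : antipodeConv (F := F) deg (fun _ => 1) w = 0 := by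
  induction h : w.length using Nat.strong_induction_on generalizing w with
  | _ n ih =>
  obtain ⟨a, u, rfl⟩ := List.exists_cons_of_ne_nil hw
  obtain ⟨v, y, hv⟩ : ∃ v y, a :: u = v ++ [y] := by
    rcases List.eq_nil_or_concat' (a :: u) with h | ⟨v, y, h⟩
    · simp at h
    · exact ⟨v, y, h⟩
  rw [antipodeConv_eq _ hv]
  have hlen := congrArg List.length hv
  simp only [List.length_cons, List.length_append, List.length_nil] at hlen h
  by_cases hu : u = []
  · subst hu
    obtain ⟨rfl, rfl⟩ : v = [] ∧ a = y := by
      cases v with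
      | nil => simpa using hv
      | cons b v => simp at hv
    simp [antipodeConv, antipodeAux, word_nil]
  · rw [ih _ (by omega) hu rfl, ih _ (by omega) (w := v) (by rintro rfl; simp at hlen; exact hu hlen)
      rfl]
    simp

/-- The adjoint of the Dynkin operator. -/
def dynkin (F : Type*) [Field F] {I : Type*} (deg : I → ℤ) :
    Θ :=
  wordLift F (antipodeConv deg fun n => (n : F))

lemma dynkin_word (w : List I) :
    dynkin F deg (Ξ w) = antipodeConv deg (fun n => (n : F)) w := by simp [dynkin]

lemma dynkin_one : dynkin F deg 1 = 0 := by rw [← word_nil, dynkin_word]; simp [antipodeConv]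

/-- Splitting off the last letter raises the weight `|v|` by one; the additional sum has constant
weight and vanishes by `antipodeConv_one`. -/
lemma dynkin_eq {a y : I} {w v : List I} (h : a :: w = v ++ [y]) (hw : w ≠ []) :
    dynkin F deg (Ξ (a :: w)) = dynkin F deg (Ξ v) * Ξ [y] -
      sgn F (deg a * η w) • (dynkin F deg (Ξ w) * Ξ [a]) := by
  have hv : v ≠ [] := by rintro rfl; simp at h; exact hw h.2
  rw [dynkin_word, antipodeConv_eq _ h, dynkin_word, dynkin_word]
  congr 2
  have := antipodeConv_one (F := F) (deg := deg) hv
  rw [antipodeConv] at this ⊢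
  rw [← add_zero (antipodeConv deg (fun n => (n : F)) v), ← this, antipodeConv, ← cutSum_add]
  refine cutSum_congr fun u v _ => ?_
  push_cast
  module

lemma dynkin_mem {S : Submodule F Λ} {w : List I}
    (h : ∀ u v, u ++ v = w → Ш (antipodeAux F deg u) (Ξ v) ∈ S) :
    dynkin F deg (Ξ w) ∈ S := by
  rw [dynkin_word]
  exact cutSum_mem fun u v huv => Submodule.smul_mem _ _ (h u v huv)

lemma antipodeAux_eq (w : List I) : ∃ c : F, antipodeAux F deg w = c • Ξ w.reverse := by
  induction w with
  | nil => exact ⟨1, by simp [antipodeAux, word_nil]⟩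
  | cons a u ih =>
    obtain ⟨c, hc⟩ := ih
    refine ⟨-(sgn F (deg a * η u) * c), ?_⟩
    rw [antipodeAux, hc, smul_mul_assoc, word_mul_word, smul_smul, neg_smul, List.reverse_cons]

lemma dynkin_mem_wordsWith {o : I} {w : List I} (h : o ∈ w) :
    dynkin F deg (Ξ w) ∈ wordsWith F o := by
  refine dynkin_mem fun u v huv => ?_
  obtain ⟨c, hc⟩ := antipodeAux_eq (F := F) (deg := deg) u
  rw [hc, map_smul, smul_apply, shuffleMul_word]
  refine Submodule.smul_mem _ _ (shuffle_mem_wordsWith ?_)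
  rw [List.mem_reverse, ← List.mem_append, huv]
  exact h

lemma homDeg_dynkin : HomDeg deg 0 (dynkin F deg) := by
  intro z
  apply word_hom_ext; intro w
  rw [zpow_zero, Units.val_one, one_smul, End.mul_apply, End.mul_apply, scale_word, map_smul,
    dynkin_word, antipodeConv, map_cutSum, ← cutSum_smul (F := F)]
  refine cutSum_congr fun u v huv => ?_
  obtain ⟨c, hc⟩ := antipodeAux_eq (F := F) (deg := deg) u
  have hrev : η u.reverse = η u := by simp [wordDeg]
  rw [hc, map_smul, map_smul, smul_apply, map_smul, shuffleMul_word, scale_shuffle, hrev,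
    ← wordDeg_append, huv]
  module

/-- Terms with two nonempty factors are shuffles up to a scalar and are killed. The cut with empty
second part has weight zero, the cut with empty first part has the length as weight. -/
lemma KillsShuffles.apply_dynkin {M : Type*} [AddCommGroup M] [Module F M]
    {f : Λ →ₗ[F] M} (hf : KillsShuffles deg f) (w : List I) :
    f (dynkin F deg (Ξ w)) = (w.length : F) • f (Ξ w) := by
  rw [dynkin_word, antipodeConv, map_cutSum]
  cases w with
  | nil => simp
  | cons a w =>
    rw [cutSum_cons, cutSum_eq_zero]
    · simp [antipodeAux]
    · intro u v _
      cases v with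
      | nil => simp
      | cons b v =>
        obtain ⟨c, hc⟩ := antipodeAux_eq (F := F) (deg := deg) (a :: u)
        rw [hc, map_smul, map_smul, smul_apply, shuffleMul_word, map_smul,
          hf _ _ (by simp) (by simp), smul_zero, smul_zero]

/-- The operator moving the first letter to the end after applying `dynkin` to the rest. -/
def dynkinRotate (F : Type*) [Field F] {I : Type*} (deg : I → ℤ) :
    Θ :=
  wordLift F fun w => match w with
    | [] => 0
    | a :: w => sgn F (deg a * η w) • (dynkin F deg (Ξ w) * Ξ [a])

lemma dynkinRotate_consL (a : I) (t : Λ) : dynkinRotate F deg (consL F a t) =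
    dynkin F deg (par deg (deg a) t) * Ξ [a] := by
  induction t using word_induction with
  | h0 => simp
  | hadd s t hs ht => simp only [map_add, add_mul, hs, ht]
  | hw c w => simp [dynkinRotate]

lemma conv_letterProj_mul_letter (c : Θ) (t : Λ) (y : I) : conv c ϖ (t * Ξ [y]) = c t * Ξ [y] := by
  induction t using word_induction with
  | h0 => simp
  | hadd s t hs ht => simp only [map_add, add_mul, hs, ht]
  | hw a w =>
    rw [smul_mul_assoc, map_smul, map_smul, smul_mul_assoc, word_mul_word,
      IsUnitalProduct.conv_letterProj_concat]

/-- The recursion `dynkin_eq` in a form that is linear in the argument and so applies to shuffles.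
-/
lemma dynkin_of_length_ge {n : ℕ} (hn : 2 ≤ n) {t : Λ} (ht : t ∈ lenEq F I n) :
    dynkin F deg t = conv (dynkin F deg) ϖ t - dynkinRotate F deg t := by
  have : lenEq F I n ≤ ker (dynkin F deg -
      (conv (dynkin F deg) ϖ - dynkinRotate F deg)) := lenEq_le_iff.2 fun w hw => by
    obtain ⟨a, u, rfl⟩ := List.exists_cons_of_ne_nil (by rintro rfl; simp at hw; omega : w ≠ [])
    obtain ⟨v, y, hv⟩ : ∃ v y, a :: u = v ++ [y] := by
      rcases List.eq_nil_or_concat' (a :: u) with h | ⟨v, y, h⟩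
      · simp at h
      · exact ⟨v, y, h⟩
    rw [mem_ker, sub_apply, sub_apply, dynkin_eq hv (by rintro rfl; simp at hw; omega),
      ← consL_word a u, dynkinRotate_consL,
      consL_word, hv, IsUnitalProduct.conv_letterProj_concat, par_word, map_smul, smul_mul_assoc,
      sub_self]
  have h := this ht
  rw [mem_ker, sub_apply, sub_eq_zero] at h
  exact h

/-- In `dynkin_of_length_ge`, one term strips last letters from the shuffle and the other strips
first letters. By induction only those terms survive in which one factor becomes empty, that is, was
a single letter; there first and last letter coincide and the contributions cancel. -/
lemma killsShuffles_dynkin : KillsShuffles deg (dynkin F deg) := by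
  intro u v hu hv
  induction h : u.length + v.length using Nat.strong_induction_on generalizing u v with
  | _ n ih =>
  have hu' := List.length_pos_iff.2 hu
  have hv' := List.length_pos_iff.2 hv
  have hz : ∀ u' v' : List I, u'.length + v'.length < n → dynkin F deg (ш u' v') =
        (if u' = [] then dynkin F deg (Ξ v') else 0) +
          (if v' = [] then dynkin F deg (Ξ u') else 0) := by
    intro u' v' hlt
    by_cases h1 : u' = []
    · subst h1
      by_cases h2 : v' = []
      · subst h2; simp [word_nil, dynkin_one]
      · simp [h2]
    · by_cases h2 : v' = []
      · subst h2; simp [h1]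
      · rw [ih _ hlt u' v' h1 h2 rfl, if_neg h1, if_neg h2, add_zero]
  rw [dynkin_of_length_ge (n := u.length + v.length) (by omega) (shuffle_mem_lenEq u v), sub_eq_zero]
  obtain ⟨a, u₁, hua⟩ := List.exists_cons_of_ne_nil hu
  obtain ⟨b, v₁, hvb⟩ := List.exists_cons_of_ne_nil hv
  obtain ⟨u₂, x, hux⟩ : ∃ u₂ x, u = u₂ ++ [x] := by
    rcases List.eq_nil_or_concat' u with h | ⟨v, y, h⟩
    · exact absurd h hu
    · exact ⟨v, y, h⟩
  obtain ⟨v₂, y, hvy⟩ : ∃ v₂ y, v = v₂ ++ [y] := by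
    rcases List.eq_nil_or_concat' v with h | ⟨v, y, h⟩
    · exact absurd h hv
    · exact ⟨v, y, h⟩
  have lu₁ : u.length = u₁.length + 1 := by rw [hua]; simp
  have lv₁ : v.length = v₁.length + 1 := by rw [hvb]; simp
  have lu₂ : u.length = u₂.length + 1 := by rw [hux]; simp
  have lv₂ : v.length = v₂.length + 1 := by rw [hvy]; simp
  have hL : conv (dynkin F deg) ϖ (ш u v) =
      (if v₂ = [] then dynkin F deg (Ξ u) else 0) * Ξ [y] + sgn F (deg x * η v) •
        ((if u₂ = [] then dynkin F deg (Ξ v) else 0) * Ξ [x]) := by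
    have e : ш u v = ш u v₂ * Ξ [y] + sgn F (deg x * η v) • (ш u₂ v * Ξ [x]) := by
      rw [hux, hvy, shuffle_concat_concat]; simp
    rw [e, map_add, map_smul, conv_letterProj_mul_letter, conv_letterProj_mul_letter,
      hz u v₂ (by omega), hz u₂ v (by omega), if_neg hu, if_neg hv, zero_add, add_zero]
  have hR : dynkinRotate F deg (ш u v) = sgn F (deg a * η v) •
        ((if u₁ = [] then dynkin F deg (Ξ v) else 0) * Ξ [a]) +
      (if v₁ = [] then dynkin F deg (Ξ u) else 0) * Ξ [b] := by
    have e : ш u v = consL F a (ш u₁ v) + sgn F (deg b * η u) • consL F b (ш u v₁) := by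
      rw [hua, hvb, shuffle_cons_cons]
    rw [e, map_add, map_smul, dynkinRotate_consL, dynkinRotate_consL, par_shuffle, par_shuffle,
      map_smul, map_smul, hz u₁ v (by omega), hz u v₁ (by omega), if_neg hu, if_neg hv, zero_add,
      add_zero, smul_mul_assoc, smul_mul_assoc, smul_smul, ← sgn_add]
    congr 1
    · split_ifs with h1
      · rw [h1, wordDeg_nil, zero_add]
      · simp
    · split_ifs with h1
      · rw [h1, wordDeg_nil, add_zero, sgn_even, one_smul]
        simp
      · simp
  have iff1 : v₁ = [] ↔ v₂ = [] := by
    rw [← List.length_eq_zero_iff, ← List.length_eq_zero_iff]; omega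
  have iff2 : u₁ = [] ↔ u₂ = [] := by
    rw [← List.length_eq_zero_iff, ← List.length_eq_zero_iff]; omega
  rw [hL, hR, add_comm]
  simp only [iff1, iff2]
  congr 1
  · split_ifs with h1
    · have := hux.symm.trans hua
      rw [h1, iff2.2 h1] at this
      rw [show x = a by simpa using this]
    · simp
  · split_ifs with h1
    · have := hvy.symm.trans hvb
      rw [h1, iff1.2 h1] at this
      rw [show y = b by simpa using this]
    · simp

end Dynkin

/-! ### Invariant forms and cyclic cochains -/

section CyclicForm

variable {F I : Type*} [Field F]

/-- The suspension of a non-degenerate invariant form of degree `N` on an algebra with product `β`. -/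
structure IsCyclicForm (deg : I → ℤ) (β : Θ) (N : ℤ)
    (ω : Λ →ₗ[F] F) : Prop where
  length : ∀ w : List I, w.length ≠ 2 → ω (Ξ w) = 0
  kills : KillsShuffles deg ω
  invariant : ∀ t, ω (κ 1 β t) = 0
  homDeg : ∀ (z : Fˣ) (t : Λ), ω (scale deg z t) = ((z ^ N : Fˣ) : F) * ω t
  nondegenerate : ∀ y : Λ, ϖ y = y → (∀ x, ω (y * Ξ [x]) = 0) → y = 0

variable {deg : I → ℤ} {β : Θ} {N : ℤ} {ω : Λ →ₗ[F] F}
  {o : I} {r : ℕ} {e : ℤ} {c : Θ}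

lemma IsCyclicForm.eq_zero_of_mem_lenEq (hω : IsCyclicForm deg β N ω) {n : ℕ} (hn : n ≠ 2)
    {t : Λ} (ht : t ∈ lenEq F I n) : ω t = 0 := by
  have : lenEq F I n ≤ ker ω := lenEq_le_iff.2 fun w hw => hω.length w (by omega)
  exact this ht

lemma letterProj_of_mem_lenEq_one {t : Λ} (ht : t ∈ lenEq F I 1) : ϖ t = t := by
  have : lenEq F I 1 ≤ ker (ϖ - 1) := lenEq_le_iff.2 fun w hw => by
    obtain ⟨x, rfl⟩ := List.length_eq_one_iff.1 hw
    simp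
  have h := this ht
  rw [mem_ker, sub_apply, sub_eq_zero] at h
  exact h

lemma IsCochain.coder_of_length_eq (hc : IsCochain deg r e c) (hr : 0 < r) {w : List I}
    (hw : w.length = r) : κ e c (Ξ w) = c (Ξ w) := by
  rw [← letterProj_of_mem_lenEq_one (hc.coder_mem_lenEq w 1 (by omega)), ← End.mul_apply,
    hc.letterProj_coder hr]

lemma IsCochain.coder_of_length_eq_succ (hc : IsCochain deg r e c) (hr : 0 < r) {a y : I}
    {u v : List I} (h : a :: u = v ++ [y]) (hv : v.length = r) :
    κ e c (Ξ (a :: u)) = c (Ξ v) * Ξ [y] + sgn F (e * deg a) • (Ξ [a] * c (Ξ u)) := by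
  have hlen := congrArg List.length h
  simp only [List.length_cons, List.length_append, List.length_nil] at hlen
  rw [coder_cons, hc.coder_of_length_eq hr (by omega), h, conv_word, cutSum_append_singleton]
  congr 1
  have : cutSum (fun p s => c (Ξ p) * (1 : Θ) (Ξ (s ++ [y]))) v = c (Ξ v) * Ξ [y] := by
    rcases List.eq_nil_or_concat' v with rfl | ⟨v, z, rfl⟩
    · simp
    · rw [cutSum_append_singleton, cutSum_eq_zero]
      · simp
      · intro p s hps
        have := congrArg List.length hps
        simp only [List.length_append, List.length_singleton] at this hv
        rw [hc.length p (by omega), zero_mul]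
  rw [this, hc.length (v ++ [y]) (by simp; omega), zero_mul, add_zero]

/-- The differential of a normalized cochain is normalized. -/
lemma IsUnitalProduct.hochschild_normalized [CharZero F] (hβ : IsUnitalProduct deg β o)
    (hc : IsCochain deg r e c) (hr : 0 < r) (hn : ∀ t ∈ wordsWith F o, c t = 0)
    {t : Λ} (ht : t ∈ wordsWith F o) : 𝒹 e c t = 0 := by
  have hw : ∀ p s : List I, c (Ξ (p ++ o :: s)) = 0 := fun p s =>
    hn _ (subset_span ⟨_, by simp, rfl⟩)
  have hmul : ∀ (x : Λ) (s : List I), c (x * Ξ (o :: s)) = 0 := by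
    intro x s
    induction x using word_induction with
    | h0 => simp
    | hadd a b ha hb => rw [add_mul, map_add, ha, hb, add_zero]
    | hw a p => rw [smul_mul_assoc, word_mul_word, map_smul, hw, smul_zero]
  have hmul' : ∀ (p : List I) (x : Λ), c (Ξ p * (Ξ [o] * x)) = 0 := by
    intro p x
    induction x using word_induction with
    | h0 => simp
    | hadd a b ha hb => rw [mul_add, mul_add, map_add, ha, hb, add_zero]
    | hw a s =>
      rw [mul_smul_comm, mul_smul_comm, word_mul_word, word_mul_word, map_smul,
        List.singleton_append, hw, smul_zero]
  have hhead : ∀ p s : List I, headTerm deg β e c p (o :: s) = 0 := by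
    intro p s
    cases p with
    | nil => rfl
    | cons x p => rw [headTerm, hw, mul_zero, map_zero, smul_zero]
  have key : wordsWith F o ≤ ker (𝒹 e c) := wordsWith_le_iff.2 fun p s => by
    rw [mem_ker]
    rcases List.eq_nil_or_concat' s with rfl | ⟨s, y, rfl⟩
    · cases p with
      | nil => exact (hβ.isCochain_hochschild hc).length _ (by simp; omega)
      | cons x p => rw [hβ.hochschild_append_unit hc hr, hhead, hmul, smul_zero, sub_zero]
    · rw [hβ.hochschild_append_unit_concat hc hr, hhead, hw, hmul, hmul']
      simp
  exact key ht

/-- A coderivation with normalized component preserves the words that contain the unit. -/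
lemma IsCoder.wordsWith_stable {D : Θ} (hD : IsCoder deg e D)
    (hn : ∀ t ∈ wordsWith F o, ϖ (D t) = 0) {t : Λ}
    (ht : t ∈ wordsWith F o) : D t ∈ wordsWith F o := by
  have hmem : ∀ {w : List I}, o ∈ w → Ξ w ∈ wordsWith F o := fun h => subset_span ⟨_, h, rfl⟩
  have hmul : ∀ (s : Λ) {v : List I}, o ∈ v → s * Ξ v ∈ wordsWith F o := by
    intro s v hv
    induction s using word_induction with
    | h0 => simp
    | hadd a b ha hb => rw [add_mul]; exact add_mem ha hb
    | hw a u =>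
      rw [smul_mul_assoc, word_mul_word]
      exact Submodule.smul_mem _ _ (hmem (by simp [hv]))
  have hmul' : ∀ (u : List I) {s : Λ}, s ∈ wordsWith F o → Ξ u * s ∈ wordsWith F o := by
    intro u s hs
    have : wordsWith F o ≤ (wordsWith F o).comap (mulLeft F (Ξ u)) :=
      wordsWith_le_iff.2 fun p s => by
        rw [mem_comap, mulLeft_apply, word_mul_word]
        exact hmem (by simp)
    exact this hs
  have hhead : ∀ s : Λ, Ξ [o] * s ∈ wordsWith F o := by
    intro s
    induction s using word_induction with
    | h0 => simp
    | hadd a b ha hb => rw [mul_add]; exact add_mem ha hb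
    | hw a u =>
      rw [mul_smul_comm, word_mul_word]
      exact Submodule.smul_mem _ _ (hmem (by simp))
  have key : ∀ w : List I, o ∈ w → D (Ξ w) ∈ wordsWith F o := by
    intro w
    induction w with
    | nil => simp
    | cons x w ih =>
      intro hw
      rw [hD.apply_cons]
      refine add_mem ?_ (Submodule.smul_mem _ _ ?_)
      · rw [conv_word]
        refine cutSum_mem fun u v huv => ?_
        by_cases hu : o ∈ u
        · rw [End.mul_apply, hn _ (hmem hu), zero_mul]; exact zero_mem _
        · refine hmul _ ?_
          rw [← huv, List.mem_append] at hw
          exact hw.resolve_left hu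
      · by_cases hx : x = o
        · rw [hx]; exact hhead _
        · exact hmul' _ (ih ((List.mem_cons.1 hw).resolve_left (Ne.symm hx)))
  have : wordsWith F o ≤ (wordsWith F o).comap D := wordsWith_le_iff.2 fun p s => key _ (by simp)
  exact this ht

/-- Every family of functionals on letters is represented by the form. -/
lemma IsCyclicForm.exists_cochain [Fintype I] (hω : IsCyclicForm deg β N ω)
    (ξ : List I → I → F) (r : ℕ) : ∃ c : Θ, ϖ * c = c ∧ (∀ w : List I, w.length ≠ r → c (Ξ w) = 0) ∧
      ∀ w : List I, w.length = r → ∀ y, ω (c (Ξ w) * Ξ [y]) = ξ w y := by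
  let L : (I → F) →ₗ[F] Λ := Fintype.linearCombination F fun x : I => Ξ [x]
  have hL : ∀ a, ϖ (L a) = L a := fun a => by simp [L, Fintype.linearCombination_apply]
  have hLinj : Function.Injective L := by
    have h1 : LinearIndependent F fun x : I => Ξ [x] :=
      (wordBasis F I).linearIndependent.comp (fun x : I => [x]) fun x y h => by simpa using h
    exact h1.fintypeLinearCombination_injective
  let Φ : (I → F) →ₗ[F] (I → F) := LinearMap.pi fun y => ω ∘ₗ mulRight F (Ξ [y]) ∘ₗ L
  have hΦ : Function.Injective Φ := by
    rw [← LinearMap.ker_eq_bot, LinearMap.ker_eq_bot']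
    intro a ha
    refine hLinj ?_
    rw [map_zero]
    refine hω.nondegenerate _ (hL a) fun x => ?_
    exact congrFun ha x
  -- The pairing with letters is an injective endomorphism of the space of functions on a finite
  -- alphabet, hence surjective.
  have hsurj := LinearMap.injective_iff_surjective.1 hΦ
  choose a ha using fun w => hsurj (ξ w)
  refine ⟨wordLift F fun w => if w.length = r then L (a w) else 0, ?_, ?_, ?_⟩
  · apply word_hom_ext; intro w
    rw [End.mul_apply, wordLift_word]
    split_ifs
    · exact hL _
    · exact map_zero _
  · intro w hw
    rw [wordLift_word, if_neg hw]
  · intro w hw y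
    rw [wordLift_word, if_pos hw]
    exact congrFun (ha w) y

lemma IsCyclicForm.letter_mul_comm (hω : IsCyclicForm deg β N ω) (a : I) {n : ℤ}
    {b : Λ} (hb : b ∈ lettersOfDeg F deg n) :
    ω (Ξ [a] * b) = -sgn F (deg a * n) * ω (b * Ξ [a]) := by
  induction hb using span_induction with
  | mem _ h =>
    obtain ⟨z, hz, rfl⟩ := h
    have hk := hω.kills [a] [z] (by simp) (by simp)
    rw [shuffle_cons_cons] at hk
    simp only [shuffle_nil_left, shuffle_nil_right, map_add, map_smul, consL_word, wordDeg_cons,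
      wordDeg_nil, add_zero, smul_eq_mul] at hk
    rw [word_mul_word, word_mul_word, List.singleton_append, List.singleton_append,
      eq_neg_of_add_eq_zero_left hk, neg_mul, hz, mul_comm (deg a)]
  | zero => simp
  | add s t _ _ hs ht => rw [mul_add, map_add, hs, ht, add_mul, map_add, mul_add]
  | smul b t _ ht =>
    rw [mul_smul_comm, map_smul, ht, smul_mul_assoc, map_smul, smul_eq_mul, smul_eq_mul]; ring

lemma IsCyclicForm.comp_coder_eq_zero (hω : IsCyclicForm deg β N ω) (hc : IsCochain deg r e c)
    {n : ℕ} (hn : n ≠ r + 1) {t : Λ} (ht : t ∈ lenEq F I n) :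
    ω (κ e c t) = 0 := by
  have : lenEq F I n ≤ ker (ω ∘ₗ κ e c) := lenEq_le_iff.2 fun w hw => by
    rw [mem_ker, comp_apply]
    rcases Nat.lt_or_ge w.length r with h | h
    · rw [hc.coder_eq_zero h, map_zero]
    · exact hω.eq_zero_of_mem_lenEq (n := w.length + 1 - r) (by omega)
        (hc.coder_mem_lenEq w _ (by omega))
  exact this ht

/-- For a normalized cochain of degree zero, the first argument of its cyclic form can be the
unit only in the obvious way. -/
lemma IsCyclicForm.comp_coder_unit_mul (hω : IsCyclicForm deg β N ω)
    (hc : IsCochain deg r 0 c) (hr : 0 < r) (hn : ∀ t ∈ wordsWith F o, c t = 0)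
    (t : Λ) : ω (κ 0 c (Ξ [o] * t)) = ω (Ξ [o] * c t) := by
  induction t using word_induction with
  | h0 => simp
  | hadd a b ha hb => simp only [mul_add, map_add, ha, hb]
  | hw d w =>
    simp only [mul_smul_comm, map_smul]
    congr 1
    rw [word_mul_word, List.singleton_append]
    by_cases hw : w.length = r
    · obtain ⟨v, y, hv⟩ : ∃ v y, o :: w = v ++ [y] := by
        rcases List.eq_nil_or_concat' (o :: w) with h | ⟨v, y, h⟩
        · simp at h
        · exact ⟨v, y, h⟩
      have hlen := congrArg List.length hv
      simp only [List.length_cons, List.length_append, List.length_nil] at hlen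
      obtain ⟨v, rfl⟩ : ∃ v', v = o :: v' := by
        cases v with
        | nil => simp only [List.length_nil] at hlen; omega
        | cons b v => exact ⟨v, by simp at hv; rw [hv.1]⟩
      rw [hc.coder_of_length_eq_succ hr hv (by omega),
        hn _ (subset_span ⟨_, List.mem_cons_self, rfl⟩)]
      simp
    · rw [hω.comp_coder_eq_zero hc (n := w.length + 1) (by omega) (word_mem_lenEq rfl),
        hc.length w hw, mul_zero, map_zero]

lemma coder_sub (c c' : Θ) : κ e (c - c') = κ e c - κ e c' := by
  rw [sub_eq_add_neg, ← neg_one_smul F c', coder_add, coder_smul]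
  module

/-- A cochain whose cyclic form is a prescribed normalized Harrison functional. -/
lemma IsCyclicForm.exists_primitive [CharZero F] [Fintype I] (hω : IsCyclicForm deg β N ω)
    (hr : 0 < r) {G : Λ →ₗ[F] F} (hG : KillsShuffles deg G)
    (hGn : ∀ t ∈ wordsWith F o, G t = 0)
    (hGl : ∀ w : List I, w.length ≠ r + 1 → G (Ξ w) = 0)
    (hGd : ∀ (z : Fˣ) (t : Λ), G (scale deg z t) = ((z ^ (N + 1) : Fˣ) : F) * G t) :
    ∃ c, IsCochain deg r (-1) c ∧ KillsShuffles deg c ∧ (∀ t ∈ wordsWith F o, c t = 0) ∧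
      ∀ t, ω (κ (-1) c t) = G t := by
  -- The operator `dynkin` in the definition makes `c` Harrison. The factor compensates
  -- `KillsShuffles.apply_dynkin` on words of length `r + 1`.
  obtain ⟨c, hc1, hc2, hc3⟩ := hω.exists_cochain
    (fun w y => (r + 1 : F)⁻¹ * G (dynkin F deg (Ξ w) * Ξ [y])) r
  have hpair : ∀ {t : Λ}, t ∈ lenEq F I r → ∀ y,
      ω (c t * Ξ [y]) = (r + 1 : F)⁻¹ * G (dynkin F deg t * Ξ [y]) := by
    intro t ht y
    have : lenEq F I r ≤ ker ((ω ∘ₗ mulRight F (Ξ [y]) ∘ₗ c) -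
        (r + 1 : F)⁻¹ • (G ∘ₗ mulRight F (Ξ [y]) ∘ₗ dynkin F deg)) :=
      lenEq_le_iff.2 fun w hw => by
        rw [mem_ker, sub_apply, sub_eq_zero]
        exact hc3 w hw y
    have h := this ht
    rw [mem_ker, sub_apply, sub_eq_zero] at h
    exact h
  have hlet : ∀ t, ϖ (c t) = c t := letter_apply hc1
  have hdeg : HomDeg deg (-1) c := by
    intro z
    apply word_hom_ext; intro w
    rw [smul_apply, End.mul_apply, End.mul_apply, scale_word, map_smul, smul_smul, ← Units.val_mul,
      ← zpow_add]
    by_cases hw : w.length = r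
    · rw [← sub_eq_zero]
      have hs : ϖ (scale deg z (c (Ξ w))) = scale deg z (c (Ξ w)) := by
        rw [← (homDeg_letterProj deg).apply_scale z, hlet]
      refine hω.nondegenerate _ (by rw [map_sub, map_smul, hlet, hs]) fun x => ?_
      rw [sub_mul, map_sub, smul_mul_assoc, map_smul, hpair (word_mem_lenEq hw), smul_eq_mul]
      have h1 : ω (scale deg z (c (Ξ w)) * Ξ [x]) * ((z ^ deg x : Fˣ) : F) =
          ((z ^ N : Fˣ) : F) * ω (c (Ξ w) * Ξ [x]) := by
        rw [← hω.homDeg, scale_mul, scale_word, mul_smul_comm, map_smul, smul_eq_mul, mul_comm]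
        simp
      have h2 : ((z ^ η w : Fˣ) : F) * ((z ^ deg x : Fˣ) : F) * G (dynkin F deg (Ξ w) * Ξ [x]) =
          ((z ^ (N + 1) : Fˣ) : F) * G (dynkin F deg (Ξ w) * Ξ [x]) := by
        rw [← hGd, scale_mul, homDeg_dynkin.apply_scale, scale_word, scale_word, map_smul,
          mul_smul_comm, smul_mul_assoc, map_smul, map_smul, smul_eq_mul, smul_eq_mul]
        simp
        ring
      have hz : ((z ^ deg x : Fˣ) : F) ≠ 0 := Units.ne_zero _
      refine mul_right_cancel₀ hz ?_
      rw [hpair (word_mem_lenEq hw)] at h1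
      rw [zero_mul, sub_mul, h1]
      rw [zpow_add, zpow_one, Units.val_mul] at h2
      rw [zpow_add, zpow_neg, zpow_one, Units.val_mul]
      have hzz : (z : F) * ((z⁻¹ : Fˣ) : F) = 1 := by simp
      linear_combination (-(r + 1 : F)⁻¹ * ((z⁻¹ : Fˣ) : F)) * h2 -
        ((z ^ N : Fˣ) : F) * (r + 1 : F)⁻¹ * G (dynkin F deg (Ξ w) * Ξ [x]) * hzz
    · rw [hc2 w hw, map_zero, smul_zero]
  have hc : IsCochain deg r (-1) c := ⟨hc1, hc2, hdeg⟩
  have hGmul : ∀ {t : Λ}, t ∈ wordsWith F o → ∀ y, G (t * Ξ [y]) = 0 := by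
    intro t ht y
    have : wordsWith F o ≤ ker (G ∘ₗ mulRight F (Ξ [y])) := wordsWith_le_iff.2 fun p s => by
        rw [mem_ker, comp_apply, mulRight_apply, word_mul_word]
        exact hGn _ (subset_span ⟨_, by simp, rfl⟩)
    exact this ht
  refine ⟨c, hc, fun u v hu hv => ?_, ?_, fun t => ?_⟩
  · by_cases h : u.length + v.length = r
    · refine hω.nondegenerate _ (hlet _) fun y => ?_
      have hm := shuffle_mem_lenEq (F := F) (deg := deg) u v
      rw [h] at hm
      rw [hpair hm, killsShuffles_dynkin u v hu hv, zero_mul, map_zero, mul_zero]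
    · exact hc.eq_zero_of_mem_lenEq h (shuffle_mem_lenEq u v)
  · have : wordsWith F o ≤ ker c := wordsWith_le_iff.2 fun p s => by
      rw [mem_ker]
      by_cases hw : (p ++ o :: s).length = r
      · refine hω.nondegenerate _ (hlet _) fun y => ?_
        rw [hpair (word_mem_lenEq hw), hGmul (dynkin_mem_wordsWith (by simp)), mul_zero]
      · exact hc2 _ hw
    exact fun t ht => this ht
  · induction t using word_induction with
    | h0 => simp
    | hadd a b ha hb => simp only [map_add, ha, hb]
    | hw d w =>
    simp only [map_smul]
    congr 1
    by_cases hw : w.length = r + 1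
    · obtain ⟨a, u, rfl⟩ := List.exists_cons_of_ne_nil (by rintro rfl; simp at hw : w ≠ [])
      obtain ⟨v, y, hv⟩ : ∃ v y, a :: u = v ++ [y] := by
        rcases List.eq_nil_or_concat' (a :: u) with h | ⟨v, y, h⟩
        · simp at h
        · exact ⟨v, y, h⟩
      have hlen := congrArg List.length hv
      simp only [List.length_cons, List.length_append, List.length_nil] at hlen hw
      -- By `dynkin_eq` the two terms of the cyclic form of `c` combine to `G` applied to `dynkin`
      -- of the whole word, which is `r + 1` times the value of `G`.
      have hG' := hG.apply_dynkin (a :: u)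
      rw [dynkin_eq hv (by rintro rfl; simp at hw; omega), map_sub, map_smul, List.length_cons,
        smul_eq_mul, smul_eq_mul, show u.length = r by omega] at hG'
      rw [hc.coder_of_length_eq_succ hr hv (by omega), map_add, map_smul, smul_eq_mul,
        hω.letter_mul_comm a (mem_lettersOfDeg hc.letter hc.homDeg u),
        hpair (word_mem_lenEq (by omega)), hpair (word_mem_lenEq (by omega))]
      have hs : sgn F (-1 * deg a) * -sgn F (deg a * (η u + -1)) = -sgn F (deg a * η u) := by
        rw [mul_neg, ← sgn_add, neg_inj]
        apply sgn_congr; simp only [Int.even_add, Int.even_mul]; simp; grind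
      have hr1 : (r + 1 : F) ≠ 0 := by exact_mod_cast Nat.succ_ne_zero r
      rw [← mul_assoc, hs]
      push_cast at hG'
      field_simp
      linear_combination hG'
    · rw [hω.comp_coder_eq_zero hc hw (word_mem_lenEq rfl), hGl w hw]

/-- A normalized Harrison cochain with cyclic differential is cohomologous to a cyclic one. -/
lemma IsUnitalProduct.exists_cyclic [CharZero F] [Fintype I] (hβ : IsUnitalProduct deg β o)
    (hω : IsCyclicForm deg β N ω) {g : Θ}
    (hg : IsCochain deg (r + 1) 0 g) (hr : 0 < r) (hk : KillsShuffles deg g)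
    (hn : ∀ t ∈ wordsWith F o, g t = 0)
    (hδ : ∀ t, ω (κ 1 (𝒹 0 g) t) = 0) :
    ∃ c, IsCochain deg r (-1) c ∧ KillsShuffles deg c ∧ (∀ t ∈ wordsWith F o, c t = 0) ∧
      ∀ t, ω (κ 0 (g - 𝒹 (-1) c) t) = 0 := by
  have hG := hω.comp_coder_unit_mul hg (Nat.succ_pos r) hn
  -- Contraction with the unit is a homotopy. The cyclic form of `g` vanishes on the image of the
  -- codifferential of the product; evaluated on the image of a word with a unit in front, this
  -- expresses the cyclic form of `g` at a word by the contracted form at its differential, and `c`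
  -- is chosen with the negative of the contracted form as its cyclic form.
  obtain ⟨c, hc, hck, hcn, hcω⟩ := hω.exists_primitive (o := o) hr
    (G := -(ω ∘ₗ mulLeft F (Ξ [o]) ∘ₗ g))
    (fun u v hu hv => by simp [hk u v hu hv]) (fun t ht => by simp [hn t ht])
    (fun w hw => by simp [hg.length w hw]) (fun z t => by
      have h1 : Ξ [o] * g (scale deg z t) = (z : F) • scale deg z (Ξ [o] * g t) := by
        rw [scale_mul, hg.homDeg.apply_scale, scale_word, smul_mul_assoc, smul_smul]
        simp [hβ.deg_unit]
      simp only [neg_apply, comp_apply, mulLeft_apply]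
      rw [h1, map_smul, hω.homDeg, zpow_add, zpow_one, Units.val_mul, smul_eq_mul]
      ring)
  refine ⟨c, hc, hck, hcn, fun t => ?_⟩
  have h1 : ∀ t, ω (κ 0 g (κ 1 β t)) = 0 := by
    intro t
    have h := hδ t
    rw [show (1 : ℤ) = 1 + 0 by rfl, hβ.coder_hochschild hg (Nat.succ_pos r)] at h
    simpa [hω.invariant] using h
  have h2 : κ 0 (𝒹 (-1) c) = κ 1 β * κ (-1) c + κ (-1) c * κ 1 β := by
    have h := hβ.coder_hochschild hc hr
    rw [show (1 : ℤ) + -1 = 0 by rfl, sgn_odd (by decide)] at h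
    rw [h]; module
  rw [coder_sub, h2, sub_apply, add_apply, End.mul_apply, End.mul_apply, map_sub, map_add,
    hω.invariant, zero_add, hcω]
  simp only [neg_apply, comp_apply, mulLeft_apply, sub_neg_eq_add]
  rw [← hG]
  induction t using word_induction with
  | h0 => simp
  | hadd a b ha hb =>
    have := congrArg₂ (· + ·) ha hb
    simp only [add_zero] at this
    rw [← this]; simp only [map_add, mul_add]; abel
  | hw d w =>
    cases w with
    | nil => simp [word_nil]
    | cons x s =>
      have h := h1 (Ξ (o :: x :: s))
      rw [hβ.coder_unit_cons] at h
      simp only [map_sub, map_neg] at h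
      simp only [map_smul, mul_smul_comm, ← smul_add]
      rw [show ω (κ 0 g (Ξ (x :: s))) + ω (κ 0 g (Ξ [o] * κ 1 β (Ξ (x :: s)))) = 0 by
          linear_combination -h, smul_zero]

end CyclicForm

/-! ### Restriction to words of one length -/

section Restriction

variable {F I : Type*} [Field F] {deg : I → ℤ}

/-- The restriction of an operator to the words of length `r`. -/
def restrictLen (r : ℕ) (f : Θ) :
    Θ :=
  wordLift F fun w => if w.length = r then f (Ξ w) else 0

lemma restrictLen_word {r : ℕ} (f : Θ) {w : List I}
    (h : w.length = r) : restrictLen r f (Ξ w) = f (Ξ w) := by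
  rw [restrictLen, wordLift_word, if_pos h]

lemma restrictLen_of_ne {r : ℕ} (f : Θ) {w : List I}
    (h : w.length ≠ r) : restrictLen r f (Ξ w) = 0 := by
  rw [restrictLen, wordLift_word, if_neg h]

lemma restrictLen_mem_lenEq {r : ℕ} (f : Θ) {t : Λ}
    (h : t ∈ lenEq F I r) : restrictLen r f t = f t := by
  have : lenEq F I r ≤ LinearMap.eqLocus (restrictLen r f) f :=
    lenEq_le_iff.2 fun w hw => restrictLen_word f hw
  exact this h

lemma isCochain_restrictLen (r : ℕ) {e : ℤ} {f : Θ}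
    (hf : HomDeg deg e f) : IsCochain deg r e (restrictLen r (ϖ * f)) where
  letter := by
    apply word_hom_ext; intro w
    by_cases h : w.length = r
    · rw [End.mul_apply, restrictLen_word _ h, ← End.mul_apply, ← mul_assoc, letterProj_idem]
    · rw [End.mul_apply, restrictLen_of_ne _ h, map_zero]
  length w hw := restrictLen_of_ne _ hw
  homDeg := by
    have hf' : HomDeg deg e (ϖ * f) := by simpa using (homDeg_letterProj deg).mul deg hf
    intro z
    apply word_hom_ext; intro w
    rw [smul_apply, End.mul_apply, End.mul_apply, scale_word, map_smul]
    by_cases h : w.length = r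
    · rw [restrictLen_word _ h, hf'.scale_apply, zpow_add, Units.val_mul, smul_smul, mul_comm]
    · rw [restrictLen_of_ne _ h, map_zero, smul_zero, smul_zero]

lemma killsShuffles_restrictLen (r : ℕ) {f : Θ}
    (hf : KillsShuffles deg f) : KillsShuffles deg (restrictLen r f) := by
  intro u v hu hv
  by_cases h : u.length + v.length = r
  · have := shuffle_mem_lenEq (F := F) (deg := deg) u v
    rw [h] at this
    rw [restrictLen_mem_lenEq f this, hf u v hu hv]
  · have : lenEq F I (u.length + v.length) ≤ ker (restrictLen r f) :=
      lenEq_le_iff.2 fun w hw => restrictLen_of_ne f (by omega)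
    exact this (shuffle_mem_lenEq u v)

lemma restrictLen_lenLT {r : ℕ} {f : Θ} (hf : ∀ w : List I, w.length < r → f (Ξ w) = 0) {t : Λ}
    (ht : t ∈ Γ (r + 1)) : restrictLen r f t = f t :=
  lenLT_induction (fun w hw => by
    by_cases h : w.length = r
    · exact restrictLen_word f h
    · rw [restrictLen_of_ne f h, hf w (by omega)]) ht

/-- A derivation sends a proper shuffle to a sum of shuffles of elements without constant term,
since a coderivation has no counit part. -/
lemma KillsShuffles.comp_isShuffleDer {c : ℤ} {D : Θ}
    {M : Type*} [AddCommGroup M] [Module F M] {f : Λ →ₗ[F] M}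
    (hf : KillsShuffles deg f) (hD : IsCoder deg c D) (hs : IsShuffleDer deg c D) :
    KillsShuffles deg (f ∘ₗ D) := by
  intro u v hu hv
  rw [comp_apply, hs u v, map_add, map_smul, hf.apply (hD.counit _) (emptyCoeff_of_ne hv),
    hf.apply (emptyCoeff_of_ne hu) (hD.counit _),
    smul_zero, add_zero]

lemma IsShuffleDer.bracket {c d : ℤ} {D E : Θ}
    (hD : IsShuffleDer deg c D) (hE : IsShuffleDer deg d E) (hD' : HomDeg deg c D)
    (hE' : HomDeg deg d E) : IsShuffleDer deg (c + d) (D * E - sgn F (c * d) • (E * D)) := by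
  intro u v
  have h1 : ∀ t, par deg c (E t) = sgn F (c * d) • E (par deg c t) := fun t =>
    LinearMap.congr_fun (hE'.par_mul deg c) t
  have h2 : ∀ t, par deg d (D t) = sgn F (d * c) • D (par deg d t) := fun t =>
    LinearMap.congr_fun (hD'.par_mul deg d) t
  simp only [sub_apply, smul_apply, End.mul_apply, hD u v, hE u v, map_add, map_smul, hD.apply_par,
    hE.apply_par, h1, h2, par_word, map_sub, smul_add, smul_sub,
    sub_apply, smul_smul, ← sgn_add]
  rw [show sgn F (c * d + (d * c + d * η u)) = sgn F (d * η u) from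
      sgn_congr (by simp only [Int.even_add, Int.even_mul]; grind),
    show sgn F ((c + d) * η u) = sgn F (d * η u + c * η u) by
      congr 1; ring,
    show sgn F ((c + d) * η u + c * d) = sgn F (c * d + (c * η u + d * η u)) by congr 1; ring]
  abel

end Restriction

/-! ### Unital cyclic models and their gauge transformations -/

section Models

variable {F I : Type*} [Field F]

/-- The codifferential of a minimal unital cyclic `C_∞`-algebra with product `β`. -/
structure IsUnitalCyclicModel (deg : I → ℤ) (β : Θ) (o : I)
    (ω : Λ →ₗ[F] F) (A : Θ) : Prop where
  isCoder : IsCoder deg 1 A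
  homDeg : HomDeg deg 1 A
  shuffleDer : IsShuffleDer deg 1 A
  minimal : ∀ w : List I, w.length < 2 → ϖ (A (Ξ w)) = 0
  quadratic : ∀ w : List I, w.length = 2 → ϖ (A (Ξ w)) = β (Ξ w)
  square : A * A = 0
  normal : ∀ p s : List I, 3 ≤ (p ++ o :: s).length → ϖ (A (Ξ (p ++ o :: s))) = 0
  cyclic : ∀ t, ω (A t) = 0

variable {deg : I → ℤ} {β : Θ} {N : ℤ} {ω : Λ →ₗ[F] F}
  {o : I} {A : Θ}

namespace IsUnitalCyclicModel

lemma apply_of_mem_lenLT_two (hA : IsUnitalCyclicModel deg β o ω A) {t : Λ}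
    (ht : t ∈ Γ 2) : A t = 0 :=
  lenLT_induction (g := 0) (fun w hw => hA.isCoder.eq_zero hA.minimal w hw) ht

lemma lowers (hA : IsUnitalCyclicModel deg β o ω A) : Lowers 1 A :=
  lowers_of_eq_zero (r := 2) le_rfl hA.isCoder fun w hw => hA.isCoder.eq_zero hA.minimal w hw

lemma letterProj_apply (hA : IsUnitalCyclicModel deg β o ω A) (hβ : IsUnitalProduct deg β o)
    {t : Λ} (ht : t ∈ Γ 3) : ϖ (A t) = β t :=
  lenLT_induction (f := ϖ * A) (fun w hw => by
    by_cases h : w.length = 2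
    · exact hA.quadratic w h
    · rw [End.mul_apply, hA.minimal w (by omega), hβ.length w h]) ht

/-- The part of the codifferential of arity at least three. -/
lemma letterProj_sub (hA : IsUnitalCyclicModel deg β o ω A) (hβ : IsUnitalProduct deg β o)
    {w : List I} (hw : w.length < 3) :
    ϖ ((A - κ 1 β) (Ξ w)) = 0 := by
  rw [sub_apply, map_sub, hA.letterProj_apply hβ (word_mem_lenLT hw), ← End.mul_apply,
    hβ.isCochain.letterProj_coder two_pos, sub_self]

lemma isCoder_sub (hA : IsUnitalCyclicModel deg β o ω A) (hβ : IsUnitalProduct deg β o) :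
    IsCoder deg 1 (A - κ 1 β) :=
  hA.isCoder.sub (hβ.isCochain.isCoder two_pos)

lemma lowers_sub (hA : IsUnitalCyclicModel deg β o ω A) (hβ : IsUnitalProduct deg β o) :
    Lowers 2 (A - κ 1 β) :=
  lowers_of_eq_zero (r := 3) (by norm_num) (hA.isCoder_sub hβ) fun w hw =>
    (hA.isCoder_sub hβ).eq_zero (fun v hv => hA.letterProj_sub hβ hv) w hw

lemma normal_sub (hA : IsUnitalCyclicModel deg β o ω A) (hβ : IsUnitalProduct deg β o)
    {t : Λ} (ht : t ∈ wordsWith F o) :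
    ϖ ((A - κ 1 β) t) = 0 := by
  have : wordsWith F o ≤ ker (ϖ * (A - κ 1 β)) := wordsWith_le_iff.2 fun p s => by
      rw [mem_ker, End.mul_apply]
      by_cases h : (p ++ o :: s).length < 3
      · exact hA.letterProj_sub hβ h
      · rw [sub_apply, map_sub, hA.normal p s (by omega), ← End.mul_apply,
          hβ.isCochain.letterProj_coder two_pos, hβ.length _ (by omega), sub_zero]
  exact this ht

lemma stable_sub (hA : IsUnitalCyclicModel deg β o ω A) (hβ : IsUnitalProduct deg β o)
    {t : Λ} (ht : t ∈ wordsWith F o) : (A - κ 1 β) t ∈ wordsWith F o :=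
  (hA.isCoder_sub hβ).wordsWith_stable (fun _ => hA.normal_sub hβ) ht

end IsUnitalCyclicModel

/-- The gauge transformation with a single component. -/
lemma IsCochain.isGaugeLie [CharZero F] {q : Θ} {r : ℕ}
    (hq : IsCochain deg r 0 q) (hr : 2 ≤ r) (hk : KillsShuffles deg q)
    (hn : ∀ t ∈ wordsWith F o, q t = 0) (hω : ∀ t, ω (κ 0 q t) = 0) :
    IsGaugeLie deg (wordsWith F o) ω (κ 0 q) := by
  have hn' : ∀ t ∈ wordsWith F o, ϖ (κ 0 q t) = 0 := fun t ht => by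
    rw [← End.mul_apply, hq.letterProj_coder (by omega), hn t ht]
  exact isGaugeLie_of_log_data hr hq.letter hq.homDeg (fun w hw => hq.length w (by omega)) hk
    (fun t ht => (hq.isCoder (by omega)).wordsWith_stable hn' ht) hn' hω

/-- Plain isotopies are the case without normalization and with zero form. -/
lemma IsGaugeGroup.forget {𝔑 : Submodule F Λ} {U : Θ}
    (hU : IsGaugeGroup deg 𝔑 ω U) : IsGaugeGroup deg ⊥ 0 U where
  coalgHom := hU.coalgHom
  homDeg := hU.homDeg
  shuffleHom := hU.shuffleHom
  lowers := hU.lowers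
  stable t ht := by rw [(mem_bot F).1 ht, map_zero]; exact zero_mem _
  normal t ht := by rw [(mem_bot F).1 ht, map_zero]
  cyclic t := rfl

/-- The sign operator commutes with `V`, which has degree zero, so conjugation leaves it unchanged
in the coproduct rule. -/
lemma IsCoder.conj {c : ℤ} {D U V : Θ} (hD : IsCoder deg c D)
    (hU : IsCoalgHom U) (hV : IsCoalgHom V) (hV' : HomDeg deg 0 V) (h : V * U = 1) :
    IsCoder deg c (V * D * U) where
  comul := by
    have hp : V * (par deg c * U) = par deg c := by
      have := hV'.par_mul deg c
      rw [mul_zero, sgn_zero, one_smul] at this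
      rw [← mul_assoc, ← this, mul_assoc, h, mul_one]
    ext1 t
    simp only [comp_apply, add_apply, End.mul_apply, hV.decon_apply, hD.decon_apply, hU.decon_apply,
      map_add, map_map_apply, one_mul]
    rw [h, hp, mul_assoc]
  counit t := by simp [hV.counit, hD.counit]
  map_one := by simp [hU.map_one, hD.map_one]

lemma IsShuffleDer.conj {c : ℤ} {D U V : Θ} (hD : IsShuffleDer deg c D)
    (hU : IsShuffleHom deg U) (hV : IsShuffleHom deg V) (hV' : HomDeg deg 0 V) (h : V * U = 1) :
    IsShuffleDer deg c (V * D * U) := by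
  intro u v
  have hp : V (par deg c (U (Ξ u))) = sgn F (c * η u) • Ξ u := by
    have h1 := LinearMap.congr_fun (hV'.par_mul deg c) (U (Ξ u))
    simp only [End.mul_apply, mul_zero, sgn_zero, one_smul] at h1
    rw [← h1, ← End.mul_apply V, h, End.one_apply, par_word]
  have hv : V (U (Ξ v)) = Ξ v := LinearMap.congr_fun h _
  simp only [End.mul_apply]
  rw [hU u v, hD.apply_par, map_add, hV.apply, hV.apply, hp, hv, map_smul, smul_apply]

/-- `A` itself is not normalized, because of the product. The first commutator is: it consists of a
commutator with the normalized part of arity at least three and of the differential of the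
normalized cochain `q`. Further commutators inherit this. -/
lemma exp_normal_aux [CharZero F] (hβ : IsUnitalProduct deg β o)
    (hA : IsUnitalCyclicModel deg β o ω A)
    {q : Θ} {r : ℕ} (hq : IsCochain deg r 0 q) (hr : 2 ≤ r)
    (hn : ∀ t ∈ wordsWith F o, q t = 0) (j : ℕ) {t : Λ} (ht : t ∈ wordsWith F o) :
    ϖ ((adOp (κ 0 q) ^ (j + 1)) A t) = 0 ∧ (adOp (κ 0 q) ^ (j + 1)) A t ∈ wordsWith F o := by
  have hr' : 0 < r := by omega
  have hn' : ∀ t ∈ wordsWith F o, ϖ (κ 0 q t) = 0 := fun t ht => by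
    rw [← End.mul_apply, hq.letterProj_coder hr', hn t ht]
  have hst : ∀ t ∈ wordsWith F o, κ 0 q t ∈ wordsWith F o := fun t ht =>
    (hq.isCoder hr').wordsWith_stable hn' ht
  induction j generalizing t with
  | zero =>
    have hδ := hβ.coder_hochschild hq hr'
    rw [add_zero, sgn_zero, one_smul] at hδ
    have hδc : IsCochain deg (r + 1) 1 (𝒹 0 q) := hβ.isCochain_hochschild hq
    have hδn : ∀ t ∈ wordsWith F o, ϖ (κ 1 (𝒹 0 q) t) = 0 := fun t ht => by
        rw [← End.mul_apply, (hδc.letterProj_coder (by omega)),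
          hβ.hochschild_normalized hq hr' hn ht]
    have hδs : ∀ t ∈ wordsWith F o, κ 1 (𝒹 0 q) t ∈ wordsWith F o :=
      fun t ht => (hδc.isCoder (by omega)).wordsWith_stable hδn ht
    have e : (adOp (κ 0 q) ^ (0 + 1)) A = (κ 0 q * (A - κ 1 β) -
        (A - κ 1 β) * κ 0 q) - κ 1 (𝒹 0 q) := by
      rw [hδ, zero_add, pow_one, adOp_apply, mul_sub, sub_mul]; abel
    rw [e]
    have h1 := hA.stable_sub hβ ht
    have h2 := hA.normal_sub hβ (hst t ht)
    have h3 := hA.stable_sub hβ (hst t ht)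
    generalize A - κ 1 β = R at h1 h2 h3 ⊢
    simp only [sub_apply, End.mul_apply, map_sub]
    rw [hδn t ht, hn' _ h1, h2]
    exact ⟨by simp, sub_mem (sub_mem (hst _ h1) h3) (hδs t ht)⟩
  | succ j ih =>
    rw [pow_succ', End.mul_apply, adOp_apply, sub_apply, End.mul_apply, End.mul_apply, map_sub,
      hn' _ (ih ht).2, (ih (hst t ht)).1, sub_zero]
    exact ⟨rfl, sub_mem (hst _ (ih ht).2) (ih (hst t ht)).2⟩

/-- The action of a normalized cyclic gauge transformation on unital cyclic codifferentials. -/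
lemma IsUnitalCyclicModel.conj_expL [CharZero F] (hβ : IsUnitalProduct deg β o)
    (hA : IsUnitalCyclicModel deg β o ω A) {q : Θ} {r : ℕ}
    (hq : IsCochain deg r 0 q) (hr : 2 ≤ r) (hn : ∀ t ∈ wordsWith F o, q t = 0)
    (hL : IsGaugeLie deg (wordsWith F o) ω (κ 0 q)) :
    IsUnitalCyclicModel deg β o ω (expL (-κ 0 q) * A * expL (κ 0 q)) := by
  have hU := hL.exp
  have hV := hL.neg.exp
  have hUV := expL_mul_expL_neg hL.lowers
  have hVU := expL_mul_expL_neg hL.neg.lowers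
  rw [neg_neg] at hVU
  have hU1 : ∀ w : List I, expL (κ 0 q) (Ξ w) - Ξ w ∈ Γ w.length := by
    intro w
    simpa using hU.lowers w
  refine ⟨hA.isCoder.conj hU.coalgHom hV.coalgHom hV.homDeg hVU, ?_,
    hA.shuffleDer.conj hU.shuffleHom hV.shuffleHom hV.homDeg hVU, ?_, ?_, ?_, ?_, ?_⟩
  · simpa using (hV.homDeg.mul deg hA.homDeg).mul deg hU.homDeg
  · intro w hw
    rw [End.mul_apply, End.mul_apply,
      hA.apply_of_mem_lenLT_two (expL_mem_lenLT hL.lowers (word_mem_lenLT hw)), map_zero, map_zero]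
  · intro w hw
    have h1 : A (expL (κ 0 q) (Ξ w)) = A (Ξ w) := by
      rw [← sub_eq_zero, ← map_sub]
      exact hA.apply_of_mem_lenLT_two (by have := hU1 w; rwa [hw] at this)
    rw [End.mul_apply, End.mul_apply, h1, hV.letterProj_apply, hA.quadratic w hw]
    have := hA.lowers w
    rwa [hw] at this
  · calc expL (-κ 0 q) * A * expL (κ 0 q) * (expL (-κ 0 q) * A * expL (κ 0 q)) =
        expL (-κ 0 q) * A * (expL (κ 0 q) * expL (-κ 0 q)) * A * expL (κ 0 q) := by noncomm_ring
      _ = 0 := by rw [hUV, mul_one, mul_assoc (expL (-κ 0 q)), hA.square]; simp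
  · intro p s hps
    have hA0 : Lowers 0 A := hA.lowers.mono (Nat.zero_le 1)
    rw [expL_mul_eq hL.neg.lowers hA0, mul_assoc, hVU, mul_one,
      opSum_apply (fun j => ((lowers_adOp_pow hL.neg.lowers hA0 j).smul _).mono (by omega))
        (word_mem_lenLT (Nat.lt_succ_self _)), map_sum]
    refine sum_eq_zero fun j _ => ?_
    rw [smul_apply, map_smul]
    have hmem : Ξ (p ++ o :: s) ∈ wordsWith F o := subset_span ⟨_, by simp, rfl⟩
    cases j with
    | zero => rw [pow_zero, End.one_apply, hA.normal p s hps, smul_zero]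
    | succ j =>
      have hneg : -κ 0 q = κ 0 (-q) := by
        rw [← neg_one_smul F q, coder_smul, neg_one_smul F (κ 0 q)]
      rw [hneg, (exp_normal_aux hβ hA hq.neg hr (fun t ht => by
        rw [neg_apply, hn t ht, neg_zero]) j hmem).1, smul_zero]
  · intro t
    rw [End.mul_apply, End.mul_apply, hV.cyclic, hA.cyclic]

end Models

/-! ### From isotopies to unital cyclic isotopies -/

section Descent

variable {F I : Type*} [Field F] {deg : I → ℤ} {β : Θ} {N : ℤ}
  {ω : Λ →ₗ[F] F} {o : I} {A C U : Θ}

/-- The remaining terms of the exponential apply `D` at least twice. -/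
lemma expL_sub_mem {D : Θ} (h1 : Lowers 1 D) {k : ℕ} (hk : Lowers k D) (w : List I) :
    expL D (Ξ w) - Ξ w - D (Ξ w) ∈ Γ (w.length + 1 - (k + k)) := by
  rw [expL_apply h1 (word_mem_lenLT (by omega : w.length < w.length + 2)), sum_range_succ',
    sum_range_succ']
  simp only [zero_add, pow_zero, pow_one, Nat.factorial_zero, Nat.factorial_one, Nat.cast_one,
    inv_one, one_smul, End.one_apply]
  rw [add_sub_cancel_right, add_sub_cancel_right]
  refine Submodule.sum_mem _ fun j _ => Submodule.smul_mem _ _ ?_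
  have := ((h1.pow j).mul (hk.mul hk)) w
  rw [← pow_two, ← pow_add] at this
  exact lenLT_mono (by omega) this

lemma letterProj_of_mem_lenLT_one {t : Λ} (ht : t ∈ Γ 1) : ϖ t = 0 :=
  lenLT_induction (g := 0) (fun w hw => by
    rw [letterProj_of_length_ne (by omega), zero_apply]) ht

lemma IsCochain.eq_zero_of_mem_lenLT {c : Θ} {r : ℕ} {e : ℤ}
    (hc : IsCochain deg r e c) {t : Λ} (ht : t ∈ Γ r) : c t = 0 :=
  lenLT_induction (g := 0) (fun w hw => by
    rw [hc.length w (by omega), zero_apply]) ht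

lemma IsCochain.isShuffleDer [CharZero F] {c : Θ} {r : ℕ} {e : ℤ}
    (hc : IsCochain deg r e c) (hr : 0 < r) (hk : KillsShuffles deg c) :
    IsShuffleDer deg e (κ e c) :=
  (hc.isCoder hr).isShuffleDer hc.homDeg_coder (by rwa [hc.letterProj_coder hr])

lemma IsUnitalProduct.killsShuffles_hochschild [CharZero F] (hβ : IsUnitalProduct deg β o)
    {c : Θ} {r : ℕ} {e : ℤ}
    (hc : IsCochain deg r e c) (hr : 0 < r) (hk : KillsShuffles deg c) :
    KillsShuffles deg (𝒹 e c) := by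
  intro u v hu hv
  have h1 := hβ.kills.comp_isShuffleDer (hc.isCoder hr) (hc.isShuffleDer hr hk) u v hu hv
  have h2 := hk.comp_isShuffleDer (hβ.isCochain.isCoder two_pos)
    (hβ.isCochain.isShuffleDer two_pos hβ.kills) u v hu hv
  rw [comp_apply] at h1 h2
  rw [hochschild, sub_apply, smul_apply, End.mul_apply, End.mul_apply, h1, h2, smul_zero, sub_zero]

/-- The first non-trivial component of a morphism between minimal models that is the identity on
short words. -/
lemma IsUnitalCyclicModel.letterProj_sub_eq [CharZero F] (hβ : IsUnitalProduct deg β o)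
    (hA : IsUnitalCyclicModel deg β o ω A) (hC : IsUnitalCyclicModel deg β o ω C)
    {L : Θ} (hL : IsGaugeLie deg ⊥ 0 L)
    (hCU : ∀ t, C (expL L t) = expL L (A t)) {r : ℕ} (hr : 2 ≤ r)
    (hL0 : ∀ w : List I, w.length < r → L (Ξ w) = 0) :
    (∀ w : List I, w.length < r + 1 → (C - A) (Ξ w) = 0) ∧
      ∀ w : List I, w.length < r + 2 → ϖ ((C - A) (Ξ w)) = -𝒹 0 (restrictLen r (ϖ * L)) (Ξ w) := by
  have hr0 : 0 < r := by omega
  have hLl : Lowers (r - 1) L := lowers_of_eq_zero hr hL.coder hL0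
  have hg := isCochain_restrictLen r hL.homDeg
  have hgL : ∀ t ∈ Γ (r + 1), restrictLen r (ϖ * L) t = ϖ (L t) :=
    fun t ht => restrictLen_lenLT (fun w hw => by
      rw [End.mul_apply, hL0 w hw, map_zero]) ht
  generalize restrictLen r (ϖ * L) = g at hg hgL ⊢
  -- Since `L` shortens words by `r - 1` with `r ≥ 2`, the quadratic remainder has length at most
  -- one here, and `C` kills such words.
  have hCL : ∀ w : List I, w.length < r + 2 → C (expL L (Ξ w)) = C (Ξ w) + C (L (Ξ w)) := by
    intro w hw
    have h := hC.apply_of_mem_lenLT_two (lenLT_mono (by omega) (expL_sub_mem hL.lowers hLl w))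
    rw [map_sub, map_sub] at h
    rw [← sub_eq_zero, ← h]; abel
  have hAw : ∀ w : List I, A (Ξ w) ∈ Γ w.length := fun w => by simpa using hA.lowers w
  have h1 : ∀ w : List I, w.length < r + 1 → (C - A) (Ξ w) = 0 := by
    intro w hw
    have e1 : C (L (Ξ w)) = 0 := hC.apply_of_mem_lenLT_two (lenLT_mono (by omega) (hLl w))
    have e2 : expL L (A (Ξ w)) = A (Ξ w) := by
      refine lenLT_induction (n := r) (g := 1) (fun v hv => ?_) (lenLT_mono (by omega) (hAw w))
      rw [expL_apply hL.lowers (word_mem_lenLT (Nat.lt_succ_self _)), sum_range_succ', sum_eq_zero]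
      · simp
      · intro j _
        rw [pow_succ, End.mul_apply, hL0 v hv, map_zero, smul_zero]
    have h := hCU (Ξ w)
    rw [hCL w (by omega), e1, add_zero, e2] at h
    rw [sub_apply, h, sub_self]
  refine ⟨h1, fun w hw => ?_⟩
  have hδ := hβ.isCochain_hochschild hg
  rcases Nat.lt_or_ge w.length (r + 1) with hlt | hge
  · rw [h1 w hlt, map_zero, hδ.length w (by omega), neg_zero]
  have hprU : ∀ t ∈ Γ (r + 1), ϖ (expL L t) = ϖ t + g t := by
    intro t ht
    refine lenLT_induction (f := ϖ * expL L) (g := ϖ + g) (fun v hv => ?_) ht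
    have h := letterProj_of_mem_lenLT_one (lenLT_mono (by omega) (expL_sub_mem hL.lowers hLl v))
    rw [map_sub, map_sub, ← hgL _ (word_mem_lenLT hv)] at h
    rw [End.mul_apply, add_apply, ← sub_eq_zero, ← h]; abel
  -- On words of length `r + 1`, `L` and the coderivation of its leading component differ by words
  -- of length at most one, on which `β` vanishes.
  have hβL : ϖ (C (L (Ξ w))) = β (κ 0 g (Ξ w)) := by
    have hl3 : L (Ξ w) ∈ Γ 3 := lenLT_mono (by omega) (hLl w)
    rw [hC.letterProj_apply hβ hl3, ← sub_eq_zero, ← map_sub]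
    have hcod := hL.coder.sub (hg.isCoder hr0)
    have hlow : Lowers (r + 1 - 1) (L - κ 0 g) :=
      lowers_of_eq_zero (by omega) hcod (fun v hv => hcod.eq_zero (fun x hx => by
        rw [sub_apply, map_sub, ← hgL _ (word_mem_lenLT hx), ← End.mul_apply _ (κ 0 g),
          hg.letterProj_coder hr0, sub_self]) v hv)
    refine hβ.isCochain.eq_zero_of_mem_lenLT ?_
    rw [← sub_apply]
    exact lenLT_mono (by omega) (hlow w)
  have hgA : g (A (Ξ w)) = g (κ 1 β (Ξ w)) := by
    rw [← sub_eq_zero, ← map_sub, ← sub_apply]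
    exact hg.eq_zero_of_mem_lenLT (lenLT_mono (by omega) (hA.lowers_sub hβ w))
  have h := congrArg ϖ (hCU (Ξ w))
  rw [hCL w hw, map_add, hβL, hprU _ (lenLT_mono (by omega) (hAw w)), hgA] at h
  rw [sub_apply, map_sub, hochschild, sub_apply, smul_apply, sgn_zero, one_smul, End.mul_apply,
    End.mul_apply, neg_sub, sub_eq_sub_iff_add_eq_add, h,
    add_comm]

/-- The first non-trivial component of a morphism between unital cyclic models can be made
normalized and cyclic. -/
lemma IsUnitalCyclicModel.exists_gauge [CharZero F] [Fintype I] (hβ : IsUnitalProduct deg β o)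
    (hω : IsCyclicForm deg β N ω)
    (hA : IsUnitalCyclicModel deg β o ω A) (hC : IsUnitalCyclicModel deg β o ω C)
    (hU : IsGaugeGroup deg ⊥ 0 U)
    (hCU : ∀ t, C (U t) = U (A t)) {r : ℕ} (hr : 2 ≤ r)
    (hUr : ∀ w : List I, w.length < r → U (Ξ w) = Ξ w) :
    ∃ q U', IsCochain deg r 0 q ∧ (∀ t ∈ wordsWith F o, q t = 0) ∧
      IsGaugeLie deg (wordsWith F o) ω (κ 0 q) ∧ IsGaugeGroup deg ⊥ 0 U' ∧
      (∀ t, C (U' t) = U' (A t)) ∧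
      ∀ w : List I, w.length < r + 1 → U' (Ξ w) = expL (κ 0 q) (Ξ w) := by
  have hL := hU.log
  have hUL := expL_logL hU.lowers
  have hL0 : ∀ w : List I, w.length < r → logL U (Ξ w) = 0 := fun w hw =>
    logL_mem_of_forall_pow hU.lowers LinearMap.id fun n => by
      induction n with
      | zero => rfl
      | succ n ih => rw [pow_succ, End.mul_apply, hUr w hw]; exact ih
  generalize logL U = L at hL hUL hL0
  subst hUL
  -- `s` is the arity of the cochains whose differentials correct the component of arity `r`.
  obtain ⟨s, rfl⟩ : ∃ s, r = s + 1 := ⟨r - 1, by omega⟩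
  have hs : 0 < s := by omega
  obtain ⟨hE1, hE2⟩ := hA.letterProj_sub_eq hβ hC hL hCU hr hL0
  have hLl : Lowers (s + 1 - 1) L := lowers_of_eq_zero hr hL.coder hL0
  have hg := isCochain_restrictLen (s + 1) hL.homDeg
  have hgk := killsShuffles_restrictLen (s + 1) (hL.shuffleDer.killsShuffles hL.coder)
  have hgL : ∀ t ∈ Γ (s + 1 + 1), restrictLen (s + 1) (ϖ * L) t = ϖ (L t) :=
    fun t ht => restrictLen_lenLT (fun w hw => by
      rw [End.mul_apply, hL0 w hw, map_zero]) ht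
  generalize restrictLen (s + 1) (ϖ * L) = g at hg hgk hgL hE2
  have hδ : IsCochain deg (s + 1 + 1) 1 (𝒹 0 g) := hβ.isCochain_hochschild hg
  -- Up to sign, the differential of `g` is the leading component of `C - A`. It is normalized
  -- because both models are; the same argument gives cyclicity next.
  have hδn : ∀ t ∈ wordsWith F o, 𝒹 0 g t = 0 := by
    have : wordsWith F o ≤ ker (𝒹 0 g) := wordsWith_le_iff.2 fun p x => by
      rw [mem_ker]
      by_cases h : (p ++ o :: x).length = s + 1 + 1
      · rw [← neg_eq_zero, ← hE2 _ (by omega), sub_apply, map_sub, hC.normal p x (by omega),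
          hA.normal p x (by omega), sub_zero]
      · exact hδ.length _ h
    exact fun t ht => this ht
  have hδω : ∀ t, ω (κ 1 (𝒹 0 g) t) = 0 := by
    have hcod := (hC.isCoder.sub hA.isCoder).add (hδ.isCoder (by omega))
    have h0 : ∀ w : List I, w.length < s + 1 + 2 → (C - A + κ 1 (𝒹 0 g)) (Ξ w) = 0 :=
      fun w hw => hcod.eq_zero (fun v hv => by
        rw [add_apply, map_add, hE2 v hv, ← End.mul_apply, hδ.letterProj_coder (by omega),
          neg_add_cancel]) w hw
    have hlow := lowers_of_eq_zero (by omega) hcod h0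
    have hω2 : ∀ t ∈ Γ 2, ω t = 0 := by
      have : Γ 2 ≤ ker ω := lenLT_le_iff.2 fun w hw => hω.length w (by omega)
      exact fun t ht => this ht
    have : ω ∘ₗ κ 1 (𝒹 0 g) = 0 := by
      apply word_hom_ext; intro w
      rw [comp_apply, zero_apply]
      by_cases hw : w.length = s + 1 + 1 + 1
      · have h := hω2 _ (lenLT_mono (by omega) (hlow w))
        rw [add_apply, map_add, sub_apply, map_sub, hC.cyclic, hA.cyclic, sub_zero, zero_add] at h
        exact h
      · exact hω.comp_coder_eq_zero hδ hw (word_mem_lenEq rfl)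
    exact fun t => LinearMap.congr_fun this t
  -- Two corrections by coboundaries: `c₁` makes the leading component normalized; `c₂`, itself
  -- normalized, then makes it cyclic and does not spoil the normalization.
  obtain ⟨c₁, hc₁, hk₁, hn₁⟩ := hβ.exists_harrison_normalized hg hgk hs hδn
  have hδ₁ : IsCochain deg (s + 1) 0 (𝒹 (-1) c₁) := hβ.isCochain_hochschild hc₁
  have hf := hg.sub hδ₁
  have hfk : KillsShuffles deg (g - 𝒹 (-1) c₁) := fun u v hu hv => by
    rw [sub_apply, hgk u v hu hv, hβ.killsShuffles_hochschild hc₁ hs hk₁ u v hu hv, sub_zero]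
  have hδf : 𝒹 0 (g - 𝒹 (-1) c₁) = 𝒹 0 g := by
    have h := hβ.hochschild_hochschild hc₁ hs
    rw [show (1 : ℤ) + -1 = 0 by rfl] at h
    rw [hochschild_sub, h, sub_zero]
  obtain ⟨c₂, hc₂, hk₂, hn₂, hω₂⟩ := hβ.exists_cyclic hω hf hs hfk hn₁ (by rw [hδf]; exact hδω)
  have hδ₂ : IsCochain deg (s + 1) 0 (𝒹 (-1) c₂) := hβ.isCochain_hochschild hc₂
  have hq := hf.sub hδ₂
  have hqk : KillsShuffles deg (g - 𝒹 (-1) c₁ - 𝒹 (-1) c₂) := fun u v hu hv => by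
      rw [sub_apply, hfk u v hu hv, hβ.killsShuffles_hochschild hc₂ hs hk₂ u v hu hv, sub_zero]
  have hqn : ∀ t ∈ wordsWith F o, (g - 𝒹 (-1) c₁ - 𝒹 (-1) c₂) t = 0 := fun t ht => by
    rw [sub_apply, hn₁ t ht, hβ.hochschild_normalized hc₂ hs hn₂ ht, sub_zero]
  have hc := hc₁.add hc₂
  have hk : KillsShuffles deg (c₁ + c₂) := fun u v hu hv => by
    rw [add_apply, hk₁ u v hu hv, hk₂ u v hu hv, add_zero]
  have hqc : g - 𝒹 (-1) c₁ - 𝒹 (-1) c₂ = g - 𝒹 (-1) (c₁ + c₂) := by rw [hochschild_add]; abel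
  rw [hqc] at hq hqk hqn hω₂
  generalize c₁ + c₂ = c at hc hk hq hqk hqn hω₂
  have hqL := hq.isGaugeLie hr hqk hqn hω₂
  -- This graded commutator commutes with `C` because `C` has square zero, so its exponentials are
  -- automorphisms of `C`. Its leading component is the differential of `c`, which can therefore be
  -- removed from the isotopy without changing the target.
  obtain ⟨K, hK⟩ : ∃ K, K = C * κ (-1) c + κ (-1) c * C := ⟨_, rfl⟩
  have hK' : K = C * κ (-1) c - sgn F (1 * -1) • (κ (-1) c * C) := by
    rw [hK, sgn_odd (by decide)]; module
  have hKl : Lowers s K := by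
    have hl := hc.lowers hs
    rw [hK]
    exact ((hC.lowers.mul hl).mono (by omega)).add ((hl.mul hC.lowers).mono (by omega))
  have hKc : IsCoder deg 0 K := by
    rw [hK']; exact hC.isCoder.bracket (hc.isCoder hs) hC.homDeg hc.homDeg_coder
  have hKL : IsGaugeLie deg ⊥ 0 K := by
    refine ⟨hKc, ?_, ?_, hKl.mono (by omega), fun t ht => ?_, fun t ht => ?_, fun t => rfl⟩
    · rw [hK]
      exact HomDeg.add deg (hC.homDeg.mul deg hc.homDeg_coder) (hc.homDeg_coder.mul deg hC.homDeg)
    · rw [hK']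
      exact hC.shuffleDer.bracket (hc.isShuffleDer hs hk) hC.homDeg hc.homDeg_coder
    · rw [(mem_bot F).1 ht, map_zero]; exact zero_mem _
    · rw [(mem_bot F).1 ht, map_zero, map_zero]
  have hKr : ∀ w : List I, w.length < s + 1 → K (Ξ w) = 0 := fun w hw =>
    hKc.eq_zero (fun v hv => letterProj_of_mem_lenLT_one (lenLT_mono (by omega) (hKl v))) w hw
  have hKδ : ∀ w : List I, w.length = s + 1 → ϖ (K (Ξ w)) = 𝒹 (-1) c (Ξ w) := by
    intro w hw
    have h1 : ϖ (C (κ (-1) c (Ξ w))) = β (κ (-1) c (Ξ w)) :=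
      hC.letterProj_apply hβ (lenLT_mono (by omega) (hc.lowers hs w))
    have h2 : c (C (Ξ w)) = c (κ 1 β (Ξ w)) := by
      rw [← sub_eq_zero, ← map_sub, ← sub_apply]
      exact hc.eq_zero_of_mem_lenLT (lenLT_mono (by omega) (hC.lowers_sub hβ w))
    rw [hK, add_apply, map_add, End.mul_apply, End.mul_apply, h1, ← End.mul_apply ϖ,
      hc.letterProj_coder hs, h2, hochschild,
      sub_apply, smul_apply, End.mul_apply, End.mul_apply,
      sgn_odd (by decide)]
    module
  have hCK : C * K = K * C := by
    rw [hK, mul_add, add_mul, ← mul_assoc, hC.square, zero_mul, zero_add, mul_assoc _ C C, hC.square,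
      mul_zero, add_zero, mul_assoc]
  refine ⟨g - 𝒹 (-1) c, expL (-K) * expL L, hq, hqn, hqL, hKL.neg.exp.mul hU, fun t => ?_,
    fun w hw => ?_⟩
  · obtain ⟨n, hn⟩ := exists_mem_lenLT (expL L t)
    have hint : Intertwines C C n (-K) := fun x _ => by
      rw [neg_apply, neg_apply, map_neg, ← End.mul_apply, hCK, End.mul_apply]
    rw [End.mul_apply, End.mul_apply, ← hCU t]
    exact intertwines_expL (hC.lowers.mono (Nat.zero_le 1)) hKL.neg.lowers hint _
      (lenLT_mono (Nat.le_succ n) hn)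
  · refine (hKL.neg.exp.mul hU).coalgHom.eqOn hqL.exp.coalgHom (n := s + 1 + 1) (fun v hv => ?_) w hw
    have hone : IsGaugeGroup deg (⊥ : Submodule F Λ) 0 1 := .one
    have e1 := letterProj_mul_expL hKL.neg.exp hr hLl hL0 (w := v) (by omega)
    have e2 := letterProj_mul_expL hone hr (D := -K) (by simpa using hKl.neg) (fun w hw => by
      rw [neg_apply, hKr w hw, neg_zero]) (w := v) (by omega)
    have e3 := letterProj_mul_expL hone hr (D := κ 0 (g - 𝒹 (-1) c))
      (hq.lowers (by omega)) (fun w hw => hq.coder_eq_zero hw) (w := v) (by omega)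
    rw [End.one_apply] at e2 e3
    rw [End.mul_apply, e1, e2, e3, End.one_apply, ← End.mul_apply _ (coder _ _ _),
      hq.letterProj_coder (by omega), sub_apply, ← hgL _ (word_mem_lenLT hv),
      neg_apply, map_neg]
    by_cases hvl : v.length = s + 1
    · rw [hKδ v hvl]; abel
    · rw [hKr v (by omega), hg.length v hvl, (hβ.isCochain_hochschild hc).length v hvl]; simp

/-- Isotopic unital cyclic models are unital cyclic isotopic. -/
lemma IsUnitalCyclicModel.exists_intertwiner [CharZero F] [Fintype I]
    (hβ : IsUnitalProduct deg β o) (hω : IsCyclicForm deg β N ω)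
    {B : Θ}
    (hA : IsUnitalCyclicModel deg β o ω A) (hB : IsUnitalCyclicModel deg β o ω B)
    (hU : IsGaugeGroup deg ⊥ 0 U) (hBU : ∀ t, B (U t) = U (A t)) :
    ∃ W, IsGaugeGroup deg (wordsWith F o) ω W ∧ ∀ t, B (W t) = W (A t) := by
  -- A state consists of an intermediate model, an isotopy from `A` to it that is the identity on
  -- words shorter than `n + 2`, and a normalized cyclic gauge transformation from it to `B`.
  let P : ℕ → (Θ × Θ × Θ) → Prop := fun n X =>
    IsUnitalCyclicModel deg β o ω X.1 ∧ IsGaugeGroup deg ⊥ 0 X.2.1 ∧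
      IsGaugeGroup deg (wordsWith F o) ω X.2.2 ∧ (∀ t, X.1 (X.2.1 t) = X.2.1 (A t)) ∧
      (∀ t, B (X.2.2 t) = X.2.2 (X.1 t)) ∧
      ∀ w : List I, w.length < n + 2 → X.2.1 (Ξ w) = Ξ w
  have h0 : P 0 (B, U, 1) := ⟨hB, hU, .one, hBU, fun t => rfl, fun w hw => by
    have hone : IsGaugeGroup deg (⊥ : Submodule F Λ) 0 1 := .one
    have := hU.coalgHom.eqOn hone.coalgHom (n := 2) (fun v hv => by
      rw [hU.letterProj_apply (word_mem_lenLT hv), End.one_apply]) w hw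
    rw [this, End.one_apply]⟩
  have hstep : ∀ n (X : {X // P n X}), ∃ Y : {X // P (n + 1) X},
      ∀ w : List I, w.length < n + 2 → Y.1.2.2 (Ξ w) = X.1.2.2 (Ξ w) := by
    rintro n ⟨⟨C, U, W⟩, hC, hU, hW, hCU, hBW, hUn⟩
    dsimp only at hC hU hW hCU hBW hUn
    obtain ⟨q, U', hq, hqn, hqL, hU', hCU', hUq⟩ :=
      hA.exists_gauge hβ hω hC hU hCU (by omega : 2 ≤ n + 2) hUn
    have h1 := expL_mul_expL_neg hqL.lowers
    have h2 := expL_mul_expL_neg hqL.neg.lowers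
    rw [neg_neg] at h2
    -- The leading component `q` is transferred from the isotopy to the gauge transformation, and
    -- the intermediate model is conjugated accordingly.
    refine ⟨⟨(expL (-κ 0 q) * C * expL (κ 0 q), expL (-κ 0 q) * U',
      W * expL (κ 0 q)), hC.conj_expL hβ hq (by omega) hqn hqL,
      hqL.neg.exp.forget.mul hU', hW.mul hqL.exp, fun t => ?_, fun t => ?_, fun w hw => ?_⟩, ?_⟩
    · dsimp only
      rw [End.mul_apply, End.mul_apply, End.mul_apply (expL (-κ 0 q)) U',
        End.mul_apply (expL (-κ 0 q)) U', ← hCU', ← End.mul_apply (expL _)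
        (expL _), h1, End.one_apply]
    · dsimp only
      rw [End.mul_apply, End.mul_apply, End.mul_apply, End.mul_apply, hBW,
        ← End.mul_apply (expL _) (expL _), h1, End.one_apply]
    · dsimp only
      rw [End.mul_apply, hUq w hw, ← End.mul_apply, h2, End.one_apply]
    · intro w hw
      dsimp only
      rw [End.mul_apply]
      congr 1
      rw [expL_apply hqL.lowers (word_mem_lenLT (Nat.lt_succ_self _)), sum_range_succ', sum_eq_zero]
      · simp
      · intro j _
        rw [pow_succ, End.mul_apply, hq.coder_eq_zero hw, map_zero, smul_zero]
  choose next hnext using hstep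
  let X : ∀ n, {X // P n X} := fun n => Nat.rec ⟨_, h0⟩ (fun n X => next n X) n
  have hX : ∀ n, X (n + 1) = next n (X n) := fun n => rfl
  obtain ⟨W, hW, hWn⟩ := exists_limit (fun n => (X n).1.2.2) (fun n => (X n).2.2.2.1)
    fun n w hw => by
      rw [hX n]
      exact hnext n (X n) w (by omega)
  refine ⟨W, hW, fun t => ?_⟩
  obtain ⟨n, hn⟩ := exists_mem_lenLT t
  have hAt : A t ∈ Γ n := lenLT_mono (Nat.sub_le n 1) (hA.lowers.mem hn)
  obtain ⟨-, -, -, h4, h5, h6⟩ := (X n).2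
  -- Where the isotopy of the `n`-th state is the identity, the intermediate model coincides with
  -- `A`, so its gauge transformation intertwines `A` and `B` there.
  have hid : ∀ s ∈ Γ n, (X n).1.2.1 s = s := fun s hs =>
    lenLT_induction (g := 1) (fun w hw => by
      rw [End.one_apply]; exact h6 w (by omega)) hs
  have h7 := h4 t
  rw [hid t hn, hid _ hAt] at h7
  rw [hWn n t hn, hWn n _ hAt, h5, h7]

end Descent

/-! ### Suspension of cochains -/

section Suspension

variable {F H I : Type*} [Field F] [NonUnitalRing H] [Module F H] {𝒜 : ℤ → Submodule F H}

/-- Projection to degree `n` keeps exactly the basis vectors of this degree in an expansion. -/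
lemma homogeneous_mem_span [DirectSum.Decomposition 𝒜] {B : Basis I F H} {deg : I → ℤ}
    (hB : ∀ i, B i ∈ 𝒜 (deg i + 1)) {n : ℤ} {h : H} (hh : h ∈ 𝒜 n) :
    h ∈ span F (B '' {i | deg i + 1 = n}) := by
  classical
  have key : ∀ x : H, ((DirectSum.decompose 𝒜 x n : 𝒜 n) : H) ∈
      span F (B '' {i | deg i + 1 = n}) := by
    intro x
    induction B.mem_span x using span_induction with
    | zero => simp
    | add a b _ _ ha hb =>
      rw [DirectSum.decompose_add, DirectSum.add_apply, Submodule.coe_add]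
      exact add_mem ha hb
    | smul c a _ ha =>
      rw [DirectSum.decompose_smul, DirectSum.smul_apply, Submodule.coe_smul]
      exact Submodule.smul_mem _ _ ha
    | mem x hx =>
      obtain ⟨i, rfl⟩ := hx
      by_cases hi : deg i + 1 = n
      · subst hi
        rw [DirectSum.decompose_of_mem_same _ (hB i)]
        exact subset_span ⟨i, rfl, rfl⟩
      · rw [DirectSum.decompose_of_mem_ne _ (hB i) hi]
        exact zero_mem _
  have := key h
  rwa [DirectSum.decompose_of_mem_same _ hh] at this

/-- The exponent of the sign relating a cochain to its suspension. -/
def suspExp {α : Type*} (deg : α → ℤ) : List α → ℤ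
  | [] => 0
  | x :: w => deg x * w.length + suspExp deg w

lemma suspExp_append {α : Type*} (deg : α → ℤ) (u v : List α) :
    suspExp deg (u ++ v) = suspExp deg u + η u * v.length + suspExp deg v := by
  induction u with
  | nil => simp [suspExp]
  | cons x u ih => simp only [List.cons_append, suspExp, ih, List.length_append, wordDeg_cons]
                   push_cast; ring

/-- Evaluation of a sequence of cochains on a list. -/
def evalList (f : CochainSeq F H) (L : List H) : H := f L.length fun i => L.getD i 0

lemma evalList_eq (f : CochainSeq F H) {L : List H} {n : ℕ} (h : L.length = n) :
    evalList f L = f n fun i => L.getD i 0 := by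
  subst h; rfl

lemma getD_append_cons (u v : List H) (h : H) (n : ℕ) (hn : (u ++ h :: v).length = n) :
    (fun i : Fin n => (u ++ h :: v).getD i 0) =
      Function.update (fun i : Fin n => (u ++ 0 :: v).getD i 0)
        ⟨u.length, by simp at hn; omega⟩ h := by
  funext i
  by_cases hi : i = ⟨u.length, by simp at hn; omega⟩
  · rw [hi, Function.update_self]; simp
  · rw [Function.update_of_ne hi]
    have hi' : (i : ℕ) ≠ u.length := fun e => hi (Fin.ext e)
    rcases lt_or_gt_of_ne hi' with h1 | h1
    · rw [List.getD_append _ _ _ _ h1, List.getD_append _ _ _ _ h1]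
    · rw [List.getD_append_right _ _ _ _ h1.le, List.getD_append_right _ _ _ _ h1.le]
      obtain ⟨m, hm⟩ : ∃ m, (i : ℕ) - u.length = m + 1 := ⟨i - u.length - 1, by omega⟩
      rw [hm]; rfl

/-- Evaluation of a sequence of cochains, as a linear map in one argument. -/
def evalAt (f : CochainSeq F H) (u v : List H) : H →ₗ[F] H where
  toFun h := evalList f (u ++ h :: v)
  map_add' x y := by
    have e : ∀ h, evalList f (u ++ h :: v) = f (u ++ (0 : H) :: v).length
        fun i => (u ++ h :: v).getD i 0 := fun h => evalList_eq f (by simp)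
    rw [e, e, e, getD_append_cons _ _ _ _ (by simp), (f _).map_update_add,
      ← getD_append_cons _ _ _ _ (by simp), ← getD_append_cons _ _ _ _ (by simp)]
  map_smul' c x := by
    have e : ∀ h, evalList f (u ++ h :: v) = f (u ++ (0 : H) :: v).length
        fun i => (u ++ h :: v).getD i 0 := fun h => evalList_eq f (by simp)
    rw [e, e, getD_append_cons _ _ _ _ (by simp), (f _).map_update_smul,
      ← getD_append_cons _ _ _ _ (by simp)]
    rfl

lemma evalAt_apply (f : CochainSeq F H) (u v : List H) (h : H) :
    evalAt f u v h = evalList f (u ++ h :: v) := rfl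

/-- The elements of `H` as combinations of letters. -/
def letterOf (B : Basis I F H) : H →ₗ[F] Λ :=
  B.constr F fun i => Ξ [i]

@[simp] lemma letterOf_basis (B : Basis I F H) (i : I) :
    letterOf B (B i) = Ξ [i] := B.constr_basis F _ i

/-- The element of `H` given by the component of length one. -/
def ofLetter (B : Basis I F H) : Λ →ₗ[F] H :=
  wordLift F fun w => match w with
    | [i] => B i
    | _ => 0

@[simp] lemma ofLetter_singleton (B : Basis I F H) (i : I) :
    ofLetter B (Ξ [i]) = B i := by simp [ofLetter]

@[simp] lemma ofLetter_letterOf (B : Basis I F H) (h : H) : ofLetter B (letterOf B h) = h := by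
  have : ofLetter B ∘ₗ letterOf B = LinearMap.id := B.ext fun i => by simp
  exact LinearMap.congr_fun this h

lemma letterOf_injective (B : Basis I F H) : Function.Injective (letterOf B) :=
  Function.LeftInverse.injective (ofLetter_letterOf B)

lemma letterOf_ofLetter (B : Basis I F H) (t : Λ) : letterOf B (ofLetter B t) = ϖ t := by
  have : letterOf B ∘ₗ ofLetter B = ϖ := by
    apply word_hom_ext; intro w
    match w with
    | [] => simp [ofLetter, letterProj]
    | [x] => simp
    | x :: y :: w => simp [ofLetter]
  exact LinearMap.congr_fun this t

@[simp] lemma letterProj_letterOf (B : Basis I F H) (h : H) : ϖ (letterOf B h) = letterOf B h := by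
  rw [← letterOf_ofLetter B (letterOf B h), ofLetter_letterOf]

lemma letterOf_mem [DirectSum.Decomposition 𝒜] {B : Basis I F H} {deg : I → ℤ}
    (hB : ∀ i, B i ∈ 𝒜 (deg i + 1)) {n : ℤ} {h : H} (hh : h ∈ 𝒜 n) :
    letterOf B h ∈ lettersOfDeg F deg (n - 1) := by
  have := homogeneous_mem_span hB hh
  clear hh
  induction this using span_induction with
  | mem x hx =>
    obtain ⟨i, hi, rfl⟩ := hx
    rw [letterOf_basis]
    exact subset_span ⟨i, by simpa using (eq_sub_of_add_eq hi), rfl⟩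
  | zero => simp
  | add a b _ _ ha hb => rw [map_add]; exact add_mem ha hb
  | smul c a _ ha => rw [map_smul]; exact Submodule.smul_mem _ _ ha

lemma ofLetter_mem {B : Basis I F H} {deg : I → ℤ}
    (hB : ∀ i, B i ∈ 𝒜 (deg i + 1)) {n : ℤ} {y : Λ} (hy : y ∈ lettersOfDeg F deg n) :
    ofLetter B y ∈ 𝒜 (n + 1) := by
  induction hy using span_induction with
  | mem x hx =>
    obtain ⟨i, hi, rfl⟩ := hx
    simp only [Set.mem_ofPred_eq] at hi
    subst hi
    simpa using hB i
  | zero => simp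
  | add a b _ _ ha hb => rw [map_add]; exact add_mem ha hb
  | smul c a _ ha => rw [map_smul]; exact Submodule.smul_mem _ _ ha

lemma scale_of_mem_lettersOfDeg {deg : I → ℤ} {n : ℤ} {y : Λ}
    (hy : y ∈ lettersOfDeg F deg n) (z : Fˣ) : scale deg z y = ((z ^ n : Fˣ) : F) • y := by
  induction hy using span_induction with
  | mem x hx =>
    obtain ⟨i, hi, rfl⟩ := hx
    simp only [Set.mem_ofPred_eq] at hi
    simp [← hi]
  | zero => simp
  | add a b _ _ ha hb => rw [map_add, ha, hb, smul_add]
  | smul c a _ ha => rw [map_smul, ha, smul_comm]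

/-- Homogeneous elements. -/
abbrev Homog (𝒜 : ℤ → Submodule F H) : Type _ := Σ n : ℤ, 𝒜 n

/-- The suspended degree of a homogeneous element. -/
def homogDeg (𝒜 : ℤ → Submodule F H) (p : Homog 𝒜) : ℤ := p.1 - 1

/-- The underlying list of elements. -/
def vals (L : List (Homog 𝒜)) : List H := L.map fun p => (p.2 : H)

@[simp] lemma vals_nil : vals ([] : List (Homog 𝒜)) = [] := rfl

@[simp] lemma vals_cons (p : Homog 𝒜) (L : List (Homog 𝒜)) :
    vals (p :: L) = (p.2 : H) :: vals L := rfl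

@[simp] lemma vals_append (L M : List (Homog 𝒜)) : vals (L ++ M) = vals L ++ vals M := by
  simp [vals]

@[simp] lemma length_vals (L : List (Homog 𝒜)) : (vals L).length = L.length := by simp [vals]

/-- The tensor product of homogeneous elements, as an element of the word space on a basis. -/
def tens (𝒜 : ℤ → Submodule F H) (B : Basis I F H) :
    WordSpace F (Homog 𝒜) →ₗ[F] Λ :=
  wordLift F fun L => (L.map fun p => letterOf B (p.2 : H)).prod

@[simp] lemma tens_nil (B : Basis I F H) : tens 𝒜 B 1 = 1 := by simp [tens]

@[simp] lemma tens_cons (B : Basis I F H) (p : Homog 𝒜) (L : List (Homog 𝒜)) :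
    tens 𝒜 B (Ξ (p :: L)) = letterOf B (p.2 : H) * tens 𝒜 B (Ξ L) := by
  simp [tens]

lemma tens_append (B : Basis I F H) (L M : List (Homog 𝒜)) :
    tens 𝒜 B (Ξ (L ++ M)) = tens 𝒜 B (Ξ L) * tens 𝒜 B (Ξ M) := by
  simp [tens]

/-- A word in the letters of a homogeneous basis as a list of homogeneous elements. -/
def homogWord {B : Basis I F H} {deg : I → ℤ} (hB : ∀ i, B i ∈ 𝒜 (deg i + 1))
    (w : List I) : List (Homog 𝒜) := w.map fun i => ⟨deg i + 1, B i, hB i⟩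

section HomogWord

variable {B : Basis I F H} {deg : I → ℤ} (hB : ∀ i, B i ∈ 𝒜 (deg i + 1))

@[simp] lemma length_homogWord (w : List I) : (homogWord hB w).length = w.length := by
  simp [homogWord]

@[simp] lemma vals_homogWord (w : List I) : vals (homogWord hB w) = w.map B := by
  simp [homogWord, vals]

@[simp] lemma wordDeg_homogWord (w : List I) : wordDeg (homogDeg 𝒜) (homogWord hB w) = η w := by
  induction w with
  | nil => rfl
  | cons x w ih => simp only [homogWord, List.map_cons, wordDeg_cons, homogDeg] at ih ⊢
                   rw [ih]; ring

@[simp] lemma tens_homogWord (w : List I) : tens 𝒜 B (Ξ (homogWord hB w)) = Ξ w := by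
  induction w with
  | nil => simp [homogWord, word_nil]
  | cons x w ih =>
    rw [homogWord, List.map_cons, tens_cons]
    rw [homogWord] at ih
    rw [ih, letterOf_basis, ← word_cons]

@[simp] lemma suspExp_homogWord (w : List I) :
    suspExp (homogDeg 𝒜) (homogWord hB w) = suspExp deg w := by
  induction w with
  | nil => rfl
  | cons x w ih =>
    simp only [homogWord, List.map_cons, suspExp, homogDeg, List.length_map] at ih ⊢
    rw [ih]; ring

end HomogWord

/-- The suspension of a sequence of cochains, as an operator with values in letters. -/
def suspend (B : Basis I F H) (deg : I → ℤ) (f : CochainSeq F H) :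
    Θ :=
  wordLift F fun w => sgn F (suspExp deg w) • letterOf B (evalList f (w.map B))

set_option hygiene false in
/-- The suspension of a sequence of cochains. -/
notation "𝔰" => suspend B deg

lemma suspend_word (B : Basis I F H) (deg : I → ℤ) (f : CochainSeq F H) (w : List I) :
    𝔰 f (Ξ w) = sgn F (suspExp deg w) • letterOf B (evalList f (w.map B)) := by
  simp [suspend]

lemma letterProj_suspend (B : Basis I F H) (deg : I → ℤ) (f : CochainSeq F H) : ϖ * 𝔰 f = 𝔰 f := by
  apply word_hom_ext; intro w
  rw [End.mul_apply, suspend_word, map_smul, letterProj_letterOf]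

lemma suspend_one (B : Basis I F H) (deg : I → ℤ) {f : CochainSeq F H} (hf : f 0 = 0) :
    𝔰 f 1 = 0 := by
  rw [← word_nil, suspend_word, List.map_nil, evalList_eq f (n := 0) rfl, hf]
  simp

lemma decon_tens (B : Basis I F H) (L : List (Homog 𝒜)) : Δ (tens 𝒜 B (Ξ L)) =
      cutSum (fun u v => tens 𝒜 B (Ξ u) ⊗ₜ tens 𝒜 B (Ξ v)) L := by
  induction L with
  | nil => simp [word_nil, decon_nil]
  | cons p L ih =>
    rw [tens_cons, decon_letter_mul (letterProj_letterOf B _), ih, cutSum_cons, map_cutSum]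
    simp [word_nil]

lemma conv_tens (B : Basis I F H) (X Y : Θ) (L : List (Homog 𝒜)) : conv X Y (tens 𝒜 B (Ξ L)) =
      cutSum (fun u v => X (tens 𝒜 B (Ξ u)) * Y (tens 𝒜 B (Ξ v))) L := by
  simp [conv, decon_tens, map_cutSum]

variable [DirectSum.Decomposition 𝒜]

/-- The homogeneous arguments are expanded in the basis one after the other and moved from the list
to the word. The sign depends on degrees only, so it is the same for all basis vectors in one
expansion. -/
lemma suspend_tens_aux {B : Basis I F H} {deg : I → ℤ} (hB : ∀ i, B i ∈ 𝒜 (deg i + 1))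
    (f : CochainSeq F H) (L : List (Homog 𝒜)) (u : List I) :
    𝔰 f (Ξ u * tens 𝒜 B (Ξ L)) = sgn F (suspExp deg u + η u * L.length + suspExp (homogDeg 𝒜) L) •
        letterOf B (evalList f (u.map B ++ vals L)) := by
  induction L generalizing u with
  | nil => simp [word_nil, suspend_word, suspExp]
  | cons p L ih =>
    obtain ⟨n, h, hh⟩ := p
    rw [tens_cons]
    simp only [vals_cons, suspExp, List.length_cons, homogDeg]
    have hspan := homogeneous_mem_span hB hh
    rw [← evalAt_apply]
    clear hh
    induction hspan using span_induction with
    | mem x hx =>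
      obtain ⟨i, hi, rfl⟩ := hx
      simp only [Set.mem_ofPred_eq] at hi
      subst hi
      have := ih (u ++ [i])
      rw [letterOf_basis, ← mul_assoc, word_mul_word, this, evalAt_apply]
      congr 1
      · apply sgn_congr
        simp only [suspExp_append, suspExp, wordDeg_append, wordDeg_cons, wordDeg_nil,
          List.length_cons, List.length_nil]
        push_cast
        simp only [Int.even_add, Int.even_mul, Int.even_sub]
        grind
      · simp
    | zero => simp
    | add a b _ _ ha hb => rw [map_add, add_mul, mul_add, map_add, ha, hb, map_add, map_add,
        smul_add]
    | smul c a _ ha => rw [map_smul, smul_mul_assoc, mul_smul_comm, map_smul, ha, map_smul,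
        map_smul, smul_comm]

/-- The suspension of a cochain, evaluated on homogeneous elements. -/
lemma suspend_tens {B : Basis I F H} {deg : I → ℤ} (hB : ∀ i, B i ∈ 𝒜 (deg i + 1))
    (f : CochainSeq F H) (L : List (Homog 𝒜)) :
    𝔰 f (tens 𝒜 B (Ξ L)) = sgn F (suspExp (homogDeg 𝒜) L) • letterOf B (evalList f (vals L)) := by
  have := suspend_tens_aux hB f L []
  simpa [word_nil, suspExp] using this

lemma scale_tens {B : Basis I F H} {deg : I → ℤ} (hB : ∀ i, B i ∈ 𝒜 (deg i + 1)) (z : Fˣ)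
    (L : List (Homog 𝒜)) : scale deg z (tens 𝒜 B (Ξ L)) =
      ((z ^ wordDeg (homogDeg 𝒜) L : Fˣ) : F) • tens 𝒜 B (Ξ L) := by
  induction L with
  | nil => simp [word_nil]
  | cons p L ih =>
    rw [tens_cons, scale_mul, ih, scale_of_mem_lettersOfDeg (letterOf_mem hB p.2.2),
      smul_mul_smul_comm, wordDeg_cons, zpow_add, Units.val_mul, homogDeg]

lemma par_tens {B : Basis I F H} {deg : I → ℤ} (hB : ∀ i, B i ∈ 𝒜 (deg i + 1)) (c : ℤ)
    (L : List (Homog 𝒜)) : par deg c (tens 𝒜 B (Ξ L)) =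
      sgn F (c * wordDeg (homogDeg 𝒜) L) • tens 𝒜 B (Ξ L) := by
  rw [par, scale_tens hB, sgn, zpow_mul]

lemma tens_shuffle {B : Basis I F H} {deg : I → ℤ} (hB : ∀ i, B i ∈ 𝒜 (deg i + 1))
    (L M : List (Homog 𝒜)) : tens 𝒜 B (shuffle F (homogDeg 𝒜) L M) =
      Ш (tens 𝒜 B (Ξ L)) (tens 𝒜 B (Ξ M)) := by
  have hone : ∀ t, Ш 1 t = t := fun t => by
    have : Ш 1 = LinearMap.id := word_hom_ext fun w => by rw [← word_nil, shuffleMul_word]; simp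
    exact LinearMap.congr_fun this t
  have hone' : ∀ t, Ш t 1 = t := fun t => by
    have : Ш.flip 1 = LinearMap.id := word_hom_ext fun w => by
      rw [← word_nil, LinearMap.flip_apply, shuffleMul_word]; simp
    exact LinearMap.congr_fun this t
  have hcons : ∀ (p : Homog 𝒜) (t : WordSpace F (Homog 𝒜)),
      tens 𝒜 B (consL F p t) = letterOf B (p.2 : H) * tens 𝒜 B t := by
    intro p t
    induction t using word_induction with
    | h0 => simp
    | hadd a b ha hb => simp only [map_add, ha, hb, mul_add]
    | hw c w => rw [map_smul, map_smul, consL_word, tens_cons, map_smul, mul_smul_comm]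
  induction L, M using shuffle.induct with
  | case1 v => simp [word_nil, hone]
  | case2 x u => simp [word_nil, hone']
  | case3 x u y v ih1 ih2 =>
    rw [shuffle_cons_cons, map_add, map_smul, hcons, hcons, ih1, ih2, tens_cons B x u, tens_cons B y v,
      shuffleMul_letter_mul (letterProj_letterOf B _) (letterOf_mem hB y.2.2), ← tens_cons B x u,
      ← tens_cons B y v, par_tens hB, map_smul, smul_apply, mul_smul_comm]
    rfl

end Suspension

/-! ### Shuffle permutations -/

section ShufflePerm

/-- The permutation sending `i` to `0` and acting by `τ` on the other elements. -/
def insertPerm {n : ℕ} (i : Fin (n + 1)) (τ : Equiv.Perm (Fin n)) : Equiv.Perm (Fin (n + 1)) :=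
  (finSuccEquiv' i).trans ((Equiv.optionCongr τ).trans (finSuccEquiv' 0).symm)

variable {n : ℕ} (i : Fin (n + 1)) (τ : Equiv.Perm (Fin n))

@[simp] lemma insertPerm_self : insertPerm i τ i = 0 := by simp [insertPerm]

@[simp] lemma insertPerm_succAbove (q : Fin n) :
    insertPerm i τ (i.succAbove q) = (τ q).succ := by simp [insertPerm]

@[simp] lemma insertPerm_symm_zero : (insertPerm i τ).symm 0 = i := by
  rw [Equiv.symm_apply_eq, insertPerm_self]

@[simp] lemma insertPerm_symm_succ (q : Fin n) :
    (insertPerm i τ).symm q.succ = i.succAbove (τ.symm q) := by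
  rw [Equiv.symm_apply_eq, insertPerm_succAbove, Equiv.apply_symm_apply]

lemma insertPerm_bijective :
    Function.Bijective fun p : Fin (n + 1) × Equiv.Perm (Fin n) => insertPerm p.1 p.2 := by
  rw [Fintype.bijective_iff_injective_and_card]
  constructor
  · rintro ⟨i, τ⟩ ⟨j, ρ⟩ h
    simp only at h
    have hij : i = j := by rw [← insertPerm_symm_zero i τ, h, insertPerm_symm_zero]
    subst hij
    congr 1
    ext1 q
    have := insertPerm_succAbove i τ q
    rw [h, insertPerm_succAbove] at this
    exact (Fin.succ_injective _ this).symm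
  · simp [Fintype.card_perm, Nat.factorial_succ]

lemma sum_insertPerm {M : Type*} [AddCommMonoid M] (f : Equiv.Perm (Fin (n + 1)) → M) :
    ∑ σ, f σ = ∑ i : Fin (n + 1), ∑ τ : Equiv.Perm (Fin n), f (insertPerm i τ) := by
  rw [← Fintype.sum_prod_type']
  exact (Fintype.sum_bijective _ insertPerm_bijective _ _ fun _ => rfl).symm

lemma isShuffle_insertPerm_zero {k : ℕ} : IsShuffle (k + 1) (insertPerm 0 τ) ↔ IsShuffle k τ := by
  constructor
  · intro h q r hqr hk
    have := h q.succ r.succ (Fin.succ_lt_succ_iff.2 hqr) (by simp; omega)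
    rw [← Fin.zero_succAbove, ← Fin.zero_succAbove, insertPerm_succAbove, insertPerm_succAbove]
      at this
    exact Fin.succ_lt_succ_iff.1 this
  · intro h q r hqr hk
    have hr : r ≠ 0 := fun e => by subst e; exact absurd hqr (Fin.not_lt_zero _)
    obtain ⟨r, rfl⟩ := Fin.exists_succ_eq.2 hr
    rw [← Fin.zero_succAbove r, insertPerm_succAbove]
    by_cases hq : q = 0
    · subst hq; rw [insertPerm_self]; exact Fin.succ_pos _
    · obtain ⟨q, rfl⟩ := Fin.exists_succ_eq.2 hq
      rw [← Fin.zero_succAbove q, insertPerm_succAbove]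
      refine Fin.succ_lt_succ_iff.2 (h q r (Fin.succ_lt_succ_iff.1 hqr) ?_)
      simp at hk; omega

lemma isShuffle_insertPerm_same {k : ℕ} (hk : (i : ℕ) = k) :
    IsShuffle k (insertPerm i τ) ↔ IsShuffle k τ := by
  have hval : ∀ q : Fin n, ((i.succAbove q : Fin (n + 1)) : ℕ) =
      if (q : ℕ) < k then (q : ℕ) else q + 1 := by
    intro q
    rw [Fin.succAbove]
    split_ifs with h1 h2 h2
    · rfl
    · exact absurd h1 (by rw [Fin.lt_def]; simp; omega)
    · exact absurd (by rw [Fin.lt_def]; simp; omega) h1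
    · rfl
  constructor
  · intro h q r hqr hc
    have := h (i.succAbove q) (i.succAbove r) (Fin.succAbove_lt_succAbove_iff.2 hqr) (by
      rw [hval, hval]; split_ifs <;> omega)
    rw [insertPerm_succAbove, insertPerm_succAbove] at this
    exact Fin.succ_lt_succ_iff.1 this
  · intro h q r hqr hc
    have hri : r ≠ i := by
      rintro rfl
      rw [Fin.lt_def] at hqr; omega
    obtain ⟨r, rfl⟩ := Fin.exists_succAbove_eq hri
    rw [insertPerm_succAbove]
    by_cases hq : q = i
    · subst hq; rw [insertPerm_self]; exact Fin.succ_pos _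
    · obtain ⟨q, rfl⟩ := Fin.exists_succAbove_eq hq
      rw [insertPerm_succAbove]
      refine Fin.succ_lt_succ_iff.2 (h q r (Fin.succAbove_lt_succAbove_iff.1 hqr) ?_)
      rw [hval, hval] at hc
      split_ifs at hc <;> omega

/-- The element sent to `0` must be the first of its block, since its predecessor would have to be
sent below `0`. Thus two families of permutations contribute, corresponding to the two terms of the
shuffle recursion. -/
lemma not_isShuffle_insertPerm {k : ℕ} (hi : (i : ℕ) ≠ 0) (hk : (i : ℕ) ≠ k) :
    ¬ IsShuffle k (insertPerm i τ) := by
  intro h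
  have hlt : (⟨(i : ℕ) - 1, by omega⟩ : Fin (n + 1)) < i :=
    Fin.lt_def.2 (by change (i : ℕ) - 1 < i; omega)
  have := h _ i hlt (by change (i : ℕ) < k ∨ k ≤ (i : ℕ) - 1; omega)
  rw [insertPerm_self] at this
  exact absurd this (Fin.not_lt_zero _)

lemma isShuffle_trivial {k : ℕ} (hk : k = 0 ∨ k = n) (σ : Equiv.Perm (Fin n)) :
    IsShuffle k σ ↔ σ = 1 := by
  constructor
  · intro h
    have hm : StrictMono σ := fun q r hqr => h q r hqr (by have := r.2; omega)
    apply Equiv.ext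
    have := (hm.range_inj strictMono_id).1 (by simp [σ.surjective.range_eq])
    exact fun x => congrFun this x
  · rintro rfl q r hqr _
    exact hqr

variable {F : Type*} [Field F]

/-- The sign of a permutation of homogeneous elements, as a scalar. -/
def permSgn (F : Type*) [Field F] (d : Fin n → ℤ) (σ : Equiv.Perm (Fin n)) : F :=
  ∏ q : Fin n, ∏ r : Fin n, if q < r ∧ σ r < σ q then sgn F (1 + d q * d r) else 1

lemma shuffleSign_smul {M : Type*} [AddCommGroup M] [Module F M] (d : Fin n → ℤ)
    (σ : Equiv.Perm (Fin n)) (x : M) : shuffleSign d σ • x = permSgn F d σ • x := by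
  have : (((shuffleSign d σ : ℤˣ) : ℤ) : F) = permSgn F d σ := by
    simp only [shuffleSign, permSgn, Units.coe_prod, Int.cast_prod]
    refine Finset.prod_congr rfl fun q _ => Finset.prod_congr rfl fun r _ => ?_
    split_ifs
    · rcases Int.even_or_odd (1 + d q * d r) with h | h
      · simp [Int.negOnePow_even _ h, sgn_even h]
      · simp [Int.negOnePow_odd _ h, sgn_odd h]
    · simp
  rw [← this, Int.cast_smul_eq_zsmul, Units.smul_def]

@[simp] lemma permSgn_one (d : Fin n → ℤ) : permSgn F d 1 = 1 := by
  refine Finset.prod_eq_one fun q _ => Finset.prod_eq_one fun r _ => if_neg ?_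
  rintro ⟨h1, h2⟩
  exact lt_asymm h1 h2

/-- The element that becomes first forms an inversion with exactly the elements in front of it. -/
lemma permSgn_insertPerm (d : Fin (n + 1) → ℤ) : permSgn F d (insertPerm i τ) =
    (∏ q : Fin (n + 1), if q < i then sgn F (1 + d q * d i) else 1) *
      permSgn F (fun q => d (i.succAbove q)) τ := by
  rw [permSgn, Fin.prod_univ_succAbove _ i, Finset.prod_eq_one, one_mul]
  · rw [Fin.prod_univ_succAbove _ i, if_neg (lt_irrefl i), one_mul, permSgn,
      ← Finset.prod_mul_distrib]
    refine Finset.prod_congr rfl fun q _ => ?_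
    rw [Fin.prod_univ_succAbove _ i]
    congr 1
    · simp
    · refine Finset.prod_congr rfl fun r _ => ?_
      simp only [insertPerm_succAbove, Fin.succAbove_lt_succAbove_iff, Fin.succ_lt_succ_iff]
  · intro r _
    rw [if_neg]
    rintro ⟨-, h⟩
    rw [insertPerm_self] at h
    exact absurd h (Fin.not_lt_zero _)

variable {J : Type*} (deg : J → ℤ)

lemma prod_map_sgn (y : ℤ) (u : List J) : (u.map fun p => sgn F (1 + (deg p + 1) * (y + 1))).prod =
      sgn F (η u + y * η u + y * u.length) := by
  induction u with
  | nil => simp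
  | cons x u ih =>
    rw [List.map_cons, List.prod_cons, ih, ← sgn_add]
    apply sgn_congr
    simp only [wordDeg_cons, List.length_cons]
    push_cast
    simp only [Int.even_add, Int.even_mul]
    grind

lemma ofFn_insertPerm (a : Fin (n + 1) → J) : List.ofFn (fun j => a ((insertPerm i τ).symm j)) =
      a i :: List.ofFn fun j => a (i.succAbove (τ.symm j)) := by
  rw [List.ofFn_succ]; simp

lemma ofFn_succAbove {i : Fin (n + 1)} (a : Fin (n + 1) → J) :
    List.ofFn a = (List.ofFn fun j => a (i.succAbove j)).take i ++
      a i :: (List.ofFn fun j => a (i.succAbove j)).drop i := by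
  apply List.ext_getElem
  · simp; omega
  · intro m h1 h2
    have hi := i.2
    simp only [List.length_ofFn] at h1
    rw [List.getElem_append]
    simp only [List.length_take, List.length_ofFn, List.getElem_ofFn, List.getElem_take]
    split_ifs with h
    · congr 1
      rw [Fin.succAbove_of_castSucc_lt _ _ (by rw [Fin.lt_def]; simp; omega)]
      rfl
    · rw [List.getElem_cons]
      split_ifs with h'
      · congr 1; ext; simp; omega
      · simp only [List.getElem_drop, List.getElem_ofFn]
        congr 1
        rw [Fin.succAbove_of_le_castSucc _ _ (by rw [Fin.le_def]; simp only [Fin.val_castSucc]; omega)]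
        ext; simp
        try omega

open Classical in
/-- The sum over shuffle permutations as a shuffle product of words. -/
lemma sum_isShuffle {M : Type*} [AddCommGroup M] [Module F M] (n k : ℕ) (hk : k ≤ n)
    (a : Fin n → J) (Y : WordSpace F J →ₗ[F] M) :
    ∑ σ : Equiv.Perm (Fin n) with IsShuffle k σ, permSgn F (fun q => deg (a q) + 1) σ •
        sgn F (suspExp deg (List.ofFn fun j => a (σ.symm j))) •
          Y (Ξ (List.ofFn fun j => a (σ.symm j))) =
      sgn F (suspExp deg (List.ofFn a)) • Y (ш ((List.ofFn a).take k) ((List.ofFn a).drop k)) := by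
  induction n generalizing k Y with
  | zero =>
    obtain rfl : k = 0 := by omega
    simp only [isShuffle_trivial (Or.inl rfl)]
    rw [sum_filter, Finset.sum_ite_eq' Finset.univ 1]
    simp
  | succ n ih =>
    by_cases h0 : k = 0 ∨ k = n + 1
    · simp only [isShuffle_trivial h0]
      rw [sum_filter, Finset.sum_ite_eq' Finset.univ 1, if_pos (Finset.mem_univ _), permSgn_one,
        one_smul]
      have hsymm : (Equiv.symm (1 : Equiv.Perm (Fin (n + 1)))) = 1 := rfl
      simp only [hsymm, Equiv.Perm.coe_one, id_eq]
      rcases h0 with rfl | rfl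
      · simp
      · have e1 : (List.ofFn a).take (n + 1) = List.ofFn a := by simp
        have e2 : (List.ofFn a).drop (n + 1) = [] := by simp
        rw [e1, e2]; simp
    · obtain ⟨m, rfl⟩ : ∃ m, k = m + 1 := ⟨k - 1, by omega⟩
      set i : Fin (n + 1) := ⟨m + 1, by omega⟩ with hi
      have hi0 : (0 : Fin (n + 1)) ≠ i := by rw [Ne, Fin.ext_iff, hi]; simp
      rw [sum_filter, sum_insertPerm, Finset.sum_eq_add (0 : Fin (n + 1)) i hi0]
      · have hz : ∀ τ : Equiv.Perm (Fin n), permSgn F (fun q => deg (a q) + 1) (insertPerm 0 τ) =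
            permSgn F (fun q => deg (a q.succ) + 1) τ := by
          intro τ
          rw [permSgn_insertPerm]
          simp
        have hs : ∀ τ, IsShuffle (m + 1) (insertPerm i τ) ↔ IsShuffle (m + 1) τ :=
          fun τ => isShuffle_insertPerm_same i τ rfl
        simp only [isShuffle_insertPerm_zero, hs, ofFn_insertPerm, hz, permSgn_insertPerm i,
          Fin.zero_succAbove]
        rw [← sum_filter, ← sum_filter]
        have ih1 := ih m (by omega) (fun q => a q.succ) (Y ∘ₗ consL F (a 0))
        have ih2 := ih (m + 1) (by omega) (fun q => a (i.succAbove q)) (Y ∘ₗ consL F (a i))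
        simp only [comp_apply, consL_word] at ih1 ih2
        have hl : ∀ (x : J) (b : Fin n → J), sgn F (suspExp deg (x :: List.ofFn b)) =
            sgn F (deg x * n) * sgn F (suspExp deg (List.ofFn b)) := by
          intro x b; rw [← sgn_add]; simp [suspExp]
        have hp : (∏ q : Fin (n + 1), if q < i then
            sgn F (1 + (deg (a q) + 1) * (deg (a i) + 1)) else 1) =
            (((List.ofFn a).take i).map fun p =>
              sgn F (1 + (deg p + 1) * (deg (a i) + 1))).prod := by
          rw [List.map_take, List.map_ofFn, List.prod_take_ofFn, Finset.prod_filter]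
          rfl
        rw [hp, prod_map_sgn]
        simp only [hl, mul_smul]
        simp only [smul_comm _ (sgn F (deg (a 0) * n)), smul_comm _ (sgn F (deg (a i) * n))]
        simp only [← smul_sum]
        rw [ih1, ih2]
        have ht : (List.ofFn a).take (m + 1) = a 0 :: (List.ofFn fun q : Fin n => a q.succ).take m := by
          rw [List.ofFn_succ, List.take_succ_cons]
        have hd : (List.ofFn a).drop (m + 1) = (List.ofFn fun q : Fin n => a q.succ).drop m := by
          rw [List.ofFn_succ, List.drop_succ_cons]
        have hlen : ((List.ofFn fun j => a (i.succAbove j)).take (m + 1)).length = m + 1 := by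
          simp; omega
        have ht' : (List.ofFn a).take (m + 1) =
            (List.ofFn fun j => a (i.succAbove j)).take (m + 1) := by
          rw [ofFn_succAbove (i := i) a]
          exact List.take_left' hlen
        have hd' : (List.ofFn a).drop (m + 1) = a i ::
            (List.ofFn fun j => a (i.succAbove j)).drop (m + 1) := by
          rw [ofFn_succAbove (i := i) a]
          exact List.drop_left' hlen
        have hs1 : sgn F (suspExp deg (List.ofFn a)) = sgn F (deg (a 0) * n) *
            sgn F (suspExp deg (List.ofFn fun q : Fin n => a q.succ)) := by
          rw [← hl, List.ofFn_succ]
        -- When a letter is moved to the front, the change of the suspension sign turns the sign of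
        -- the permutation times the Koszul sign into the Koszul sign for suspended degrees.
        have hs2 : sgn F (suspExp deg (List.ofFn a)) *
            sgn F (deg (a i) * η ((List.ofFn a).take i)) =
            sgn F (η ((List.ofFn a).take i) + deg (a i) * η ((List.ofFn a).take i) +
              deg (a i) * ((List.ofFn a).take i).length) * sgn F (deg (a i) * n) *
            sgn F (suspExp deg (List.ofFn fun j => a (i.succAbove j))) := by
          have e1 : List.ofFn a = (List.ofFn a).take (m + 1) ++ a i ::
              (List.ofFn fun j => a (i.succAbove j)).drop (m + 1) := by
            rw [← hd', List.take_append_drop]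
          have e2 : (List.ofFn fun j => a (i.succAbove j)) = (List.ofFn a).take (m + 1) ++
              (List.ofFn fun j => a (i.succAbove j)).drop (m + 1) := by
            rw [ht', List.take_append_drop]
          have e3 : (i : ℕ) = m + 1 := rfl
          have e4 : (n : ℤ) = ((List.ofFn a).take (m + 1)).length +
              ((List.ofFn fun j => a (i.succAbove j)).drop (m + 1)).length := by
            simp; omega
          rw [e3]
          conv_lhs => rw [e1]
          conv_rhs => rw [e2]
          rw [e4]
          generalize (List.ofFn fun j => a (i.succAbove j)).drop (m + 1) = v
          have e5 : ∀ w, (((List.ofFn a).take (m + 1)) ++ w).take (m + 1) =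
              (List.ofFn a).take (m + 1) := fun w => List.take_left' (by simp; omega)
          rw [e5]
          generalize (List.ofFn a).take (m + 1) = u
          simp only [← sgn_add]
          apply sgn_congr
          simp only [suspExp_append, suspExp, List.length_cons]
          push_cast
          simp only [Int.even_add, Int.even_mul]
          grind
        rw [ht, hd', shuffle_cons_cons, ← ht, ← hd', map_add, map_smul, smul_add, hd]
        congr 1
        · rw [hs1, mul_smul]
        · rw [smul_smul, smul_smul, smul_smul, ht', ← ht']
          rw [hs2]
          congr 1
          ring
      · intro j _ hj
        refine sum_eq_zero fun τ _ => if_neg ?_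
        refine not_isShuffle_insertPerm j τ (fun h => hj.1 (Fin.ext h)) fun h => hj.2 (Fin.ext h)
      · intro h; exact absurd (Finset.mem_univ _) h
      · intro h; exact absurd (Finset.mem_univ _) h

end ShufflePerm

/-! ### Properties of cochains and of their suspensions -/

section Dictionary

variable {F H I : Type*} [Field F] [NonUnitalRing H] [Module F H] {𝒜 : ℤ → Submodule F H}
  {B : Basis I F H} {deg : I → ℤ}

@[simp] lemma evalList_ofFn (f : CochainSeq F H) {n : ℕ} (a : Fin n → H) :
    evalList f (List.ofFn a) = f n a := by
  rw [evalList_eq f (List.length_ofFn (f := a))]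
  congr 1
  funext i
  simp

lemma vals_ofFn {n : ℕ} (a : Fin n → Homog 𝒜) :
    vals (List.ofFn a) = List.ofFn fun i => ((a i).2 : H) := by
  simp only [vals, List.map_ofFn]; rfl

lemma evalList_add (f g : CochainSeq F H) (L : List H) :
    evalList (f + g) L = evalList f L + evalList g L := rfl

lemma suspend_add (f g : CochainSeq F H) : 𝔰 (f + g) = 𝔰 f + 𝔰 g := by
  apply word_hom_ext; intro w
  simp only [add_apply, suspend_word, evalList_add, map_add, smul_add]

lemma suspend_smul (c : F) (f : CochainSeq F H) : 𝔰 (c • f) = c • 𝔰 f := by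
  apply word_hom_ext; intro w
  have : evalList (c • f) (w.map B) = c • evalList f (w.map B) := rfl
  simp only [smul_apply, suspend_word, this, map_smul]
  rw [smul_comm]

lemma suspend_sub (f g : CochainSeq F H) : 𝔰 (f - g) = 𝔰 f - 𝔰 g := by
  apply word_hom_ext; intro w
  have : evalList (f - g) (w.map B) = evalList f (w.map B) - evalList g (w.map B) := rfl
  simp only [sub_apply, suspend_word, this, map_sub, smul_sub]

/-- A multilinear map is determined by its values on basis vectors, and the suspension signs are
invertible. -/
lemma eq_of_suspend_eq {f g : CochainSeq F H} {n : ℕ}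
    (h : ∀ w : List I, w.length = n → 𝔰 f (Ξ w) = 𝔰 g (Ξ w)) :
    f n = g n := by
  refine Basis.ext_multilinear (fun _ => B) fun v => ?_
  have := h (List.ofFn v) (by simp)
  rw [suspend_word, suspend_word, List.map_ofFn, evalList_ofFn, evalList_ofFn] at this
  have h2 := congrArg (fun t => sgn F (suspExp deg (List.ofFn v)) • t) this
  simp only [smul_smul, sgn_mul_self, one_smul] at h2
  exact letterOf_injective B h2

lemma suspend_eq_of_eq {f g : CochainSeq F H} {n : ℕ} (h : f n = g n) {w : List I}
    (hw : w.length = n) : 𝔰 f (Ξ w) = 𝔰 g (Ξ w) := by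
  rw [suspend_word, suspend_word, evalList_eq f (n := n) (by simpa using hw),
    evalList_eq g (n := n) (by simpa using hw), h]

lemma suspend_injective : Function.Injective (suspend (F := F) B deg) := fun f g h =>
  funext fun n => eq_of_suspend_eq fun w _ => by rw [h]

/-- The sequence of cochains with a given suspension. -/
def desuspend (B : Basis I F H) (deg : I → ℤ)
    (g : Θ) : CochainSeq F H := fun n =>
  (ofLetter B ∘ₗ g ∘ₗ wordLift F fun w => sgn F (suspExp deg w) • Ξ w).compMultilinearMap
    ((MultilinearMap.mkPiAlgebraFin F n Λ).compLinearMap fun _ => letterOf B)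

lemma desuspend_apply (g : Θ) {n : ℕ} (a : Fin n → H) :
    desuspend B deg g n a = ofLetter B (g (wordLift F (fun w => sgn F (suspExp deg w) • Ξ w)
      (List.ofFn fun i => letterOf B (a i)).prod)) := by
  simp [desuspend, MultilinearMap.mkPiAlgebraFin_apply]

lemma prod_map_letter (w : List I) : (w.map fun i => Ξ [i]).prod = Ξ w := by
  induction w with
  | nil => rw [List.map_nil, List.prod_nil, word_nil]
  | cons x w ih => rw [List.map_cons, List.prod_cons, ih, ← word_cons]

lemma suspend_desuspend {g : Θ} (hg : ϖ * g = g) : 𝔰 (desuspend B deg g) = g := by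
  apply word_hom_ext; intro w
  rw [suspend_word]
  have : w.map B = List.ofFn fun i => B (w.get i) := by
    conv_lhs => rw [← List.ofFn_get w, List.map_ofFn]
    rfl
  rw [this, evalList_ofFn, desuspend_apply]
  simp only [letterOf_basis]
  have h2 : (List.ofFn fun i => Ξ [w.get i]).prod = Ξ w := by
    rw [← prod_map_letter w]
    congr 1
    conv_rhs => rw [← List.ofFn_get w, List.map_ofFn]
    rfl
  rw [h2, wordLift_word, map_smul, map_smul, map_smul, smul_smul, sgn_mul_self, one_smul,
    letterOf_ofLetter, letter_apply hg]

lemma evalList_mem {f : CochainSeq F H} {c : ℤ} (hf : ∀ n : ℕ, HasDegree 𝒜 (f n) (c + 1 - n))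
    (L : List (Homog 𝒜)) : evalList f (vals L) ∈ 𝒜 (wordDeg (homogDeg 𝒜) L + c + 1) := by
  have h := hf L.length (fun i => (L.get i).1) (fun i => ((L.get i).2 : H)) fun i => (L.get i).2.2
  rw [← evalList_ofFn, ← vals_ofFn, List.ofFn_get] at h
  convert h using 2
  have : ∑ i, (L.get i).1 = wordDeg (homogDeg 𝒜) L + L.length := by
    conv_rhs => rw [← List.ofFn_get L]
    simp only [wordDeg, List.map_ofFn, List.sum_ofFn, Function.comp_def, homogDeg, sum_sub_distrib]
    simp
  rw [this]; ring

variable [DirectSum.Decomposition 𝒜]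

lemma letterOf_evalList (hB : ∀ i, B i ∈ 𝒜 (deg i + 1)) (f : CochainSeq F H) (L : List (Homog 𝒜)) :
    letterOf B (evalList f (vals L)) = sgn F (suspExp (homogDeg 𝒜) L) • 𝔰 f (tens 𝒜 B (Ξ L)) := by
  rw [suspend_tens hB, smul_smul, sgn_mul_self, one_smul]

/-- It carries statements about basis words over to arbitrary homogeneous arguments. -/
lemma tens_mem_span (hB : ∀ i, B i ∈ 𝒜 (deg i + 1)) (L : List (Homog 𝒜)) : tens 𝒜 B (Ξ L) ∈
    span F (Ξ '' {w | η w = wordDeg (homogDeg 𝒜) L ∧ w.length = L.length}) := by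
  induction L with
  | nil => exact subset_span ⟨[], by simp, by simp [word_nil]⟩
  | cons p L ih =>
    rw [tens_cons]
    have h1 := letterOf_mem hB p.2.2
    generalize letterOf B (p.2 : H) = y at h1 ⊢
    generalize tens 𝒜 B (Ξ L) = t at ih ⊢
    induction h1 using span_induction with
    | zero => simp
    | add a b _ _ ha hb => rw [add_mul]; exact add_mem ha hb
    | smul c a _ ha => rw [smul_mul_assoc]; exact Submodule.smul_mem _ _ ha
    | mem x hx =>
      obtain ⟨i, hi, rfl⟩ := hx
      simp only [Set.mem_ofPred_eq] at hi
      induction ih using span_induction with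
      | zero => simp
      | add a b _ _ ha hb => rw [mul_add]; exact add_mem ha hb
      | smul c a _ ha => rw [mul_smul_comm]; exact Submodule.smul_mem _ _ ha
      | mem x hx =>
        obtain ⟨w, ⟨hw1, hw2⟩, rfl⟩ := hx
        beta_reduce
        rw [← word_cons]
        refine subset_span ⟨i :: w, ⟨?_, ?_⟩, rfl⟩
        · simp [hw1, hi, homogDeg]
        · simp [hw2]

/-! #### Degrees -/

lemma homDeg_suspend (hB : ∀ i, B i ∈ 𝒜 (deg i + 1)) {f : CochainSeq F H} {c : ℤ}
    (hf : ∀ n : ℕ, HasDegree 𝒜 (f n) (c + 1 - n)) : HomDeg deg c (𝔰 f) := by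
  intro z
  apply word_hom_ext; intro w
  have h := evalList_mem hf (homogWord hB w)
  rw [vals_homogWord, wordDeg_homogWord] at h
  rw [End.mul_apply, smul_apply, End.mul_apply, scale_word, map_smul, suspend_word, map_smul,
    scale_of_mem_lettersOfDeg (letterOf_mem hB h), smul_smul, smul_smul,
    smul_smul, add_sub_cancel_right, zpow_add, Units.val_mul]
  congr 1; ring

lemma hasDegree_of_homDeg_suspend [CharZero F] (hB : ∀ i, B i ∈ 𝒜 (deg i + 1))
    {f : CochainSeq F H} {c : ℤ}
    (hf : HomDeg deg c (𝔰 f)) (n : ℕ) : HasDegree 𝒜 (f n) (c + 1 - n) := by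
  intro d a ha
  have key : ∀ L : List (Homog 𝒜), evalList f (vals L) ∈ 𝒜 (wordDeg (homogDeg 𝒜) L + c + 1) := by
    intro L
    rw [← ofLetter_letterOf B (evalList f (vals L)), letterOf_evalList hB, map_smul]
    refine Submodule.smul_mem _ _ (ofLetter_mem hB ?_)
    have h := tens_mem_span hB L
    generalize tens 𝒜 B (Ξ L) = t at h ⊢
    induction h using span_induction with
    | zero => simp
    | add a b _ _ ha hb => rw [map_add]; exact add_mem ha hb
    | smul c a _ ha => rw [map_smul]; exact Submodule.smul_mem _ _ ha
    | mem x hx =>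
      obtain ⟨w, ⟨hw1, hw2⟩, rfl⟩ := hx
      rw [← hw1]
      exact mem_lettersOfDeg (letterProj_suspend B deg f) hf w
  have h := key (List.ofFn fun i => ⟨d i, a i, ha i⟩)
  rw [vals_ofFn, evalList_ofFn] at h
  convert h using 2
  simp only [wordDeg, List.map_ofFn, List.sum_ofFn, Function.comp_def, homogDeg, sum_sub_distrib]
  simp; ring

/-! #### Harrison cochains -/

-- By `sum_isShuffle` suspension absorbs the signs of the permutations: the relation over shuffle
-- permutations is the value at a shuffle product of words.
open Classical in
lemma suspend_shuffle (hB : ∀ i, B i ∈ 𝒜 (deg i + 1))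
    (f : CochainSeq F H) {n k : ℕ} (hk : k ≤ n) (a : Fin n → Homog 𝒜) :
    sgn F (suspExp (homogDeg 𝒜) (List.ofFn a)) • 𝔰 f (Ш
      (tens 𝒜 B (Ξ ((List.ofFn a).take k))) (tens 𝒜 B (Ξ ((List.ofFn a).drop k)))) =
    letterOf B (∑ σ : Equiv.Perm (Fin n) with IsShuffle k σ,
      shuffleSign (fun q => (a q).1) σ • f n fun j => ((a (σ.symm j)).2 : H)) := by
  have h := sum_isShuffle (homogDeg 𝒜) n k hk a (𝔰 f ∘ₗ tens 𝒜 B)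
  rw [comp_apply, tens_shuffle hB] at h
  rw [← h, map_sum]
  refine sum_congr rfl fun σ _ => ?_
  rw [comp_apply, ← letterOf_evalList hB, vals_ofFn, evalList_ofFn, shuffleSign_smul (F := F),
    map_smul]
  simp [homogDeg]

lemma killsShuffles_suspend (hB : ∀ i, B i ∈ 𝒜 (deg i + 1))
    {f : CochainSeq F H} (hf : ∀ n, IsHarrison 𝒜 (f n)) :
    KillsShuffles deg (𝔰 f) := by
  intro u v hu hv
  set L := homogWord hB (u ++ v) with hL
  have hlen : L.length = u.length + v.length := by rw [hL, length_homogWord, List.length_append]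
  have h := suspend_shuffle hB f (n := L.length) (k := u.length) (by omega) L.get
  have hu' := List.length_pos_of_ne_nil hu
  have hv' := List.length_pos_of_ne_nil hv
  have h2 := hf L.length u.length hu' (by omega) (fun q => (L.get q).1) (fun q => ((L.get q).2 : H))
    fun q => (L.get q).2.2
  rw [h2, map_zero, List.ofFn_get] at h
  have e1 : L.take u.length = homogWord hB u := by simp [hL, homogWord]
  have e2 : L.drop u.length = homogWord hB v := by simp [hL, homogWord]
  rw [e1, e2, tens_homogWord, tens_homogWord, shuffleMul_word] at h
  have h3 := congrArg (fun t => sgn F (suspExp (homogDeg 𝒜) L) • t) h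
  simpa only [smul_smul, sgn_mul_self, one_smul, smul_zero] using h3

lemma isHarrison_of_killsShuffles (hB : ∀ i, B i ∈ 𝒜 (deg i + 1)) {f : CochainSeq F H}
    (hf : KillsShuffles deg (𝔰 f)) (n : ℕ) : IsHarrison 𝒜 (f n) := by
  intro k hk hkn d a ha
  have h := suspend_shuffle hB f hkn.le fun i => ⟨d i, a i, ha i⟩
  apply letterOf_injective B
  rw [map_zero]
  refine h.symm.trans ?_
  have key : ∀ L M : List (Homog 𝒜), L ≠ [] → M ≠ [] → 𝔰 f (Ш
      (tens 𝒜 B (Ξ L)) (tens 𝒜 B (Ξ M))) = 0 := by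
    intro L M hL hM
    have h1 := tens_mem_span hB L
    have h2 := tens_mem_span hB M
    have hL' := List.length_pos_of_ne_nil hL
    have hM' := List.length_pos_of_ne_nil hM
    generalize tens 𝒜 B (Ξ L) = s at h1 ⊢
    generalize tens 𝒜 B (Ξ M) = t at h2 ⊢
    induction h1 using span_induction with
    | zero => simp
    | add a b _ _ ha hb => rw [map_add, add_apply, map_add, ha, hb, add_zero]
    | smul c a _ ha => rw [map_smul, smul_apply, map_smul, ha, smul_zero]
    | mem x hx =>
    obtain ⟨u, ⟨-, hu⟩, rfl⟩ := hx
    induction h2 using span_induction with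
    | zero => simp
    | add a b _ _ ha hb => rw [map_add, map_add, ha, hb, add_zero]
    | smul c a _ ha => rw [map_smul, map_smul, ha, smul_zero]
    | mem x hx =>
    obtain ⟨v, ⟨-, hv⟩, rfl⟩ := hx
    rw [shuffleMul_word]
    exact hf u v (List.ne_nil_of_length_pos (by omega)) (List.ne_nil_of_length_pos (by omega))
  rw [key, smul_zero]
  · exact List.ne_nil_of_length_pos (by simp; omega)
  · exact List.ne_nil_of_length_pos (by simp; omega)

end Dictionary

/-! ### The Gerstenhaber product and coderivations -/

section Circ

variable {F H I : Type*} [Field F] [NonUnitalRing H] [Module F H] {𝒜 : ℤ → Submodule F H}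
  {B : Basis I F H} {deg : I → ℤ}

lemma sgn_eq_of_eq_add {a b : ℤ} (m : ℤ) (h : a = b + 2 * m) : sgn F a = sgn F b := by
  rw [h, sgn_add, sgn_even (a := 2 * m) (by simp), mul_one]

lemma coder_word {c : ℤ} {g : Θ} (hg1 : g 1 = 0) (w : List I) :
    κ c g (Ξ w) = cutSum (fun u v => sgn F (c * η u) • (Ξ u * conv g 1 (Ξ v))) w := by
  induction w with
  | nil => simp [word_nil, conv_nil, hg1]
  | cons x w ih =>
    rw [coder_cons, cutSum_cons, ih, mul_cutSum, ← cutSum_smul]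
    congr 1
    · simp [word_nil]
    · refine cutSum_congr fun u v _ => ?_
      rw [mul_smul_comm, smul_smul, ← sgn_add, ← mul_assoc, ← word_cons, wordDeg_cons, mul_add]

lemma koszul_apply [DirectSum.Decomposition 𝒜] (s : ℤ) {d : ℤ} {x : H} (hx : x ∈ 𝒜 d) :
    koszul 𝒜 s x = sgn F (s * d) • x := by
  rw [koszul, comp_apply, LinearEquiv.coe_coe, DirectSum.decomposeLinearEquiv_apply]
  lift x to 𝒜 d using hx
  rw [DirectSum.decompose_coe, ← DirectSum.lof_eq_of F, DirectSum.toModule_lof, smul_apply]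
  rw [← negOnePow_smul_eq, Units.smul_def]
  rfl

lemma insertArgs_eq {n k l : ℕ} (hk : 1 ≤ k) (hl : l + k ≤ n) (K : H →ₗ[F] H)
    (g : CochainSeq F H) (L : List H) (hL : L.length = n) :
    insertArgs hk hl K (g k) (fun i : Fin n => L.getD i 0) = fun i : Fin (n - k + 1) =>
      (((L.take l).map K) ++ evalList g ((L.drop l).take k) :: L.drop (l + k)).getD i 0 := by
  funext j
  have hj := j.2
  have h1 : ((L.take l).map K).length = l := by simp; omega
  have h2 : ((L.drop l).take k).length = k := by simp; omega
  unfold insertArgs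
  split_ifs with h h'
  · rw [List.getD_append _ _ _ _ (by omega)]
    simp [List.getD_eq_getElem?_getD, List.getElem?_map, h,
      List.getElem?_eq_getElem (show (j : ℕ) < L.length by omega)]
  · rw [List.getD_append_right _ _ _ _ (by omega), h1, h', Nat.sub_self, List.getD_cons_zero,
      evalList_eq g h2]
    congr 1
    funext i
    simp [List.getD_eq_getElem?_getD, List.getElem?_drop]
  · rw [List.getD_append_right _ _ _ _ (by omega), h1]
    obtain ⟨m, hm⟩ : ∃ m, (j : ℕ) - l = m + 1 := ⟨j - l - 1, by omega⟩
    rw [hm, List.getD_cons_succ]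
    simp only [List.getD_eq_getElem?_getD, List.getElem?_drop]
    congr 2; omega

lemma evalList_circ [DirectSum.Decomposition 𝒜] (c : ℤ) (f g : CochainSeq F H) (L : List H) :
    evalList (circ 𝒜 c f g) L = ∑ l ∈ range (L.length + 1),
      ∑ k ∈ range (L.length + 1), if 1 ≤ k ∧ l + k ≤ L.length then
        sgn F (((k : ℤ) - 1) * l + ((L.length : ℤ) - k) * c) •
          evalList f (((L.take l).map (koszul 𝒜 (c + 1 - k))) ++
            evalList g ((L.drop l).take k) :: L.drop (l + k)) else 0 := by
  rw [sum_comm, evalList, circ, sum_apply]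
  refine sum_congr rfl fun k _ => ?_
  rw [sum_apply]
  refine sum_congr rfl fun l _ => ?_
  split_ifs with h
  · rw [smul_apply, negOnePow_smul_eq (F := F)]
    congr 1
    rw [evalList_eq f (n := L.length - k + 1) (by simp; omega), ← insertArgs_eq h.1 h.2 _ _ _ rfl]
    rfl
  · rfl

lemma evalList_map_koszul [DirectSum.Decomposition 𝒜] (s : ℤ) (f : CochainSeq F H)
    (L : List (Homog 𝒜)) (u v : List H) :
    evalList f (u ++ (vals L).map (koszul 𝒜 s) ++ v) =
      sgn F (s * (wordDeg (homogDeg 𝒜) L + L.length)) • evalList f (u ++ vals L ++ v) := by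
  induction L generalizing u with
  | nil => simp
  | cons p L ih =>
    have h := ih (u ++ [koszul 𝒜 s (p.2 : H)])
    simp only [List.append_assoc, List.nil_append, vals_cons, List.map_cons,
      List.cons_append] at h ⊢
    rw [h, ← evalAt_apply, koszul_apply (F := F) s p.2.2, map_smul, smul_smul, ← sgn_add,
      evalAt_apply]
    congr 2
    simp only [wordDeg_cons, homogDeg, List.length_cons]
    push_cast; ring

/-- Both sides insert `g` at every position and in every arity; the explicit signs of the circle
product are those of suspension and of the coderivation. -/
lemma suspend_circ [DirectSum.Decomposition 𝒜] (hB : ∀ i, B i ∈ 𝒜 (deg i + 1)) {c : ℤ}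
    (f : CochainSeq F H) {g : CochainSeq F H} (hg : ∀ n : ℕ, HasDegree 𝒜 (g n) (c + 1 - n))
    (hg0 : g 0 = 0) :
    𝔰 (circ 𝒜 c f g) = 𝔰 f * κ c (𝔰 g) := by
  apply word_hom_ext; intro w
  rw [suspend_word, evalList_circ, End.mul_apply, coder_word (suspend_one B deg hg0), cutSum,
    List.length_map, map_sum, map_sum, smul_sum]
  refine sum_congr rfl fun l hl => ?_
  simp only [mem_range] at hl
  rw [conv_word, cutSum, List.length_drop, Finset.mul_sum, smul_sum, map_sum, map_sum, smul_sum]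
  symm
  refine Finset.sum_subset_zero_on_sdiff (range_mono (by omega)) (fun k hk => ?_) fun k hk => ?_
  · simp only [Finset.mem_sdiff, mem_range] at hk
    rw [if_neg (by omega), map_zero, smul_zero]
  · simp only [mem_range] at hk
    by_cases hk0 : k = 0
    · subst hk0
      rw [if_neg (by omega), List.take_zero, word_nil, suspend_one B deg hg0]
      simp
    rw [if_pos (by omega)]
    obtain ⟨u, v, t, rfl, hu, hv⟩ : ∃ u v t : List I, w = u ++ (v ++ t) ∧ u.length = l ∧
        v.length = k := ⟨w.take l, (w.drop l).take k, (w.drop l).drop k, by simp, by simp; omega,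
          by simp; omega⟩
    have e1 : (u ++ (v ++ t)).take l = u := List.take_left' hu
    have e2 : (u ++ (v ++ t)).drop l = v ++ t := List.drop_left' hu
    have e3 : (v ++ t).take k = v := List.take_left' hv
    have e4 : (v ++ t).drop k = t := List.drop_left' hv
    rw [← List.drop_drop, ← List.map_take, ← List.map_drop, ← List.map_take, ← List.map_drop, e1,
      e2, e3, e4]
    have hmem := evalList_mem hg (homogWord hB v)
    rw [vals_homogWord, wordDeg_homogWord] at hmem
    have h1 := evalList_map_koszul (c + 1 - k) f (homogWord hB u) []
      (evalList g (v.map B) :: t.map B)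
    rw [vals_homogWord, List.nil_append, wordDeg_homogWord, length_homogWord, List.nil_append] at h1
    have h2 := suspend_tens hB f (homogWord hB u ++
      (⟨_, ⟨evalList g (v.map B), hmem⟩⟩ : Homog 𝒜) :: homogWord hB t)
    rw [tens_append, tens_cons, tens_homogWord, tens_homogWord] at h2
    simp only [vals_append, vals_cons, vals_homogWord, suspExp_append, suspExp, wordDeg_homogWord,
      suspExp_homogWord, length_homogWord, List.length_cons, homogDeg] at h2
    rw [h1, suspend_word (deg := deg) (f := g), smul_mul_assoc, mul_smul_comm, End.one_apply,
      smul_smul, map_smul, h2]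
    simp only [map_smul, smul_smul, ← sgn_add]
    congr 1
    subst hu hv
    -- The two exponents agree only modulo two; this is half of their difference.
    refine sgn_eq_of_eq_add (-(u.length * c)) ?_
    simp only [suspExp_append, List.length_append]
    push_cast
    ring

end Circ

/-! ### Compositions and coalgebra morphisms -/

section Compositions

/-- Prepend a block to a composition. -/
def Composition.consBlock {n : ℕ} (p : Σ i : Fin (n + 1), Composition (n - i)) :
    Composition (n + 1) where
  blocks := (p.1 + 1 : ℕ) :: p.2.blocks
  blocks_pos := by
    intro j hj
    rcases List.mem_cons.1 hj with rfl | h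
    · omega
    · exact p.2.blocks_pos h
  blocks_sum := by
    have := p.1.2
    rw [List.sum_cons, p.2.blocks_sum]; omega

lemma Composition.consBlock_bijective (n : ℕ) :
    Function.Bijective (Composition.consBlock (n := n)) := by
  constructor
  · rintro ⟨i, c⟩ ⟨j, d⟩ h
    have h1 := congrArg Composition.blocks h
    simp only [Composition.consBlock, List.cons.injEq, Nat.add_right_cancel_iff] at h1
    obtain ⟨hij, hcd⟩ := h1
    obtain rfl := Fin.ext hij
    obtain rfl := Composition.ext hcd
    rfl
  · rintro ⟨bs, hpos, hsum⟩
    cases bs with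
    | nil => simp at hsum
    | cons b bs =>
      have hb : 0 < b := hpos List.mem_cons_self
      rw [List.sum_cons] at hsum
      refine ⟨⟨⟨b - 1, by omega⟩, ⟨bs, fun h => hpos (List.mem_cons_of_mem _ h), ?_⟩⟩, ?_⟩
      · simp only; omega
      · apply Composition.ext
        simp only [Composition.consBlock]
        congr 1; omega

lemma sum_composition_succ {M : Type*} [AddCommMonoid M] (n : ℕ) (X : List ℕ → M) :
    ∑ c : Composition (n + 1), X c.blocks =
      ∑ i ∈ range (n + 1), ∑ c : Composition (n - i), X ((i + 1) :: c.blocks) := by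
  rw [Finset.sum_range, ← Fintype.sum_sigma']
  exact (Fintype.sum_bijective _ (Composition.consBlock_bijective n) _ _ fun _ => rfl).symm

variable {F H I : Type*} [Field F] [NonUnitalRing H] [Module F H] {𝒜 : ℤ → Submodule F H}
  {B : Basis I F H} {deg : I → ℤ}

/-- The list of values of `φ` on consecutive blocks of a list. -/
def blockVals (φ : CochainSeq F H) : List ℕ → List H → List H
  | [], _ => []
  | r :: rs, L => evalList φ (L.take r) :: blockVals φ rs (L.drop r)

lemma length_blockVals (φ : CochainSeq F H) (bs : List ℕ) (L : List H) :
    (blockVals φ bs L).length = bs.length := by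
  induction bs generalizing L with
  | nil => rfl
  | cons r rs ih => simp [blockVals, ih]

lemma getElem_blockVals (φ : CochainSeq F H) (bs : List ℕ) (L : List H) (i : ℕ)
    (hi : i < bs.length) (hi' : i < (blockVals φ bs L).length) : (blockVals φ bs L)[i] =
      evalList φ ((L.drop (bs.take i).sum).take bs[i]) := by
  induction bs generalizing L i with
  | nil => simp at hi
  | cons r rs ih =>
    cases i with
    | zero => simp [blockVals]
    | succ i =>
      simp only [blockVals, List.getElem_cons_succ, List.take_succ_cons, List.sum_cons]
      rw [ih _ _ (by simpa using hi), List.drop_drop]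

lemma evalList_blockVals (g φ : CochainSeq F H) {n : ℕ} (c : Composition n) (a : Fin n → H) :
    evalList g (blockVals φ c.blocks (List.ofFn a)) =
      g c.length fun α => φ (c.blocksFun α) fun j => a (c.embedding α j) := by
  rw [evalList_eq g (length_blockVals φ c.blocks _)]
  congr 1
  funext α
  rw [List.getD_eq_getElem _ _ (by rw [length_blockVals]; exact α.2), getElem_blockVals φ _ _ _ α.2]
  have hle : c.sizeUpTo α + c.blocksFun α ≤ n := by
    have h1 := c.sizeUpTo_succ α.2
    have h2 := c.sizeUpTo_le (α + 1)
    have h3 : c.blocksFun α = c.blocks[(α : ℕ)] := rfl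
    omega
  have hlen : (((List.ofFn a).drop (c.sizeUpTo α)).take (c.blocksFun α)).length =
      c.blocksFun α := by simp; omega
  refine (evalList_eq φ hlen).trans ?_
  congr 1
  funext j
  have hj := j.2
  rw [List.getD_eq_getElem _ _ (by rw [hlen]; exact j.2)]
  simp only [List.getElem_take, List.getElem_drop, List.getElem_ofFn]
  rfl

/-- The sign exponent of a list of blocks. -/
def blockExp {α : Type*} (deg : α → ℤ) : List ℕ → List α → ℤ
  | [], _ => 0
  | r :: rs, L => (η (L.take r) + 2 * r) * (rs.map fun b : ℕ => 1 + (b : ℤ)).sum +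
      blockExp deg rs (L.drop r)

lemma blockExp_eq {α : Type*} (deg : α → ℤ) (bs : List ℕ) (L : List α) : blockExp deg bs L =
    ∑ i : Fin bs.length, ∑ j : Fin bs.length, if i < j then
      (η ((L.drop (bs.take i).sum).take bs[i]) + 2 * (bs[i] : ℕ)) *
        (1 + ((bs[j] : ℕ) : ℤ)) else 0 := by
  induction bs generalizing L with
  | nil => rfl
  | cons r rs ih =>
    rw [blockExp, ih]
    have hlen : (r :: rs).length = rs.length + 1 := rfl
    symm
    refine (Fin.sum_univ_succ (n := rs.length) _).trans ?_
    congr 1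
    · refine (Fin.sum_univ_succ (n := rs.length) _).trans ?_
      have : (rs.map fun b : ℕ => 1 + (b : ℤ)).sum = ∑ j : Fin rs.length, (1 + ((rs[j] : ℕ) : ℤ)) := by
        conv_lhs => rw [← List.ofFn_get rs, List.map_ofFn, List.sum_ofFn]
        rfl
      rw [this, Finset.mul_sum]
      simp
    · refine sum_congr rfl fun i _ => ?_
      refine (Fin.sum_univ_succ (n := rs.length) _).trans ?_
      rw [if_neg (by exact Fin.not_lt_zero _), zero_add]
      refine sum_congr rfl fun j _ => ?_
      simp [Fin.succ_lt_succ_iff, List.drop_drop]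

lemma blockExponent_eq {n : ℕ} (c : Composition n) (a : Fin n → Homog 𝒜) :
    blockExponent c (fun i => (a i).1) = blockExp (homogDeg 𝒜) c.blocks (List.ofFn a) := by
  rw [blockExp_eq, blockExponent]
  refine sum_congr rfl fun α _ => sum_congr rfl fun β _ => ?_
  refine if_congr Iff.rfl ?_ rfl
  congr 1
  have hle : c.sizeUpTo α + c.blocksFun α ≤ n := by
    have h1 := c.sizeUpTo_succ α.2
    have h2 := c.sizeUpTo_le (α + 1)
    have h3 : c.blocksFun α = c.blocks[(α : ℕ)] := rfl
    omega
  have hL : ((List.ofFn a).drop (c.blocks.take α).sum).take c.blocks[α] =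
      List.ofFn fun j : Fin (c.blocksFun α) => a (c.embedding α j) := by
    apply List.ext_getElem
    · simp only [List.length_take, List.length_drop, List.length_ofFn]
      have h3 : c.blocksFun α = c.blocks[α] := rfl
      have h4 : c.sizeUpTo α = (c.blocks.take α).sum := rfl
      omega
    · intro m h1 h2
      simp only [List.getElem_take, List.getElem_drop, List.getElem_ofFn]
      rfl
  rw [hL]
  simp only [wordDeg, List.map_ofFn, List.sum_ofFn, Function.comp_def, homogDeg, sum_sub_distrib]
  have h3 : c.blocksFun α = c.blocks[α] := rfl
  simp [h3]; ring

/-- The tensor product of the suspended values of `φ` on consecutive blocks. -/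
def blockTens (B : Basis I F H) (φ : Θ) :
    List ℕ → List (Homog 𝒜) → Λ
  | [], _ => 1
  | r :: rs, L => φ (tens 𝒜 B (Ξ (L.take r))) * blockTens B φ rs (L.drop r)

/-- Splitting off the first block of a composition matches the recursion of a coalgebra morphism
over the first tensor factor of its value. -/
lemma coalgHom_tens {φ : Θ} (hφ : ϖ * φ = φ)
    (hφ1 : φ 1 = 0) (n : ℕ) (L : List (Homog 𝒜)) (hL : L.length = n) :
    coalgHom φ (tens 𝒜 B (Ξ L)) = ∑ c : Composition n, blockTens B φ c.blocks L := by
  induction n using Nat.strong_induction_on generalizing L with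
  | _ n ih =>
  rcases L with _ | ⟨p, L⟩
  · subst hL
    rw [word_nil, tens_nil, coalgHom_one]
    have : ∀ c : Composition ([] : List (Homog 𝒜)).length, blockTens (𝒜 := 𝒜) B φ c.blocks [] = 1 := by
      rintro ⟨bs, hpos, hsum⟩
      cases bs with
      | nil => rfl
      | cons b bs =>
        have := hpos List.mem_cons_self
        simp at hsum; omega
    rw [sum_congr rfl fun c _ => this c]
    have hcard : Fintype.card (Composition ([] : List (Homog 𝒜)).length) = 1 := composition_card 0
    rw [Finset.sum_const, Finset.card_univ, hcard, one_smul]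
  · obtain rfl : L.length + 1 = n := hL
    have hU := isCoalgHom_coalgHom hφ
    rw [sum_composition_succ L.length fun bs => blockTens B φ bs (p :: L),
      eq_emptyCoeff_add_conv (coalgHom φ _), hU.counit, tens_cons,
      emptyCoeff_letter (letterProj_letterOf B _), zero_smul, zero_add, ← tens_cons,
      ← End.mul_apply, hU.conv_comp, one_mul, letterProj_coalgHom hφ hφ1, conv_tens, cutSum,
      List.length_cons, sum_range_succ', List.take_zero, word_nil, tens_nil, hφ1, zero_mul,
      add_zero]
    refine sum_congr rfl fun i hi => ?_
    simp only [mem_range] at hi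
    rw [ih (L.length - i) (by omega) _ (by simp), Finset.mul_sum]
    rfl

variable [DirectSum.Decomposition 𝒜]

/-- The sign exponents are equal modulo two, and `m` is half of their difference. The summand `2 *
r` in `blockExp` arises because the degree `|A_α|` exceeds the suspended degree by the length `r_α`.
-/
lemma blockTens_eq (hB : ∀ i, B i ∈ 𝒜 (deg i + 1)) {φ : CochainSeq F H}
    (hφ : ∀ n : ℕ, HasDegree 𝒜 (φ n) (1 - n)) (bs : List ℕ) (L : List (Homog 𝒜))
    (hL : bs.sum = L.length) : ∃ (M : List (Homog 𝒜)) (s m : ℤ), vals M = blockVals φ bs (vals L) ∧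
      blockTens B (𝔰 φ) bs L = sgn F s • tens 𝒜 B (Ξ M) ∧
      s + suspExp (homogDeg 𝒜) M = suspExp (homogDeg 𝒜) L + blockExp (homogDeg 𝒜) bs L + 2 * m := by
  induction bs generalizing L with
  | nil =>
    have : L = [] := List.length_eq_zero_iff.1 (by simpa using hL.symm)
    subst this
    exact ⟨[], 0, 0, rfl, by simp [blockTens, word_nil], by simp [suspExp, blockExp]⟩
  | cons r rs ih =>
    rw [List.sum_cons] at hL
    have h1 : (L.take r).length = r := by simp; omega
    have h2 : (L.drop r).length = rs.sum := by simp; omega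
    obtain ⟨M, s, m, hM, hT, hs⟩ := ih (L.drop r) h2.symm
    have hmem := evalList_mem (c := 0) (by simpa using hφ) (L.take r)
    refine ⟨⟨_, ⟨_, hmem⟩⟩ :: M, suspExp (homogDeg 𝒜) (L.take r) + s,
      m - wordDeg (homogDeg 𝒜) (L.take r) * rs.sum - r * (rs.length + rs.sum), ?_, ?_, ?_⟩
    · rw [vals_cons, hM, blockVals]
      simp [vals]
    · rw [blockTens, hT, suspend_tens hB, tens_cons, smul_mul_smul_comm, ← sgn_add]
    · have h3 : (rs.map fun b : ℕ => 1 + (b : ℤ)).sum = rs.length + rs.sum := by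
        clear * -
        induction rs with
        | nil => rfl
        | cons b bs ih => simp only [List.map_cons, List.sum_cons, ih, List.length_cons]
                          push_cast; ring
      have h4 : suspExp (homogDeg 𝒜) L = suspExp (homogDeg 𝒜) (L.take r) +
          wordDeg (homogDeg 𝒜) (L.take r) * (L.drop r).length +
          suspExp (homogDeg 𝒜) (L.drop r) := by
        rw [← suspExp_append, List.take_append_drop]
      have h5 : M.length = rs.length := by rw [← length_vals, hM, length_blockVals]
      rw [suspExp, blockExp, h3, h4, h2, h5]
      have h6 : suspExp (homogDeg 𝒜) M = suspExp (homogDeg 𝒜) (L.drop r) +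
          blockExp (homogDeg 𝒜) rs (L.drop r) + 2 * m - s := by linarith
      rw [h6, homogDeg]
      ring

/-- The components of the composite of a coalgebra morphism with a coderivation. -/
lemma suspend_coalgHom_tens (hB : ∀ i, B i ∈ 𝒜 (deg i + 1)) {φ : CochainSeq F H}
    (hφ : ∀ n : ℕ, HasDegree 𝒜 (φ n) (1 - n)) (hφ0 : φ 0 = 0) (g : CochainSeq F H) {n : ℕ}
    (a : Fin n → Homog 𝒜) :
    𝔰 g (coalgHom (𝔰 φ) (tens 𝒜 B (Ξ (List.ofFn a)))) =
      sgn F (suspExp (homogDeg 𝒜) (List.ofFn a)) • letterOf B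
        (∑ c : Composition n, (blockExponent c fun i => (a i).1).negOnePow •
          g c.length fun α => φ (c.blocksFun α) fun j => ((a (c.embedding α j)).2 : H)) := by
  rw [coalgHom_tens (letterProj_suspend B deg φ) (suspend_one B deg hφ0) n _ (by simp), map_sum,
    map_sum, smul_sum]
  refine sum_congr rfl fun c _ => ?_
  obtain ⟨M, s, m, hM, hT, hs⟩ := blockTens_eq hB hφ c.blocks (List.ofFn a)
    (by rw [c.blocks_sum, List.length_ofFn])
  rw [hT, map_smul, suspend_tens hB, hM, vals_ofFn, evalList_blockVals, smul_smul, ← sgn_add, hs,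
    negOnePow_smul_eq (F := F), map_smul, smul_smul, ← sgn_add, blockExponent_eq]
  congr 1
  exact sgn_eq_of_eq_add m rfl

end Compositions

/-! ### The bar construction of an enhancement -/

section BarConstruction

variable {F I : Type*} [Field F] {deg : I → ℤ}

lemma letter_mul_mem_lenLT {y : Λ} (hy : ϖ y = y) {n : ℕ}
    {t : Λ} (ht : t ∈ Γ n) : y * t ∈ Γ (n + 1) := by
  have : Γ n ≤ (Γ (n + 1)).comap (mulLeft F y) := by
    refine lenLT_le_iff.2 fun w hw => ?_
    rw [mem_comap, mulLeft_apply]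
    refine letter_induction y hy ?_ ?_ ?_
    · simp
    · intro a b ha hb; rw [add_mul]; exact add_mem ha hb
    · intro c x
      rw [smul_mul_assoc, ← word_cons]
      exact Submodule.smul_mem _ _ (word_mem_lenLT (by simpa using hw))
  exact this ht

/-- The composition into blocks of length one gives the identity; every other one shortens the word.
-/
lemma lowers_coalgHom_sub_one {φ : Θ} (hφ : ϖ * φ = φ)
    (h1 : ∀ x, φ (Ξ [x]) = Ξ [x]) : Lowers 1 (coalgHom φ - 1) := by
  intro w
  simp only [Nat.add_sub_cancel]
  induction h : w.length using Nat.strong_induction_on generalizing w with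
  | _ k ih =>
  subst h
  cases w with
  | nil => rw [sub_apply, word_nil, coalgHom_one]; simp
  | cons x w =>
    have key : ∀ v : List I, v.length ≤ w.length → coalgHom φ (Ξ v) ∈ Γ (v.length + 1) := by
      intro v hv
      have := ih v.length (by simp; omega) v rfl
      rw [← sub_add_cancel (coalgHom φ (Ξ v)) (Ξ v)]
      exact add_mem (lenLT_mono (Nat.le_succ _) this) (word_mem_lenLT (Nat.lt_succ_self _))
    rw [sub_apply, coalgHom_cons, conv_word, End.one_apply]
    have hw := ih w.length (by simp) w rfl
    rw [sub_apply, End.one_apply] at hw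
    cases w with
    | nil =>
      have : coalgHom φ (Ξ ([] : List I)) = 1 := by rw [word_nil, coalgHom_one]
      rw [cutSum_nil, End.mul_apply, consL_word, h1, this, mul_one, sub_self]
      exact zero_mem _
    | cons y w =>
      rw [cutSum_cons, End.mul_apply, consL_word, h1, add_sub_right_comm, word_cons x (y :: w),
        ← mul_sub]
      refine add_mem (letter_mul_mem_lenLT (letterProj_singleton x) hw) (cutSum_mem fun u v huv => ?_)
      have hlen : u.length + v.length = w.length := by rw [← huv, List.length_append]
      refine lenLT_mono ?_ (letter_mul_mem_lenLT (letter_apply hφ _) (key v (by simp; omega)))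
      simp; omega

lemma letterProj_eq_of_lowers {U : Θ} (hU : Lowers 1 (U - 1)) (x : I) : ϖ (U (Ξ [x])) = Ξ [x] := by
  have h := hU [x]
  have hle : Γ 1 ≤ ker ϖ := lenLT_le_iff.2 fun w hw => by
    obtain rfl : w = [] := List.length_eq_zero_iff.1 (by omega)
    rw [mem_ker, word_nil, letterProj_nil]
  have h2 := hle h
  rwa [mem_ker, sub_apply, map_sub, End.one_apply, letterProj_singleton, sub_eq_zero] at h2

/-- The difference of the two composites is a coderivation along `U`, so it is controlled by its
letter component (`eq_zero_of_comul`). -/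
lemma comm_of_letterProj {c : ℤ} {X Y U : Θ} (hX : IsCoder deg c X)
    (hY : IsCoder deg c Y) (hU : IsCoalgHom U) (hd : HomDeg deg 0 U) {n : ℕ}
    (h : ∀ w : List I, w.length < n → ϖ (Y (U (Ξ w))) = ϖ (U (X (Ξ w)))) (w : List I)
    (hw : w.length < n) : Y (U (Ξ w)) = U (X (Ξ w)) := by
  have hp : par deg c * U = U * par deg c := by
    have := hd.par_mul deg c
    simpa using this
  rw [← sub_eq_zero]
  refine eq_zero_of_comul (deg := deg) (c := c) (U := U) (E := Y * U - U * X)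
    (by rw [hU.map_one, letterProj_nil]) ?_ (fun t => ?_) (fun v hv => ?_) w hw
  · rw [sub_eq_add_neg, ← neg_one_smul F (U * X)]
    ext1 t
    simp only [comp_apply, add_apply, End.mul_apply, map_smul, hY.decon_apply, hU.decon_apply,
      hX.decon_apply, map_add, map_map_apply, one_mul, mul_one,
      hp, map_add_left, map_add_right, map_smul_left,
      map_smul_right, smul_apply]
    module
  · rw [sub_apply, map_sub, End.mul_apply, End.mul_apply, hY.counit, hU.counit, hX.counit, sub_zero]
  · rw [sub_apply, map_sub, End.mul_apply, End.mul_apply, h v hv, sub_self]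

/-- For an odd coderivation the square is half of the bracket with itself, hence again a
coderivation, and it vanishes if its component does. For a suspended enhancement this component is
the Stasheff relation. -/
lemma coder_mul_self_eq_zero [CharZero F] {g : Θ}
    (hg : ϖ * g = g) (hg1 : g 1 = 0) (hd : HomDeg deg 1 g)
    (h : g * κ 1 g = 0) : κ 1 g * κ 1 g = 0 := by
  have hD := isCoder_coder (deg := deg) 1 hg hg1
  have hb := hD.bracket hD (homDeg_coder hd) (homDeg_coder hd)
  have h2 : (2 : F) • (κ 1 g * κ 1 g) = 0 := by
    have e : κ 1 g * κ 1 g - sgn F (1 * 1) • (κ 1 g * κ 1 g) = (2 : F) • (κ 1 g * κ 1 g) := by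
      rw [mul_one, sgn_one]; module
    rw [e] at hb
    refine hb.ext (isCoder_zero _) ?_
    rw [mul_smul_comm, ← mul_assoc, letterProj_coder 1 hg hg1, h, smul_zero, mul_zero]
  exact (smul_eq_zero.1 h2).resolve_left two_ne_zero

variable {H : Type*} [NonUnitalRing H] [Module F H] [IsScalarTower F H H] [SMulCommClass F H H]
  {𝒜 : ℤ → Submodule F H} [DirectSum.Decomposition 𝒜]

/-- The codifferential of the bar construction, in the letters of a basis. -/
def MinimalCInfEnhancement.bar (A : MinimalCInfEnhancement 𝒜)
    (B : Basis I F H) (deg : I → ℤ) : Θ :=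
  κ 1 (𝔰 A.op)

namespace MinimalCInfEnhancement

variable (A C : MinimalCInfEnhancement 𝒜) {B : Basis I F H}

lemma hasDegree (n : ℕ) : HasDegree 𝒜 (A.op n) (1 + 1 - n) := A.degree n

lemma isCoder_bar : IsCoder deg 1 (A.bar B deg) :=
  isCoder_coder 1 (letterProj_suspend B deg _) (suspend_one B deg A.op_zero)

lemma letterProj_bar : ϖ * A.bar B deg = 𝔰 A.op :=
  letterProj_coder 1 (letterProj_suspend B deg _) (suspend_one B deg A.op_zero)

lemma letterProj_bar_apply (t : Λ) : ϖ (A.bar B deg t) = 𝔰 A.op t :=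
  LinearMap.congr_fun (A.letterProj_bar (B := B) (deg := deg)) t

lemma suspend_op_eq_zero {w : List I} (hw : w.length < 2) : 𝔰 A.op (Ξ w) = 0 := by
  have h : ∀ n : ℕ, n < 2 → A.op n = 0 := by
    intro n hn
    interval_cases n
    · exact A.op_zero
    · exact A.op_one
  rw [suspend_word, evalList_eq A.op rfl, List.length_map, h _ hw]
  simp

lemma bar_eq_zero {w : List I} (hw : w.length < 2) : A.bar B deg (Ξ w) = 0 :=
  A.isCoder_bar.eq_zero (n := 2)
    (fun v hv => by rw [letterProj_bar_apply, A.suspend_op_eq_zero hv]) w hw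

lemma lowers_bar : Lowers 0 (A.bar B deg) :=
  (lowers_coder (k := 1) (letterProj_suspend B deg _) fun w hw =>
    A.suspend_op_eq_zero (by omega)).mono (Nat.zero_le 1)

lemma homDeg_bar (hB : ∀ i, B i ∈ 𝒜 (deg i + 1)) : HomDeg deg 1 (A.bar B deg) :=
  homDeg_coder (homDeg_suspend hB A.hasDegree)

lemma isShuffleDer_bar [CharZero F] (hB : ∀ i, B i ∈ 𝒜 (deg i + 1))
    : IsShuffleDer deg 1 (A.bar B deg) :=
  A.isCoder_bar.isShuffleDer (A.homDeg_bar hB) (by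
    rw [letterProj_bar]; exact killsShuffles_suspend hB A.harrison)

lemma bar_mul_bar [CharZero F] (hB : ∀ i, B i ∈ 𝒜 (deg i + 1)) : A.bar B deg * A.bar B deg = 0 := by
  refine coder_mul_self_eq_zero (letterProj_suspend B deg _) (suspend_one B deg A.op_zero)
    (homDeg_suspend hB A.hasDegree) ?_
  have := suspend_circ hB (B := B) (deg := deg) A.op A.hasDegree A.op_zero
  rw [← this, A.stasheff]
  simpa using suspend_smul (B := B) (deg := deg) (0 : F) (0 : CochainSeq F H)

lemma bar_eq_of_equalMod {k : ℕ} (h : EqualMod k A C) {t : Λ}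
    (ht : t ∈ Γ (k + 1)) : A.bar B deg t = C.bar B deg t := by
  have hle : Γ (k + 1) ≤ ker (A.bar B deg - C.bar B deg) :=
    lenLT_le_iff.2 fun w hw => (A.isCoder_bar.sub C.isCoder_bar).eq_zero (n := k + 1)
      (fun v hv => by
        rw [sub_apply, map_sub, letterProj_bar_apply, letterProj_bar_apply,
          suspend_eq_of_eq (h v.length (by omega)) rfl, sub_self]) w hw
  have := hle ht
  rwa [mem_ker, sub_apply, sub_eq_zero] at this

end MinimalCInfEnhancement

variable {A C : MinimalCInfEnhancement 𝒜} {B : Basis I F H}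

/-- The isotopy equation in arity `n` in terms of coalgebra morphisms. -/
lemma isotopy_equation_iff (hB : ∀ i, B i ∈ 𝒜 (deg i + 1))
    {φ : CochainSeq F H} (hφ : ∀ n : ℕ, HasDegree 𝒜 (φ n) (1 - n))
    (hφ0 : φ 0 = 0) {n : ℕ} (a : Fin n → Homog 𝒜) :
    𝔰 C.op (coalgHom (𝔰 φ) (tens 𝒜 B (Ξ (List.ofFn a)))) =
        𝔰 φ (A.bar B deg (tens 𝒜 B (Ξ (List.ofFn a)))) ↔
      ∑ c : Composition n, (blockExponent c fun i => (a i).1).negOnePow •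
          C.op c.length (fun α => φ (c.blocksFun α) (fun j => ((a (c.embedding α j)).2 : H))) =
        circ 𝒜 1 φ A.op n fun i => ((a i).2 : H) := by
  rw [suspend_coalgHom_tens hB hφ hφ0, MinimalCInfEnhancement.bar, ← End.mul_apply,
    ← suspend_circ hB φ A.hasDegree A.op_zero, suspend_tens hB, vals_ofFn, evalList_ofFn]
  constructor
  · intro h
    have h2 := congrArg (fun t => sgn F (suspExp (homogDeg 𝒜) (List.ofFn a)) • t) h
    simp only [smul_smul, sgn_mul_self, one_smul] at h2
    exact letterOf_injective B h2
  · intro h; rw [h]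

/-- The equations of an isotopy are the letter components of the intertwining relation for the
coalgebra morphism with component `φ`. -/
lemma IsCInfIsotopy.exists_gauge [CharZero F] (hB : ∀ i, B i ∈ 𝒜 (deg i + 1))
    {φ : CochainSeq F H} (h : IsCInfIsotopy A C φ) :
    ∃ U, IsGaugeGroup deg ⊥ 0 U ∧ ∀ t, C.bar B deg (U t) = U (A.bar B deg t) := by
  obtain ⟨h, h1⟩ := h
  have hl := letterProj_suspend B deg φ
  have h0 := suspend_one B deg h.zero
  have hd : HomDeg deg 0 (𝔰 φ) := homDeg_suspend hB (by simpa using h.degree)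
  have hU := isCoalgHom_coalgHom hl
  have hlp := letterProj_coalgHom hl h0
  have hx : ∀ x, 𝔰 φ (Ξ [x]) = Ξ [x] := by
    intro x
    rw [suspend_word, evalList_eq φ (n := 1) rfl, h1]
    simp [suspExp]
  refine ⟨coalgHom (𝔰 φ), ⟨hU, homDeg_coalgHom hd, hU.isShuffleHom
    (homDeg_coalgHom hd) (by rw [hlp]; exact killsShuffles_suspend hB h.harrison),
    lowers_coalgHom_sub_one hl hx, ?_, ?_, fun _ => rfl⟩, ?_⟩
  · intro t ht; rw [(mem_bot F).1 ht, map_zero]; exact zero_mem _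
  · intro t ht; rw [(mem_bot F).1 ht, map_zero]
  · suffices e : C.bar B deg * coalgHom (𝔰 φ) =
        coalgHom (𝔰 φ) * A.bar B deg from fun t => LinearMap.congr_fun e t
    apply word_hom_ext; intro w
    have hX : IsCoder deg 1 (A.bar B deg) := A.isCoder_bar
    have hY : IsCoder deg 1 (C.bar B deg) := C.isCoder_bar
    have hUd := homDeg_coalgHom (deg := deg) hd
    have key := comm_of_letterProj (n := w.length + 1) hX hY hU hUd
    refine key (fun v _ => ?_) w (Nat.lt_succ_self _)
    clear key
    rw [C.letterProj_bar_apply, ← End.mul_apply ϖ, hlp]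
    -- The isotopy equation begins in arity two; on shorter words both sides vanish by minimality.
    by_cases hv : v.length < 2
    · rw [A.bar_eq_zero hv, map_zero]
      match v with
      | [] => rw [word_nil, coalgHom_one, suspend_one B deg C.op_zero]
      | [x] =>
        rw [coalgHom_cons, word_nil, conv_nil, coalgHom_one, mul_one, End.mul_apply, consL_one, hx]
        exact C.suspend_op_eq_zero (by simp)
      | x :: y :: v => simp at hv
    · have h3 := h.equation (homogWord hB v).length (by simp; omega)
        (fun i => ((homogWord hB v).get i).1) (fun i => (((homogWord hB v).get i).2 : H))
        fun i => ((homogWord hB v).get i).2.2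
      have h4 := (isotopy_equation_iff hB h.degree h.zero _).2 h3
      rwa [List.ofFn_get, tens_homogWord] at h4

lemma isotopic_of_gauge [CharZero F] (hB : ∀ i, B i ∈ 𝒜 (deg i + 1)) {U : Θ}
    (hU : IsGaugeGroup deg ⊥ 0 U) (h : ∀ t, C.bar B deg (U t) = U (A.bar B deg t)) :
    Isotopic A C := by
  have hl : ϖ * (ϖ * U) = ϖ * U := by rw [← mul_assoc, letterProj_idem]
  have hs : 𝔰 (desuspend B deg (ϖ * U)) = ϖ * U := suspend_desuspend hl
  have h0 : (ϖ * U) 1 = 0 := by rw [End.mul_apply, hU.coalgHom.map_one, letterProj_nil]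
  have hUc : coalgHom (ϖ * U) = U :=
    (isCoalgHom_coalgHom hl).ext hU.coalgHom (letterProj_coalgHom hl h0)
  have hdeg : HomDeg deg 0 (ϖ * U) := by simpa using (homDeg_letterProj deg).mul deg hU.homDeg
  generalize desuspend B deg (ϖ * U) = φ at hs
  have hφ0 : φ 0 = 0 := by
    refine eq_of_suspend_eq (B := B) (deg := deg) (g := 0) fun w hw => ?_
    obtain rfl := List.length_eq_zero_iff.1 hw
    rw [hs, word_nil, h0, suspend_one B deg rfl]
  have hφ : ∀ n : ℕ, HasDegree 𝒜 (φ n) (1 - n) := by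
    simpa using hasDegree_of_homDeg_suspend hB (c := 0) (by rwa [hs])
  refine ⟨φ, ⟨hφ0, hφ, isHarrison_of_killsShuffles hB ?_, ?_⟩, ?_⟩
  · rw [hs]; exact hU.shuffleHom.killsShuffles hU.coalgHom
  · intro n _ d a ha
    refine (isotopy_equation_iff hB (A := A) (C := C) hφ hφ0
      (fun i => (⟨d i, a i, ha i⟩ : Homog 𝒜))).1 ?_
    rw [hs, hUc, ← C.letterProj_bar_apply, h, End.mul_apply]
  · intro a
    have : φ 1 = LinearMap.id.compMultilinearMap (MultilinearMap.ofSubsingleton F H H 0 LinearMap.id) := by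
      refine Basis.ext_multilinear (fun _ => B) fun v => ?_
      have h2 := letterProj_eq_of_lowers hU.lowers (v 0)
      rw [← End.mul_apply, ← hs, suspend_word, evalList_eq φ (n := 1) rfl] at h2
      apply letterOf_injective B
      have h3 : (fun i => B (v i)) = fun _ => B (v 0) := funext fun i => by
        rw [Subsingleton.elim i 0]
      rw [h3]
      simpa [suspExp] using h2
    rw [this]; simp

end BarConstruction

/-! ### Homogeneous bases and isotopies -/

section HomogeneousBasis

universe u v

variable {F : Type u} {H : Type v} [Field F] [NonUnitalRing H] [Module F H]
  {𝒜 : ℤ → Submodule F H}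

lemma finite_deg_eq (hfin : ∀ i : ℤ, FiniteDimensional F (𝒜 i)) {I : Type*}
    {B : Basis I F H} {deg : I → ℤ} (hB : ∀ i, B i ∈ 𝒜 (deg i + 1)) (n : ℤ) :
    {i | deg i = n}.Finite := by
  let f : {i | deg i = n} → 𝒜 (n + 1) := fun i => ⟨B i, by
    have := hB i; rwa [show deg i = n from i.2] at this⟩
  have hf : LinearIndependent F f := by
    refine LinearIndependent.of_comp (𝒜 (n + 1)).subtype ?_
    exact B.linearIndependent.comp _ Subtype.val_injective
  have : Finite {i | deg i = n} := hf.finite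
  exact Set.toFinite _

variable [DirectSum.Decomposition 𝒜]

/-- A homogeneous basis, containing a given element of degree zero. -/
lemma exists_homogeneous_basis {e : H} (he : e ∈ 𝒜 0) :
    ∃ (I : Type v) (B : Basis I F H) (deg : I → ℤ), (∀ i, B i ∈ 𝒜 (deg i + 1)) ∧
      (e ≠ 0 → ∃ o, B o = e ∧ deg o = -1) := by
  -- At most one nonzero vector in each degree, so the set is independent; its extension in degree
  -- zero has `e` as a member.
  let s : ∀ i : ℤ, Set (𝒜 i) := fun i => {x | (x : H) = e ∧ e ≠ 0}
  have hs : ∀ i, LinearIndepOn F id (s i) := by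
    intro i
    by_cases h : (s i).Nonempty
    · obtain ⟨x, hx⟩ := h
      have hx0 : x ≠ 0 := fun h => hx.2 (by rw [← hx.1, h, Submodule.coe_zero])
      have : s i = {x} := by
        ext y
        rw [Set.mem_singleton_iff]
        exact ⟨fun hy => Subtype.ext (hy.1.trans hx.1.symm), fun hy => hy ▸ hx⟩
      rw [this]
      exact LinearIndepOn.singleton (v := id) hx0
    · rw [Set.not_nonempty_iff_eq_empty.1 h]
      exact linearIndepOn_empty F id
  let b : ∀ i : ℤ, Basis _ F (𝒜 i) := fun i => Basis.extend (hs i)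
  let C := (DirectSum.Decomposition.isInternal 𝒜).collectedBasis b
  refine ⟨_, C, fun i => i.1 - 1, fun i => ?_, fun h0 => ?_⟩
  · rw [sub_add_cancel]
    exact (DirectSum.Decomposition.isInternal 𝒜).collectedBasis_mem b i
  · have hmem : (⟨e, he⟩ : 𝒜 0) ∈ (hs 0).extend (Set.subset_univ _) :=
      Basis.subset_extend (hs 0) ⟨rfl, h0⟩
    refine ⟨⟨0, ⟨⟨e, he⟩, hmem⟩⟩, ?_, by simp⟩
    rw [DirectSum.IsInternal.collectedBasis_coe]
    simp only [b, Basis.extend_apply_self]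

variable [IsScalarTower F H H] [SMulCommClass F H H]

/-- An isotopy onto an enhancement equal to `C` modulo `k` is an intertwiner of `A` and `C` on words
of length at most `k`, so `exists_intertwiner_of_forall` applies with `𝔑 = ⊥` and `ω = 0`. -/
lemma isotopic_iff_forall_isotopicMod [CharZero F]
    (hfin : ∀ i : ℤ, FiniteDimensional F (𝒜 i)) (A C : MinimalCInfEnhancement 𝒜) :
    Isotopic A C ↔ ∀ k : ℕ, 3 ≤ k → IsotopicMod k A C := by
  constructor
  · rintro ⟨φ, hφ⟩ k _
    exact ⟨φ, C, hφ, fun _ _ => rfl⟩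
  · intro h
    obtain ⟨I, B, deg, hB, -⟩ := exists_homogeneous_basis (𝒜 := 𝒜) (Submodule.zero_mem _)
    have key : ∀ k, ∃ V, IsGaugeGroup deg ⊥ 0 V ∧ Intertwines (A.bar B deg) (C.bar B deg) k V := by
      intro k
      -- The hypothesis is available only from three on.
      obtain ⟨φ, D, hφ, hD⟩ := h (max k 3) (le_max_right _ _)
      obtain ⟨V, hV, hAD⟩ := hφ.exists_gauge hB
      refine ⟨V, hV, fun t ht => ?_⟩
      have hVt : V t ∈ Γ (k + 1) := by simpa using hV.lowers.of_sub_one.mem ht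
      rw [← hAD, D.bar_eq_of_equalMod C hD (lenLT_mono (by omega) hVt)]
    obtain ⟨U, hU, hAC⟩ := exists_intertwiner_of_forall (finite_deg_eq hfin hB) A.lowers_bar key
    exact isotopic_of_gauge hB hU hAC

end HomogeneousBasis

/-! ### The gauge action and conjugation by exponentials -/

section GaugeAction

variable {F H I : Type*} [Field F] [NonUnitalRing H] [Module F H] {𝒜 : ℤ → Submodule F H}
  {B : Basis I F H} {deg : I → ℤ}

lemma hasDegree_zero {n : ℕ} (s : ℤ) : HasDegree 𝒜 (0 : Cochain F H n) s :=
  fun _ _ _ => Submodule.zero_mem _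

/-- A sequence of cochains of degree `c` in the Gerstenhaber Lie algebra, without component in
arity zero. -/
structure IsGraded (𝒜 : ℤ → Submodule F H) (c : ℤ) (x : CochainSeq F H) : Prop where
  zero : x 0 = 0
  degree : ∀ n : ℕ, HasDegree 𝒜 (x n) (c + 1 - n)

lemma IsGraded.isCoder {c : ℤ} {x : CochainSeq F H} (hx : IsGraded 𝒜 c x) :
    IsCoder deg c (κ c (𝔰 x)) :=
  isCoder_coder c (letterProj_suspend B deg x) (suspend_one B deg hx.zero)

lemma IsGraded.letterProj_coder {c : ℤ} {x : CochainSeq F H} (hx : IsGraded 𝒜 c x) :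
    ϖ * κ c (𝔰 x) = 𝔰 x :=
  _root_.letterProj_coder c (letterProj_suspend B deg x) (suspend_one B deg hx.zero)

variable [DirectSum.Decomposition 𝒜]

lemma isGraded_of_suspend [CharZero F] (hB : ∀ i, B i ∈ 𝒜 (deg i + 1)) {c : ℤ}
    {x : CochainSeq F H} (h1 : 𝔰 x 1 = 0) (hd : HomDeg deg c (𝔰 x)) :
    IsGraded 𝒜 c x where
  zero := by
    refine eq_of_suspend_eq (B := B) (deg := deg) (g := 0) fun w hw => ?_
    obtain rfl := List.length_eq_zero_iff.1 hw
    rw [word_nil, h1, suspend_one B deg rfl]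
  degree := hasDegree_of_homDeg_suspend hB hd

lemma IsGraded.homDeg_coder (hB : ∀ i, B i ∈ 𝒜 (deg i + 1)) {c : ℤ} {x : CochainSeq F H}
    (hx : IsGraded 𝒜 c x) : HomDeg deg c (κ c (𝔰 x)) :=
  _root_.homDeg_coder (homDeg_suspend hB hx.degree)

lemma isCoder_adOp {D X : Θ} (hD : IsCoder deg 0 D)
    (hX : IsCoder deg 1 X) (hD' : HomDeg deg 0 D) (hX' : HomDeg deg 1 X) :
    IsCoder deg 1 (adOp D X) := by
  have := hD.bracket hX hD' hX'
  simpa [adOp_apply] using this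

lemma homDeg_adOp {D X : Θ} (hD : HomDeg deg 0 D)
    (hX : HomDeg deg 1 X) : HomDeg deg 1 (adOp D X) := by
  rw [adOp_apply]
  exact HomDeg.sub deg (by simpa using hD.mul deg hX) (by simpa using hX.mul deg hD)

lemma suspend_adZero (hB : ∀ i, B i ∈ 𝒜 (deg i + 1)) {p x : CochainSeq F H}
    (hp : IsGraded 𝒜 0 p) (hx : IsGraded 𝒜 1 x) : 𝔰 (adZero 𝒜 p x) =
      ϖ * adOp (κ 0 (𝔰 p)) (κ 1 (𝔰 x)) := by
  rw [adZero, gerstenhaberBracket, zero_mul, Int.negOnePow_zero, one_smul, suspend_sub,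
    suspend_circ hB p hx.degree hx.zero, suspend_circ hB x hp.degree hp.zero, adOp_apply, mul_sub,
    ← mul_assoc, ← mul_assoc, hp.letterProj_coder, hx.letterProj_coder]

/-- The bracket of cochains is the commutator of coderivations; the degrees of the bracket are read
off on the operator side. -/
lemma adZero_spec [CharZero F] (hB : ∀ i, B i ∈ 𝒜 (deg i + 1)) {p x : CochainSeq F H}
    (hp : IsGraded 𝒜 0 p) (hx : IsGraded 𝒜 1 x) : IsGraded 𝒜 1 (adZero 𝒜 p x) ∧
      κ 1 (𝔰 (adZero 𝒜 p x)) = adOp (κ 0 (𝔰 p)) (κ 1 (𝔰 x)) := by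
  have hc := isCoder_adOp hp.isCoder hx.isCoder (hp.homDeg_coder hB) (hx.homDeg_coder hB)
  have hd := homDeg_adOp (hp.homDeg_coder hB) (hx.homDeg_coder hB)
  have hs := suspend_adZero hB hp hx
  have hg : IsGraded 𝒜 1 (adZero 𝒜 p x) := isGraded_of_suspend hB
    (by rw [hs, End.mul_apply, hc.map_one, map_zero])
    (by rw [hs]; simpa using (homDeg_letterProj deg).mul deg hd)
  exact ⟨hg, hg.isCoder.ext hc (by rw [hg.letterProj_coder, hs])⟩

lemma adZero_iterate_spec [CharZero F] (hB : ∀ i, B i ∈ 𝒜 (deg i + 1)) {p x : CochainSeq F H}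
    (hp : IsGraded 𝒜 0 p) (hx : IsGraded 𝒜 1 x) (j : ℕ) : IsGraded 𝒜 1 ((adZero 𝒜 p)^[j] x) ∧
      κ 1 (𝔰 ((adZero 𝒜 p)^[j] x)) = (adOp (κ 0 (𝔰 p)) ^ j) (κ 1 (𝔰 x)) := by
  induction j with
  | zero => exact ⟨hx, rfl⟩
  | succ j ih =>
    rw [Function.iterate_succ_apply', pow_succ', End.mul_apply, ← ih.2]
    exact adZero_spec hB hp ih.1

/-- The suspension of the component of arity `n` of a sequence of cochains. -/
lemma suspend_word_of_length (f : CochainSeq F H) {w : List I} {n : ℕ} (hw : w.length = n) :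
    𝔰 f (Ξ w) = sgn F (suspExp deg w) • letterOf B (f n fun i => (w.map B).getD i 0) := by
  rw [suspend_word, evalList_eq f (n := n) (by simpa using hw)]

lemma suspend_neg (f : CochainSeq F H) : 𝔰 (-f) = -𝔰 f := by
  rw [← neg_one_smul F f, suspend_smul, ← neg_one_smul F (𝔰 f)]

lemma coder_neg (c : ℤ) (g : Θ) : κ c (-g) = -κ c g := by
  rw [← neg_one_smul F g, coder_smul, ← neg_one_smul F (κ c g)]

variable [IsScalarTower F H H] [SMulCommClass F H H]

/-- Antisymmetry of the bracket. It turns the second series of the gauge action into the exponential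
of `ad_p` without its term of order zero, applied to `-m_2`. -/
lemma deltaZero_eq (hB : ∀ i, B i ∈ 𝒜 (deg i + 1)) {p : CochainSeq F H}
    (hp : IsGraded 𝒜 0 p) (hμ : IsGraded 𝒜 1 (mulSeq F H)) (hμ' : IsGraded 𝒜 1 (-mulSeq F H)) :
    deltaZero 𝒜 p = adZero 𝒜 p (-mulSeq F H) := by
  apply suspend_injective (B := B) (deg := deg)
  rw [suspend_adZero hB hp hμ', deltaZero, gerstenhaberBracket, mul_zero, Int.negOnePow_zero,
    one_smul, suspend_sub, suspend_circ hB p hμ.degree hμ.zero,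
    suspend_circ hB (mulSeq F H) hp.degree hp.zero, suspend_neg, coder_neg, map_neg, adOp_apply]
  ext1 t
  have h1 := fun t => LinearMap.congr_fun (hp.letterProj_coder (B := B) (deg := deg)) t
  have h2 := fun t => LinearMap.congr_fun (hμ.letterProj_coder (B := B) (deg := deg)) t
  simp only [End.mul_apply] at h1 h2
  simp only [sub_apply, End.mul_apply, map_sub, h1, h2, neg_sub]

namespace MinimalCInfEnhancement

variable (A C : MinimalCInfEnhancement 𝒜)

lemma isGraded_op : IsGraded 𝒜 1 A.op := ⟨A.op_zero, A.hasDegree⟩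

lemma op_eq : A.op = A.twisting + mulSeq F H := by
  funext n
  change A.op n = A.twisting n + mulSeq F H n
  match n with
  | 0 => simp [twisting, mulSeq, A.op_zero]
  | 1 => simp [twisting, mulSeq, A.op_one]
  | 2 => simp [twisting, mulSeq, A.op_two]
  | n + 3 => simp [twisting, mulSeq]

lemma isGraded_mulSeq (A : MinimalCInfEnhancement 𝒜) : IsGraded 𝒜 1 (mulSeq F H) where
  zero := rfl
  degree n := by
    match n with
    | 0 => exact hasDegree_zero _
    | 1 => exact hasDegree_zero _
    | 2 => have := A.hasDegree 2; rwa [A.op_two] at this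
    | n + 3 => exact hasDegree_zero _

lemma isHarrison_mulSeq (A : MinimalCInfEnhancement 𝒜) (n : ℕ) : IsHarrison 𝒜 (mulSeq F H n) := by
  match n with
  | 0 => intro i _ _; simp [mulSeq]
  | 1 => intro i _ _; simp [mulSeq]
  | 2 => have := A.harrison 2; rwa [A.op_two] at this
  | n + 3 => intro i _ _; simp [mulSeq]

lemma isGraded_neg_mulSeq (A : MinimalCInfEnhancement 𝒜) : IsGraded 𝒜 1 (-mulSeq F H) where
  zero := by rw [Pi.neg_apply, A.isGraded_mulSeq.zero, neg_zero]
  degree n d a ha := Submodule.neg_mem _ (A.isGraded_mulSeq.degree n d a ha)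

lemma isGraded_twisting : IsGraded 𝒜 1 A.twisting where
  zero := rfl
  degree n := by
    rw [twisting]
    split_ifs
    · exact A.hasDegree n
    · exact hasDegree_zero _

/-- With `δ p = ad_p (-m_2)`, adding `m_2` to the gauge action completes the two series to
`e^{ad_p}` applied to the whole structure including the product, and this is conjugation by the
exponential. -/
lemma suspend_gaugeAction [CharZero F] (hB : ∀ i, B i ∈ 𝒜 (deg i + 1)) {p : CochainSeq F H}
    (hp : IsGraded 𝒜 0 p) (hl : Lowers 1 (κ 0 (𝔰 p))) (w : List I) :
    𝔰 (gaugeAction 𝒜 p A.twisting + mulSeq F H) (Ξ w) = ϖ ((expL (κ 0 (𝔰 p)) * A.bar B deg *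
        expL (-κ 0 (𝔰 p))) (Ξ w)) := by
  set D := κ 0 (𝔰 p) with hD
  have hμ := A.isGraded_mulSeq
  have hμ' := A.isGraded_neg_mulSeq
  have hconj : expL D * A.bar B deg * expL (-D) =
      opSum fun j => (j.factorial : F)⁻¹ • (adOp D ^ j) (A.bar B deg) := by
    rw [expL_mul_eq hl A.lowers_bar, mul_assoc, expL_mul_expL_neg hl, mul_one]
  have hlow : ∀ j, Lowers j ((j.factorial : F)⁻¹ • (adOp D ^ j) (A.bar B deg)) := fun j => by
    simpa using (lowers_adOp_pow hl A.lowers_bar j).smul (j.factorial : F)⁻¹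
  rw [hconj, opSum_apply hlow (word_mem_lenLT (Nat.lt_succ_self _)), suspend_add, add_apply,
    suspend_word_of_length _ rfl, gaugeAction]
  have hsum : ∀ (x : CochainSeq F H), IsGraded 𝒜 1 x → ∀ j : ℕ,
      sgn F (suspExp deg w) • letterOf B (((adZero 𝒜 p)^[j] x) w.length
        fun i => (w.map B).getD i 0) =
      ϖ ((adOp D ^ j) (κ 1 (𝔰 x)) (Ξ w)) := by
    intro x hx j
    obtain ⟨h1, h2⟩ := adZero_iterate_spec (B := B) (deg := deg) hB hp hx j
    rw [← h2, ← suspend_word_of_length _ rfl, ← End.mul_apply ϖ, h1.letterProj_coder]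
  rw [deltaZero_eq hB hp hμ hμ', sub_apply, sum_apply, sum_apply, map_sub, map_sum, map_sum,
    smul_sub, smul_sum, smul_sum]
  simp only [smul_apply, map_smul, smul_comm (sgn F (suspExp deg w)), ← Function.iterate_succ_apply,
    hsum _ A.isGraded_twisting, hsum _ hμ']
  have hbar : A.bar B deg = κ 1 (𝔰 A.twisting) + κ 1 (𝔰 (mulSeq F H)) := by
    rw [bar, A.op_eq, suspend_add, coder_add]
  have hneg : κ 1 (𝔰 (-mulSeq F H)) = -κ 1 (𝔰 (mulSeq F H)) := by rw [suspend_neg, coder_neg]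
  have hlμ : Lowers 0 (κ 1 (𝔰 (mulSeq F H))) := by
    refine lowers_coder (letterProj_suspend B deg _) fun v hv => ?_
    obtain rfl := List.length_eq_zero_iff.1 (Nat.le_zero.1 hv)
    rw [word_nil, suspend_one B deg hμ.zero]
  have hz : (adOp D ^ (w.length + 1)) (κ 1 (𝔰 (mulSeq F H))) (Ξ w) = 0 := by
    have := lowers_adOp_pow hl hlμ (w.length + 1) w
    rwa [show w.length + 1 - (w.length + 1 + 0) = 0 by omega, lenLT_zero, mem_bot] at this
  rw [hneg, hbar]
  simp only [map_neg, map_add, add_apply, neg_apply, map_sum, map_smul, smul_add,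
    smul_neg, Finset.sum_add_distrib, Finset.sum_neg_distrib,
    sub_neg_eq_add]
  rw [add_assoc]
  congr 1
  -- The second series starts at order one. The missing term of order zero is the product, and the
  -- surplus last term vanishes on `w` by `hz`.
  have htel := sum_range_succ' (fun j => ((j.factorial : F))⁻¹ • ϖ
    ((adOp D ^ j) (κ 1 (𝔰 (mulSeq F H))) (Ξ w))) (w.length + 1)
  rw [Finset.sum_range_succ] at htel
  simp only [hz, map_zero, smul_zero, add_zero, Nat.factorial_zero, Nat.cast_one, inv_one, one_smul,
    pow_zero, End.one_apply] at htel
  rw [htel, ← End.mul_apply ϖ, hμ.letterProj_coder]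

/-- Agreement of components up to arity `k` is agreement of coderivations on words of length at most
`k`. Since exponentials preserve the length filtration, conjugation can be rewritten as intertwining
there. -/
lemma twisting_eq_gaugeAction_iff [CharZero F] (hB : ∀ i, B i ∈ 𝒜 (deg i + 1))
    {p : CochainSeq F H} (hp : IsGraded 𝒜 0 p) {𝔑 : Submodule F Λ}
    {ω : Λ →ₗ[F] F} (hL : IsGaugeLie deg 𝔑 ω (κ 0 (𝔰 p))) (k : ℕ) :
    (∀ i ≤ k, C.twisting i = gaugeAction 𝒜 p A.twisting i) ↔
      Intertwines (A.bar B deg) (C.bar B deg) k (expL (κ 0 (𝔰 p))) := by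
  have hs := A.suspend_gaugeAction hB hp hL.lowers
  generalize κ 0 (𝔰 p) = D at hL hs ⊢
  have h1 : expL D * expL (-D) = 1 := expL_mul_expL_neg hL.lowers
  have h2 : expL (-D) * expL D = 1 := by simpa using expL_mul_expL_neg hL.lowers.neg
  have hE : IsCoder deg 1 (expL D * A.bar B deg * expL (-D)) :=
    A.isCoder_bar.conj hL.neg.exp.coalgHom hL.exp.coalgHom hL.exp.homDeg h1
  have hiff : (∀ i ≤ k, C.twisting i = gaugeAction 𝒜 p A.twisting i) ↔
      ∀ w : List I, w.length ≤ k → 𝔰 C.op (Ξ w) = ϖ ((expL D * A.bar B deg * expL (-D)) (Ξ w)) := by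
    constructor
    · intro h w hw
      rw [← hs]
      refine suspend_eq_of_eq (n := w.length) ?_ rfl
      rw [C.op_eq, Pi.add_apply, Pi.add_apply, h _ hw]
    · intro h i hi
      have : C.op i = (gaugeAction 𝒜 p A.twisting + mulSeq F H) i :=
        eq_of_suspend_eq (B := B) (deg := deg) fun w hw => by rw [hs, h w (by omega)]
      rw [C.op_eq, Pi.add_apply, Pi.add_apply] at this
      exact add_right_cancel this
  rw [hiff]
  constructor
  · intro h t ht
    have ht' : expL D t ∈ Γ (k + 1) := expL_mem_lenLT hL.lowers ht
    have hle : Γ (k + 1) ≤ ker (C.bar B deg - expL D * A.bar B deg * expL (-D)) :=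
      lenLT_le_iff.2 fun w hw => (C.isCoder_bar.sub hE).eq_zero (n := k + 1) (fun v hv => by
          rw [sub_apply, map_sub, letterProj_bar_apply, h v (by omega), sub_self]) w hw
    have h3 := hle ht'
    rw [mem_ker, sub_apply, sub_eq_zero] at h3
    rw [h3, End.mul_apply, End.mul_apply, ← End.mul_apply (expL (-D)), h2, End.one_apply]
  · intro h w hw
    have ht : expL (-D) (Ξ w) ∈ Γ (k + 1) :=
      expL_mem_lenLT hL.lowers.neg (word_mem_lenLT (by omega))
    have h3 := h _ ht
    rw [← End.mul_apply (expL D), h1, End.one_apply] at h3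
    rw [← letterProj_bar_apply, h3]
    rfl

end MinimalCInfEnhancement

end GaugeAction

/-! ### Poincaré algebras -/

section Poincare

variable {F I : Type*} [Field F]

lemma cutSum_eq_nil_left {α M : Type*} [AddCommGroup M] {f : List α → List α → M} {w : List α}
    (h : ∀ u v, u ++ v = w → u ≠ [] → f u v = 0) : cutSum f w = f [] w := by
  rw [cutSum, Finset.sum_eq_single 0]
  · simp
  · intro i hi hi0
    simp only [mem_range] at hi
    refine h _ _ (List.take_append_drop _ _) (List.ne_nil_of_length_pos ?_)
    rw [List.length_take]; omega
  · simp

lemma cutSum_eq_nil_right {α M : Type*} [AddCommGroup M] {f : List α → List α → M} {w : List α}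
    (h : ∀ u v, u ++ v = w → v ≠ [] → f u v = 0) : cutSum f w = f w [] := by
  rw [cutSum, Finset.sum_eq_single w.length]
  · simp
  · intro i hi hi0
    simp only [mem_range] at hi
    refine h _ _ (List.take_append_drop _ _) (List.ne_nil_of_length_pos ?_)
    rw [List.length_drop]; omega
  · simp

variable {H : Type*} [NonUnitalRing H] [Module F H] {𝒜 : ℤ → Submodule F H}
  {B : Basis I F H} {deg : I → ℤ}

lemma letterProj_tens_of_length_ne {L : List (Homog 𝒜)} (h : L.length ≠ 1) :
    ϖ (tens 𝒜 B (Ξ L)) = 0 := by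
  match L with
  | [] => rw [word_nil, tens_nil, letterProj_nil]
  | [p] => simp at h
  | p :: q :: L =>
    rw [tens_cons, letterProj_letter_mul (letterProj_letterOf B _), tens_cons,
      emptyCoeff_letter (letterProj_letterOf B _), zero_smul]

lemma tens_singleton (p : Homog 𝒜) : tens 𝒜 B (Ξ [p]) = letterOf B (p.2 : H) := by
  rw [tens_cons, word_nil, tens_nil, mul_one]

variable [DirectSum.Decomposition 𝒜]

namespace PoincareStructure

variable (P : PoincareStructure 𝒜)

/-- The fundamental class, extended by zero. -/
def trace : H →ₗ[F] F :=
  P.fundamentalClass ∘ₗ DirectSum.component F ℤ (fun i => 𝒜 i) P.dim ∘ₗ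
    (DirectSum.decomposeLinearEquiv 𝒜).toLinearMap

lemma pairing_eq (a b : H) : P.pairing a b = P.trace (a * b) := rfl

lemma trace_of_mem {n : ℤ} {x : H} (hx : x ∈ 𝒜 n) (hn : n ≠ P.dim) : P.trace x = 0 := by
  have : DirectSum.decompose 𝒜 x (P.dim : ℤ) = 0 := by
    rw [DirectSum.decompose_of_mem 𝒜 hx, DirectSum.of_eq_of_ne _ _ _ (Ne.symm hn)]
  change P.fundamentalClass (DirectSum.decompose 𝒜 x (P.dim : ℤ)) = 0
  rw [this, map_zero]

/-- Comparing degrees in `1 · a = a` shows that the degree zero part of the unit is itself a left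
unit, hence equal to the unit. -/
lemma unit_mem [SetLike.GradedMul 𝒜] : P.unit ∈ 𝒜 0 := by
  classical
  set e₀ : H := ((DirectSum.decompose 𝒜 P.unit 0 : 𝒜 0) : H) with he₀
  have key : ∀ (j : ℤ) (a : H), a ∈ 𝒜 j → e₀ * a = a := by
    intro j a ha
    have h1 : ((DirectSum.decompose 𝒜 (P.unit * a) j : 𝒜 j) : H) = e₀ * a := by
      conv_lhs => rw [← DirectSum.sum_support_decompose 𝒜 P.unit]
      rw [Finset.sum_mul, DirectSum.decompose_sum, DFinsupp.finsetSum_apply,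
        AddSubmonoidClass.coe_finsetSum]
      rw [Finset.sum_eq_single 0]
      · have := SetLike.mul_mem_graded (DirectSum.decompose 𝒜 P.unit 0).2 ha
        rw [zero_add] at this
        exact DirectSum.decompose_of_mem_same 𝒜 this
      · intro i _ hi
        have := SetLike.mul_mem_graded (DirectSum.decompose 𝒜 P.unit i).2 ha
        exact DirectSum.decompose_of_mem_ne 𝒜 this (by omega)
      · intro h0
        rw [DFinsupp.notMem_support_iff] at h0
        rw [h0]
        simp
    rw [P.unit_mul, DirectSum.decompose_of_mem_same 𝒜 ha] at h1
    exact h1.symm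
  have key' : ∀ a, e₀ * a = a := by
    intro a
    rw [← DirectSum.sum_support_decompose 𝒜 a, Finset.mul_sum]
    exact sum_congr rfl fun i _ => key i _ (DirectSum.decompose 𝒜 a i).2
  have : P.unit = e₀ := by rw [← P.mul_unit e₀, key']
  rw [this]
  exact (DirectSum.decompose 𝒜 P.unit 0).2

lemma pairing_comm (hcomm : IsGradedCommutative 𝒜) {i j : ℤ} {a b : H} (ha : a ∈ 𝒜 i)
    (hb : b ∈ 𝒜 j) : P.pairing a b = sgn F (i * j) * P.pairing b a := by
  rw [pairing_eq, pairing_eq, hcomm i j a b ha hb, negOnePow_smul_eq (F := F), map_smul,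
    smul_eq_mul]

end PoincareStructure

variable [IsScalarTower F H H] [SMulCommClass F H H]

lemma evalList_mulSeq (a b : H) : evalList (mulSeq F H) [a, b] = a * b := rfl

lemma suspend_mulSeq_of_length_ne {w : List I} (hw : w.length ≠ 2) : 𝔰 (mulSeq F H) (Ξ w) = 0 := by
  have h : ∀ n : ℕ, n ≠ 2 → mulSeq F H n = 0 := by
    intro n hn
    match n with
    | 0 => rfl
    | 1 => rfl
    | 2 => exact absurd rfl hn
    | n + 3 => rfl
  rw [suspend_word_of_length _ rfl, h _ hw]
  simp

lemma suspend_mulSeq_letters (hB : ∀ i, B i ∈ 𝒜 (deg i + 1)) {m : ℤ} {a : H} (ha : a ∈ 𝒜 m)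
    (b : H) : 𝔰 (mulSeq F H) (letterOf B a * letterOf B b) =
      sgn F (m - 1) • letterOf B (a * b) := by
  induction B.mem_span b using span_induction with
  | zero => simp
  | add x y _ _ hx hy => rw [map_add, mul_add, map_add, hx, hy, mul_add, map_add, smul_add]
  | smul c x _ hx => rw [map_smul, mul_smul_comm, map_smul, hx, mul_smul_comm, map_smul, smul_comm]
  | mem x hx =>
    obtain ⟨i, rfl⟩ := hx
    have h := suspend_tens hB (mulSeq F H) [(⟨m, a, ha⟩ : Homog 𝒜), ⟨_, B i, hB i⟩]
    rw [tens_cons, tens_singleton] at h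
    simp only [vals_cons, vals_nil, evalList_mulSeq] at h
    rw [h]
    simp [suspExp, homogDeg]

/-- Only words of length three matter; on them the two bracketings appear with opposite suspension
signs and cancel by associativity. -/
lemma suspend_mulSeq_assoc [SetLike.GradedMul 𝒜] (hB : ∀ i, B i ∈ 𝒜 (deg i + 1))
    (hμ : IsGraded 𝒜 1 (mulSeq F H)) :
    𝔰 (mulSeq F H) * κ 1 (𝔰 (mulSeq F H)) = 0 := by
  have hβ : IsCochain deg 2 1 (𝔰 (mulSeq F H)) :=
    ⟨letterProj_suspend B deg _, fun w hw => suspend_mulSeq_of_length_ne hw,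
      homDeg_suspend hB hμ.degree⟩
  apply word_hom_ext; intro w
  rw [End.mul_apply, zero_apply]
  match w with
  | [] => rw [word_nil, coder_one, map_zero]
  | [x] => exact hβ.eq_zero_of_mem_lenEq (n := 0) (by norm_num) (hβ.coder_mem_lenEq _ _ rfl)
  | [x, y] => exact hβ.eq_zero_of_mem_lenEq (n := 1) (by norm_num) (hβ.coder_mem_lenEq _ _ rfl)
  | x :: y :: z :: t :: w =>
    exact hβ.eq_zero_of_mem_lenEq (n := (t :: w).length + 2) (by simp)
      (hβ.coder_mem_lenEq _ _ (by simp))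
  | [x, y, z] =>
    have hβ0 : 𝔰 (mulSeq F H) 1 = 0 := suspend_one B deg hμ.zero
    have hβ1 : ∀ x, 𝔰 (mulSeq F H) (Ξ [x]) = 0 := fun x => suspend_mulSeq_of_length_ne (by simp)
    have hβ2 : ∀ x y, 𝔰 (mulSeq F H) (Ξ [x, y]) =
        sgn F (deg x) • letterOf B (B x * B y) := fun x y => by
      have := suspend_mulSeq_letters hB (hB x) (B y)
      rwa [letterOf_basis, letterOf_basis, word_mul_word, add_sub_cancel_right] at this
    have hβ3 : ∀ x y z, 𝔰 (mulSeq F H) (Ξ [x, y, z]) = 0 := fun x y z =>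
      suspend_mulSeq_of_length_ne (by simp)
    have hxy : B x * B y ∈ 𝒜 (deg x + 1 + (deg y + 1)) := SetLike.mul_mem_graded (hB x) (hB y)
    rw [coder_cons, coder_cons, coder_cons]
    simp only [conv_word, cutSum_cons, cutSum_nil, word_nil, coder_one, hβ0, hβ1, hβ2, hβ3,
      End.one_apply, zero_mul, mul_zero, zero_add, add_zero, smul_zero, mul_one,
      map_add, map_smul, smul_mul_assoc, mul_smul_comm]
    have e1 := suspend_mulSeq_letters hB hxy (B z)
    have e2 := suspend_mulSeq_letters hB (hB x) (B y * B z)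
    rw [letterOf_basis] at e1 e2
    rw [e1, e2, mul_assoc, smul_smul, smul_smul, smul_smul, ← add_smul]
    convert zero_smul F _
    have : sgn F (deg x + 1 + (deg y + 1) - 1) = -(sgn F (deg x) * sgn F (deg y)) := by
      rw [show deg x + 1 + (deg y + 1) - 1 = deg x + deg y + 1 by ring, sgn_add, sgn_add, sgn_one]
      ring
    rw [this, one_mul, add_sub_cancel_right]
    ring

namespace PoincareStructure

variable (P : PoincareStructure 𝒜)

/-- The suspended pairing, as a linear form on words. -/
def form (B : Basis I F H) (deg : I → ℤ) : Λ →ₗ[F] F :=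
  P.trace ∘ₗ ofLetter B ∘ₗ 𝔰 (mulSeq F H)

lemma form_apply (t : Λ) : P.form B deg t = P.trace (ofLetter B (𝔰 (mulSeq F H) t)) := rfl

lemma form_letters (hB : ∀ i, B i ∈ 𝒜 (deg i + 1)) {m : ℤ} {a : H} (ha : a ∈ 𝒜 m) (b : H) :
    P.form B deg (letterOf B a * letterOf B b) = sgn F (m - 1) * P.pairing a b := by
  rw [form_apply, suspend_mulSeq_letters hB ha, map_smul, map_smul, ofLetter_letterOf, smul_eq_mul,
    pairing_eq]

lemma form_of_length_ne {w : List I} (hw : w.length ≠ 2) : P.form B deg (Ξ w) = 0 := by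
  rw [form_apply, suspend_mulSeq_of_length_ne hw, map_zero, map_zero]

lemma form_letter_mul {y : Λ} (hy : ϖ y = y) (t : Λ) :
    P.form B deg (y * t) = P.form B deg (y * ϖ t) := by
  induction t using word_induction with
  | h0 => simp
  | hadd a b ha hb => rw [mul_add, map_add, ha, hb, map_add, mul_add, map_add]
  | hw c w =>
    by_cases hw : w.length = 1
    · obtain ⟨x, rfl⟩ := List.length_eq_one_iff.1 hw
      rw [map_smul, letterProj_singleton]
    · rw [map_smul, letterProj_of_length_ne hw, smul_zero, mul_zero, map_zero, mul_smul_comm,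
        map_smul]
      refine letter_induction y hy ?_ ?_ ?_
      · simp
      · intro a b ha hb; rw [add_mul, map_add, smul_add, ha, hb, add_zero]
      · intro d x
        rw [smul_mul_assoc, ← word_cons, map_smul, P.form_of_length_ne (by simpa using hw)]
        simp

/-- The pairing lives in total degree `dim`, and suspension lowers the degree of each of the two
arguments by one. -/
lemma form_scale [SetLike.GradedMul 𝒜] (hB : ∀ i, B i ∈ 𝒜 (deg i + 1)) (z : Fˣ) (t : Λ) :
    P.form B deg (scale deg z t) = ((z ^ ((P.dim : ℤ) - 2) : Fˣ) : F) * P.form B deg t := by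
  induction t using word_induction with
  | h0 => simp
  | hadd a b ha hb => rw [map_add, map_add, ha, hb, map_add, mul_add]
  | hw c w =>
    rw [map_smul, map_smul, map_smul, scale_word, map_smul, smul_eq_mul, smul_eq_mul, smul_eq_mul]
    by_cases hw : w.length = 2
    · obtain ⟨x, y, rfl⟩ := List.length_eq_two.1 hw
      have h := P.form_letters hB (hB x) (B y)
      rw [letterOf_basis, letterOf_basis, word_mul_word] at h
      change P.form B deg (Ξ [x, y]) = _ at h
      by_cases hd : deg x + 1 + (deg y + 1) = P.dim
      · rw [← hd, wordDeg_cons, wordDeg_cons, wordDeg_nil,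
          show deg x + 1 + (deg y + 1) - 2 = deg x + (deg y + 0) by ring]
        ring
      · rw [h, pairing_eq, P.trace_of_mem (SetLike.mul_mem_graded (hB x) (hB y)) hd]
        simp
    · rw [P.form_of_length_ne hw]; simp

lemma isUnitalProduct [CharZero F] [SetLike.GradedMul 𝒜] (A : MinimalCInfEnhancement 𝒜)
    (hB : ∀ i, B i ∈ 𝒜 (deg i + 1)) {o : I} (ho : B o = P.unit) (hdo : deg o = -1) :
    IsUnitalProduct deg (𝔰 (mulSeq F H)) o where
  letter := letterProj_suspend B deg _
  length w hw := suspend_mulSeq_of_length_ne hw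
  homDeg := homDeg_suspend hB A.isGraded_mulSeq.degree
  kills := killsShuffles_suspend hB A.isHarrison_mulSeq
  square := coder_mul_self_eq_zero (letterProj_suspend B deg _)
    (suspend_one B deg A.isGraded_mulSeq.zero) (homDeg_suspend hB A.isGraded_mulSeq.degree)
    (suspend_mulSeq_assoc hB A.isGraded_mulSeq)
  deg_unit := hdo
  unit_left x := by
    have := suspend_mulSeq_letters hB (hB o) (B x)
    rw [letterOf_basis, letterOf_basis, word_mul_word, add_sub_cancel_right, hdo,
      sgn_odd (by decide), ho, P.unit_mul, letterOf_basis, neg_one_smul F] at this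
    exact this
  unit_right x := by
    have := suspend_mulSeq_letters hB (hB x) (B o)
    rw [letterOf_basis, letterOf_basis, word_mul_word, add_sub_cancel_right, ho, P.mul_unit,
      letterOf_basis] at this
    exact this

lemma isCyclicForm [SetLike.GradedMul 𝒜] (A : MinimalCInfEnhancement 𝒜)
    (hB : ∀ i, B i ∈ 𝒜 (deg i + 1)) :
    IsCyclicForm deg (𝔰 (mulSeq F H)) (P.dim - 2) (P.form B deg) where
  length w hw := P.form_of_length_ne hw
  kills u v hu hv := by
    rw [form_apply, killsShuffles_suspend hB A.isHarrison_mulSeq u v hu hv, map_zero, map_zero]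
  invariant t := by
    have := LinearMap.congr_fun (suspend_mulSeq_assoc hB A.isGraded_mulSeq) t
    rw [End.mul_apply, zero_apply] at this
    rw [form_apply, this, map_zero, map_zero]
  homDeg := P.form_scale hB
  nondegenerate y hy h := by
    -- The form and the pairing differ by a sign in the degree of the first argument. As `y` need
    -- not be homogeneous, the sign operator takes its place; homogeneity of the form removes it
    -- again in `hpar`.
    have key : ∀ x, P.trace (ofLetter B y * B x) = P.form B deg (par deg 1 y * Ξ [x]) := by
      intro x
      refine letter_induction y hy ?_ ?_ ?_
      · simp
      · intro a b ha hb; rw [map_add, add_mul, map_add, ha, hb, map_add, add_mul, map_add]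
      · intro c v
        have h2 := P.form_letters hB (hB v) (B x)
        rw [letterOf_basis, letterOf_basis, add_sub_cancel_right, pairing_eq] at h2
        rw [map_smul, map_smul, par_word, wordDeg_cons, wordDeg_nil, add_zero, one_mul,
          ofLetter_singleton, smul_mul_assoc, smul_mul_assoc, smul_mul_assoc, map_smul, map_smul,
          map_smul, h2, smul_eq_mul (sgn F _), ← mul_assoc, sgn_mul_self, one_mul]
    have hpar : ∀ x, P.form B deg (par deg 1 y * Ξ [x]) = 0 := by
      intro x
      have e : par deg 1 (y * Ξ [x]) = sgn F (deg x) • (par deg 1 y * Ξ [x]) := by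
        rw [par, scale_mul, ← par, par_word, mul_smul_comm]
        simp
      have e2 : P.form B deg (par deg 1 (y * Ξ [x])) =
          sgn F (P.dim - 2) * P.form B deg (y * Ξ [x]) := by
        have : ∀ t, P.form B deg (par deg 1 t) = sgn F (P.dim - 2) * P.form B deg t := by
          intro t
          have := P.form_scale (deg := deg) hB ((-1) ^ (1 : ℤ)) t
          rwa [← par, zpow_one, ← sgn] at this
        exact this _
      rw [h x, mul_zero, e, map_smul, smul_eq_mul] at e2
      have := congrArg (fun s => sgn F (deg x) * s) e2
      simpa only [← mul_assoc, sgn_mul_self, one_mul, mul_zero] using this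
    have hz : ofLetter B y = 0 := by
      refine P.nondegenerate _ fun b => ?_
      change P.trace (ofLetter B y * b) = 0
      induction B.mem_span b using span_induction with
      | zero => simp
      | add a b _ _ ha hb => rw [mul_add, map_add, ha, hb, add_zero]
      | smul c a _ ha => rw [mul_smul_comm, map_smul, ha, smul_zero]
      | mem x hx =>
        obtain ⟨x, rfl⟩ := hx
        rw [key, hpar]
    rw [← hy, ← letterOf_ofLetter B, hz, map_zero]

end PoincareStructure

end Poincare

/-! ### Cyclic cochains and invariant forms -/

section Cyclic

variable {F H I : Type*} [Field F] [NonUnitalRing H] [Module F H] {𝒜 : ℤ → Submodule F H}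
  {B : Basis I F H} {deg : I → ℤ}

lemma sum_ofFn_homog {n : ℕ} (x : Fin n → Homog 𝒜) :
    ∑ i, (x i).1 = wordDeg (homogDeg 𝒜) (List.ofFn x) + n := by
  simp only [wordDeg, List.map_ofFn, List.sum_ofFn, Function.comp_def, homogDeg, sum_sub_distrib]
  simp

variable [DirectSum.Decomposition 𝒜]

lemma isCyclicCochain_iff_list (P : PoincareStructure 𝒜) (f : CochainSeq F H) (m : ℕ) :
    IsCyclicCochain P (f (m + 1)) ↔ ∀ (p q : Homog 𝒜) (K : List (Homog 𝒜)), K.length = m →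
      P.pairing (evalList f (vals (p :: K))) q.2 =
        sgn F ((m + 1 : ℕ) + p.1 * (wordDeg (homogDeg 𝒜) (K ++ [q]) + (m + 1 : ℕ))) *
          P.pairing (evalList f (vals (K ++ [q]))) p.2 := by
  have key : ∀ y : Fin (m + 2) → Homog 𝒜,
      (P.pairing (f (m + 1) fun i => ((y i.castSucc).2 : H)) (y (Fin.last _)).2 =
        (((m + 1 : ℕ) : ℤ) + (y 0).1 * ∑ i : Fin (m + 1), (y i.succ).1).negOnePow •
          P.pairing (f (m + 1) fun i => ((y i.succ).2 : H)) (y 0).2) ↔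
      P.pairing (evalList f (vals (y 0 :: List.ofFn fun i : Fin m => y i.succ.castSucc)))
          (y (Fin.last _)).2 =
        sgn F ((m + 1 : ℕ) + (y 0).1 * (wordDeg (homogDeg 𝒜)
          ((List.ofFn fun i : Fin m => y i.succ.castSucc) ++ [y (Fin.last _)]) + (m + 1 : ℕ))) *
          P.pairing (evalList f (vals ((List.ofFn fun i : Fin m => y i.succ.castSucc) ++
            [y (Fin.last _)]))) (y 0).2 := by
    intro y
    have e1 : y 0 :: List.ofFn (fun i : Fin m => y i.succ.castSucc) =
        List.ofFn fun i : Fin (m + 1) => y i.castSucc := by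
      rw [List.ofFn_succ]; rfl
    have e2 : List.ofFn (fun i : Fin m => y i.succ.castSucc) ++ [y (Fin.last _)] =
        List.ofFn fun i : Fin (m + 1) => y i.succ := by
      rw [List.ofFn_succ', List.concat_eq_append]; rfl
    rw [e1, e2, vals_ofFn, vals_ofFn, evalList_ofFn, evalList_ofFn, ← sum_ofFn_homog,
      negOnePow_smul_eq (F := F), smul_eq_mul]
  constructor
  · intro h p q K hK
    subst hK
    have h1 := (key (Fin.cons p (Fin.snoc K.get q : Fin (K.length + 1) → Homog 𝒜))).1
      (h _ _ fun i => (Fin.cons (α := fun _ => Homog 𝒜) p (Fin.snoc K.get q :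
        Fin (K.length + 1) → Homog 𝒜) i).2.2)
    have e : (fun i : Fin K.length => (Fin.cons p (Fin.snoc K.get q :
        Fin (K.length + 1) → Homog 𝒜) : Fin (K.length + 2) → Homog 𝒜) i.succ.castSucc) =
        K.get := by
      funext i
      rw [← Fin.succ_castSucc, Fin.cons_succ, Fin.snoc_castSucc]
    rw [e, List.ofFn_get, ← Fin.succ_last, Fin.cons_succ, Fin.snoc_last, Fin.cons_zero] at h1
    exact h1
  · intro h d x hx
    exact (key fun i => ⟨d i, x i, hx i⟩).2 (h _ _ _ (by simp))

variable [IsScalarTower F H H] [SMulCommClass F H H] (P : PoincareStructure 𝒜)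

namespace PoincareStructure

/-- The form sees words of length two only, so two terms of the coderivation remain: those that
leave out the last or the first argument. Symmetry of the pairing brings the second into the shape
of the cyclicity relation. -/
lemma form_coder_tens (hB : ∀ i, B i ∈ 𝒜 (deg i + 1)) (hcomm : IsGradedCommutative 𝒜) {c : ℤ}
    {f : CochainSeq F H} (hf : IsGraded 𝒜 c f) (p q : Homog 𝒜) (K : List (Homog 𝒜)) :
    P.form B deg (κ c (𝔰 f) (tens 𝒜 B (Ξ (p :: (K ++ [q]))))) =
      sgn F (suspExp (homogDeg 𝒜) (p :: K) + wordDeg (homogDeg 𝒜) (p :: K) + c) *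
        (P.pairing (evalList f (vals (p :: K))) q.2 - sgn F ((K.length + 1 : ℕ) +
            p.1 * (wordDeg (homogDeg 𝒜) (K ++ [q]) + (K.length + 1 : ℕ))) *
            P.pairing (evalList f (vals (K ++ [q]))) p.2) := by
  have hg := letterProj_suspend B deg f
  have hD : IsCoder deg c (κ c (𝔰 f)) := hf.isCoder
  have hl : ∀ t, ϖ (𝔰 f t) = 𝔰 f t := fun t => LinearMap.congr_fun hg t
  have hDg : ∀ t, ϖ (κ c (𝔰 f) t) = 𝔰 f t := fun t =>
    LinearMap.congr_fun (hf.letterProj_coder (B := B) (deg := deg)) t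
  have h1 : P.form B deg (conv (𝔰 f) 1 (tens 𝒜 B (Ξ (p :: (K ++ [q]))))) =
      sgn F (suspExp (homogDeg 𝒜) (p :: K) + wordDeg (homogDeg 𝒜) (p :: K) + c) *
        P.pairing (evalList f (vals (p :: K))) q.2 := by
    rw [conv_tens, map_cutSum, ← List.cons_append, cutSum_append_singleton, cutSum_eq_nil_right]
    · simp only [List.nil_append, tens_singleton, End.one_apply]
      rw [suspend_tens hB, smul_mul_assoc, map_smul,
        P.form_letters hB (evalList_mem hf.degree (p :: K)), smul_eq_mul, ← mul_assoc, ← sgn_add,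
        P.form_letter_mul (hl _), word_nil, tens_nil, letterProj_nil, mul_zero, map_zero, add_zero]
      congr 2
      ring
    · intro u v _ hv
      rw [P.form_letter_mul (hl _), End.one_apply, letterProj_tens_of_length_ne, mul_zero, map_zero]
      simpa using hv
  have h2 : P.form B deg (conv (ϖ * par deg c) (κ c (𝔰 f)) (tens 𝒜 B (Ξ (p :: (K ++ [q]))))) =
      sgn F (c * homogDeg 𝒜 p + suspExp (homogDeg 𝒜) (K ++ [q]) + homogDeg 𝒜 p +
        p.1 * (wordDeg (homogDeg 𝒜) (K ++ [q]) + c + 1)) *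
        P.pairing (evalList f (vals (K ++ [q]))) p.2 := by
    rw [conv_tens, map_cutSum, cutSum_cons, cutSum_eq_nil_left]
    · rw [End.mul_apply, End.mul_apply, word_nil, tens_nil, par_tens hB, tens_singleton, map_smul,
        letterProj_letterOf, smul_mul_assoc, map_smul,
        P.form_letter_mul (letterProj_letterOf B _), hDg, suspend_tens hB, mul_smul_comm, map_smul, P.form_letters hB p.2.2,
        P.pairing_comm hcomm p.2.2 (evalList_mem hf.degree (K ++ [q]))]
      have : par deg c (1 : Λ) = 1 := by rw [← word_nil, par_word]; simp
      rw [this, letterProj_nil, zero_mul, map_zero, zero_add, smul_eq_mul, smul_eq_mul]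
      simp only [← mul_assoc, ← sgn_add]
      congr 2
      simp [homogDeg]
      ring
    · intro u v _ hu
      rw [End.mul_apply, par_tens hB, map_smul, letterProj_tens_of_length_ne, smul_zero, zero_mul,
        map_zero]
      simpa using hu
  rw [hD.apply_eq, hf.letterProj_coder, map_add, h1, h2, mul_sub, sub_eq_add_neg, ← mul_assoc,
    ← sgn_add, ← neg_mul]
  congr 2
  rw [← neg_one_mul, ← sgn_one (F := F), ← sgn_add]
  refine sgn_congr ?_
  simp only [suspExp_append, suspExp, wordDeg_cons, wordDeg_append, wordDeg_nil, homogDeg,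
    List.length_cons, List.length_nil]
  push_cast
  simp only [Int.even_add, Int.even_mul, Int.even_sub, Int.not_even_one]
  grind

/-- By `form_coder_tens` the form is, up to sign, the defect of cyclicity on words of length at
least two; shorter words contribute nothing. -/
lemma form_coder_eq_zero_iff (hB : ∀ i, B i ∈ 𝒜 (deg i + 1)) (hcomm : IsGradedCommutative 𝒜)
    {c : ℤ} {f : CochainSeq F H} (hf : IsGraded 𝒜 c f) :
    (∀ t, P.form B deg (κ c (𝔰 f) t) = 0) ↔ ∀ n, IsCyclicCochain P (f n) := by
  constructor
  · rintro h (_ | m)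
    · intro d x hx
      simp [hf.zero, pairing_eq]
    · rw [isCyclicCochain_iff_list]
      rintro p q K rfl
      have := h (tens 𝒜 B (Ξ (p :: (K ++ [q]))))
      rw [P.form_coder_tens hB hcomm hf] at this
      exact sub_eq_zero.1 ((mul_eq_zero.1 this).resolve_left (Units.ne_zero _))
  · intro h t
    induction t using word_induction with
    | h0 => simp
    | hadd a b ha hb => rw [map_add, map_add, ha, hb, add_zero]
    | hw e w =>
      rw [map_smul, map_smul]
      match w with
      | [] => rw [word_nil, coder_one, map_zero, smul_zero]
      | [x] =>
        have hg := LinearMap.congr_fun (letterProj_suspend B deg f) (Ξ [x])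
        have h0 := P.form_letter_mul (B := B) (deg := deg) hg 1
        rw [letterProj_nil, mul_zero, map_zero, mul_one] at h0
        rw [coder_cons, word_nil, coder_one, mul_zero, smul_zero, add_zero, conv_word, cutSum_cons,
          cutSum_nil, word_nil, suspend_one B deg hf.zero, zero_mul, zero_add, End.one_apply,
          mul_one, h0, smul_zero]
      | x :: y :: w =>
        obtain ⟨v, z, hv⟩ : ∃ v z, y :: w = v ++ [z] :=
          ⟨_, _, (List.dropLast_append_getLast (List.cons_ne_nil y w)).symm⟩
        have e1 := P.form_coder_tens hB hcomm hf ⟨_, B x, hB x⟩ ⟨_, B z, hB z⟩ (homogWord hB v)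
        rw [(isCyclicCochain_iff_list P f v.length).1 (h _) _ _ _ (by simp)] at e1
        have e2 : (⟨_, B x, hB x⟩ : Homog 𝒜) :: (homogWord hB v ++ [⟨_, B z, hB z⟩]) =
            homogWord hB (x :: (v ++ [z])) := by
          simp [homogWord]
        rw [e2, tens_homogWord] at e1
        rw [hv, e1]
        simp

end PoincareStructure

end Cyclic

/-! ### Unital cyclic enhancements and unital cyclic isotopies -/

section UnitalCyclic

variable {F H I : Type*} [Field F] [NonUnitalRing H] [Module F H] {𝒜 : ℤ → Submodule F H}
  {B : Basis I F H} {deg : I → ℤ} [DirectSum.Decomposition 𝒜] {P : PoincareStructure 𝒜}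
  {o : I}

lemma suspend_eq_zero_of_isNormalized {f : CochainSeq F H} (ho : B o = P.unit) {w : List I}
    (hf : IsNormalized P (f w.length)) (hw : o ∈ w) : 𝔰 f (Ξ w) = 0 := by
  obtain ⟨i, hi⟩ := List.mem_iff_get.1 hw
  rw [suspend_word_of_length f rfl, hf _ ⟨i, ?_⟩, map_zero, smul_zero]
  rw [← ho, ← hi]
  simp

/-- An argument equal to the unit is itself the basis vector `o` and is kept; the other arguments
are expanded in the basis one at a time. -/
lemma isNormalized_of_suspend_eq_zero {f : CochainSeq F H} (ho : B o = P.unit) {n : ℕ}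
    (hf : ∀ w : List I, w.length = n → o ∈ w → 𝔰 f (Ξ w) = 0) :
    IsNormalized P (f n) := by
  have key : ∀ (v : List H) (u : List I), u.length + v.length = n → (o ∈ u ∨ P.unit ∈ v) →
      evalList f (u.map B ++ v) = 0 := by
    intro v
    induction v with
    | nil =>
      intro u hu h
      have h1 := hf u (by simpa using hu) (by simpa using h)
      rw [suspend_word] at h1
      refine letterOf_injective B ?_
      rw [List.append_nil, map_zero, ← one_smul F (letterOf B _), ← sgn_mul_self (suspExp deg u),
        ← smul_smul, h1, smul_zero]
    | cons x v ih =>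
      have hstep : ∀ (u : List I), u.length + (x :: v).length = n → ∀ i, (o ∈ u ++ [i] ∨ P.unit ∈ v) →
          evalList f (u.map B ++ B i :: v) = 0 := by
        intro u hu i h
        have := ih (u ++ [i]) (by simp at hu ⊢; omega) h
        simpa using this
      intro u hu h
      by_cases hx : x = P.unit
      · rw [hx, ← ho]
        exact hstep u hu o (by simp)
      · have h' : o ∈ u ∨ P.unit ∈ v := by
          rcases h with h | h
          · exact Or.inl h
          · rcases List.mem_cons.1 h with h | h
            · exact absurd h.symm hx
            · exact Or.inr h
        have : evalAt f (u.map B) v = 0 := B.ext fun i => by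
          rw [evalAt_apply, zero_apply]
          exact hstep u hu i (h'.imp_left fun h => List.mem_append_left _ h)
        exact LinearMap.congr_fun this x
  rintro a ⟨i, hi⟩
  rw [← evalList_ofFn]
  exact key (List.ofFn a) [] (by simp) (Or.inr (List.mem_ofFn.2 ⟨i, hi⟩))

lemma IsUnitalCyclicGauge.isGraded {p : CochainSeq F H} (hp : IsUnitalCyclicGauge P p) :
    IsGraded 𝒜 0 p where
  zero := hp.zero
  degree n := by simpa using hp.degree n

/-- Finitely many degrees occur, each of finite dimension. The arguments with Eulerian idempotents
and with the form need a finite alphabet. -/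
lemma finite_index (P : PoincareStructure 𝒜) (hfin : ∀ i : ℤ, FiniteDimensional F (𝒜 i))
    (hB : ∀ i, B i ∈ 𝒜 (deg i + 1)) : Finite I := by
  have h : (Set.univ : Set I) ⊆ ⋃ n ∈ Set.Icc (-1 : ℤ) (P.dim - 1), {i | deg i = n} := by
    intro i _
    simp only [Set.mem_iUnion]
    refine ⟨deg i, ?_, rfl⟩
    by_contra hi
    have hbot := P.bounded (deg i + 1) (by
      simp only [Set.mem_Icc, not_and_or, not_le] at hi
      omega)
    have := hB i
    rw [hbot, mem_bot] at this
    exact B.ne_zero i this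
  exact Set.finite_univ_iff.1
    (((Set.finite_Icc _ _).biUnion fun n _ => finite_deg_eq hfin hB n).subset h)

variable [IsScalarTower F H H] [SMulCommClass F H H] [CharZero F]

lemma IsUnitalCyclic.isUnitalCyclicModel {A : MinimalCInfEnhancement 𝒜}
    (hA : IsUnitalCyclic P A) (hB : ∀ i, B i ∈ 𝒜 (deg i + 1)) (hcomm : IsGradedCommutative 𝒜)
    (ho : B o = P.unit) :
    IsUnitalCyclicModel deg (𝔰 (mulSeq F H)) o (P.form B deg) (A.bar B deg) where
  isCoder := A.isCoder_bar
  homDeg := A.homDeg_bar hB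
  shuffleDer := A.isShuffleDer_bar hB
  minimal w hw := by rw [A.letterProj_bar_apply, A.suspend_op_eq_zero hw]
  quadratic w hw := by
    rw [A.letterProj_bar_apply]
    exact suspend_eq_of_eq (A.op_two.trans rfl) hw
  square := A.bar_mul_bar hB
  normal p s h := by
    rw [A.letterProj_bar_apply]
    exact suspend_eq_zero_of_isNormalized ho (hA.1 _ h) (by simp)
  cyclic := (P.form_coder_eq_zero_iff hB hcomm A.isGraded_op).2 hA.2

lemma IsUnitalCyclicGauge.isGaugeLie {p : CochainSeq F H} (hp : IsUnitalCyclicGauge P p)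
    (hB : ∀ i, B i ∈ 𝒜 (deg i + 1)) (hcomm : IsGradedCommutative 𝒜) (ho : B o = P.unit) :
    IsGaugeLie deg (wordsWith F o) (P.form B deg) (κ 0 (𝔰 p)) := by
  have hn : ∀ t ∈ wordsWith F o, ϖ (κ 0 (𝔰 p) t) = 0 := by
    have hle : wordsWith F o ≤ ker (𝔰 p) := wordsWith_le_iff.2 fun u s =>
      suspend_eq_zero_of_isNormalized ho (hp.normalized _) (by simp)
    intro t ht
    rw [← End.mul_apply, hp.isGraded.letterProj_coder]
    exact hle ht
  refine isGaugeLie_of_log_data le_rfl (letterProj_suspend B deg p)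
    (homDeg_suspend hB hp.isGraded.degree) ?_ (killsShuffles_suspend hB hp.harrison)
    (fun t ht => hp.isGraded.isCoder.wordsWith_stable hn ht) hn
    ((P.form_coder_eq_zero_iff hB hcomm hp.isGraded).2 hp.cyclic)
  intro w hw
  have h : p w.length = 0 := by
    obtain h | h : w.length = 0 ∨ w.length = 1 := by omega
    · rw [h, hp.zero]
    · rw [h, hp.one]
  rw [suspend_word_of_length p rfl, h]
  simp

lemma exists_unitalCyclicGauge (hB : ∀ i, B i ∈ 𝒜 (deg i + 1)) (hcomm : IsGradedCommutative 𝒜)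
    (ho : B o = P.unit) {D : Θ}
    (hD : IsGaugeLie deg (wordsWith F o) (P.form B deg) D) :
    ∃ p, IsUnitalCyclicGauge P p ∧ κ 0 (𝔰 p) = D := by
  have hl : ϖ * (ϖ * D) = ϖ * D := by rw [← mul_assoc, letterProj_idem]
  have hs : 𝔰 (desuspend B deg (ϖ * D)) = ϖ * D := suspend_desuspend hl
  have hlow : ∀ w : List I, w.length < 2 → (ϖ * D) (Ξ w) = 0 := by
    have hle : Γ 1 ≤ ker ϖ := lenLT_le_iff.2 fun w hw => by
      obtain rfl : w = [] := List.length_eq_zero_iff.1 (by omega)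
      rw [mem_ker, word_nil, letterProj_nil]
    exact fun w hw => hle (lenLT_mono (by omega) (hD.lowers w))
  have h1 : (ϖ * D) 1 = 0 := by rw [← word_nil]; exact hlow [] (by simp)
  have hd : HomDeg deg 0 (ϖ * D) := by simpa using (homDeg_letterProj deg).mul deg hD.homDeg
  have hc : κ 0 (ϖ * D) = D := (isCoder_coder 0 hl h1).ext hD.coder (letterProj_coder 0 hl h1)
  set p := desuspend B deg (ϖ * D)
  have hpg : IsGraded 𝒜 0 p := isGraded_of_suspend hB (by rw [hs, h1]) (by rwa [hs])
  refine ⟨p, ⟨hpg.zero, ?_, fun n => by simpa using hpg.degree n, isHarrison_of_killsShuffles hB ?_,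
    ?_, fun n => ?_⟩, by rw [hs, hc]⟩
  · refine eq_of_suspend_eq (B := B) (deg := deg) (g := 0) fun w hw => ?_
    rw [hs, hlow w (by omega)]
    simp [suspend_word_of_length (0 : CochainSeq F H) rfl]
  · rw [hs]
    exact hD.shuffleDer.killsShuffles hD.coder
  · refine (P.form_coder_eq_zero_iff (deg := deg) hB hcomm hpg).1 ?_
    rw [hs, hc]
    exact hD.cyclic
  · refine isNormalized_of_suspend_eq_zero (deg := deg) ho fun w _ hw => ?_
    rw [hs]
    exact hD.normal _ (subset_span ⟨w, hw, rfl⟩)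

/-- Every normalized cyclic gauge transformation is the exponential of its logarithm, so passing
from exponentials to arbitrary group elements loses nothing. -/
lemma unitalCyclicIsotopic_iff {A C : MinimalCInfEnhancement 𝒜}
    (hB : ∀ i, B i ∈ 𝒜 (deg i + 1)) (hcomm : IsGradedCommutative 𝒜) (ho : B o = P.unit) :
    UnitalCyclicIsotopic P A C ↔ ∃ U, IsGaugeGroup deg (wordsWith F o) (P.form B deg) U ∧
      ∀ t, C.bar B deg (U t) = U (A.bar B deg t) := by
  constructor
  · rintro ⟨p, hp, h⟩
    have hL := hp.isGaugeLie hB hcomm ho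
    refine ⟨_, hL.exp, fun t => ?_⟩
    obtain ⟨k, hk⟩ := exists_mem_lenLT t
    exact (A.twisting_eq_gaugeAction_iff C hB hp.isGraded hL k).1 (fun i _ => by rw [h]) t
      (lenLT_mono (Nat.le_succ k) hk)
  · rintro ⟨U, hU, h⟩
    obtain ⟨p, hp, hpD⟩ := exists_unitalCyclicGauge hB hcomm ho hU.log
    refine ⟨p, hp, funext fun k => ?_⟩
    refine (A.twisting_eq_gaugeAction_iff C hB hp.isGraded (hp.isGaugeLie hB hcomm ho) k).2 ?_ k
      le_rfl
    rw [hpD, expL_logL hU.lowers]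
    exact fun t _ => h t

lemma UnitalCyclicIsotopicMod.exists_gauge {A C : MinimalCInfEnhancement 𝒜} {k : ℕ}
    (hB : ∀ i, B i ∈ 𝒜 (deg i + 1)) (hcomm : IsGradedCommutative 𝒜) (ho : B o = P.unit)
    (h : UnitalCyclicIsotopicMod P k A C) :
    ∃ U, IsGaugeGroup deg (wordsWith F o) (P.form B deg) U ∧
      Intertwines (A.bar B deg) (C.bar B deg) k U := by
  obtain ⟨p, hp, h⟩ := h
  have hL := hp.isGaugeLie hB hcomm ho
  exact ⟨_, hL.exp, (A.twisting_eq_gaugeAction_iff C hB hp.isGraded hL k).1 h⟩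

end UnitalCyclic

/-! ### Assembly of the equivalences -/

section Main

variable {F H : Type*} [Field F] [NonUnitalRing H] [Module F H] {𝒜 : ℤ → Submodule F H}
  [DirectSum.Decomposition 𝒜]

lemma subsingleton_of_unit_eq_zero {P : PoincareStructure 𝒜} (h : P.unit = 0) : Subsingleton H :=
  subsingleton_of_forall_eq 0 fun a => by rw [← P.unit_mul a, h, zero_mul]

variable [IsScalarTower F H H] [SMulCommClass F H H]

lemma isotopic_of_subsingleton [Subsingleton H] (A C : MinimalCInfEnhancement 𝒜) :
    Isotopic A C := by
  refine ⟨0, ⟨rfl, fun n => hasDegree_zero _, ?_, ?_⟩, ?_⟩ <;> intros <;> 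
    first | exact Subsingleton.elim _ _ | (intro; intros; exact Subsingleton.elim _ _)

lemma unitalCyclicIsotopic_of_subsingleton [Subsingleton H] (P : PoincareStructure 𝒜)
    (A C : MinimalCInfEnhancement 𝒜) : UnitalCyclicIsotopic P A C := by
  refine ⟨0, ⟨rfl, rfl, fun n => hasDegree_zero _, ?_, ?_, ?_⟩, ?_⟩
  · intro n i _ _ d a _
    exact Subsingleton.elim _ _
  · intro n d x _
    simp [PoincareStructure.pairing_eq]
  · intro n a _
    exact Subsingleton.elim _ _
  · funext n
    ext a
    exact Subsingleton.elim _ _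

variable [CharZero F]

/-- One direction is `IsUnitalCyclicModel.exists_intertwiner`; the other forgets normalization and
form. -/
lemma isotopic_iff_unitalCyclicIsotopic [SetLike.GradedMul 𝒜] (hcomm : IsGradedCommutative 𝒜)
    (hfin : ∀ i : ℤ, FiniteDimensional F (𝒜 i)) {P : PoincareStructure 𝒜}
    {A C : MinimalCInfEnhancement 𝒜} (hA : IsUnitalCyclic P A) (hC : IsUnitalCyclic P C) :
    Isotopic A C ↔ UnitalCyclicIsotopic P A C := by
  -- If the unit is zero then so is `H`, and the unit cannot be a member of a basis; this case is
  -- separate.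
  by_cases hu : P.unit = 0
  · have := subsingleton_of_unit_eq_zero hu
    exact iff_of_true (isotopic_of_subsingleton A C) (unitalCyclicIsotopic_of_subsingleton P A C)
  obtain ⟨I, B, deg, hB, ho⟩ := exists_homogeneous_basis P.unit_mem
  obtain ⟨o, ho, hdo⟩ := ho hu
  have := finite_index P hfin hB
  have := Fintype.ofFinite I
  rw [unitalCyclicIsotopic_iff hB hcomm ho]
  constructor
  · rintro ⟨φ, hφ⟩
    obtain ⟨U, hU, h⟩ := hφ.exists_gauge hB
    exact (hA.isUnitalCyclicModel hB hcomm ho).exists_intertwiner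
      (P.isUnitalProduct A hB ho hdo) (P.isCyclicForm A hB) (hC.isUnitalCyclicModel hB hcomm ho)
      hU h
  · rintro ⟨U, hU, h⟩
    exact isotopic_of_gauge hB hU.forget h

/-- The same limit argument as for plain isotopies, now in the group of normalized cyclic gauge
transformations. -/
lemma unitalCyclicIsotopic_iff_forall [SetLike.GradedMul 𝒜] (hcomm : IsGradedCommutative 𝒜)
    (hfin : ∀ i : ℤ, FiniteDimensional F (𝒜 i)) (P : PoincareStructure 𝒜)
    (A C : MinimalCInfEnhancement 𝒜) :
    UnitalCyclicIsotopic P A C ↔ ∀ k : ℕ, 3 ≤ k → UnitalCyclicIsotopicMod P k A C := by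
  constructor
  · rintro ⟨p, hp, h⟩ k _
    exact ⟨p, hp, fun i _ => by rw [h]⟩
  intro h
  by_cases hu : P.unit = 0
  · have := subsingleton_of_unit_eq_zero hu
    exact unitalCyclicIsotopic_of_subsingleton P A C
  obtain ⟨I, B, deg, hB, ho⟩ := exists_homogeneous_basis P.unit_mem
  obtain ⟨o, ho, hdo⟩ := ho hu
  rw [unitalCyclicIsotopic_iff hB hcomm ho]
  refine exists_intertwiner_of_forall (finite_deg_eq hfin hB) A.lowers_bar fun k => ?_
  obtain ⟨U, hU, hI⟩ := (h (max k 3) (le_max_right _ _)).exists_gauge hB hcomm ho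
  exact ⟨U, hU, fun t ht => hI t (lenLT_mono (by omega) ht)⟩

end Main

end

theorem theorem4p3 {F H : Type*} [Field F] [CharZero F] [NonUnitalRing H] [Module F H]
    [IsScalarTower F H H] [SMulCommClass F H H]
    (𝒜 : ℤ → Submodule F H) [DirectSum.Decomposition 𝒜] [SetLike.GradedMul 𝒜]
    (hcomm : IsGradedCommutative 𝒜) (hfin : ∀ i : ℤ, FiniteDimensional F (𝒜 i))
    (A₁ A₂ : MinimalCInfEnhancement 𝒜) :
    (Isotopic A₁ A₂ ↔ ∀ k : ℕ, 3 ≤ k → IsotopicMod k A₁ A₂) ∧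
    (∀ P : PoincareStructure 𝒜, IsUnitalCyclic P A₁ → IsUnitalCyclic P A₂ →
      (Isotopic A₁ A₂ ↔ UnitalCyclicIsotopic P A₁ A₂) ∧
      (UnitalCyclicIsotopic P A₁ A₂ ↔
        ∀ k : ℕ, 3 ≤ k → UnitalCyclicIsotopicMod P k A₁ A₂)) :=
  ⟨isotopic_iff_forall_isotopicMod hfin A₁ A₂, fun P h₁ h₂ =>
    ⟨isotopic_iff_unitalCyclicIsotopic hcomm hfin h₁ h₂,
      unitalCyclicIsotopic_iff_forall hcomm hfin P A₁ A₂⟩⟩
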